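/- **Setting.** Let $\sigma_3=\mathrm{diag}(1,-1)$. A loop $g(\lambda)$ with values in $2\times2$ complex matrices is *twisted* if its diagonal entries are even and its off-diagonal entries odd in $\lambda$. For $0<r\le 1$ let $\Lambda^r$ be the group of smooth twisted maps from $\{|\lambda|=r\}$ to $\mathrm{SL}_2\mathbb C$; $\Lambda^r_+$ the subgroup of loops extending smoothly to $\{|\lambda|\le r\}$, holomorphically inside (*normalized* if the diagonal matrix at $\lambda=0$ has positive real entries); $\Lambda^r_{u}$ the subgroup of loops extending to $\{r\le|\lambda|\le 1/r\}$, holomorphically inside, with values in $\mathrm{SU}(2)$ on $|\lambda|=1$. For $r=1$ these are the usual loop groups on the unit circle. Given a potential $\xi$ on a domain, the DPW method takes a solution $L$, with values in $\Lambda^r$, of $dL=L\xi$, splits $L=FB$ with $F\in\Lambda^r_u$ and $B\in\Lambda^r_+$ normalized, and, for $|\lambda_0|=1$ and a real number $H\ne0$, forms the surface in $\mathfrak{su}(2)\cong\mathbb R^3$ $$f=\frac{-i}{2H}\Big[F\sigma_3F^{-1}+2\varepsilon\,\lambda(\partial_\lambda F)F^{-1}\Big]_{\lambda=\lambda_0},$$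 where $\varepsilon\in\{1,-1\}$ is a fixed sign (the two signs give, up to a point reflection, the two parallel CMC surfaces of the same frame), and the basis $-i\sigma_1,-i\sigma_2,-i\sigma_3$ formed from the Pauli matrices is orthonormal. A gauge transformation is $\xi\mapsto p^{-1}\xi p+p^{-1}dp$ with $p$ holomorphic in $z$ and $\Lambda^r_+$-valued. An *annular domain winding around $0$* is an open $\Omega\subset\mathbb C\setminus\{0\}$ homeomorphic to a round annulus and admitting no continuous branch of the logarithm. A potential *produces a surface closing on $\Omega$* if for some DPW data $(L,F,B)$ on the covering $\exp^{-1}(\Omega)\to\Omega$ the resulting surface is the lift of a map $f:\Omega\to\mathbb R^3$. **Theorem.** Let $c\in\mathbb C\setminus\{0\}$, $H\in\mathbb R\setminus\{0\}$, $\varepsilon\in\{1,-1\}$ and, for $k\in\mathbb Z$, let $$\xi_k=\lambda^{-1}\begin{pmatrix}0&1\\ c z^k&0\end{pmatrix}dz .$$ 1. For every $k\in\mathbb Z$ and every $r\in(0,1]$, the pull-back of $\xi_k$ under $z\mapsto 1/z$ is gauge equivalent on $\mathbb C\setminus\{0\}$ to $\xi_{-k-4}$, and $\xi_k$ and $\xi_{-k-4}$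 produce the same surfaces, up to this coordinate change, on every open subset of the universal cover of $\mathbb C\setminus\{0\}$, for each $\lambda_0$. Hence every $\xi_k$ is equivalent, under a biholomorphic coordinate change of $\mathbb C\setminus\{0\}$ and a gauge transformation, to $\xi_{k'}$ for some $k'\in\{k,-k-4\}$ with $k'\ge-2$. 2. For every integer $k\ge-2$ with $k\neq-1$ there are $r\in(0,1]$, $|\lambda_0|=1$ and a smooth conformal immersion $f:\mathbb C\setminus\{0\}\to\mathbb R^3$ of constant mean curvature $H$ (for a suitable unit normal) which is produced by $\xi_k$ and closes on $\mathbb C\setminus\{0\}$, hence on every annular domain winding around $0$. 3. For $k=-1$ no surface produced by $\xi_{-1}$, for any $r\in(0,1]$ and any $|\lambda_0|=1$, closes on any annular domain winding around $0$. 4. For every integer $k\ge0$ and every $|\lambda_0|=1$ the Smyth surface, that is the surface produced by $\xi_k$ on all of $\mathbb C$ with $r=1$ and $L|_{z=0}=\mathrm{id}$, exists; it closes on $\mathbb C\setminus\{0\}$, hence on every annular domain winding around $0$, and is a conformal immersion of constant mean curvature $H$ on $\mathbb C\setminus\{0\}$, and for $\varepsilon=1$ on all of $\mathbb C$. 5.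 For $k=-2$, $a^2=c$ and every $r\in(0,1]$ with $r^2<4|c|$, the potential $\xi_{-2}$ is gauge equivalent, on the universal cover of $\mathbb C\setminus\{0\}$, to $$a\,\lambda^{-1}\begin{pmatrix}0&1\\1&0\end{pmatrix}\frac{dz}{z},$$ and for every $|\lambda_0|=1$ both potentials produce, on this universal cover, a common conformal immersion of constant mean curvature $H$ whose image is a round cylinder of radius $1/(2|H|)$. -/

import Mathlib

open scoped ContDiff

noncomputable section

namespace DPW

/-- Complex `2 × 2` matrices. -/
abbrev Mat2 := Matrix (Fin 2) (Fin 2) ℂ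

/-- Euclidean three-space. -/
abbrev E3 := EuclideanSpace ℝ (Fin 3)

/-- The diagonal matrix with entries `1, -1`. -/
def sigma3 : Mat2 := !![1, 0; 0, -1]

/-! ### Loops

A loop is a function of `lam : ℂ`, of which only the values on the relevant set (the circle of
radius `r`, a closed disk, a closed annulus) matter. For `r = 1` the circle is the unit circle. -/

/-- Twisted on `S`: the diagonal entries are even and the off-diagonal entries are odd. -/
def IsTwistedOn (S : Set ℂ) (g : ℂ → Mat2) : Prop :=
  ∀ lam ∈ S, g (-lam) = sigma3 * g lam * sigma3

/-- The twisted loop group: smooth maps from the circle `|lam| = r` to `SL₂ ℂ`. -/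
structure IsLoop (r : ℝ) (g : ℂ → Mat2) : Prop where
  smooth : ∀ i j, ContDiff ℝ ∞ (fun t : ℝ => g (circleMap 0 r t) i j)
  det_eq_one : ∀ lam ∈ Metric.sphere (0 : ℂ) r, (g lam).det = 1
  twisted : IsTwistedOn (Metric.sphere 0 r) g

/-- The positive twisted loops: those which extend holomorphically to the disk `|lam| < r`. -/
structure IsPosLoop (r : ℝ) (B : ℂ → Mat2) : Prop where
  smooth : ∀ i j, ContDiff ℝ ∞ (fun t : ℝ => B (circleMap 0 r t) i j)
  continuousOn : ∀ i j, ContinuousOn (fun lam => B lam i j) (Metric.closedBall 0 r)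
  holomorphic : ∀ i j, DifferentiableOn ℂ (fun lam => B lam i j) (Metric.ball 0 r)
  det_eq_one : ∀ lam ∈ Metric.closedBall (0 : ℂ) r, (B lam).det = 1
  twisted : IsTwistedOn (Metric.closedBall 0 r) B

/-- The normalized positive loops: at `lam = 0` diagonal with positive real diagonal entries. -/
def IsNormalized (B : ℂ → Mat2) : Prop :=
  ∃ b : ℝ, 0 < b ∧ B 0 = !![(b : ℂ), 0; 0, (b : ℂ)⁻¹]

/-- The closed annulus `r ≤ |lam| ≤ 1/r`; for `r = 1` it is the unit circle. -/
def closedAnnulus (r : ℝ) : Set ℂ := {lam | r ≤ ‖lam‖ ∧ ‖lam‖ ≤ r⁻¹}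

/-- The twisted `SU(2)`-loops, `0 < r ≤ 1`. For `r = 1` these are the smooth twisted maps from the
unit circle to `SU(2)`; for `r < 1` they extend holomorphically to `r < |lam| < 1/r` and are
`SU(2)`-valued on the unit circle. -/
structure IsUnitaryLoop (r : ℝ) (F : ℂ → Mat2) : Prop where
  smooth : ∀ i j, ContDiff ℝ ∞ (fun t : ℝ => F (circleMap 0 r t) i j)
  continuousOn : ∀ i j, ContinuousOn (fun lam => F lam i j) (closedAnnulus r)
  holomorphic : ∀ i j, DifferentiableOn ℂ (fun lam => F lam i j) {lam | r < ‖lam‖ ∧ ‖lam‖ < r⁻¹}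
  det_eq_one : ∀ lam ∈ closedAnnulus r, (F lam).det = 1
  twisted : IsTwistedOn (closedAnnulus r) F
  unitary : ∀ lam ∈ Metric.sphere (0 : ℂ) 1, F lam ∈ Matrix.unitaryGroup (Fin 2) ℂ

/-- A `z`-dependent loop is jointly smooth in `z ∈ U` and in the angle on the circle `|lam| = s`. -/
def JointlySmooth (s : ℝ) (U : Set ℂ) (g : ℂ → ℂ → Mat2) : Prop :=
  ∀ i j, ContDiffOn ℝ ∞ (fun q : ℂ × ℝ => g q.1 (circleMap 0 s q.2) i j) (U ×ˢ Set.univ)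

/-! ### Potentials -/

/-- A potential `ξ = (xi z lam) dz`. -/
abbrev Potential := ℂ → ℂ → Mat2

/-- `lam⁻¹ [[0, 1], [c z^k, 0]] dz`. -/
def xi (c : ℂ) (k : ℤ) : Potential := fun z lam => lam⁻¹ • !![0, 1; c * z ^ k, 0]

/-- `a lam⁻¹ [[0, 1], [1, 0]] dz / z`. -/
def cylinderPotential (a : ℂ) : Potential := fun z lam => (a * lam⁻¹ * z⁻¹) • !![0, 1; 1, 0]

/-- The pull-back of a potential under a holomorphic map `φ`. -/
def pullback (φ : ℂ → ℂ) (ξ : Potential) : Potential := fun w lam => deriv φ w • ξ (φ w) lam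

/-- Entrywise `z`-derivative of a `z`-dependent loop. -/
def zDeriv (p : ℂ → ℂ → Mat2) (z lam : ℂ) : Mat2 :=
  Matrix.of fun i j => deriv (fun w => p w lam i j) z

/-- `ξ' = p⁻¹ ξ p + p⁻¹ dp` on `U` for a gauge `p` that is holomorphic in `z ∈ U` with values in
the positive loops. -/
def GaugeEquiv (r : ℝ) (U : Set ℂ) (ξ ξ' : Potential) : Prop :=
  ∃ p : ℂ → ℂ → Mat2,
    (∀ z ∈ U, IsPosLoop r (p z)) ∧
    (∀ lam ∈ Metric.closedBall (0 : ℂ) r, ∀ i j, DifferentiableOn ℂ (fun z => p z lam i j) U) ∧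
    JointlySmooth r U p ∧
    ∀ z ∈ U, ∀ lam ∈ Metric.sphere (0 : ℂ) r,
      ξ' z lam = (p z lam)⁻¹ * ξ z lam * p z lam + (p z lam)⁻¹ * zDeriv p z lam

/-- Two potentials on `ℂ \ {0}` agree up to a biholomorphic coordinate change of `ℂ \ {0}` and a
gauge transformation. -/
def CoordGaugeEquiv (r : ℝ) (ξ ξ' : Potential) : Prop :=
  ∃ φ : ℂ → ℂ, DifferentiableOn ℂ φ {0}ᶜ ∧ Set.BijOn φ {0}ᶜ {0}ᶜ ∧
    GaugeEquiv r {0}ᶜ (pullback φ ξ) ξ'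

/-! ### The DPW construction -/

/-- `dL = L ξ` on `U`, with Iwasawa splitting `L = F B`. -/
structure IsDPWData (r : ℝ) (ξ : Potential) (U : Set ℂ) (L F B : ℂ → ℂ → Mat2) : Prop where
  loop : ∀ z ∈ U, IsLoop r (L z)
  solves : ∀ z ∈ U, ∀ lam ∈ Metric.sphere (0 : ℂ) r, ∀ i j,
    HasDerivAt (fun w => L w lam i j) ((L z lam * ξ z lam) i j) z
  smooth_L : JointlySmooth r U L
  unitary : ∀ z ∈ U, IsUnitaryLoop r (F z)
  smooth_F : ∀ s ∈ Set.Icc r 1, JointlySmooth s U F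
  positive : ∀ z ∈ U, IsPosLoop r (B z)
  normalized : ∀ z ∈ U, IsNormalized (B z)
  splitting : ∀ z ∈ U, ∀ lam ∈ Metric.sphere (0 : ℂ) r, L z lam = F z lam * B z lam

/-- `lam ∂F/∂lam` at a point `lam₀` of the unit circle, as `-i` times the angular derivative. -/
def lamDeriv (F : ℂ → Mat2) (lam₀ : ℂ) : Mat2 :=
  Matrix.of fun i j => -Complex.I * deriv (fun t : ℝ => F (lam₀ * circleMap 0 1 t) i j) 0

/-- The Sym-Bobenko formula `-i/(2H) [F σ₃ F⁻¹ + 2 ε lam (∂F/∂lam) F⁻¹]`, where the sign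
`ε = ±1` distinguishes the two parallel CMC surfaces of a frame (up to a point reflection). -/
def symBobenko (ε H : ℝ) (F : ℂ → Mat2) (lam₀ : ℂ) : Mat2 :=
  (-Complex.I / (2 * (H : ℂ))) •
    (F lam₀ * sigma3 * (F lam₀)⁻¹ + (2 * (ε : ℂ)) • (lamDeriv F lam₀ * (F lam₀)⁻¹))

/-- The identification of `su(2)` with `ℝ³`: the coordinates of `X` in the basis `-i σ₁, -i σ₂,
-i σ₃` of Pauli matrices, orthonormal for `⟨X, Y⟩ = -(1/2) tr (X Y)`. -/
def toR3 (X : Mat2) : E3 := !₂[-(X 0 1).im, -(X 0 1).re, -(X 0 0).im]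

/-- `f` is, on `U`, a surface which the DPW method makes from `ξ`, at the spectral parameter
`lam₀`. -/
def IsDPWSurface (r ε H : ℝ) (lam₀ : ℂ) (ξ : Potential) (U : Set ℂ) (f : ℂ → E3) : Prop :=
  ∃ L F B : ℂ → ℂ → Mat2, IsDPWData r ξ U L F B ∧
    ∀ z ∈ U, f z = toR3 (symBobenko ε H (F z) lam₀)

/-- `f` is, on `Ω ⊆ ℂ \ {0}`, a well-defined surface which the DPW method makes from `ξ`: the
frame and the solution `L` live over `Ω` on the covering `exp`, while `f` is a function on `Ω`. -/
def IsClosedDPWSurface (r ε H : ℝ) (lam₀ : ℂ) (ξ : Potential) (Ω : Set ℂ) (f : ℂ → E3) : Prop :=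
  IsDPWSurface r ε H lam₀ (pullback Complex.exp ξ) (Complex.exp ⁻¹' Ω) (f ∘ Complex.exp)

/-- Smyth surfaces: the potential `lam⁻¹ [[0, 1], [c z^k, 0]] dz` on all of `ℂ`, loops on the unit
circle, and the initial condition `L = id` at `z = 0`. -/
def IsSmythSurface (ε H : ℝ) (lam₀ : ℂ) (c : ℂ) (k : ℕ) (f : ℂ → E3) : Prop :=
  ∃ L F B : ℂ → ℂ → Mat2, IsDPWData 1 (xi c k) Set.univ L F B ∧
    (∀ lam ∈ Metric.sphere (0 : ℂ) 1, L 0 lam = 1) ∧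
    ∀ z, f z = toR3 (symBobenko ε H (F z) lam₀)

/-! ### Surfaces in `ℝ³` -/

/-- `f` is, on the open set `V`, a smooth conformal immersion of constant mean curvature `H` with
respect to a continuous unit normal field. (For a conformal immersion the mean curvature, half
the trace of the second fundamental form, is `⟨Δ f, N⟩ / (2 |f_x|²)`.) -/
def IsConformalCMC (H : ℝ) (V : Set ℂ) (f : ℂ → E3) : Prop :=
  ContDiffOn ℝ ∞ f V ∧ (∀ z ∈ V, ConformalAt f z) ∧
  ∃ N : ℂ → E3, ContinuousOn N V ∧ ∀ z ∈ V, ‖N z‖ = 1 ∧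
    (∀ v : ℂ, inner ℝ (fderiv ℝ f z v) (N z) = 0) ∧
    inner ℝ (Laplacian.laplacian f z) (N z) = 2 * H * ‖fderiv ℝ f z 1‖ ^ 2

/-- The round cylinders of radius `R`. -/
def IsRoundCylinder (R : ℝ) (S : Set E3) : Prop :=
  ∃ x₀ v : E3, ‖v‖ = 1 ∧ S = {x | ‖(x - x₀) - (inner ℝ v (x - x₀)) • v‖ = R}

/-- Annular domains in `ℂ \ {0}` with nontrivial winding about `0`: open, homeomorphic to a round
annulus, and carrying no continuous branch of the logarithm. -/
structure IsWindingAnnulus (Ω : Set ℂ) : Prop where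
  isOpen : IsOpen Ω
  zero_notMem : (0 : ℂ) ∉ Ω
  annular : Nonempty (Ω ≃ₜ {z : ℂ | 1 < ‖z‖ ∧ ‖z‖ < 2})
  winding : ¬ ∃ l : ℂ → ℂ, ContinuousOn l Ω ∧ ∀ z ∈ Ω, Complex.exp (l z) = z

end DPW

end

noncomputable section

namespace DPW

open Set Metric MeasureTheory

/-! ### Fourier modes on circles -/

/-- The integral of `lam ^ n * g lam` over the circle `|lam| = s`, with respect to the angle. -/
def mode (s : ℝ) (n : ℤ) (g : ℂ → ℂ) : ℂ :=
  ∫ t in (0 : ℝ)..2 * Real.pi, (circleMap 0 s t) ^ n * g (circleMap 0 s t)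

lemma circleMap_mem_sphere_zero {s : ℝ} (hs : 0 ≤ s) (t : ℝ) : circleMap 0 s t ∈ sphere (0 : ℂ) s :=
  circleMap_mem_sphere 0 hs t

lemma circleMap_zero_ne_zero {s : ℝ} (hs : 0 < s) (t : ℝ) : circleMap 0 s t ≠ 0 := by
  simpa using circleMap_ne_center (c := 0) (R := s) hs.ne' (θ := t)

lemma exists_circleMap_eq {s : ℝ} (hs : 0 < s) {lam : ℂ} (h : lam ∈ sphere (0 : ℂ) s) :
    ∃ t, circleMap 0 s t = lam := by
  have : lam ∈ range (circleMap 0 s) := by rw [range_circleMap, abs_of_pos hs]; exact h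
  exact this

lemma mode_congr {s : ℝ} (hs : 0 ≤ s) {n : ℤ} {g h : ℂ → ℂ}
    (hgh : ∀ lam ∈ sphere (0 : ℂ) s, g lam = h lam) : mode s n g = mode s n h := by
  unfold mode
  congr 1; funext t; rw [hgh _ (circleMap_mem_sphere_zero hs t)]

lemma continuous_comp_circleMap {s : ℝ} (hs : 0 ≤ s) {g : ℂ → ℂ}
    (hg : ContinuousOn g (sphere 0 s)) : Continuous fun t => g (circleMap 0 s t) :=
  hg.comp_continuous (continuous_circleMap 0 s) (circleMap_mem_sphere_zero hs)

lemma continuous_zpow_circleMap {s : ℝ} (hs : 0 < s) (n : ℤ) :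
    Continuous fun t => (circleMap 0 s t) ^ n :=
  (continuous_circleMap 0 s).zpow₀ n fun t => Or.inl (circleMap_zero_ne_zero hs t)

lemma mode_intervalIntegrable {s : ℝ} (hs : 0 < s) {n : ℤ} {g : ℂ → ℂ}
    (hg : ContinuousOn g (sphere 0 s)) :
    IntervalIntegrable (fun t => (circleMap 0 s t) ^ n * g (circleMap 0 s t)) volume 0
      (2 * Real.pi) :=
  ((continuous_zpow_circleMap hs n).mul (continuous_comp_circleMap hs.le hg)).intervalIntegrable _ _

lemma mode_add {s : ℝ} (hs : 0 < s) {n : ℤ} {g h : ℂ → ℂ} (hg : ContinuousOn g (sphere 0 s))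
    (hh : ContinuousOn h (sphere 0 s)) :
    mode s n (fun lam => g lam + h lam) = mode s n g + mode s n h := by
  unfold mode
  rw [← intervalIntegral.integral_add (mode_intervalIntegrable hs hg)
    (mode_intervalIntegrable hs hh)]
  congr 1; funext t; ring

lemma mode_sub {s : ℝ} (hs : 0 < s) {n : ℤ} {g h : ℂ → ℂ} (hg : ContinuousOn g (sphere 0 s))
    (hh : ContinuousOn h (sphere 0 s)) :
    mode s n (fun lam => g lam - h lam) = mode s n g - mode s n h := by
  unfold mode
  rw [← intervalIntegral.integral_sub (mode_intervalIntegrable hs hg)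
    (mode_intervalIntegrable hs hh)]
  congr 1; funext t; ring

lemma mode_const_mul (s : ℝ) (n : ℤ) (a : ℂ) (g : ℂ → ℂ) :
    mode s n (fun lam => a * g lam) = a * mode s n g := by
  unfold mode
  rw [← intervalIntegral.integral_const_mul]
  congr 1; funext t; ring

lemma mode_zpow_mul {s : ℝ} (hs : 0 < s) (n m : ℤ) (g : ℂ → ℂ) :
    mode s n (fun lam => lam ^ m * g lam) = mode s (n + m) g := by
  unfold mode
  congr 1; funext t
  rw [zpow_add₀ (circleMap_zero_ne_zero hs t)]; ring

lemma mode_eq_circleIntegral {s : ℝ} (hs : 0 < s) (n : ℤ) (g : ℂ → ℂ) :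
    (∮ z in C(0, s), (z - 0)⁻¹ • (z ^ n * g z)) = Complex.I * mode s n g := by
  unfold mode circleIntegral
  rw [← intervalIntegral.integral_const_mul]
  congr 1; funext t
  have := circleMap_zero_ne_zero hs t
  simp only [deriv_circleMap, sub_zero, smul_eq_mul]
  field_simp

lemma mode_annulus {r R : ℝ} (hr : 0 < r) (hrR : r ≤ R) (n : ℤ) {g : ℂ → ℂ}
    (hc : ContinuousOn g {lam | r ≤ ‖lam‖ ∧ ‖lam‖ ≤ R})
    (hd : DifferentiableOn ℂ g {lam | r < ‖lam‖ ∧ ‖lam‖ < R}) : mode R n g = mode r n g := by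
  have key := Complex.circleIntegral_sub_center_inv_smul_eq_of_differentiable_on_annulus_off_countable
    (c := 0) hr hrR (f := fun z => z ^ n * g z) (s := ∅) countable_empty ?_ ?_
  · rw [mode_eq_circleIntegral (hr.trans_le hrR), mode_eq_circleIntegral hr] at key
    exact mul_left_cancel₀ Complex.I_ne_zero key
  · refine ContinuousOn.mul ?_ (hc.mono ?_)
    · intro z hz
      have : z ≠ 0 := by rintro rfl; simp at hz; linarith [hz.2]
      exact (continuousAt_zpow₀ z n (Or.inl this)).continuousWithinAt
    · intro z hz; simp at hz; exact ⟨hz.2, hz.1⟩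
  · intro z hz
    simp at hz
    have h0 : z ≠ 0 := by rintro rfl; simp at hz; linarith [hz.2]
    have ho : IsOpen {lam : ℂ | r < ‖lam‖ ∧ ‖lam‖ < R} :=
      (isOpen_lt continuous_const continuous_norm).inter (isOpen_lt continuous_norm continuous_const)
    exact (differentiableAt_zpow.2 (Or.inl h0)).mul (hd.differentiableAt (ho.mem_nhds ⟨hz.2, hz.1⟩))

lemma mode_disc_zero {s : ℝ} (hs : 0 < s) {g : ℂ → ℂ} (hc : ContinuousOn g (closedBall 0 s))
    (hd : DifferentiableOn ℂ g (ball 0 s)) : mode s 0 g = 2 * Real.pi * g 0 := by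
  have key := Complex.circleIntegral_sub_center_inv_smul_of_differentiable_on_off_countable
    (c := 0) hs (f := g) (s := ∅) countable_empty hc
    (fun z hz => hd.differentiableAt (isOpen_ball.mem_nhds hz.1))
  have h2 := mode_eq_circleIntegral hs 0 g
  simp only [zpow_zero, one_mul] at h2
  rw [h2] at key
  apply mul_left_cancel₀ Complex.I_ne_zero
  rw [key, smul_eq_mul]; ring

lemma mode_disc_pos {s : ℝ} (hs : 0 < s) {n : ℤ} (hn : 0 < n) {g : ℂ → ℂ}
    (hc : ContinuousOn g (closedBall 0 s)) (hd : DifferentiableOn ℂ g (ball 0 s)) :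
    mode s n g = 0 := by
  obtain ⟨m, rfl⟩ := Int.eq_ofNat_of_zero_le hn.le
  have hm : m ≠ 0 := by rintro rfl; simp at hn
  have := mode_disc_zero hs (g := fun z => z ^ m * g z) ((continuousOn_id.pow m).mul hc)
    ((differentiableOn_id.pow m).mul hd)
  simp only [zero_pow hm, zero_mul, mul_zero] at this
  rw [← this]; unfold mode; simp

instance fact_two_pi_pos : Fact (0 < 2 * Real.pi) := ⟨Real.two_pi_pos⟩

lemma fourier_two_pi_coe (n : ℤ) (t : ℝ) :
    fourier n (t : AddCircle (2 * Real.pi)) = (circleMap 0 1 t) ^ n := by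
  rw [fourier_coe_apply, circleMap_zero, Complex.ofReal_one, one_mul, ← Complex.exp_int_mul]
  congr 1
  have : (Real.pi : ℂ) ≠ 0 := by exact_mod_cast Real.pi_ne_zero
  push_cast
  field_simp

lemma circleMap_zero_eq_mul_one (s t : ℝ) : circleMap 0 s t = s * circleMap 0 1 t := by
  simp [circleMap]

/-- The continuous function on `ℝ / 2πℤ` of a function on the circle of radius `s`. -/
def onAddCircle (s : ℝ) (g : ℂ → ℂ) (hs : 0 ≤ s) (hg : ContinuousOn g (sphere 0 s)) :
    C(AddCircle (2 * Real.pi), ℂ) where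
  toFun x := g (s * fourier 1 x)
  continuous_toFun := by
    refine hg.comp_continuous (by fun_prop) fun x => ?_
    have : ‖(fourier 1 x : ℂ)‖ = 1 := by rw [fourier_one]; exact Circle.norm_coe _
    rw [mem_sphere_zero_iff_norm, norm_mul, this, mul_one, Complex.norm_real,
      Real.norm_of_nonneg hs]

lemma onAddCircle_coe {s : ℝ} {g : ℂ → ℂ} (hs : 0 ≤ s) (hg : ContinuousOn g (sphere 0 s)) (t : ℝ) :
    onAddCircle s g hs hg (t : AddCircle (2 * Real.pi)) = g (circleMap 0 s t) := by
  simp only [onAddCircle, ContinuousMap.coe_mk]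
  rw [fourier_two_pi_coe, zpow_one, ← circleMap_zero_eq_mul_one]

lemma fourierCoeff_onAddCircle {s : ℝ} {g : ℂ → ℂ} (hs : 0 < s) (hg : ContinuousOn g (sphere 0 s))
    (n : ℤ) : fourierCoeff (onAddCircle s g hs.le hg) n =
      (2 * Real.pi : ℂ)⁻¹ * ((s : ℂ) ^ n * mode s (-n) g) := by
  rw [fourierCoeff_eq_intervalIntegral _ n 0, zero_add, mode, ← intervalIntegral.integral_const_mul]
  simp only [one_div, Complex.real_smul]
  push_cast
  congr 2
  funext t
  rw [onAddCircle_coe hs.le hg, smul_eq_mul, fourier_two_pi_coe, circleMap_zero_eq_mul_one s,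
    mul_zpow, zpow_neg, zpow_neg, ← circleMap_zero_eq_mul_one]
  have : (s : ℂ) ^ n ≠ 0 := zpow_ne_zero _ (by exact_mod_cast hs.ne')
  field_simp

theorem eq_zero_of_mode_eq_zero {s : ℝ} (hs : 0 < s) {g : ℂ → ℂ} (hg : ContinuousOn g (sphere 0 s))
    (h : ∀ n, mode s n g = 0) : ∀ lam ∈ sphere (0 : ℂ) s, g lam = 0 := by
  intro lam hlam
  obtain ⟨t, rfl⟩ := exists_circleMap_eq hs hlam
  have hz : ∀ n, fourierCoeff (onAddCircle s g hs.le hg) n = 0 := fun n => by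
    rw [fourierCoeff_onAddCircle hs hg, h, mul_zero, mul_zero]
  have hsum := has_pointwise_sum_fourier_series_of_summable
    (f := onAddCircle s g hs.le hg) (by rw [funext hz]; exact summable_zero)
    (t : AddCircle (2 * Real.pi))
  simp only [hz, zero_smul] at hsum
  rw [← onAddCircle_coe hs.le hg t]
  exact (hsum.unique hasSum_zero)

theorem eq_of_mode_eq {s : ℝ} (hs : 0 < s) {g h : ℂ → ℂ} (hg : ContinuousOn g (sphere 0 s))
    (hh : ContinuousOn h (sphere 0 s)) (H : ∀ n, mode s n g = mode s n h) :
    ∀ lam ∈ sphere (0 : ℂ) s, g lam = h lam := fun lam hlam =>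
  sub_eq_zero.1 (eq_zero_of_mode_eq_zero hs (hg.sub hh)
    (fun n => (mode_sub hs hg hh).trans (by rw [H, sub_self])) lam hlam)

lemma sphere_subset_annulus_left {r R : ℝ} (hrR : r ≤ R) :
    sphere (0 : ℂ) r ⊆ {lam | r ≤ ‖lam‖ ∧ ‖lam‖ ≤ R} := by
  intro z hz; simp at hz; simp [hz, hrR]

lemma sphere_subset_annulus_right {r R : ℝ} (hrR : r ≤ R) :
    sphere (0 : ℂ) R ⊆ {lam | r ≤ ‖lam‖ ∧ ‖lam‖ ≤ R} := by
  intro z hz; simp at hz; simp [hz, hrR]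

/-- A function holomorphic on an annulus which vanishes on one boundary circle vanishes on the
other one. -/
theorem eq_zero_on_outer_iff {r R : ℝ} (hr : 0 < r) (hrR : r ≤ R) {g : ℂ → ℂ}
    (hc : ContinuousOn g {lam | r ≤ ‖lam‖ ∧ ‖lam‖ ≤ R})
    (hd : DifferentiableOn ℂ g {lam | r < ‖lam‖ ∧ ‖lam‖ < R}) :
    (∀ lam ∈ sphere (0 : ℂ) R, g lam = 0) ↔ ∀ lam ∈ sphere (0 : ℂ) r, g lam = 0 := by
  have h0 : ∀ s n, mode s n (fun _ => 0) = 0 := by intros; simp [mode]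
  constructor <;> intro h
  · refine eq_zero_of_mode_eq_zero hr (hc.mono (sphere_subset_annulus_left hrR)) fun n => ?_
    rw [← mode_annulus hr hrR n hc hd, mode_congr (hr.le.trans hrR) h, h0]
  · refine eq_zero_of_mode_eq_zero (hr.trans_le hrR) (hc.mono (sphere_subset_annulus_right hrR))
      fun n => ?_
    rw [mode_annulus hr hrR n hc hd, mode_congr hr.le h, h0]

lemma mode_zpow {s : ℝ} (hs : 0 < s) (n m : ℤ) :
    mode s n (fun lam => lam ^ m) = if n + m = 0 then 2 * (Real.pi : ℂ) else 0 := by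
  have h1 : mode s n (fun lam => lam ^ m) = mode s (n + m) (fun _ => 1) := by
    rw [← mode_zpow_mul hs]; simp
  rw [h1]
  split_ifs with h
  · rw [h, mode_disc_zero hs continuousOn_const (differentiableOn_const _)]; simp
  · have key := circleIntegral.integral_sub_zpow_of_ne (n := n + m - 1) (by omega) 0 0 s
    apply mul_left_cancel₀ Complex.I_ne_zero
    rw [← mode_eq_circleIntegral hs, mul_zero]
    refine Eq.trans ?_ key
    refine circleIntegral.integral_congr (E := ℂ) hs.le fun z hz => ?_
    have : z ≠ 0 := by rintro rfl; simp at hz; linarith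
    simp only [sub_zero, mul_one, smul_eq_mul]
    rw [zpow_sub_one₀ this]; ring

/-- Differentiation under the integral that defines a Fourier mode. -/
theorem hasFDerivAt_mode {s : ℝ} (hs : 0 < s) (n : ℤ) {U : Set ℂ} (hU : IsOpen U)
    {G : ℂ → ℂ → ℂ}
    (hG : ContDiffOn ℝ ∞ (fun q : ℂ × ℝ => G q.1 (circleMap 0 s q.2)) (U ×ˢ univ))
    {z₀ : ℂ} (hz : z₀ ∈ U) :
    ∃ D : ℂ →L[ℝ] ℂ, HasFDerivAt (fun z => mode s n (G z)) D z₀ ∧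
      ∀ v, D v = mode s n fun lam => fderiv ℝ (fun z => G z lam) z₀ v := by
  set g : ℂ × ℝ → ℂ := fun q => G q.1 (circleMap 0 s q.2) with hgdef
  have hO : IsOpen (U ×ˢ (univ : Set ℝ)) := hU.prod isOpen_univ
  have hdiff : ∀ q ∈ U ×ˢ (univ : Set ℝ), HasFDerivAt g (fderiv ℝ g q) q := fun q hq =>
    ((hG.differentiableOn (by simp)).differentiableAt (hO.mem_nhds hq)).hasFDerivAt
  have hcont : ContinuousOn (fderiv ℝ g) (U ×ˢ univ) :=
    hG.continuousOn_fderiv_of_isOpen hO (by simp)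
  have hgc : ContinuousOn g (U ×ˢ univ) := hG.continuousOn
  obtain ⟨δ, hδ, hball⟩ : ∃ δ > 0, closedBall z₀ δ ⊆ U := by
    obtain ⟨δ, hδ, h⟩ := Metric.isOpen_iff.1 hU z₀ hz
    exact ⟨δ / 2, by positivity, (closedBall_subset_ball (by linarith)).trans h⟩
  set g' : ℂ → ℝ → ℂ →L[ℝ] ℂ := fun z t => (circleMap 0 s t) ^ n •
    (fderiv ℝ g (z, t)).comp (ContinuousLinearMap.inl ℝ ℂ ℝ) with hg'
  have hpart : ∀ z ∈ U, ∀ t, HasFDerivAt (fun z => G z (circleMap 0 s t))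
      ((fderiv ℝ g (z, t)).comp (ContinuousLinearMap.inl ℝ ℂ ℝ)) z := fun z hz t => by
    have h2 : HasFDerivAt (fun z : ℂ => (z, t)) (ContinuousLinearMap.inl ℝ ℂ ℝ) z :=
      hasFDerivAt_prodMk_left z t
    exact (hdiff (z, t) ⟨hz, mem_univ _⟩).comp z h2
  have hg'c : ContinuousOn (fun q : ℂ × ℝ => g' q.1 q.2) (U ×ˢ univ) := by
    refine ((continuous_zpow_circleMap hs n).comp continuous_snd).continuousOn.smul ?_
    exact hcont.clm_comp continuousOn_const
  obtain ⟨C, hC⟩ := ((isCompact_closedBall z₀ δ).prod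
    (isCompact_Icc (a := 0) (b := 2 * Real.pi))).exists_bound_of_continuousOn
    (hg'c.mono (prod_mono hball (subset_univ _)))
  have hcont_t : ∀ z ∈ U, Continuous fun t => (circleMap 0 s t) ^ n * g (z, t) := fun z hz =>
    (continuous_zpow_circleMap hs n).mul
      (hgc.comp_continuous (by fun_prop) fun t => ⟨hz, mem_univ _⟩)
  have hcont' : Continuous (g' z₀) :=
    hg'c.comp_continuous (f := fun t : ℝ => (z₀, t)) (by fun_prop) fun t => ⟨hz, mem_univ _⟩
  have main := intervalIntegral.hasFDerivAt_integral_of_dominated_of_fderiv_le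
    (μ := volume) (a := 0) (b := 2 * Real.pi) (x₀ := z₀) (s := closedBall z₀ δ) (𝕜 := ℝ)
    (F := fun z t => (circleMap 0 s t) ^ n * g (z, t)) (F' := g')
    (bound := fun _ => C) (closedBall_mem_nhds _ hδ) ?_ ?_ ?_ ?_ ?_ ?_
  · refine ⟨_, main, fun v => ?_⟩
    rw [ContinuousLinearMap.intervalIntegral_apply (hcont'.intervalIntegrable _ _)]
    unfold mode
    congr 1; funext t
    beta_reduce
    rw [(hpart z₀ hz t).fderiv]; simp [hg']
  · filter_upwards [closedBall_mem_nhds z₀ hδ] with z hz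
    exact (hcont_t z (hball hz)).aestronglyMeasurable
  · exact (hcont_t z₀ hz).intervalIntegrable _ _
  · exact hcont'.aestronglyMeasurable
  · refine Filter.Eventually.of_forall fun t ht z hz => hC (z, t) ⟨hz, ?_⟩
    rw [uIoc_of_le Real.two_pi_pos.le] at ht
    exact ⟨ht.1.le, ht.2⟩
  · exact intervalIntegrable_const
  · refine Filter.Eventually.of_forall fun t _ z hz => ?_
    exact (hpart z (hball hz) t).const_mul _

lemma continuousOn_sphere_of_comp {s : ℝ} (hs : 0 < s) {g : ℂ → ℂ}
    (h : Continuous fun t => g (circleMap 0 s t)) : ContinuousOn g (sphere 0 s) := by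
  rw [continuousOn_iff_continuous_domRestrict]
  let φ : Icc 0 (2 * Real.pi) → sphere (0 : ℂ) s := fun t =>
    ⟨circleMap 0 s t, circleMap_mem_sphere_zero hs.le t⟩
  have hφ : Continuous φ := by
    refine Continuous.subtype_mk ?_ _
    exact (continuous_circleMap 0 s).comp continuous_subtype_val
  have hsurj : Function.Surjective φ := by
    rintro ⟨z, hz⟩
    have : z ∈ circleMap 0 s '' Ioc 0 (2 * Real.pi) := by
      rw [image_circleMap_Ioc, abs_of_pos hs]; exact hz
    obtain ⟨t, ht, rfl⟩ := this
    exact ⟨⟨t, ht.1.le, ht.2⟩, rfl⟩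
  have hq : Topology.IsQuotientMap φ := hφ.isClosedMap.isQuotientMap hφ hsurj
  rw [hq.continuous_iff]
  exact h.comp continuous_subtype_val

lemma mode_comp_neg (s : ℝ) (n : ℤ) (g : ℂ → ℂ) :
    mode s n (fun lam => g (-lam)) = (-1) ^ n * mode s n g := by
  unfold mode
  rw [← intervalIntegral.integral_const_mul]
  set φ : ℝ → ℂ := fun t => (-1) ^ n * ((circleMap 0 s t) ^ n * g (circleMap 0 s t)) with hφ
  have hper : Function.Periodic φ (2 * Real.pi) := by
    intro t; simp only [hφ, periodic_circleMap 0 s t]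
  have hneg : ∀ t, circleMap 0 s (t + Real.pi) = -circleMap 0 s t := by
    intro t; simp [circleMap, add_mul, Complex.exp_add]
  have h1 : (∫ t in (0 : ℝ)..2 * Real.pi, φ t) = ∫ t in (0 : ℝ)..2 * Real.pi, φ (t + Real.pi) := by
    rw [intervalIntegral.integral_comp_add_right, zero_add, add_comm (2 * Real.pi)]
    simpa using hper.intervalIntegral_add_eq 0 Real.pi
  rw [h1]
  congr 1; funext t
  simp only [hφ, hneg, neg_eq_neg_one_mul (circleMap 0 s t), mul_zpow]
  rw [← mul_assoc, ← mul_assoc, ← mul_zpow]; simp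

lemma mode_conj (n : ℤ) (g : ℂ → ℂ) :
    mode 1 n (fun lam => (starRingEnd ℂ) (g lam)) = (starRingEnd ℂ) (mode 1 (-n) g) := by
  unfold mode
  rw [intervalIntegral.integral_of_le Real.two_pi_pos.le,
    intervalIntegral.integral_of_le Real.two_pi_pos.le, ← integral_conj]
  congr 1; funext t
  have : (starRingEnd ℂ) (circleMap 0 1 t) = (circleMap 0 1 t)⁻¹ := by
    rw [Complex.inv_def]; simp [Complex.normSq_eq_norm_sq]
  rw [map_mul, map_zpow₀, this, inv_zpow', neg_neg]

lemma laurent_of_modes {s : ℝ} (hs : 0 < s) {g : ℂ → ℂ} (hg : ContinuousOn g (sphere 0 s))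
    {a b c : ℂ} (h1 : mode s 1 g = 2 * Real.pi * a) (h0 : mode s 0 g = 2 * Real.pi * b)
    (h2 : mode s (-1) g = 2 * Real.pi * c) (hp : ∀ n : ℤ, 2 ≤ n → mode s n g = 0)
    (hm : ∀ n : ℤ, n ≤ -2 → mode s n g = 0) :
    ∀ lam ∈ sphere (0 : ℂ) s, g lam = a * lam⁻¹ + b + c * lam := by
  have hinv : ∀ m : ℤ, ContinuousOn (fun lam : ℂ => lam ^ m) (sphere 0 s) := fun m lam hlam => by
    refine (continuousAt_zpow₀ lam m (Or.inl ?_)).continuousWithinAt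
    rintro rfl; simp at hlam; linarith
  have hmul : ∀ (a : ℂ) (m : ℤ), ContinuousOn (fun lam : ℂ => a * lam ^ m) (sphere 0 s) :=
    fun a m => continuousOn_const.mul (hinv m)
  have hsum : ContinuousOn (fun lam : ℂ => a * lam ^ (-1 : ℤ) + b * lam ^ (0 : ℤ)) (sphere 0 s) :=
    (hmul _ _).add (hmul _ _)
  have key := eq_of_mode_eq hs hg (h := fun lam => (a * lam ^ (-1 : ℤ) + b * lam ^ (0 : ℤ)) +
    c * lam ^ (1 : ℤ)) (hsum.add (hmul _ _)) fun n => ?_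
  · simpa using key
  rw [mode_add hs hsum (hmul _ _), mode_add hs (hmul _ _) (hmul _ _), mode_const_mul,
    mode_const_mul, mode_const_mul, mode_zpow hs, mode_zpow hs, mode_zpow hs]
  rcases lt_trichotomy n 0 with hn | rfl | hn
  · rcases eq_or_lt_of_le (show n ≤ -1 by omega) with rfl | hn'
    · rw [h2]; simp [mul_comm]
    · rw [hm n (by omega), if_neg (by omega), if_neg (by omega), if_neg (by omega)]; simp
  · rw [h0]; simp [mul_comm]
  · rcases eq_or_lt_of_le (show 1 ≤ n by omega) with rfl | hn'
    · rw [h1]; simp [mul_comm]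
    · rw [hp n (by omega), if_neg (by omega), if_neg (by omega), if_neg (by omega)]; simp

end DPW

end

noncomputable section

namespace DPW

open Set Metric MeasureTheory

/-! ### Algebra of loops -/

lemma mat2_mul_apply (A B : Mat2) (i j : Fin 2) : (A * B) i j = A i 0 * B 0 j + A i 1 * B 1 j := by
  rw [Matrix.mul_apply, Fin.sum_univ_two]

lemma inv_eq_of_det_eq_one {A : Mat2} (h : A.det = 1) :
    A⁻¹ = !![A 1 1, -A 0 1; -A 1 0, A 0 0] := by
  rw [Matrix.inv_def, h, Ring.inverse_one, one_smul, Matrix.adjugate_fin_two]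

lemma mul_inv_of_det_eq_one {A : Mat2} (h : A.det = 1) : A * A⁻¹ = 1 :=
  Matrix.mul_nonsing_inv A (by rw [h]; exact isUnit_one)

lemma inv_mul_of_det_eq_one {A : Mat2} (h : A.det = 1) : A⁻¹ * A = 1 :=
  Matrix.nonsing_inv_mul A (by rw [h]; exact isUnit_one)

lemma det_inv_of_det_eq_one {A : Mat2} (h : A.det = 1) : A⁻¹.det = 1 := by
  rw [Matrix.det_nonsing_inv, h, Ring.inverse_one]

lemma sigma3_mul_self : sigma3 * sigma3 = 1 := by
  ext i j; fin_cases i <;> fin_cases j <;> simp [sigma3, mat2_mul_apply]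

lemma sigma3_inv : sigma3⁻¹ = sigma3 := Matrix.inv_eq_right_inv sigma3_mul_self

lemma IsTwistedOn.mul {S : Set ℂ} {g h : ℂ → Mat2} (hg : IsTwistedOn S g) (hh : IsTwistedOn S h) :
    IsTwistedOn S fun lam => g lam * h lam := by
  intro lam hlam
  simp only [hg lam hlam, hh lam hlam]
  calc sigma3 * g lam * sigma3 * (sigma3 * h lam * sigma3)
      = sigma3 * g lam * (sigma3 * sigma3) * h lam * sigma3 := by simp only [mul_assoc]
    _ = _ := by rw [sigma3_mul_self, mul_one]; simp only [mul_assoc]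

lemma IsTwistedOn.inv {S : Set ℂ} {g : ℂ → Mat2} (hg : IsTwistedOn S g) :
    IsTwistedOn S fun lam => (g lam)⁻¹ := by
  intro lam hlam
  simp only [hg lam hlam, Matrix.mul_inv_rev, sigma3_inv, mul_assoc]

lemma IsTwistedOn.mono {S S' : Set ℂ} {g : ℂ → Mat2} (hg : IsTwistedOn S g) (h : S' ⊆ S) :
    IsTwistedOn S' g := fun lam hlam => hg lam (h hlam)

lemma sigma3_conj_apply (A : Mat2) :
    sigma3 * A * sigma3 = !![A 0 0, -A 0 1; -A 1 0, A 1 1] := by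
  ext i j; rw [mat2_mul_apply, mat2_mul_apply, mat2_mul_apply]
  fin_cases i <;> fin_cases j <;> simp [sigma3]

lemma isTwistedOn_iff {S : Set ℂ} {g : ℂ → Mat2} : IsTwistedOn S g ↔ ∀ lam ∈ S,
    g (-lam) 0 0 = g lam 0 0 ∧ g (-lam) 0 1 = -g lam 0 1 ∧ g (-lam) 1 0 = -g lam 1 0 ∧
      g (-lam) 1 1 = g lam 1 1 := by
  refine forall₂_congr fun lam _ => ?_
  rw [sigma3_conj_apply]
  constructor
  · intro h; simp [h]
  · rintro ⟨h1, h2, h3, h4⟩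
    ext i j; fin_cases i <;> fin_cases j <;> simp [h1, h2, h3, h4]

lemma IsPosLoop.mul {r : ℝ} {A B : ℂ → Mat2} (hA : IsPosLoop r A) (hB : IsPosLoop r B) :
    IsPosLoop r fun lam => A lam * B lam where
  smooth i j := by
    simp only [mat2_mul_apply]
    exact ((hA.smooth _ _).mul (hB.smooth _ _)).add ((hA.smooth _ _).mul (hB.smooth _ _))
  continuousOn i j := by
    simp only [mat2_mul_apply]
    exact ((hA.continuousOn _ _).mul (hB.continuousOn _ _)).add
      ((hA.continuousOn _ _).mul (hB.continuousOn _ _))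
  holomorphic i j := by
    simp only [mat2_mul_apply]
    exact ((hA.holomorphic _ _).mul (hB.holomorphic _ _)).add
      ((hA.holomorphic _ _).mul (hB.holomorphic _ _))
  det_eq_one lam h := by rw [Matrix.det_mul, hA.det_eq_one lam h, hB.det_eq_one lam h, one_mul]
  twisted := hA.twisted.mul hB.twisted

lemma IsPosLoop.inv {r : ℝ} (hr : 0 ≤ r) {A : ℂ → Mat2} (hA : IsPosLoop r A) :
    IsPosLoop r fun lam => (A lam)⁻¹ := by
  have key : ∀ lam ∈ closedBall (0 : ℂ) r, (A lam)⁻¹ =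
      !![A lam 1 1, -A lam 0 1; -A lam 1 0, A lam 0 0] := fun lam h =>
    inv_eq_of_det_eq_one (hA.det_eq_one lam h)
  have hs : ∀ t, circleMap 0 r t ∈ closedBall (0 : ℂ) r := fun t =>
    sphere_subset_closedBall (circleMap_mem_sphere 0 hr t)
  constructor
  · intro i j
    simp only [fun t => key _ (hs t)]
    fin_cases i <;> fin_cases j
    · exact hA.smooth 1 1
    · exact (hA.smooth 0 1).neg
    · exact (hA.smooth 1 0).neg
    · exact hA.smooth 0 0
  · intro i j
    refine ContinuousOn.congr ?_ fun lam h => congrFun (congrFun (key lam h) i) j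
    fin_cases i <;> fin_cases j
    · exact hA.continuousOn 1 1
    · exact (hA.continuousOn 0 1).neg
    · exact (hA.continuousOn 1 0).neg
    · exact hA.continuousOn 0 0
  · intro i j
    refine DifferentiableOn.congr ?_ fun lam h =>
      congrFun (congrFun (key lam (ball_subset_closedBall h)) i) j
    fin_cases i <;> fin_cases j
    · exact hA.holomorphic 1 1
    · exact (hA.holomorphic 0 1).neg
    · exact (hA.holomorphic 1 0).neg
    · exact hA.holomorphic 0 0
  · exact fun lam h => det_inv_of_det_eq_one (hA.det_eq_one lam h)
  · exact hA.twisted.inv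

lemma IsPosLoop.const {r : ℝ} {D : Mat2} (hD : D.det = 1) (h : sigma3 * D * sigma3 = D) :
    IsPosLoop r fun _ => D where
  smooth _ _ := contDiff_const
  continuousOn _ _ := continuousOn_const
  holomorphic _ _ := differentiableOn_const _
  det_eq_one _ _ := hD
  twisted _ _ := h.symm

lemma IsPosLoop.apply_zero {r : ℝ} (hr : 0 ≤ r) {A : ℂ → Mat2} (hA : IsPosLoop r A) :
    A 0 0 1 = 0 ∧ A 0 1 0 = 0 ∧ A 0 0 0 * A 0 1 1 = 1 := by
  have h0 : (0 : ℂ) ∈ closedBall (0 : ℂ) r := by simpa using hr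
  obtain ⟨-, h1, h2, -⟩ := isTwistedOn_iff.1 hA.twisted 0 h0
  rw [neg_zero] at h1 h2
  have h1' : A 0 0 1 = 0 := self_eq_neg.1 h1
  have h2' : A 0 1 0 = 0 := self_eq_neg.1 h2
  have := hA.det_eq_one 0 h0
  rw [Matrix.det_fin_two, h1', zero_mul, sub_zero] at this
  exact ⟨h1', h2', this⟩

lemma IsLoop.mul {r : ℝ} {A B : ℂ → Mat2} (hA : IsLoop r A) (hB : IsLoop r B) :
    IsLoop r fun lam => A lam * B lam where
  smooth i j := by
    simp only [mat2_mul_apply]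
    exact ((hA.smooth _ _).mul (hB.smooth _ _)).add ((hA.smooth _ _).mul (hB.smooth _ _))
  det_eq_one lam h := by rw [Matrix.det_mul, hA.det_eq_one lam h, hB.det_eq_one lam h, one_mul]
  twisted := hA.twisted.mul hB.twisted

lemma IsPosLoop.isLoop {r : ℝ} {A : ℂ → Mat2} (hA : IsPosLoop r A) : IsLoop r A where
  smooth := hA.smooth
  det_eq_one lam h := hA.det_eq_one lam (sphere_subset_closedBall h)
  twisted := hA.twisted.mono sphere_subset_closedBall

lemma IsUnitaryLoop.mul {r : ℝ} {A B : ℂ → Mat2} (hA : IsUnitaryLoop r A)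
    (hB : IsUnitaryLoop r B) : IsUnitaryLoop r fun lam => A lam * B lam where
  smooth i j := by
    simp only [mat2_mul_apply]
    exact ((hA.smooth _ _).mul (hB.smooth _ _)).add ((hA.smooth _ _).mul (hB.smooth _ _))
  continuousOn i j := by
    simp only [mat2_mul_apply]
    exact ((hA.continuousOn _ _).mul (hB.continuousOn _ _)).add
      ((hA.continuousOn _ _).mul (hB.continuousOn _ _))
  holomorphic i j := by
    simp only [mat2_mul_apply]
    exact ((hA.holomorphic _ _).mul (hB.holomorphic _ _)).add
      ((hA.holomorphic _ _).mul (hB.holomorphic _ _))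
  det_eq_one lam h := by rw [Matrix.det_mul, hA.det_eq_one lam h, hB.det_eq_one lam h, one_mul]
  twisted := hA.twisted.mul hB.twisted
  unitary lam h := mul_mem (hA.unitary lam h) (hB.unitary lam h)

lemma IsUnitaryLoop.const {r : ℝ} {D : Mat2} (hD : D.det = 1) (h : sigma3 * D * sigma3 = D)
    (hu : D ∈ Matrix.unitaryGroup (Fin 2) ℂ) : IsUnitaryLoop r fun _ => D where
  smooth _ _ := contDiff_const
  continuousOn _ _ := continuousOn_const
  holomorphic _ _ := differentiableOn_const _
  det_eq_one _ _ := hD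
  twisted _ _ := h.symm
  unitary _ _ := hu

lemma JointlySmooth.mul {s : ℝ} {U : Set ℂ} {g h : ℂ → ℂ → Mat2} (hg : JointlySmooth s U g)
    (hh : JointlySmooth s U h) : JointlySmooth s U fun z lam => g z lam * h z lam := by
  intro i j
  simp only [mat2_mul_apply]
  exact ((hg _ _).mul (hh _ _)).add ((hg _ _).mul (hh _ _))

lemma JointlySmooth.congr {s : ℝ} (hs : 0 ≤ s) {U : Set ℂ} {g h : ℂ → ℂ → Mat2}
    (hg : JointlySmooth s U g) (hgh : ∀ z ∈ U, ∀ lam ∈ sphere (0 : ℂ) s, h z lam = g z lam) :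
    JointlySmooth s U h := by
  intro i j
  refine (hg i j).congr fun q hq => ?_
  simp only [hgh q.1 hq.1 _ (circleMap_mem_sphere_zero hs q.2)]

lemma JointlySmooth.inv {s : ℝ} (hs : 0 ≤ s) {U : Set ℂ} {g : ℂ → ℂ → Mat2}
    (hg : JointlySmooth s U g)
    (hdet : ∀ z ∈ U, ∀ lam ∈ sphere (0 : ℂ) s, (g z lam).det = 1) :
    JointlySmooth s U fun z lam => (g z lam)⁻¹ := by
  have key : JointlySmooth s U fun z lam =>
      !![g z lam 1 1, -g z lam 0 1; -g z lam 1 0, g z lam 0 0] := by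
    intro i j
    fin_cases i <;> fin_cases j
    · exact hg 1 1
    · exact (hg 0 1).neg
    · exact (hg 1 0).neg
    · exact hg 0 0
  exact key.congr hs fun z hz lam hlam => inv_eq_of_det_eq_one (hdet z hz lam hlam)

lemma JointlySmooth.comp {s : ℝ} {U V : Set ℂ} {g : ℂ → ℂ → Mat2} (hg : JointlySmooth s U g)
    {φ : ℂ → ℂ} (hφ : ContDiffOn ℝ ∞ φ V) (hm : MapsTo φ V U) :
    JointlySmooth s V fun z => g (φ z) := by
  intro i j
  refine (hg i j).comp (f := fun q : ℂ × ℝ => (φ q.1, q.2)) (t := U ×ˢ univ) ?_ ?_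
  · exact (hφ.comp contDiffOn_fst fun q hq => hq.1).prodMk contDiffOn_snd
  · exact fun q hq => ⟨hm hq.1, mem_univ _⟩

lemma JointlySmooth.mono {s : ℝ} {U V : Set ℂ} {g : ℂ → ℂ → Mat2} (hg : JointlySmooth s U g)
    (h : V ⊆ U) : JointlySmooth s V g := fun i j => (hg i j).mono (prod_mono h le_rfl)

lemma jointlySmooth_of_fst {s : ℝ} {U : Set ℂ} {g : ℂ → Mat2}
    (hg : ∀ i j, ContDiffOn ℝ ∞ (fun z => g z i j) U) : JointlySmooth s U fun z _ => g z :=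
  fun i j => (hg i j).comp contDiffOn_fst fun _ hq => hq.1

lemma contDiffOn_real_of_differentiableOn {U : Set ℂ} (hU : IsOpen U) {φ : ℂ → ℂ}
    (hφ : DifferentiableOn ℂ φ U) : ContDiffOn ℝ ∞ φ U :=
  (hφ.contDiffOn (n := ∞) hU).restrict_scalars ℝ

/-! ### Coordinate changes -/

lemma IsDPWData.congr {r : ℝ} {ξ ξ' : Potential} {U : Set ℂ} {L F B : ℂ → ℂ → Mat2}
    (h : IsDPWData r ξ U L F B) (hξ : ∀ z ∈ U, ∀ lam ∈ sphere (0 : ℂ) r, ξ' z lam = ξ z lam) :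
    IsDPWData r ξ' U L F B :=
  { h with
    solves := fun z hz lam hlam i j => (hξ z hz lam hlam).symm ▸ h.solves z hz lam hlam i j }

lemma IsDPWData.mono {r : ℝ} {ξ : Potential} {U V : Set ℂ} {L F B : ℂ → ℂ → Mat2}
    (h : IsDPWData r ξ U L F B) (hV : V ⊆ U) : IsDPWData r ξ V L F B where
  loop z hz := h.loop z (hV hz)
  solves z hz := h.solves z (hV hz)
  smooth_L := h.smooth_L.mono hV
  unitary z hz := h.unitary z (hV hz)
  smooth_F s hs := (h.smooth_F s hs).mono hV
  positive z hz := h.positive z (hV hz)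
  normalized z hz := h.normalized z (hV hz)
  splitting z hz := h.splitting z (hV hz)

lemma IsDPWData.pullback {r : ℝ} {ξ : Potential} {U V : Set ℂ} {L F B : ℂ → ℂ → Mat2}
    (h : IsDPWData r ξ U L F B) (hV : IsOpen V) {φ : ℂ → ℂ} (hφ : DifferentiableOn ℂ φ V)
    (hm : MapsTo φ V U) :
    IsDPWData r (DPW.pullback φ ξ) V (fun z => L (φ z)) (fun z => F (φ z)) (fun z => B (φ z)) where
  loop z hz := h.loop _ (hm hz)
  solves z hz lam hlam i j := by
    have h1 := h.solves (φ z) (hm hz) lam hlam i j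
    have h2 := (hφ.differentiableAt (hV.mem_nhds hz)).hasDerivAt
    have h3 := h1.comp z h2
    have h4 : (L (φ z) lam * DPW.pullback φ ξ z lam) i j =
        (L (φ z) lam * ξ (φ z) lam) i j * deriv φ z := by
      simp [DPW.pullback, mul_comm]
    rw [h4]; exact h3
  smooth_L := h.smooth_L.comp (contDiffOn_real_of_differentiableOn hV hφ) hm
  unitary z hz := h.unitary _ (hm hz)
  smooth_F s hs := (h.smooth_F s hs).comp (contDiffOn_real_of_differentiableOn hV hφ) hm
  positive z hz := h.positive _ (hm hz)
  normalized z hz := h.normalized _ (hm hz)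
  splitting z hz := h.splitting _ (hm hz)

lemma IsDPWSurface.congr {r ε H : ℝ} {lam₀ : ℂ} {ξ ξ' : Potential} {U : Set ℂ} {f f' : ℂ → E3}
    (h : IsDPWSurface r ε H lam₀ ξ U f)
    (hξ : ∀ z ∈ U, ∀ lam ∈ sphere (0 : ℂ) r, ξ' z lam = ξ z lam) (hf : ∀ z ∈ U, f' z = f z) :
    IsDPWSurface r ε H lam₀ ξ' U f' := by
  obtain ⟨L, F, B, h, hs⟩ := h
  exact ⟨L, F, B, h.congr hξ, fun z hz => (hf z hz).trans (hs z hz)⟩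

lemma IsDPWSurface.mono {r ε H : ℝ} {lam₀ : ℂ} {ξ : Potential} {U V : Set ℂ} {f : ℂ → E3}
    (h : IsDPWSurface r ε H lam₀ ξ U f) (hV : V ⊆ U) : IsDPWSurface r ε H lam₀ ξ V f := by
  obtain ⟨L, F, B, h, hs⟩ := h
  exact ⟨L, F, B, h.mono hV, fun z hz => hs z (hV hz)⟩

lemma IsDPWSurface.pullback {r ε H : ℝ} {lam₀ : ℂ} {ξ : Potential} {U V : Set ℂ} {f : ℂ → E3}
    (h : IsDPWSurface r ε H lam₀ ξ U f) (hV : IsOpen V) {φ : ℂ → ℂ} (hφ : DifferentiableOn ℂ φ V)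
    (hm : MapsTo φ V U) : IsDPWSurface r ε H lam₀ (DPW.pullback φ ξ) V (f ∘ φ) := by
  obtain ⟨L, F, B, h, hs⟩ := h
  exact ⟨_, _, _, h.pullback hV hφ hm, fun z hz => hs _ (hm hz)⟩

lemma GaugeEquiv.congr {r : ℝ} {ξ ξ' η η' : Potential} {U : Set ℂ} (h : GaugeEquiv r U ξ ξ')
    (h1 : ∀ z ∈ U, ∀ lam ∈ sphere (0 : ℂ) r, η z lam = ξ z lam)
    (h2 : ∀ z ∈ U, ∀ lam ∈ sphere (0 : ℂ) r, η' z lam = ξ' z lam) : GaugeEquiv r U η η' := by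
  obtain ⟨p, hp, hd, hs, he⟩ := h
  exact ⟨p, hp, hd, hs, fun z hz lam hlam => by rw [h1 z hz lam hlam, h2 z hz lam hlam]
                                                exact he z hz lam hlam⟩

lemma GaugeEquiv.pullback {r : ℝ} {ξ ξ' : Potential} {U V : Set ℂ} (h : GaugeEquiv r U ξ ξ')
    (hU : IsOpen U) (hV : IsOpen V) {φ : ℂ → ℂ} (hφ : DifferentiableOn ℂ φ V) (hm : MapsTo φ V U) :
    GaugeEquiv r V (DPW.pullback φ ξ) (DPW.pullback φ ξ') := by
  obtain ⟨p, hp, hd, hs, he⟩ := h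
  refine ⟨fun z => p (φ z), fun z hz => hp _ (hm hz), fun lam hlam i j => ?_,
    hs.comp (contDiffOn_real_of_differentiableOn hV hφ) hm, fun z hz lam hlam => ?_⟩
  · exact (hd lam hlam i j).comp hφ hm
  · have hz' : zDeriv (fun z => p (φ z)) z lam = deriv φ z • zDeriv p (φ z) lam := by
      ext i j
      have h1 := ((hd lam (sphere_subset_closedBall hlam) i j).differentiableAt
        (hU.mem_nhds (hm hz))).hasDerivAt
      have h2 := (hφ.differentiableAt (hV.mem_nhds hz)).hasDerivAt
      have h3 := (h1.comp z h2).deriv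
      simp only [zDeriv, Matrix.of_apply, Matrix.smul_apply, smul_eq_mul]
      rw [mul_comm]; exact h3
    simp only [DPW.pullback, hz', he _ (hm hz) lam hlam, smul_add, Matrix.mul_smul,
      Matrix.smul_mul]

/-! ### Gauge transformations -/

lemma zDeriv_inv {r : ℝ} {U : Set ℂ} (hU : IsOpen U) {p : ℂ → ℂ → Mat2}
    (hp : ∀ z ∈ U, IsPosLoop r (p z))
    (hd : ∀ lam ∈ closedBall (0 : ℂ) r, ∀ i j, DifferentiableOn ℂ (fun z => p z lam i j) U)
    {z : ℂ} (hz : z ∈ U) {lam : ℂ} (hlam : lam ∈ closedBall (0 : ℂ) r) :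
    p z lam * zDeriv (fun z lam => (p z lam)⁻¹) z lam = -(zDeriv p z lam * (p z lam)⁻¹) := by
  have hev : ∀ᶠ w in nhds z, w ∈ U := hU.mem_nhds hz
  have hD : ∀ i j, HasDerivAt (fun w => p w lam i j) (zDeriv p z lam i j) z := fun i j =>
    ((hd lam hlam i j).differentiableAt (hU.mem_nhds hz)).hasDerivAt
  have hi : zDeriv (fun z lam => (p z lam)⁻¹) z lam =
      !![zDeriv p z lam 1 1, -zDeriv p z lam 0 1; -zDeriv p z lam 1 0, zDeriv p z lam 0 0] := by
    ext i j
    have h1 : (fun w => (p w lam)⁻¹ i j) =ᶠ[nhds z]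
        fun w => !![p w lam 1 1, -p w lam 0 1; -p w lam 1 0, p w lam 0 0] i j := by
      filter_upwards [hev] with w hw
      rw [inv_eq_of_det_eq_one ((hp w hw).det_eq_one lam hlam)]
    simp only [zDeriv, Matrix.of_apply]
    rw [h1.deriv_eq]
    fin_cases i <;> fin_cases j <;> simp
  have hdet : zDeriv p z lam 0 0 * p z lam 1 1 + p z lam 0 0 * zDeriv p z lam 1 1 -
      (zDeriv p z lam 0 1 * p z lam 1 0 + p z lam 0 1 * zDeriv p z lam 1 0) = 0 := by
    have h1 := ((hD 0 0).mul (hD 1 1)).sub ((hD 0 1).mul (hD 1 0))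
    have h2 : (fun w => p w lam 0 0 * p w lam 1 1 - p w lam 0 1 * p w lam 1 0) =ᶠ[nhds z]
        fun _ => 1 := by
      filter_upwards [hev] with w hw
      rw [← Matrix.det_fin_two, (hp w hw).det_eq_one lam hlam]
    exact h1.unique ((hasDerivAt_const z (1 : ℂ)).congr_of_eventuallyEq h2)
  rw [hi, inv_eq_of_det_eq_one ((hp z hz).det_eq_one lam hlam)]
  ext i j
  rw [Matrix.neg_apply, mat2_mul_apply, mat2_mul_apply]
  fin_cases i <;> fin_cases j <;> simp <;> first | ring1 | linear_combination hdet

lemma GaugeEquiv.symm {r : ℝ} (hr : 0 ≤ r) {ξ ξ' : Potential} {U : Set ℂ} (hU : IsOpen U)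
    (h : GaugeEquiv r U ξ ξ') : GaugeEquiv r U ξ' ξ := by
  obtain ⟨p, hp, hd, hs, he⟩ := h
  refine ⟨fun z lam => (p z lam)⁻¹, fun z hz => (hp z hz).inv hr, fun lam hlam i j => ?_,
    hs.inv hr fun z hz lam hlam => (hp z hz).det_eq_one lam (sphere_subset_closedBall hlam),
    fun z hz lam hlam => ?_⟩
  · refine DifferentiableOn.congr (f := fun z =>
      !![p z lam 1 1, -p z lam 0 1; -p z lam 1 0, p z lam 0 0] i j) ?_ fun z hz => ?_
    · fin_cases i <;> fin_cases j
      · exact hd lam hlam 1 1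
      · exact (hd lam hlam 0 1).neg
      · exact (hd lam hlam 1 0).neg
      · exact hd lam hlam 0 0
    · change (p z lam)⁻¹ i j = _
      rw [inv_eq_of_det_eq_one ((hp z hz).det_eq_one lam hlam)]
  · have hlam' := sphere_subset_closedBall hlam
    have hdet := (hp z hz).det_eq_one lam hlam'
    have h1 := mul_inv_of_det_eq_one hdet
    have h2 := zDeriv_inv hU hp hd hz hlam'
    rw [Matrix.nonsing_inv_nonsing_inv _ (by rw [hdet]; exact isUnit_one), h2, he z hz lam hlam]
    rw [mul_add, ← mul_assoc, ← mul_assoc, ← mul_assoc, h1, one_mul, one_mul, add_mul,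
      mul_assoc (ξ z lam), h1, mul_one, add_neg_cancel_right]

/-- The phase of a nonzero complex number. -/
def phase (a : ℂ) : ℂ := a / (‖a‖ : ℂ)

lemma phase_mul_conj {a : ℂ} (ha : a ≠ 0) : phase a * (starRingEnd ℂ) (phase a) = 1 := by
  have h : (‖a‖ : ℂ) ≠ 0 := by exact_mod_cast norm_ne_zero_iff.2 ha
  rw [phase, map_div₀, Complex.conj_ofReal, div_mul_div_comm, Complex.mul_conj,
    Complex.normSq_eq_norm_sq]
  push_cast
  field_simp

lemma conj_phase_mul {a : ℂ} (ha : a ≠ 0) : (starRingEnd ℂ) (phase a) * a = (‖a‖ : ℂ) := by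
  have h : (‖a‖ : ℂ) ≠ 0 := by exact_mod_cast norm_ne_zero_iff.2 ha
  rw [phase, map_div₀, Complex.conj_ofReal, div_mul_eq_mul_div, mul_comm, Complex.mul_conj,
    Complex.normSq_eq_norm_sq]
  push_cast
  field_simp

/-- The diagonal matrix with entries `u, conj u`. -/
def phaseDiag (u : ℂ) : Mat2 := !![u, 0; 0, (starRingEnd ℂ) u]

lemma det_phaseDiag {u : ℂ} (hu : u * (starRingEnd ℂ) u = 1) : (phaseDiag u).det = 1 := by
  simp [phaseDiag, Matrix.det_fin_two, hu]

lemma phaseDiag_twisted (u : ℂ) : sigma3 * phaseDiag u * sigma3 = phaseDiag u := by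
  rw [sigma3_conj_apply]; simp [phaseDiag]

lemma phaseDiag_mem_unitary {u : ℂ} (hu : u * (starRingEnd ℂ) u = 1) :
    phaseDiag u ∈ Matrix.unitaryGroup (Fin 2) ℂ := by
  rw [Matrix.mem_unitaryGroup_iff]
  ext i j
  rw [mat2_mul_apply]
  fin_cases i <;> fin_cases j <;> simp [phaseDiag, hu, mul_comm, Matrix.star_apply]

lemma symBobenko_mul_phaseDiag (ε H : ℝ) {F : ℂ → Mat2} {lam₀ u : ℂ}
    (hu : u * (starRingEnd ℂ) u = 1) :
    symBobenko ε H (fun lam => F lam * phaseDiag u) lam₀ = symBobenko ε H F lam₀ := by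
  have hdet := det_phaseDiag hu
  have h1 := mul_inv_of_det_eq_one hdet
  have hcomm : phaseDiag u * sigma3 = sigma3 * phaseDiag u := by
    ext i j; rw [mat2_mul_apply, mat2_mul_apply]
    fin_cases i <;> fin_cases j <;> simp [phaseDiag, sigma3]
  have hlam : lamDeriv (fun lam => F lam * phaseDiag u) lam₀ = lamDeriv F lam₀ * phaseDiag u := by
    ext i j
    rw [mat2_mul_apply]
    simp only [lamDeriv, Matrix.of_apply, mat2_mul_apply]
    fin_cases j <;> simp [phaseDiag, deriv_mul_const_field, mul_assoc]
  unfold symBobenko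
  rw [hlam, Matrix.mul_inv_rev]
  have e1 : F lam₀ * phaseDiag u * sigma3 * ((phaseDiag u)⁻¹ * (F lam₀)⁻¹) =
      F lam₀ * sigma3 * (F lam₀)⁻¹ := by
    rw [mul_assoc (F lam₀), hcomm, mul_assoc, mul_assoc, mul_assoc, ← mul_assoc (phaseDiag u), h1,
      one_mul]
  have e2 : lamDeriv F lam₀ * phaseDiag u * ((phaseDiag u)⁻¹ * (F lam₀)⁻¹) =
      lamDeriv F lam₀ * (F lam₀)⁻¹ := by
    rw [mul_assoc, ← mul_assoc (phaseDiag u), h1, one_mul]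
  rw [e1, e2]

/-- Gauge equivalent potentials produce the same surfaces. -/
theorem GaugeEquiv.isDPWSurface {r ε H : ℝ} (hr : 0 < r) {lam₀ : ℂ} {ξ ξ' : Potential} {U : Set ℂ}
    (hU : IsOpen U) (h : GaugeEquiv r U ξ ξ') {f : ℂ → E3} (hf : IsDPWSurface r ε H lam₀ ξ U f) :
    IsDPWSurface r ε H lam₀ ξ' U f := by
  obtain ⟨p, hp, hd, hs, he⟩ := h
  obtain ⟨L, F, B, hdata, hsurf⟩ := hf
  have h0 : (0 : ℂ) ∈ closedBall (0 : ℂ) r := by simpa using hr.le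
  set a : ℂ → ℂ := fun z => p z 0 0 0 with ha
  have ha0 : ∀ z ∈ U, a z ≠ 0 := fun z hz h => by
    have := ((hp z hz).apply_zero hr.le).2.2
    simp only [ha] at h
    rw [h, zero_mul] at this; exact zero_ne_one this
  set u : ℂ → ℂ := fun z => phase (a z) with hu
  have hu1 : ∀ z ∈ U, u z * (starRingEnd ℂ) (u z) = 1 := fun z hz => phase_mul_conj (ha0 z hz)
  have hus : ContDiffOn ℝ ∞ u U := by
    have h1 : ContDiffOn ℝ ∞ a U := contDiffOn_real_of_differentiableOn hU (hd 0 h0 0 0)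
    have h2 : ContDiffOn ℝ ∞ (fun z => ((‖a z‖ : ℝ) : ℂ)) U :=
      Complex.ofRealCLM.contDiff.comp_contDiffOn (h1.norm ℝ ha0)
    exact (h1.mul (h2.inv fun z hz => by exact_mod_cast norm_ne_zero_iff.2 (ha0 z hz))).congr
      fun z _ => div_eq_mul_inv _ _
  have hDs : ∀ s, JointlySmooth s U fun z _ => phaseDiag (u z) := fun s => by
    refine jointlySmooth_of_fst fun i j => ?_
    fin_cases i <;> fin_cases j
    · exact hus
    · exact contDiffOn_const
    · exact contDiffOn_const
    · exact Complex.conjCLE.contDiff.comp_contDiffOn hus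
  have hdet : ∀ z ∈ U, (phaseDiag (u z)).det = 1 := fun z hz => det_phaseDiag (hu1 z hz)
  refine ⟨fun z lam => L z lam * p z lam, fun z lam => F z lam * phaseDiag (u z),
    fun z lam => (phaseDiag (u z))⁻¹ * (B z lam * p z lam), ?_, fun z hz => ?_⟩
  · refine ⟨fun z hz => (hdata.loop z hz).mul (hp z hz).isLoop, fun z hz lam hlam i j => ?_,
      hdata.smooth_L.mul hs, fun z hz => ?_, fun s hsr => (hdata.smooth_F s hsr).mul (hDs s),
      fun z hz => ?_, fun z hz => ?_, fun z hz lam hlam => ?_⟩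
    · have hlam' := sphere_subset_closedBall hlam
      have hpd : ∀ i j, HasDerivAt (fun w => p w lam i j) (zDeriv p z lam i j) z := fun i j =>
        ((hd lam hlam' i j).differentiableAt (hU.mem_nhds hz)).hasDerivAt
      have hL := hdata.solves z hz lam hlam
      have key : L z lam * p z lam * ξ' z lam =
          (L z lam * ξ z lam) * p z lam + L z lam * zDeriv p z lam := by
        have h1 := mul_inv_of_det_eq_one ((hp z hz).det_eq_one lam hlam')
        rw [he z hz lam hlam, mul_assoc, mul_add, ← mul_assoc, ← mul_assoc, ← mul_assoc, h1,
          one_mul, one_mul, mul_add, ← mul_assoc]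
      rw [key, Matrix.add_apply, mat2_mul_apply (L z lam * ξ z lam),
        mat2_mul_apply (L z lam) (zDeriv p z lam)]
      simp only [mat2_mul_apply _ (p _ lam)]
      have := ((hL i 0).mul (hpd 0 j)).add ((hL i 1).mul (hpd 1 j))
      refine this.congr_deriv ?_
      ring
    · exact (hdata.unitary z hz).mul (IsUnitaryLoop.const (hdet z hz) (phaseDiag_twisted _)
        (phaseDiag_mem_unitary (hu1 z hz)))
    · exact ((IsPosLoop.const (hdet z hz) (phaseDiag_twisted _)).inv hr.le).mul
        ((hdata.positive z hz).mul (hp z hz))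
    · obtain ⟨b, hb, hB⟩ := hdata.normalized z hz
      obtain ⟨h01, h10, h11⟩ := (hp z hz).apply_zero hr.le
      have hn : (‖a z‖ : ℂ) ≠ 0 := by exact_mod_cast norm_ne_zero_iff.2 (ha0 z hz)
      refine ⟨b * ‖a z‖, mul_pos hb (norm_pos_iff.2 (ha0 z hz)), ?_⟩
      have hc := conj_phase_mul (ha0 z hz)
      have hbz : (b : ℂ) ≠ 0 := by exact_mod_cast hb.ne'
      have hinv : p z 0 1 1 = (a z)⁻¹ := eq_inv_of_mul_eq_one_right h11
      change (phaseDiag (u z))⁻¹ * (B z 0 * p z 0) = _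
      rw [inv_eq_of_det_eq_one (hdet z hz), hB]
      ext i j
      rw [mat2_mul_apply, mat2_mul_apply, mat2_mul_apply]
      have hu2 : u z = a z / ‖a z‖ := rfl
      fin_cases i <;> fin_cases j
      · simp [phaseDiag, h10]
        change (starRingEnd ℂ) (u z) * (b * a z) = b * ‖a z‖
        rw [← hc]; ring
      · simp [phaseDiag, h01]
      · simp [phaseDiag, h10]
      · simp [phaseDiag, h01, hinv, hu2]
        have := ha0 z hz
        field_simp
    · change L z lam * p z lam = F z lam * phaseDiag (u z) * ((phaseDiag (u z))⁻¹ * _)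
      rw [mul_assoc, ← mul_assoc (phaseDiag (u z)), mul_inv_of_det_eq_one (hdet z hz), one_mul,
        hdata.splitting z hz lam hlam, mul_assoc]
  · rw [hsurf z hz, symBobenko_mul_phaseDiag ε H (hu1 z hz)]

end DPW

end

noncomputable section

namespace DPW

open Set Metric MeasureTheory

/-! ### Entrywise real derivatives of matrix functions -/

lemma congr_entry {A B : Mat2} (h : A = B) (i j : Fin 2) : A i j = B i j := by rw [h]

/-- Entrywise real differentiability. -/
def MDiff (g : ℂ → Mat2) (z : ℂ) : Prop := ∀ i j, DifferentiableAt ℝ (fun w => g w i j) z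

/-- Entrywise real derivative in the direction `v`. -/
def mfd (g : ℂ → Mat2) (z v : ℂ) : Mat2 := Matrix.of fun i j => fderiv ℝ (fun w => g w i j) z v

lemma mfd_apply (g : ℂ → Mat2) (z v : ℂ) (i j : Fin 2) :
    mfd g z v i j = fderiv ℝ (fun w => g w i j) z v := rfl

lemma MDiff.const (A : Mat2) (z : ℂ) : MDiff (fun _ => A) z := fun _ _ => differentiableAt_const _

lemma mfd_const (A : Mat2) (z v : ℂ) : mfd (fun _ => A) z v = 0 := by
  ext i j; simp [mfd_apply]

lemma MDiff.mul {g h : ℂ → Mat2} {z : ℂ} (hg : MDiff g z) (hh : MDiff h z) :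
    MDiff (fun w => g w * h w) z := fun i j => by
  simp only [mat2_mul_apply]
  exact ((hg _ _).mul (hh _ _)).add ((hg _ _).mul (hh _ _))

lemma mfd_mul {g h : ℂ → Mat2} {z : ℂ} (hg : MDiff g z) (hh : MDiff h z) (v : ℂ) :
    mfd (fun w => g w * h w) z v = mfd g z v * h z + g z * mfd h z v := by
  ext i j
  rw [mfd_apply]
  simp only [Matrix.add_apply, mat2_mul_apply, mfd_apply]
  have e := (((hg i 0).hasFDerivAt.mul (hh 0 j).hasFDerivAt).add
    ((hg i 1).hasFDerivAt.mul (hh 1 j).hasFDerivAt)).fderiv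
  have e' : ((fun w => g w i 0) * fun w => h w 0 j) + ((fun w => g w i 1) * fun w => h w 1 j) =
    fun w => g w i 0 * h w 0 j + g w i 1 * h w 1 j := rfl
  rw [← e', e]
  simp
  ring

lemma MDiff.congr {g h : ℂ → Mat2} {z : ℂ} (hg : MDiff g z) (e : h =ᶠ[nhds z] g) : MDiff h z :=
  fun i j => (hg i j).congr_of_eventuallyEq (e.mono fun w hw => by simp [hw])

lemma mfd_congr {g h : ℂ → Mat2} {z : ℂ} (e : h =ᶠ[nhds z] g) (v : ℂ) : mfd h z v = mfd g z v := by
  ext i j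
  simp only [mfd_apply]
  have e' : (fun w => h w i j) =ᶠ[nhds z] fun w => g w i j := e.mono fun w hw => by simp [hw]
  rw [e'.fderiv_eq]

lemma MDiff.inv {g : ℂ → Mat2} {z : ℂ} (hg : MDiff g z) (hdet : ∀ᶠ w in nhds z, (g w).det = 1) :
    MDiff (fun w => (g w)⁻¹) z := by
  refine MDiff.congr (g := fun w => !![g w 1 1, -g w 0 1; -g w 1 0, g w 0 0]) ?_
    (hdet.mono fun w hw => inv_eq_of_det_eq_one hw)
  intro i j
  fin_cases i <;> fin_cases j
  · exact hg 1 1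
  · exact (hg 0 1).neg
  · exact (hg 1 0).neg
  · exact hg 0 0

lemma mfd_inv {g : ℂ → Mat2} {z : ℂ} (hg : MDiff g z) (hdet : ∀ᶠ w in nhds z, (g w).det = 1)
    (v : ℂ) : mfd (fun w => (g w)⁻¹) z v = -((g z)⁻¹ * mfd g z v * (g z)⁻¹) := by
  have hz : (g z).det = 1 := hdet.self_of_nhds
  have h1 := mfd_mul hg (hg.inv hdet) v
  have h2 : (fun w => g w * (g w)⁻¹) =ᶠ[nhds z] fun _ => 1 :=
    hdet.mono fun w hw => mul_inv_of_det_eq_one hw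
  rw [mfd_congr h2, mfd_const] at h1
  have h3 : g z * mfd (fun w => (g w)⁻¹) z v = -(mfd g z v * (g z)⁻¹) :=
    (neg_eq_of_add_eq_zero_right h1.symm).symm
  have h4 := congrArg ((g z)⁻¹ * ·) h3
  simp only [← mul_assoc, inv_mul_of_det_eq_one hz, one_mul] at h4
  rw [h4, mul_neg, ← mul_assoc]

lemma JointlySmooth.mdiff {s : ℝ} (hs : 0 < s) {U : Set ℂ} (hU : IsOpen U) {g : ℂ → ℂ → Mat2}
    (hg : JointlySmooth s U g) {z : ℂ} (hz : z ∈ U) {lam : ℂ} (hlam : lam ∈ sphere (0 : ℂ) s) :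
    MDiff (fun w => g w lam) z := by
  intro i j
  obtain ⟨t, rfl⟩ := exists_circleMap_eq hs hlam
  have h1 : ContDiffOn ℝ ∞ (fun w => g w (circleMap 0 s t) i j) U :=
    (hg i j).comp (f := fun w : ℂ => (w, t)) (contDiffOn_id.prodMk contDiffOn_const)
      fun w hw => ⟨hw, mem_univ _⟩
  exact (h1.differentiableOn (by simp)).differentiableAt (hU.mem_nhds hz)

lemma JointlySmooth.continuousOn_mfd {s : ℝ} (hs : 0 < s) {U : Set ℂ} (hU : IsOpen U)
    {g : ℂ → ℂ → Mat2} (hg : JointlySmooth s U g) {z : ℂ} (hz : z ∈ U) (v : ℂ) (i j : Fin 2) :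
    ContinuousOn (fun lam => mfd (fun w => g w lam) z v i j) (sphere 0 s) := by
  refine continuousOn_sphere_of_comp hs ?_
  set G : ℂ × ℝ → ℂ := fun q => g q.1 (circleMap 0 s q.2) i j
  have hO : IsOpen (U ×ˢ (univ : Set ℝ)) := hU.prod isOpen_univ
  have hG : ContDiffOn ℝ ∞ G (U ×ˢ univ) := hg i j
  have hc : ContinuousOn (fderiv ℝ G) (U ×ˢ univ) := hG.continuousOn_fderiv_of_isOpen hO (by simp)
  have h1 : ∀ t, mfd (fun w => g w (circleMap 0 s t)) z v i j = fderiv ℝ G (z, t) (v, 0) := by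
    intro t
    have h2 : HasFDerivAt (fun z : ℂ => (z, t)) (ContinuousLinearMap.inl ℝ ℂ ℝ) z :=
      hasFDerivAt_prodMk_left z t
    have h3 := ((hG.differentiableOn (by simp)).differentiableAt
      (hO.mem_nhds (x := (z, t)) ⟨hz, mem_univ t⟩)).hasFDerivAt.comp z h2
    have h4 : (G ∘ fun z : ℂ => (z, t)) = fun w => g w (circleMap 0 s t) i j := rfl
    rw [h4] at h3
    rw [mfd_apply, h3.fderiv]; simp
  simp only [h1]
  have h5 : Continuous fun t : ℝ => fderiv ℝ G (z, t) :=
    hc.comp_continuous (by fun_prop) fun t => ⟨hz, mem_univ _⟩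
  exact h5.clm_apply continuous_const

lemma JointlySmooth.continuousOn_sphere {s : ℝ} (hs : 0 < s) {U : Set ℂ} {g : ℂ → ℂ → Mat2}
    (hg : JointlySmooth s U g) {z : ℂ} (hz : z ∈ U) (i j : Fin 2) :
    ContinuousOn (fun lam => g z lam i j) (sphere 0 s) := by
  refine continuousOn_sphere_of_comp hs ?_
  exact (hg i j).continuousOn.comp_continuous (f := fun t : ℝ => (z, t)) (by fun_prop)
    fun t => ⟨hz, mem_univ _⟩

lemma mode_mfd {s : ℝ} (hs : 0 < s) (n : ℤ) {U : Set ℂ} (hU : IsOpen U) {g : ℂ → ℂ → Mat2}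
    (hg : JointlySmooth s U g) {z : ℂ} (hz : z ∈ U) (i j : Fin 2) :
    ∃ D : ℂ →L[ℝ] ℂ, HasFDerivAt (fun w => mode s n fun lam => g w lam i j) D z ∧
      ∀ v, D v = mode s n fun lam => mfd (fun w => g w lam) z v i j :=
  hasFDerivAt_mode hs n hU (G := fun w lam => g w lam i j) (hg i j) hz

/-! ### The frame equation -/

/-- The potential `lam⁻¹ [[0, p], [q, 0]] dz`. -/
def offDiag (p q : ℂ → ℂ) : Potential := fun z lam => lam⁻¹ • !![0, p z; q z, 0]

/-- The Maurer-Cartan form of the frame with metric function `b`. -/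
def frameForm (b : ℂ → ℝ) (p q : ℂ → ℂ) (z lam v : ℂ) : Mat2 :=
  !![-(Complex.I * (fderiv ℝ b z (Complex.I * v) / b z : ℝ)),
      v * (b z ^ 2 * p z) * lam⁻¹ - (starRingEnd ℂ) (v * (((b z : ℂ) ^ 2)⁻¹ * q z)) * lam;
    v * (((b z : ℂ) ^ 2)⁻¹ * q z) * lam⁻¹ - (starRingEnd ℂ) (v * (b z ^ 2 * p z)) * lam,
      Complex.I * (fderiv ℝ b z (Complex.I * v) / b z : ℝ)]

/-- The metric function of DPW data. -/
def metricFn (B : ℂ → ℂ → Mat2) (z : ℂ) : ℝ := (B z 0 0 0).re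

section Frame

variable {r : ℝ} {U : Set ℂ} {p q : ℂ → ℂ} {ξ : Potential} {L F B : ℂ → ℂ → Mat2}

lemma IsDPWData.metricFn_pos (h : IsDPWData r ξ U L F B) {z : ℂ} (hz : z ∈ U) :
    0 < metricFn B z ∧ B z 0 = !![(metricFn B z : ℂ), 0; 0, (metricFn B z : ℂ)⁻¹] := by
  obtain ⟨b, hb, hB⟩ := h.normalized z hz
  have : metricFn B z = b := by simp [metricFn, hB]
  rw [this]; exact ⟨hb, hB⟩

lemma IsDPWData.det_L (h : IsDPWData r ξ U L F B) {z : ℂ} (hz : z ∈ U) {lam : ℂ}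
    (hlam : lam ∈ sphere (0 : ℂ) r) : (L z lam).det = 1 := (h.loop z hz).det_eq_one lam hlam

lemma mem_closedAnnulus_of_sphere {r s : ℝ} (hr : 0 < r) (hs : s ∈ Icc r 1) {lam : ℂ}
    (hlam : lam ∈ sphere (0 : ℂ) s) : lam ∈ closedAnnulus r := by
  have h1 : ‖lam‖ = s := by simpa using hlam
  have : 1 ≤ r⁻¹ := (one_le_inv₀ hr).2 (hs.1.trans hs.2)
  exact ⟨by rw [h1]; exact hs.1, by rw [h1]; exact hs.2.trans this⟩

lemma IsDPWData.det_F (h : IsDPWData r ξ U L F B) (hr : 0 < r) {s : ℝ} (hs : s ∈ Icc r 1) {z : ℂ}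
    (hz : z ∈ U) {lam : ℂ} (hlam : lam ∈ sphere (0 : ℂ) s) : (F z lam).det = 1 :=
  (h.unitary z hz).det_eq_one lam (mem_closedAnnulus_of_sphere hr hs hlam)

lemma IsDPWData.det_B (h : IsDPWData r ξ U L F B) {z : ℂ} (hz : z ∈ U) {lam : ℂ}
    (hlam : lam ∈ sphere (0 : ℂ) r) : (B z lam).det = 1 :=
  (h.positive z hz).det_eq_one lam (sphere_subset_closedBall hlam)

lemma IsDPWData.smooth_B (h : IsDPWData r ξ U L F B) (hr : r ∈ Ioc (0 : ℝ) 1) :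
    JointlySmooth r U B := by
  have hr1 : r ∈ Icc r 1 := ⟨le_rfl, hr.2⟩
  refine (((h.smooth_F r hr1).inv hr.1.le fun z hz lam hlam => h.det_F hr.1 hr1 hz hlam).mul
    h.smooth_L).congr hr.1.le fun z hz lam hlam => ?_
  rw [h.splitting z hz lam hlam, ← mul_assoc, inv_mul_of_det_eq_one (h.det_F hr.1 hr1 hz hlam),
    one_mul]

lemma IsDPWData.differentiableAt_metricFn (h : IsDPWData r ξ U L F B) (hr : r ∈ Ioc (0 : ℝ) 1)
    (hU : IsOpen U) {z : ℂ} (hz : z ∈ U) : DifferentiableAt ℝ (metricFn B) z := by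
  obtain ⟨D, hD, -⟩ := mode_mfd hr.1 0 hU (h.smooth_B hr) hz 0 0
  have h1 : (fun w => mode r 0 fun lam => B w lam 0 0) =ᶠ[nhds z]
      fun w => 2 * Real.pi * B w 0 0 0 := by
    filter_upwards [hU.mem_nhds hz] with w hw
    exact mode_disc_zero hr.1 ((h.positive w hw).continuousOn 0 0)
      ((h.positive w hw).holomorphic 0 0)
  have h2 := (hD.differentiableAt.congr_of_eventuallyEq h1.symm).const_mul (2 * (Real.pi : ℂ))⁻¹
  have h3 : (fun w => (2 * (Real.pi : ℂ))⁻¹ * (2 * Real.pi * B w 0 0 0)) = fun w => B w 0 0 0 := by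
    have : (Real.pi : ℂ) ≠ 0 := by exact_mod_cast Real.pi_ne_zero
    funext w; field_simp
  rw [h3] at h2
  exact (Complex.reCLM.differentiableAt.comp z h2)

/-- `F⁻¹ dF` in the direction `v`. -/
def maurerCartan (F : ℂ → ℂ → Mat2) (z v lam : ℂ) : Mat2 :=
  (F z lam)⁻¹ * mfd (fun w => F w lam) z v

lemma IsDPWData.smooth_relFrame (h : IsDPWData r ξ U L F B) (hr : 0 < r) {s : ℝ}
    (hs : s ∈ Icc r 1) {z : ℂ} (hz : z ∈ U) :
    JointlySmooth s U fun w lam => (F z lam)⁻¹ * F w lam := by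
  have hs0 : 0 < s := hr.trans_le hs.1
  have h1 := (h.smooth_F s hs).inv hs0.le fun w hw lam hlam => h.det_F hr hs hw hlam
  exact (h1.comp (φ := fun _ => z) (V := U) contDiffOn_const fun _ _ => hz).mul (h.smooth_F s hs)

lemma IsDPWData.mfd_relFrame (h : IsDPWData r ξ U L F B) (hr : 0 < r) (hU : IsOpen U) {s : ℝ}
    (hs : s ∈ Icc r 1) {z : ℂ} (hz : z ∈ U) (v : ℂ) {lam : ℂ} (hlam : lam ∈ sphere (0 : ℂ) s) :
    mfd (fun w => (F z lam)⁻¹ * F w lam) z v = maurerCartan F z v lam := by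
  rw [mfd_mul (MDiff.const _ _) ((h.smooth_F s hs).mdiff (hr.trans_le hs.1) hU hz hlam), mfd_const,
    zero_mul, zero_add, maurerCartan]

lemma IsDPWData.continuousOn_maurerCartan (h : IsDPWData r ξ U L F B) (hr : 0 < r) (hU : IsOpen U)
    {s : ℝ} (hs : s ∈ Icc r 1) {z : ℂ} (hz : z ∈ U) (v : ℂ) (i j : Fin 2) :
    ContinuousOn (fun lam => maurerCartan F z v lam i j) (sphere 0 s) :=
  ((h.smooth_relFrame hr hs hz).continuousOn_mfd (hr.trans_le hs.1) hU hz v i j).congr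
    fun _ hlam => (congr_entry (h.mfd_relFrame hr hU hs hz v hlam) i j).symm

lemma IsDPWData.mode_maurerCartan_eq (h : IsDPWData r ξ U L F B) (hr : r ∈ Ioc (0 : ℝ) 1)
    (hU : IsOpen U) {z : ℂ} (hz : z ∈ U) (v : ℂ) (n : ℤ) (i j : Fin 2) :
    mode 1 n (fun lam => maurerCartan F z v lam i j) =
      mode r n fun lam => maurerCartan F z v lam i j := by
  have hr1 : r ∈ Icc r 1 := ⟨le_rfl, hr.2⟩
  have h11 : (1 : ℝ) ∈ Icc r 1 := ⟨hr.2, le_rfl⟩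
  obtain ⟨D₁, hD₁, e₁⟩ := mode_mfd one_pos n hU (h.smooth_relFrame hr.1 h11 hz) hz i j
  obtain ⟨D₂, hD₂, e₂⟩ := mode_mfd hr.1 n hU (h.smooth_relFrame hr.1 hr1 hz) hz i j
  have hev : (fun w => mode r n fun lam => ((F z lam)⁻¹ * F w lam) i j) =ᶠ[nhds z]
      fun w => mode 1 n fun lam => ((F z lam)⁻¹ * F w lam) i j := by
    filter_upwards [hU.mem_nhds hz] with w hw
    have hinv : 1 ≤ r⁻¹ := (one_le_inv₀ hr.1).2 hr.2
    have hsub : {lam : ℂ | r ≤ ‖lam‖ ∧ ‖lam‖ ≤ 1} ⊆ closedAnnulus r := fun lam hl =>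
      ⟨hl.1, hl.2.trans hinv⟩
    have hsub' : {lam : ℂ | r < ‖lam‖ ∧ ‖lam‖ < 1} ⊆ {lam | r < ‖lam‖ ∧ ‖lam‖ < r⁻¹} :=
      fun lam hl => ⟨hl.1, hl.2.trans_le hinv⟩
    have hF := h.unitary z hz
    have hW := h.unitary w hw
    have hexp : ∀ lam ∈ closedAnnulus r, ((F z lam)⁻¹ * F w lam) i j =
        !![F z lam 1 1, -F z lam 0 1; -F z lam 1 0, F z lam 0 0] i 0 * F w lam 0 j +
        !![F z lam 1 1, -F z lam 0 1; -F z lam 1 0, F z lam 0 0] i 1 * F w lam 1 j := by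
      intro lam hl
      rw [mat2_mul_apply, inv_eq_of_det_eq_one (hF.det_eq_one lam hl)]
    have hc : ∀ k l, ContinuousOn (fun lam =>
        !![F z lam 1 1, -F z lam 0 1; -F z lam 1 0, F z lam 0 0] k l) (closedAnnulus r) := by
      intro k l
      fin_cases k <;> fin_cases l
      · exact hF.continuousOn 1 1
      · exact (hF.continuousOn 0 1).neg
      · exact (hF.continuousOn 1 0).neg
      · exact hF.continuousOn 0 0
    have hd : ∀ k l, DifferentiableOn ℂ (fun lam =>
        !![F z lam 1 1, -F z lam 0 1; -F z lam 1 0, F z lam 0 0] k l)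
        {lam | r < ‖lam‖ ∧ ‖lam‖ < r⁻¹} := by
      intro k l
      fin_cases k <;> fin_cases l
      · exact hF.holomorphic 1 1
      · exact (hF.holomorphic 0 1).neg
      · exact (hF.holomorphic 1 0).neg
      · exact hF.holomorphic 0 0
    refine (mode_annulus hr.1 hr.2 n ?_ ?_).symm
    · refine ContinuousOn.mono (ContinuousOn.congr ?_ hexp) hsub
      exact ((hc i 0).mul (hW.continuousOn 0 j)).add ((hc i 1).mul (hW.continuousOn 1 j))
    · refine DifferentiableOn.congr (DifferentiableOn.mono ?_ hsub') fun lam hl =>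
        hexp lam ⟨hl.1.le, (hl.2.trans_le hinv).le⟩
      exact ((hd i 0).mul (hW.holomorphic 0 j)).add ((hd i 1).mul (hW.holomorphic 1 j))
  have hDD : D₁ = D₂ := hD₁.unique (hD₂.congr_of_eventuallyEq hev.symm)
  rw [← mode_congr zero_le_one fun lam hlam =>
      congr_entry (h.mfd_relFrame hr.1 hU h11 hz v hlam) i j,
    ← mode_congr hr.1.le fun lam hlam => congr_entry (h.mfd_relFrame hr.1 hU hr1 hz v hlam) i j,
    ← e₁, ← e₂, hDD]

lemma IsDPWData.smooth_relPos (h : IsDPWData r ξ U L F B) (hr : r ∈ Ioc (0 : ℝ) 1) {z : ℂ}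
    (hz : z ∈ U) : JointlySmooth r U fun w lam => B z lam * (B w lam)⁻¹ := by
  have h1 := (h.smooth_B hr).inv hr.1.le fun w hw lam hlam => h.det_B hw hlam
  exact ((h.smooth_B hr).comp (φ := fun _ => z) (V := U) contDiffOn_const fun _ _ => hz).mul h1

lemma IsDPWData.mfd_L (h : IsDPWData r ξ U L F B) {z : ℂ} (hz : z ∈ U) (v : ℂ)
    {lam : ℂ} (hlam : lam ∈ sphere (0 : ℂ) r) :
    mfd (fun w => L w lam) z v = v • (L z lam * ξ z lam) := by
  ext i j
  have := (h.solves z hz lam hlam i j).hasFDerivAt.restrictScalars ℝ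
  rw [mfd_apply, this.fderiv]
  simp

lemma IsDPWData.maurerCartan_eq (h : IsDPWData r ξ U L F B) (hr : r ∈ Ioc (0 : ℝ) 1)
    (hU : IsOpen U) {z : ℂ} (hz : z ∈ U) (v : ℂ) {lam : ℂ} (hlam : lam ∈ sphere (0 : ℂ) r) :
    maurerCartan F z v lam = v • (B z lam * ξ z lam * (B z lam)⁻¹) +
      mfd (fun w => B z lam * (B w lam)⁻¹) z v := by
  have hr1 : r ∈ Icc r 1 := ⟨le_rfl, hr.2⟩
  have hB := (h.smooth_B hr).mdiff hr.1 hU hz hlam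
  have hL := h.smooth_L.mdiff hr.1 hU hz hlam
  have hdetB : ∀ᶠ w in nhds z, (B w lam).det = 1 := by
    filter_upwards [hU.mem_nhds hz] with w hw using h.det_B hw hlam
  have hBi := hB.inv hdetB
  have key : (fun w => (F z lam)⁻¹ * F w lam) =ᶠ[nhds z]
      fun w => (B z lam * (L z lam)⁻¹) * (L w lam * (B w lam)⁻¹) := by
    filter_upwards [hU.mem_nhds hz] with w hw
    have e1 : F w lam = L w lam * (B w lam)⁻¹ := by
      rw [h.splitting w hw lam hlam, mul_assoc, mul_inv_of_det_eq_one (h.det_B hw hlam), mul_one]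
    have e2 : (F z lam)⁻¹ = B z lam * (L z lam)⁻¹ := by
      rw [h.splitting z hz lam hlam, Matrix.mul_inv_rev, ← mul_assoc,
        mul_inv_of_det_eq_one (h.det_B hz hlam), one_mul]
    rw [e1, e2]
  rw [← h.mfd_relFrame hr.1 hU hr1 hz v hlam, mfd_congr key,
    mfd_mul (MDiff.const _ _) (hL.mul hBi), mfd_const, zero_mul, zero_add, mfd_mul hL hBi,
    mfd_mul (MDiff.const _ _) hBi, mfd_const, zero_mul, zero_add, h.mfd_L hz v hlam]
  have e3 : (L z lam)⁻¹ * L z lam = 1 := inv_mul_of_det_eq_one (h.det_L hz hlam)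
  rw [mul_add, Matrix.smul_mul, Matrix.mul_smul]
  congr 1
  · congr 1
    calc B z lam * (L z lam)⁻¹ * (L z lam * ξ z lam * (B z lam)⁻¹)
        = B z lam * ((L z lam)⁻¹ * L z lam) * ξ z lam * (B z lam)⁻¹ := by simp only [mul_assoc]
      _ = _ := by rw [e3, mul_one]
  · calc B z lam * (L z lam)⁻¹ * (L z lam * mfd (fun w => (B w lam)⁻¹) z v)
        = B z lam * ((L z lam)⁻¹ * L z lam) * mfd (fun w => (B w lam)⁻¹) z v := by
          simp only [mul_assoc]
      _ = _ := by rw [e3, mul_one]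

lemma inv_eq_star_of_mem_unitary {A : Mat2} (h : A ∈ Matrix.unitaryGroup (Fin 2) ℂ) :
    A⁻¹ = star A := Matrix.inv_eq_right_inv (Matrix.mem_unitaryGroup_iff.1 h)

lemma mfd_star {g : ℂ → Mat2} {z : ℂ} (hg : MDiff g z) (v : ℂ) :
    mfd (fun w => star (g w)) z v = star (mfd g z v) := by
  ext i j
  rw [Matrix.star_apply, mfd_apply, mfd_apply]
  have := (Complex.conjCLE.toContinuousLinearMap.hasFDerivAt.comp z (hg j i).hasFDerivAt).fderiv
  have e : (Complex.conjCLE.toContinuousLinearMap ∘ fun w => g w j i) =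
    fun w => star (g w) i j := rfl
  rw [← e, this]; rfl

lemma IsDPWData.star_maurerCartan (h : IsDPWData r ξ U L F B) (hr : r ∈ Ioc (0 : ℝ) 1)
    (hU : IsOpen U) {z : ℂ} (hz : z ∈ U) (v : ℂ) {lam : ℂ} (hlam : lam ∈ sphere (0 : ℂ) 1) :
    star (maurerCartan F z v lam) = -maurerCartan F z v lam := by
  have h11 : (1 : ℝ) ∈ Icc r 1 := ⟨hr.2, le_rfl⟩
  have hF := (h.smooth_F 1 h11).mdiff one_pos hU hz hlam
  have hdet : ∀ᶠ w in nhds z, (F w lam).det = 1 := by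
    filter_upwards [hU.mem_nhds hz] with w hw using h.det_F hr.1 h11 hw hlam
  have hev : (fun w => (F w lam)⁻¹) =ᶠ[nhds z] fun w => star (F w lam) := by
    filter_upwards [hU.mem_nhds hz] with w hw using
      inv_eq_star_of_mem_unitary ((h.unitary w hw).unitary lam hlam)
  have h1 := mfd_inv hF hdet v
  rw [mfd_congr hev, mfd_star hF] at h1
  have h2 := inv_mul_of_det_eq_one (h.det_F hr.1 h11 hz hlam)
  rw [maurerCartan, star_mul, h1, inv_eq_star_of_mem_unitary ((h.unitary z hz).unitary lam hlam),
    star_star, ← inv_eq_star_of_mem_unitary ((h.unitary z hz).unitary lam hlam), neg_mul,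
    mul_assoc, h2, mul_one]

lemma IsDPWData.maurerCartan_neg (h : IsDPWData r ξ U L F B) (hr : r ∈ Ioc (0 : ℝ) 1)
    (hU : IsOpen U) {z : ℂ} (hz : z ∈ U) (v : ℂ) {lam : ℂ} (hlam : lam ∈ sphere (0 : ℂ) 1) :
    maurerCartan F z v (-lam) = sigma3 * maurerCartan F z v lam * sigma3 := by
  have h11 : (1 : ℝ) ∈ Icc r 1 := ⟨hr.2, le_rfl⟩
  have hF := (h.smooth_F 1 h11).mdiff one_pos hU hz hlam
  have htw : ∀ w ∈ U, F w (-lam) = sigma3 * F w lam * sigma3 := fun w hw =>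
    (h.unitary w hw).twisted lam (mem_closedAnnulus_of_sphere hr.1 h11 hlam)
  have hev : (fun w => F w (-lam)) =ᶠ[nhds z] fun w => sigma3 * F w lam * sigma3 := by
    filter_upwards [hU.mem_nhds hz] with w hw using htw w hw
  rw [maurerCartan, mfd_congr hev, mfd_mul ((MDiff.const _ _).mul hF) (MDiff.const _ _),
    mfd_mul (MDiff.const _ _) hF, mfd_const, zero_mul, zero_add, mul_zero, add_zero,
    htw z hz, Matrix.mul_inv_rev, Matrix.mul_inv_rev, sigma3_inv, maurerCartan]
  calc sigma3 * ((F z lam)⁻¹ * sigma3) * (sigma3 * mfd (fun w => F w lam) z v * sigma3)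
      = sigma3 * (F z lam)⁻¹ * (sigma3 * sigma3) * mfd (fun w => F w lam) z v * sigma3 := by
        simp only [mul_assoc]
    _ = _ := by rw [sigma3_mul_self, mul_one]; simp only [mul_assoc]

lemma IsPosLoop.conj_const {r : ℝ} (hr : 0 ≤ r) {B : ℂ → Mat2} (hB : IsPosLoop r B) (A : Mat2)
    (i j : Fin 2) : ContinuousOn (fun lam => (B lam * A * (B lam)⁻¹) i j) (closedBall 0 r) ∧
      DifferentiableOn ℂ (fun lam => (B lam * A * (B lam)⁻¹) i j) (ball 0 r) := by
  have hi := hB.inv hr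
  simp only [mat2_mul_apply]
  constructor
  · have hc : ∀ k l, ContinuousOn (fun lam => B lam k 0 * A 0 l + B lam k 1 * A 1 l)
        (closedBall 0 r) := fun k l =>
      ((hB.continuousOn k 0).mul continuousOn_const).add
        ((hB.continuousOn k 1).mul continuousOn_const)
    exact ((hc i 0).mul (hi.continuousOn 0 j)).add ((hc i 1).mul (hi.continuousOn 1 j))
  · have hd : ∀ k l, DifferentiableOn ℂ (fun lam => B lam k 0 * A 0 l + B lam k 1 * A 1 l)
        (ball 0 r) := fun k l =>
      ((hB.holomorphic k 0).mul (differentiableOn_const _)).add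
        ((hB.holomorphic k 1).mul (differentiableOn_const _))
    exact ((hd i 0).mul (hi.holomorphic 0 j)).add ((hd i 1).mul (hi.holomorphic 1 j))

/-- The nonnegative modes of the Maurer-Cartan form. -/
lemma IsDPWData.mode_maurerCartan (h : IsDPWData r (offDiag p q) U L F B) (hr : r ∈ Ioc (0 : ℝ) 1)
    (hU : IsOpen U) {z : ℂ} (hz : z ∈ U) (i j : Fin 2) :
    (∀ n : ℤ, 2 ≤ n → ∀ v, mode 1 n (fun lam => maurerCartan F z v lam i j) = 0) ∧
    (∀ v, mode 1 1 (fun lam => maurerCartan F z v lam i j) =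
      2 * Real.pi * (v * !![0, metricFn B z ^ 2 * p z; ((metricFn B z : ℂ) ^ 2)⁻¹ * q z, 0] i j)) ∧
    ∃ κ : ℂ, ∀ v, mode 1 0 (fun lam => maurerCartan F z v lam i j) = v * κ +
      2 * Real.pi * !![-((fderiv ℝ (metricFn B) z v / metricFn B z : ℝ) : ℂ), 0;
        0, ((fderiv ℝ (metricFn B) z v / metricFn B z : ℝ) : ℂ)] i j := by
  set A : Mat2 := !![0, p z; q z, 0] with hA
  set R : ℂ → ℂ := fun lam => (B z lam * A * (B z lam)⁻¹) i j with hR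
  obtain ⟨hRc, hRd⟩ := (h.positive z hz).conj_const hr.1.le A i j
  have hK := h.smooth_relPos hr hz
  have hinv0 : ContinuousOn (fun lam : ℂ => lam⁻¹) (sphere 0 r) := fun lam hlam => by
    refine (continuousAt_inv₀ ?_).continuousWithinAt
    rintro rfl; simp at hlam; linarith [hr.1]
  have hsplit : ∀ n v, mode 1 n (fun lam => maurerCartan F z v lam i j) =
      v * mode r (n - 1) R +
        mode r n fun lam => mfd (fun w => B z lam * (B w lam)⁻¹) z v i j := by
    intro n v
    rw [h.mode_maurerCartan_eq hr hU hz v n i j, mode_congr (h := fun lam => v * (lam ^ (-1 : ℤ) * R lam) +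
      mfd (fun w => B z lam * (B w lam)⁻¹) z v i j) hr.1.le, mode_add hr.1, mode_const_mul,
      mode_zpow_mul hr.1, ← sub_eq_add_neg]
    · simp only [zpow_neg_one]
      exact continuousOn_const.mul (hinv0.mul (hRc.mono sphere_subset_closedBall))
    · exact hK.continuousOn_mfd hr.1 hU hz v i j
    · intro lam hlam
      rw [h.maurerCartan_eq hr hU hz v hlam, Matrix.add_apply, Matrix.smul_apply]
      have e : B z lam * offDiag p q z lam * (B z lam)⁻¹ = lam⁻¹ • (B z lam * A * (B z lam)⁻¹) := by
        rw [offDiag, Matrix.mul_smul, Matrix.smul_mul]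
      rw [e, Matrix.smul_apply, zpow_neg_one]
      simp only [smul_eq_mul, hR]
  have hpos : ∀ w ∈ U, IsPosLoop r fun lam => B z lam * (B w lam)⁻¹ := fun w hw =>
    (h.positive z hz).mul ((h.positive w hw).inv hr.1.le)
  have hKpos : ∀ n : ℤ, 0 < n → ∀ v,
      mode r n (fun lam => mfd (fun w => B z lam * (B w lam)⁻¹) z v i j) = 0 := by
    intro n hn v
    obtain ⟨D, hD, e⟩ := mode_mfd hr.1 n hU hK hz i j
    have hev : (fun w => mode r n fun lam => (B z lam * (B w lam)⁻¹) i j) =ᶠ[nhds z]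
        fun _ => 0 := by
      filter_upwards [hU.mem_nhds hz] with w hw using
        mode_disc_pos hr.1 hn ((hpos w hw).continuousOn i j) ((hpos w hw).holomorphic i j)
    have : D = 0 := hD.unique ((hasFDerivAt_const (0 : ℂ) z).congr_of_eventuallyEq hev)
    rw [← e, this]; rfl
  obtain ⟨hb, hBz⟩ := h.metricFn_pos hz
  set b := metricFn B with hbdef
  have hbC : (b z : ℂ) ≠ 0 := by exact_mod_cast hb.ne'
  have h0 : (0 : ℂ) ∈ closedBall (0 : ℂ) r := by simpa using hr.1.le
  refine ⟨fun n hn v => ?_, fun v => ?_, mode r (0 - 1) R, fun v => ?_⟩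
  · rw [hsplit, hKpos n (by omega), mode_disc_pos hr.1 (by omega) hRc hRd]; simp
  · rw [hsplit, hKpos 1 one_pos, sub_self, mode_disc_zero (g := R) hr.1 hRc hRd]
    have : R 0 = !![0, (b z) ^ 2 * p z; ((b z : ℂ) ^ 2)⁻¹ * q z, 0] i j := by
      simp only [hR]
      rw [inv_eq_of_det_eq_one ((h.positive z hz).det_eq_one 0 h0), hBz]
      simp only [mat2_mul_apply]
      fin_cases i <;> fin_cases j <;> simp [hA] <;> field_simp
    rw [this]; ring
  · rw [hsplit]
    congr 1
    obtain ⟨D, hD, e⟩ := mode_mfd hr.1 0 hU hK hz i j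
    rw [← e]
    set β : ℂ → ℂ := fun w => ((b z : ℂ) * ((b w : ℝ) : ℂ)⁻¹) with hβ
    have hbd := (h.differentiableAt_metricFn hr hU hz).hasFDerivAt
    have hbdC : HasFDerivAt (fun w => ((b w : ℝ) : ℂ))
        (Complex.ofRealCLM.comp (fderiv ℝ b z)) z :=
      Complex.ofRealCLM.hasFDerivAt.comp z hbd
    have hev : (fun w => mode r 0 fun lam => (B z lam * (B w lam)⁻¹) i j) =ᶠ[nhds z]
        fun w => 2 * Real.pi * !![(b z : ℂ) * ((b w : ℝ) : ℂ)⁻¹, 0; 0, (b z : ℂ)⁻¹ * b w] i j := by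
      filter_upwards [hU.mem_nhds hz] with w hw
      rw [mode_disc_zero hr.1 ((hpos w hw).continuousOn i j) ((hpos w hw).holomorphic i j),
        inv_eq_of_det_eq_one ((h.positive w hw).det_eq_one 0 h0), hBz, (h.metricFn_pos hw).2]
      rw [mat2_mul_apply]
      fin_cases i <;> fin_cases j <;> simp [hbdef]
    have hD' := hD.congr_of_eventuallyEq hev.symm
    fin_cases i <;> fin_cases j
    · have h1 := ((hasDerivAt_inv hbC).hasFDerivAt.restrictScalars ℝ).comp z hbdC
      have h2 := ((h1.const_mul (b z : ℂ)).const_mul (2 * (Real.pi : ℂ)))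
      have h3 := hD'.unique h2
      rw [h3]
      simp
      field_simp
    · have h3 := hD'.unique (by simpa using hasFDerivAt_const (0 : ℂ) z)
      rw [h3]; simp
    · have h3 := hD'.unique (by simpa using hasFDerivAt_const (0 : ℂ) z)
      rw [h3]; simp
    · have h2 := ((hbdC.const_mul ((b z : ℂ)⁻¹)).const_mul (2 * (Real.pi : ℂ)))
      have h3 := hD'.unique h2
      rw [h3]
      simp
      field_simp

/-- The frame equation. -/
theorem IsDPWData.frame_eq (h : IsDPWData r (offDiag p q) U L F B) (hr : r ∈ Ioc (0 : ℝ) 1)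
    (hU : IsOpen U) {z : ℂ} (hz : z ∈ U) (v : ℂ) {s : ℝ} (hs : s = r ∨ s = 1) {lam : ℂ}
    (hlam : lam ∈ sphere (0 : ℂ) s) :
    mfd (fun w => F w lam) z v = F z lam * frameForm (metricFn B) p q z lam v := by
  have hsI : s ∈ Icc r 1 := by
    rcases hs with rfl | rfl
    · exact ⟨le_rfl, hr.2⟩
    · exact ⟨hr.2, le_rfl⟩
  have hs0 : 0 < s := hr.1.trans_le hsI.1
  have hmode : ∀ n i j, mode s n (fun lam => maurerCartan F z v lam i j) =
      mode 1 n fun lam => maurerCartan F z v lam i j := by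
    intro n i j
    rcases hs with rfl | rfl
    · exact (h.mode_maurerCartan_eq hr hU hz v n i j).symm
    · rfl
  suffices hmc : maurerCartan F z v lam = frameForm (metricFn B) p q z lam v by
    rw [← hmc, maurerCartan, ← mul_assoc, mul_inv_of_det_eq_one (h.det_F hr.1 hsI hz hlam), one_mul]
  set b := metricFn B with hbdef
  set m : ℤ → Fin 2 → Fin 2 → ℂ → ℂ := fun n i j v =>
    mode 1 n (fun lam => maurerCartan F z v lam i j) with hm
  have hskew : ∀ n i j v, m (-n) i j v = -(starRingEnd ℂ) (m n j i v) := by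
    intro n i j v
    have h1 := mode_conj (-n) (fun lam => maurerCartan F z v lam j i)
    rw [neg_neg] at h1
    have h2 : mode 1 (-n) (fun lam => (starRingEnd ℂ) (maurerCartan F z v lam j i)) =
        mode 1 (-n) fun lam => -1 * maurerCartan F z v lam i j := by
      refine mode_congr zero_le_one fun lam hlam => ?_
      have := congr_entry (h.star_maurerCartan hr hU hz v hlam) i j
      rw [Matrix.star_apply, Matrix.neg_apply] at this
      rw [neg_one_mul, ← this]; rfl
    rw [h2, mode_const_mul, neg_one_mul] at h1
    rw [← h1, neg_neg]
  have hodd : m 0 0 1 v = 0 ∧ m 0 1 0 v = 0 := by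
    have key : ∀ i j, (∀ lam ∈ sphere (0 : ℂ) 1, maurerCartan F z v (-lam) i j =
        -1 * maurerCartan F z v lam i j) → m 0 i j v = 0 := by
      intro i j hij
      have h1 := mode_comp_neg 1 0 (fun lam => maurerCartan F z v lam i j)
      rw [mode_congr zero_le_one hij, mode_const_mul, zpow_zero, one_mul, neg_one_mul] at h1
      exact neg_eq_self.1 h1
    constructor
    · refine key 0 1 fun lam hlam => ?_
      rw [h.maurerCartan_neg hr hU hz v hlam, sigma3_conj_apply]; simp
    · refine key 1 0 fun lam hlam => ?_
      rw [h.maurerCartan_neg hr hU hz v hlam, sigma3_conj_apply]; simp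
  have hdiag : ∀ i : Fin 2, ∀ σ : ℝ, (∃ κ : ℂ, ∀ v, m 0 i i v = v * κ + 2 * Real.pi *
      ((-(σ * (fderiv ℝ b z v / b z)) : ℝ) : ℂ)) →
      m 0 i i v = 2 * Real.pi * (-(Complex.I * ((σ * (fderiv ℝ b z (Complex.I * v) / b z) : ℝ) : ℂ))) := by
    rintro i σ ⟨κ, hκ⟩
    have hre : ∀ v, (v * κ).re = 2 * Real.pi * (σ * (fderiv ℝ b z v / b z)) := by
      intro v
      have h1 := hskew 0 i i v
      rw [neg_zero] at h1
      have h2 := congrArg Complex.re h1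
      simp only [Complex.neg_re, Complex.conj_re] at h2
      have h3 : (m 0 i i v).re = 0 := by linarith
      rw [hκ, Complex.add_re] at h3
      have h4 : (2 * (Real.pi : ℂ) * ((-(σ * (fderiv ℝ b z v / b z)) : ℝ) : ℂ)) =
        ((2 * Real.pi * (-(σ * (fderiv ℝ b z v / b z))) : ℝ) : ℂ) := by push_cast; ring
      rw [h4, Complex.ofReal_re] at h3
      linarith
    have h1 := hre v
    have h2 := hre (Complex.I * v)
    have h3 : (Complex.I * v * κ).re = -(v * κ).im := by
      rw [mul_assoc, Complex.I_mul_re]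
    rw [h3] at h2
    have h4 : v * κ = ((2 * Real.pi * (σ * (fderiv ℝ b z v / b z)) : ℝ) : ℂ) +
        ((-(2 * Real.pi * (σ * (fderiv ℝ b z (Complex.I * v) / b z))) : ℝ) : ℂ) * Complex.I := by
      apply Complex.ext
      · simp only [Complex.add_re, Complex.ofReal_re, Complex.re_ofReal_mul, Complex.I_re]
        rw [h1]; ring
      · simp only [Complex.add_im, Complex.ofReal_im, Complex.im_ofReal_mul, Complex.I_im]
        linarith
    rw [hκ, h4]; push_cast; ring
  have hentry : ∀ i j, ∀ a c d : ℂ, m 1 i j v = 2 * Real.pi * a → m 0 i j v = 2 * Real.pi * c →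
      m (-1) i j v = 2 * Real.pi * d →
      maurerCartan F z v lam i j = a * lam⁻¹ + c + d * lam := by
    intro i j a c d ha hc hd
    refine laurent_of_modes hs0 (h.continuousOn_maurerCartan hr.1 hU hsI hz v i j)
      ((hmode _ _ _).trans ha) ((hmode _ _ _).trans hc) ((hmode _ _ _).trans hd)
      (fun n hn => ?_) (fun n hn => ?_) lam hlam
    · rw [hmode, (h.mode_maurerCartan hr hU hz i j).1 n hn]
    · rw [hmode]
      have h1 := hskew (-n) i j v
      rw [neg_neg] at h1
      exact h1.trans (by
        simp only [hm]
        rw [(h.mode_maurerCartan hr hU hz j i).1 (-n) (by omega), map_zero, neg_zero])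
  have hone : ∀ i j, m 1 i j v = 2 * Real.pi *
      (v * !![0, b z ^ 2 * p z; ((b z : ℂ) ^ 2)⁻¹ * q z, 0] i j) := fun i j =>
    (h.mode_maurerCartan hr hU hz i j).2.1 v
  have hmone : ∀ i j, m (-1) i j v = 2 * Real.pi *
      (-(starRingEnd ℂ) (v * !![0, b z ^ 2 * p z; ((b z : ℂ) ^ 2)⁻¹ * q z, 0] j i)) := fun i j => by
    rw [hskew, hone, map_mul, map_mul, Complex.conj_ofReal, map_ofNat]; ring
  have hd0 := hdiag 0 1 (by
    obtain ⟨κ, hκ⟩ := (h.mode_maurerCartan hr hU hz 0 0).2.2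
    exact ⟨κ, fun v => by simpa using hκ v⟩)
  have hd1 := hdiag 1 (-1) (by
    obtain ⟨κ, hκ⟩ := (h.mode_maurerCartan hr hU hz 1 1).2.2
    exact ⟨κ, fun v => by simpa using hκ v⟩)
  ext i j
  fin_cases i <;> fin_cases j
  · refine (hentry 0 0 _ _ _ (hone 0 0) hd0 (hmone 0 0)).trans ?_
    simp [frameForm]
  · refine (hentry 0 1 _ 0 _ (hone 0 1) (by rw [hodd.1, mul_zero]) (hmone 0 1)).trans ?_
    simp [frameForm]; ring
  · refine (hentry 1 0 _ 0 _ (hone 1 0) (by rw [hodd.2, mul_zero]) (hmone 1 0)).trans ?_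
    simp [frameForm]; ring
  · refine (hentry 1 1 _ _ _ (hone 1 1) hd1 (hmone 1 1)).trans ?_
    simp [frameForm]

end Frame

end DPW

end

noncomputable section

namespace DPW

open Set Metric MeasureTheory

/-! ### Euclidean geometry of `su(2)` -/

/-- The Hermitian matrix `[[0, k], [conj k, 0]]`. -/
def hermOff (k : ℂ) : Mat2 := !![0, k; (starRingEnd ℂ) k, 0]

lemma star_hermOff (k : ℂ) : star (hermOff k) = hermOff k := by
  ext i j; rw [Matrix.star_apply]; fin_cases i <;> fin_cases j <;> simp [hermOff]

lemma star_sigma3 : star sigma3 = sigma3 := by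
  ext i j; rw [Matrix.star_apply]; fin_cases i <;> fin_cases j <;> simp [sigma3]

lemma toR3_smul (c : ℝ) (X : Mat2) : toR3 ((c : ℂ) • X) = c • toR3 X := by
  ext i; fin_cases i <;> simp [toR3]

lemma toR3_add (X Y : Mat2) : toR3 (X + Y) = toR3 X + toR3 Y := by
  ext i; fin_cases i <;> simp [toR3] <;> ring

lemma inner_toR3 {X Y : Mat2} (hX : star X = X) (hX0 : X.trace = 0) (hY : star Y = Y)
    (hY0 : Y.trace = 0) :
    inner ℝ (toR3 (-Complex.I • X)) (toR3 (-Complex.I • Y)) = (X * Y).trace.re / 2 := by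
  have e1 := congr_entry hX 0 0
  have e2 := congr_entry hX 1 0
  have e3 := congr_entry hY 0 0
  have e4 := congr_entry hY 1 0
  rw [Matrix.star_apply] at e1 e2 e3 e4
  rw [Matrix.trace_fin_two] at hX0 hY0 ⊢
  have e5 : X 1 1 = -X 0 0 := by linear_combination hX0
  have e6 : Y 1 1 = -Y 0 0 := by linear_combination hY0
  have i1 := congrArg Complex.im e1
  have i2 := congrArg Complex.im e3
  simp only [Complex.star_def, Complex.conj_im] at i1 i2
  have i1' : (X 0 0).im = 0 := by linarith
  have i2' : (Y 0 0).im = 0 := by linarith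
  rw [mat2_mul_apply, mat2_mul_apply, e5, e6, ← e2, ← e4]
  simp [toR3, PiLp.inner_apply, Fin.sum_univ_three, i1', i2']
  ring

lemma trace_conj_mul {F : Mat2} (hF : F.det = 1) (X Y : Mat2) :
    ((F * X * F⁻¹) * (F * Y * F⁻¹)).trace = (X * Y).trace := by
  have h := inv_mul_of_det_eq_one hF
  have : (F * X * F⁻¹) * (F * Y * F⁻¹) = F * (X * Y) * F⁻¹ := by
    calc (F * X * F⁻¹) * (F * Y * F⁻¹) = F * X * (F⁻¹ * F) * Y * F⁻¹ := by simp only [mul_assoc]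
      _ = _ := by rw [h, mul_one]; simp only [mul_assoc]
  rw [this, Matrix.trace_mul_comm, ← mul_assoc, h, one_mul]

lemma star_conj_of_unitary {F : Mat2} (hF : F ∈ Matrix.unitaryGroup (Fin 2) ℂ) {X : Mat2}
    (hX : star X = X) : star (F * X * F⁻¹) = F * X * F⁻¹ := by
  rw [inv_eq_star_of_mem_unitary hF, star_mul, star_mul, star_star, hX, mul_assoc]

lemma trace_conj {F : Mat2} (hF : F.det = 1) (X : Mat2) : (F * X * F⁻¹).trace = X.trace := by
  rw [Matrix.trace_mul_comm, ← mul_assoc, inv_mul_of_det_eq_one hF, one_mul]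

lemma inner_toR3_conj {F : Mat2} (hF : F ∈ Matrix.unitaryGroup (Fin 2) ℂ) (hd : F.det = 1)
    {X Y : Mat2} (hX : star X = X) (hX0 : X.trace = 0) (hY : star Y = Y) (hY0 : Y.trace = 0) :
    inner ℝ (toR3 (-Complex.I • (F * X * F⁻¹))) (toR3 (-Complex.I • (F * Y * F⁻¹))) =
      (X * Y).trace.re / 2 := by
  rw [inner_toR3 (star_conj_of_unitary hF hX) (by rw [trace_conj hd, hX0])
    (star_conj_of_unitary hF hY) (by rw [trace_conj hd, hY0]), trace_conj_mul hd]

lemma hasFDerivAt_toR3 {S : ℂ → Mat2} {z : ℂ} (hS : MDiff S z) :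
    DifferentiableAt ℝ (fun w => toR3 (S w)) z ∧
      ∀ v, fderiv ℝ (fun w => toR3 (S w)) z v = toR3 (mfd S z v) := by
  have him : ∀ i j, HasFDerivAt (fun w => -(S w i j).im)
      (-(Complex.imCLM.comp (fderiv ℝ (fun w => S w i j) z))) z := fun i j =>
    (Complex.imCLM.hasFDerivAt.comp z (hS i j).hasFDerivAt).neg
  have hre : ∀ i j, HasFDerivAt (fun w => -(S w i j).re)
      (-(Complex.reCLM.comp (fderiv ℝ (fun w => S w i j) z))) z := fun i j =>
    (Complex.reCLM.hasFDerivAt.comp z (hS i j).hasFDerivAt).neg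
  have hd : DifferentiableAt ℝ (fun w => toR3 (S w)) z := by
    rw [differentiableAt_euclidean]
    intro i
    fin_cases i
    · exact (him 0 1).differentiableAt
    · exact (hre 0 1).differentiableAt
    · exact (him 0 0).differentiableAt
  refine ⟨hd, fun v => ?_⟩
  ext i
  have h1 : (fderiv ℝ (fun w => toR3 (S w)) z v) i = fderiv ℝ (fun w => toR3 (S w) i) z v := by
    have := ((EuclideanSpace.proj i : E3 →L[ℝ] ℝ).hasFDerivAt.comp z
      hd.hasFDerivAt).fderiv
    have e : ((EuclideanSpace.proj i : E3 →L[ℝ] ℝ) ∘ fun w => toR3 (S w)) =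
      fun w => toR3 (S w) i := rfl
    rw [e] at this; rw [this]; rfl
  rw [h1]
  fin_cases i
  · change fderiv ℝ (fun w => -(S w 0 1).im) z v = -(mfd S z v 0 1).im
    rw [(him 0 1).fderiv]; rfl
  · change fderiv ℝ (fun w => -(S w 0 1).re) z v = -(mfd S z v 0 1).re
    rw [(hre 0 1).fderiv]; rfl
  · change fderiv ℝ (fun w => -(S w 0 0).im) z v = -(mfd S z v 0 0).im
    rw [(him 0 0).fderiv]; rfl

/-! ### Pointwise form of the CMC condition -/

/-- Conformal with constant mean curvature `H ≠ 0` at `z`, the normal being eliminated. -/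
def IsCMCAt (H : ℝ) (f : ℂ → E3) (z : ℂ) : Prop :=
  ConformalAt f z ∧ (∀ v, inner ℝ (fderiv ℝ f z v) (Laplacian.laplacian f z) = 0) ∧
    ‖Laplacian.laplacian f z‖ = 2 * |H| * ‖fderiv ℝ f z 1‖ ^ 2

lemma IsCMCAt.congr {H : ℝ} {f g : ℂ → E3} {z : ℂ} (h : IsCMCAt H f z) (e : g =ᶠ[nhds z] f) :
    IsCMCAt H g z := by
  have h1 : Laplacian.laplacian g z = Laplacian.laplacian f z :=
    (InnerProductSpace.laplacian_congr_nhds e).self_of_nhds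
  have h2 : fderiv ℝ g z = fderiv ℝ f z := e.fderiv_eq
  refine ⟨?_, ?_, ?_⟩
  · rw [conformalAt_iff', h2]; exact conformalAt_iff'.1 h.1
  · rw [h1, h2]; exact h.2.1
  · rw [h1, h2]; exact h.2.2

lemma iteratedFDeriv_two_diag {f : ℂ → E3} {z : ℂ} (v : ℂ) :
    iteratedFDeriv ℝ 2 f z ![v, v] = fderiv ℝ (fderiv ℝ f) z v v := by
  rw [iteratedFDeriv_two_apply]; rfl

lemma isConformalCMC_of_isCMCAt {H : ℝ} (hH : H ≠ 0) {V : Set ℂ} (hV : IsOpen V) {f : ℂ → E3}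
    (hf : ContDiffOn ℝ ∞ f V) (h : ∀ z ∈ V, IsCMCAt H f z) : IsConformalCMC H V f := by
  have hne : ∀ z ∈ V, ‖fderiv ℝ f z 1‖ ≠ 0 := by
    intro z hz h0
    obtain ⟨c, hc, hcc⟩ := conformalAt_iff'.1 (h z hz).1
    have := hcc 1 1
    rw [real_inner_self_eq_norm_sq, real_inner_self_eq_norm_sq, h0] at this
    simp at this; linarith
  have hfd : ContDiffOn ℝ ∞ (fderiv ℝ f) V := hf.fderiv_of_isOpen hV (by simp)
  have hfc : ContinuousOn (fun z => ‖fderiv ℝ f z 1‖) V :=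
    (hfd.continuousOn.clm_apply continuousOn_const).norm
  have hLc : ContinuousOn (Laplacian.laplacian f) V := by
    have h2 : ContinuousOn (fderiv ℝ (fderiv ℝ f)) V :=
      hfd.continuousOn_fderiv_of_isOpen hV (by simp)
    have e : Laplacian.laplacian f = fun z => fderiv ℝ (fderiv ℝ f) z 1 1 +
        fderiv ℝ (fderiv ℝ f) z Complex.I Complex.I := by
      rw [InnerProductSpace.laplacian_eq_iteratedFDeriv_complexPlane]
      funext z; rw [iteratedFDeriv_two_diag, iteratedFDeriv_two_diag]
    rw [e]
    exact ((h2.clm_apply continuousOn_const).clm_apply continuousOn_const).add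
      ((h2.clm_apply continuousOn_const).clm_apply continuousOn_const)
  refine ⟨hf, fun z hz => (h z hz).1,
    fun z => (2 * H * ‖fderiv ℝ f z 1‖ ^ 2)⁻¹ • Laplacian.laplacian f z, ?_, fun z hz => ?_⟩
  · refine ContinuousOn.smul (ContinuousOn.inv₀ (continuousOn_const.mul (hfc.pow 2)) ?_) hLc
    intro z hz
    exact mul_ne_zero (mul_ne_zero two_ne_zero hH) (pow_ne_zero 2 (hne z hz))
  · have h0 := hne z hz
    obtain ⟨-, h1, h2⟩ := h z hz
    have hpos : 2 * |H| * ‖fderiv ℝ f z 1‖ ^ 2 ≠ 0 := by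
      have := abs_pos.2 hH
      positivity
    refine ⟨?_, fun v => ?_, ?_⟩
    · rw [norm_smul, h2, norm_inv, norm_mul, norm_mul, norm_pow, norm_norm]
      simp only [Real.norm_eq_abs, abs_two]
      exact inv_mul_cancel₀ hpos
    · rw [inner_smul_right, h1, mul_zero]
    · rw [inner_smul_right, real_inner_self_eq_norm_sq, h2]
      have : |H| ^ 2 = H ^ 2 := sq_abs H
      have h3 : (2 * |H| * ‖fderiv ℝ f z 1‖ ^ 2) ^ 2 = (2 * H * ‖fderiv ℝ f z 1‖ ^ 2) ^ 2 := by
        rw [mul_pow, mul_pow, this]; ring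
      rw [h3]
      field_simp

/-! ### The surface of a frame -/

section Surface

variable {r : ℝ} {U : Set ℂ} {p q : ℂ → ℂ} {L F B : ℂ → ℂ → Mat2}

lemma mul_circleMap_one {t₀ : ℝ} (t : ℝ) :
    circleMap 0 1 t₀ * circleMap 0 1 t = circleMap 0 1 (t₀ + t) := by
  simp [circleMap, add_mul, Complex.exp_add]

lemma lamDeriv_eq_fderiv (hU : IsOpen U) (hF : JointlySmooth 1 U F) {z : ℂ} (hz : z ∈ U) (t₀ : ℝ)
    (i j : Fin 2) : lamDeriv (F z) (circleMap 0 1 t₀) i j =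
      -Complex.I * fderiv ℝ (fun q : ℂ × ℝ => F q.1 (circleMap 0 1 q.2) i j) (z, t₀) (0, 1) := by
  simp only [lamDeriv, Matrix.of_apply, mul_circleMap_one]
  congr 1
  set G : ℂ × ℝ → ℂ := fun q => F q.1 (circleMap 0 1 q.2) i j with hG
  have hO : IsOpen (U ×ˢ (univ : Set ℝ)) := hU.prod isOpen_univ
  have hGs : ContDiffOn ℝ ∞ G (U ×ˢ univ) := hF i j
  have h1 : HasDerivAt (fun t : ℝ => (z, t₀ + t)) ((0 : ℂ), (1 : ℝ)) 0 :=
    (hasDerivAt_const _ _).prodMk ((hasDerivAt_id _).const_add _)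
  have h2 : HasFDerivAt G (fderiv ℝ G (z, t₀ + 0)) (z, t₀ + 0) :=
    ((hGs.differentiableOn (by simp)).differentiableAt
      (hO.mem_nhds (x := (z, t₀ + 0)) ⟨hz, mem_univ _⟩)).hasFDerivAt
  have h3 := (h2.comp_hasDerivAt (0 : ℝ) h1).deriv
  rw [add_zero] at h3
  exact h3

lemma contDiffOn_lamDeriv (hU : IsOpen U) (hF : JointlySmooth 1 U F) (t₀ : ℝ) (i j : Fin 2) :
    ContDiffOn ℝ ∞ (fun z => lamDeriv (F z) (circleMap 0 1 t₀) i j) U := by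
  have hO : IsOpen (U ×ˢ (univ : Set ℝ)) := hU.prod isOpen_univ
  have h1 : ContDiffOn ℝ ∞ (fderiv ℝ fun q : ℂ × ℝ => F q.1 (circleMap 0 1 q.2) i j)
      (U ×ˢ univ) := (hF i j).fderiv_of_isOpen hO (by simp)
  have h2 : ContDiffOn ℝ ∞ (fun z : ℂ => (z, t₀)) U := contDiffOn_id.prodMk contDiffOn_const
  have h3 := (h1.comp h2 fun z hz => ⟨hz, mem_univ _⟩).clm_apply
    (contDiffOn_const (c := ((0 : ℂ), (1 : ℝ))))
  exact (contDiffOn_const.mul h3).congr fun z hz => lamDeriv_eq_fderiv hU hF hz t₀ i j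

lemma mfd_lamDeriv (hU : IsOpen U) (hF : JointlySmooth 1 U F) {z : ℂ} (hz : z ∈ U) (t₀ : ℝ) (v : ℂ)
    {A : ℝ → Mat2} (hA : ∀ t, mfd (fun w => F w (circleMap 0 1 t)) z v =
      F z (circleMap 0 1 t) * A t) {A' : Mat2} (hA' : ∀ i j, HasDerivAt (fun t => A t i j) (A' i j) t₀) :
    mfd (fun w => lamDeriv (F w) (circleMap 0 1 t₀)) z v =
      lamDeriv (F z) (circleMap 0 1 t₀) * A t₀ + -Complex.I • (F z (circleMap 0 1 t₀) * A') := by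
  have hO : IsOpen (U ×ˢ (univ : Set ℝ)) := hU.prod isOpen_univ
  have hmem : ∀ t : ℝ, U ×ˢ (univ : Set ℝ) ∈ nhds (z, t) := fun t =>
    hO.mem_nhds (x := (z, t)) ⟨hz, mem_univ _⟩
  set G : Fin 2 → Fin 2 → ℂ × ℝ → ℂ := fun i j q => F q.1 (circleMap 0 1 q.2) i j with hGdef
  have hGs : ∀ i j, ContDiffOn ℝ ∞ (G i j) (U ×ˢ univ) := hF
  have hG1 : ∀ i j t, HasFDerivAt (G i j) (fderiv ℝ (G i j) (z, t)) (z, t) := fun i j t =>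
    (((hGs i j).differentiableOn (by simp)).differentiableAt (hmem t)).hasFDerivAt
  have hpart : ∀ i j t, mfd (fun w => F w (circleMap 0 1 t)) z v i j =
      fderiv ℝ (G i j) (z, t) (v, 0) := by
    intro i j t
    have h2 : HasFDerivAt (fun z : ℂ => (z, t)) (ContinuousLinearMap.inl ℝ ℂ ℝ) z :=
      hasFDerivAt_prodMk_left z t
    have h3 := ((hG1 i j t).comp z h2).fderiv
    have h4 : (G i j ∘ fun z : ℂ => (z, t)) = fun w => F w (circleMap 0 1 t) i j := rfl
    rw [h4] at h3
    rw [mfd_apply, h3]; simp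
  have hG2 : ∀ i j, HasFDerivAt (fderiv ℝ (G i j)) (fderiv ℝ (fderiv ℝ (G i j)) (z, t₀))
      (z, t₀) := fun i j =>
    ((((hGs i j).fderiv_of_isOpen hO (m := ∞) (by simp)).differentiableOn (by simp)).differentiableAt
      (hmem t₀)).hasFDerivAt
  have htder : ∀ i j, HasDerivAt (fun t => F z (circleMap 0 1 t) i j)
      (Complex.I * lamDeriv (F z) (circleMap 0 1 t₀) i j) t₀ := by
    intro i j
    have h1 : HasDerivAt (fun t : ℝ => (z, t)) ((0 : ℂ), (1 : ℝ)) t₀ :=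
      (hasDerivAt_const _ _).prodMk (hasDerivAt_id _)
    have h2 := (hG1 i j t₀).comp_hasDerivAt t₀ h1
    rw [lamDeriv_eq_fderiv hU hF hz, ← mul_assoc, mul_neg, Complex.I_mul_I, neg_neg, one_mul]
    exact h2
  ext i j
  have hsym : fderiv ℝ (fderiv ℝ (G i j)) (z, t₀) (v, 0) (0, 1) =
      fderiv ℝ (fderiv ℝ (G i j)) (z, t₀) (0, 1) (v, 0) :=
    (((hGs i j).contDiffAt (hmem t₀)).isSymmSndFDerivAt (by
      simp only [minSmoothness_of_isRCLikeNormedField]; exact WithTop.coe_le_coe.2 le_top)) _ _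
  have hE : (fun w => lamDeriv (F w) (circleMap 0 1 t₀) i j) =ᶠ[nhds z]
      fun w => -Complex.I * fderiv ℝ (G i j) (w, t₀) (0, 1) := by
    filter_upwards [hU.mem_nhds hz] with w hw using lamDeriv_eq_fderiv hU hF hw t₀ i j
  have hE' : HasFDerivAt (fun w : ℂ => fderiv ℝ (G i j) (w, t₀) (0, 1))
      ((ContinuousLinearMap.apply ℝ ℂ ((0 : ℂ), (1 : ℝ))).comp
        ((fderiv ℝ (fderiv ℝ (G i j)) (z, t₀)).comp (ContinuousLinearMap.inl ℝ ℂ ℝ))) z := by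
    have h2 : HasFDerivAt (fun z : ℂ => (z, t₀)) (ContinuousLinearMap.inl ℝ ℂ ℝ) z :=
      hasFDerivAt_prodMk_left z t₀
    exact (ContinuousLinearMap.apply ℝ ℂ ((0 : ℂ), (1 : ℝ))).hasFDerivAt.comp z
      ((hG2 i j).comp z h2)
  have hL : mfd (fun w => lamDeriv (F w) (circleMap 0 1 t₀)) z v i j =
      -Complex.I * fderiv ℝ (fderiv ℝ (G i j)) (z, t₀) (v, 0) (0, 1) := by
    rw [mfd_apply, hE.fderiv_eq, (hE'.const_mul (-Complex.I)).fderiv]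
    simp
  have hR : HasDerivAt (fun t => fderiv ℝ (G i j) (z, t) (v, 0))
      (fderiv ℝ (fderiv ℝ (G i j)) (z, t₀) (0, 1) (v, 0)) t₀ := by
    have h1 : HasDerivAt (fun t : ℝ => (z, t)) ((0 : ℂ), (1 : ℝ)) t₀ :=
      (hasDerivAt_const _ _).prodMk (hasDerivAt_id _)
    exact (ContinuousLinearMap.apply ℝ ℂ (v, (0 : ℝ))).hasFDerivAt.comp_hasDerivAt t₀
      ((hG2 i j).comp_hasDerivAt t₀ h1)
  have hR' : HasDerivAt (fun t => fderiv ℝ (G i j) (z, t) (v, 0))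
      ((Complex.I * lamDeriv (F z) (circleMap 0 1 t₀) i 0 * A t₀ 0 j +
        F z (circleMap 0 1 t₀) i 0 * A' 0 j) +
        (Complex.I * lamDeriv (F z) (circleMap 0 1 t₀) i 1 * A t₀ 1 j +
        F z (circleMap 0 1 t₀) i 1 * A' 1 j)) t₀ := by
    have e : (fun t => fderiv ℝ (G i j) (z, t) (v, 0)) = fun t =>
        F z (circleMap 0 1 t) i 0 * A t 0 j + F z (circleMap 0 1 t) i 1 * A t 1 j := by
      funext t
      rw [← hpart, hA, mat2_mul_apply]
    rw [e]
    exact ((htder i 0).mul (hA' 0 j)).add ((htder i 1).mul (hA' 1 j))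
  rw [hL, hsym, hR.unique hR', Matrix.add_apply, Matrix.smul_apply, mat2_mul_apply, mat2_mul_apply,
    smul_eq_mul]
  linear_combination (-(lamDeriv (F z) (circleMap 0 1 t₀) i 0 * A t₀ 0 j) -
    lamDeriv (F z) (circleMap 0 1 t₀) i 1 * A t₀ 1 j) * Complex.I_mul_I

/-- The coefficient of the derivative of the surface in the frame. -/
def surfCoeff (ε : ℝ) (b : ℂ → ℝ) (p q : ℂ → ℂ) (lam z v : ℂ) : ℂ :=
  if ε = 1 then -4 * (v * (b z ^ 2 * p z) * lam⁻¹)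
  else 4 * (starRingEnd ℂ) (v * (((b z : ℂ) ^ 2)⁻¹ * q z) * lam⁻¹)

lemma inv_eq_conj_of_norm_one {lam : ℂ} (h : lam ∈ sphere (0 : ℂ) 1) :
    lam⁻¹ = (starRingEnd ℂ) lam := by
  rw [Complex.inv_def, Complex.normSq_eq_norm_sq]
  simp at h; simp [h]

lemma IsDPWData.mdiff_F_one (h : IsDPWData r (offDiag p q) U L F B) (hr : r ∈ Ioc (0 : ℝ) 1)
    (hU : IsOpen U) {z : ℂ} (hz : z ∈ U) {lam : ℂ} (hlam : lam ∈ sphere (0 : ℂ) 1) :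
    MDiff (fun w => F w lam) z ∧ ∀ᶠ w in nhds z, (F w lam).det = 1 := by
  have h11 : (1 : ℝ) ∈ Icc r 1 := ⟨hr.2, le_rfl⟩
  refine ⟨(h.smooth_F 1 h11).mdiff one_pos hU hz hlam, ?_⟩
  filter_upwards [hU.mem_nhds hz] with w hw using h.det_F hr.1 h11 hw hlam

/-- Derivative of a conjugate `F K F⁻¹` of a moving matrix `K` by the frame. -/
lemma IsDPWData.mfd_conj (h : IsDPWData r (offDiag p q) U L F B) (hr : r ∈ Ioc (0 : ℝ) 1)
    (hU : IsOpen U) {z : ℂ} (hz : z ∈ U) {lam : ℂ} (hlam : lam ∈ sphere (0 : ℂ) 1)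
    {K : ℂ → Mat2} (hK : MDiff K z) (v : ℂ) :
    MDiff (fun w => F w lam * K w * (F w lam)⁻¹) z ∧
    mfd (fun w => F w lam * K w * (F w lam)⁻¹) z v =
      F z lam * (frameForm (metricFn B) p q z lam v * K z - K z * frameForm (metricFn B) p q z lam v
        + mfd K z v) * (F z lam)⁻¹ := by
  obtain ⟨hF, hdet⟩ := h.mdiff_F_one hr hU hz hlam
  refine ⟨(hF.mul hK).mul (hF.inv hdet), ?_⟩
  have hinv := inv_mul_of_det_eq_one hdet.self_of_nhds
  rw [mfd_mul (hF.mul hK) (hF.inv hdet), mfd_mul hF hK, mfd_inv hF hdet,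
    h.frame_eq hr hU hz v (Or.inr rfl) hlam]
  set α := frameForm (metricFn B) p q z lam v
  have e : F z lam * K z * -((F z lam)⁻¹ * (F z lam * α) * (F z lam)⁻¹) =
      -(F z lam * K z * ((F z lam)⁻¹ * F z lam) * α * (F z lam)⁻¹) := by
    simp only [mul_assoc, mul_neg]
  rw [e, hinv, mul_one]
  noncomm_ring

lemma frameForm_mul_circleMap {b : ℂ → ℝ} {z v : ℂ} (t₀ : ℝ) (i j : Fin 2) :
    HasDerivAt (fun t => frameForm b p q z (circleMap 0 1 t) v i j)
      (!![0, -Complex.I * (v * (b z ^ 2 * p z) * (circleMap 0 1 t₀)⁻¹ +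
          (starRingEnd ℂ) (v * (((b z : ℂ) ^ 2)⁻¹ * q z)) * circleMap 0 1 t₀);
        -Complex.I * (v * (((b z : ℂ) ^ 2)⁻¹ * q z) * (circleMap 0 1 t₀)⁻¹ +
          (starRingEnd ℂ) (v * (b z ^ 2 * p z)) * circleMap 0 1 t₀), 0] i j) t₀ := by
  have h1 := hasDerivAt_circleMap 0 1 t₀
  have hne := circleMap_zero_ne_zero one_pos t₀
  have h2 : HasDerivAt (fun t => (circleMap 0 1 t)⁻¹) (-Complex.I * (circleMap 0 1 t₀)⁻¹) t₀ := by
    refine (h1.fun_inv hne).congr_deriv ?_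
    field_simp
  have key : ∀ a c : ℂ, HasDerivAt (fun t => a * (circleMap 0 1 t)⁻¹ - c * circleMap 0 1 t)
      (-Complex.I * (a * (circleMap 0 1 t₀)⁻¹ + c * circleMap 0 1 t₀)) t₀ := by
    intro a c
    refine ((h2.const_mul a).sub (h1.const_mul c)).congr_deriv ?_
    ring
  fin_cases i <;> fin_cases j
  · exact hasDerivAt_const _ _
  · exact key _ _
  · exact key _ _
  · exact hasDerivAt_const _ _

theorem IsDPWData.mfd_symBobenko (h : IsDPWData r (offDiag p q) U L F B) (hr : r ∈ Ioc (0 : ℝ) 1)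
    (hU : IsOpen U) {z : ℂ} (hz : z ∈ U) {lam : ℂ} (hlam : lam ∈ sphere (0 : ℂ) 1) {ε : ℝ}
    (hε : ε = 1 ∨ ε = -1) (H : ℝ) (v : ℂ) :
    MDiff (fun w => symBobenko ε H (F w) lam) z ∧
    mfd (fun w => symBobenko ε H (F w) lam) z v = (-Complex.I / (2 * (H : ℂ))) •
      (F z lam * hermOff (surfCoeff ε (metricFn B) p q lam z v) * (F z lam)⁻¹) := by
  obtain ⟨hF, hdet⟩ := h.mdiff_F_one hr hU hz hlam
  have h11 : (1 : ℝ) ∈ Icc r 1 := ⟨hr.2, le_rfl⟩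
  obtain ⟨t₀, rfl⟩ := exists_circleMap_eq one_pos hlam
  have hFs := h.smooth_F 1 h11
  have hE : MDiff (fun w => lamDeriv (F w) (circleMap 0 1 t₀)) z := fun i j =>
    ((contDiffOn_lamDeriv hU hFs t₀ i j).differentiableOn (by simp)).differentiableAt
      (hU.mem_nhds hz)
  obtain ⟨hN, hN'⟩ := h.mfd_conj hr hU hz hlam (MDiff.const sigma3 z) v
  have hT := hE.mul (hF.inv hdet)
  have hinv := inv_mul_of_det_eq_one hdet.self_of_nhds
  set lam := circleMap 0 1 t₀ with hlamdef
  set α := frameForm (metricFn B) p q z lam v with hα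
  set α' : Mat2 := !![0, -Complex.I * (v * (metricFn B z ^ 2 * p z) * lam⁻¹ +
          (starRingEnd ℂ) (v * (((metricFn B z : ℂ) ^ 2)⁻¹ * q z)) * lam);
        -Complex.I * (v * (((metricFn B z : ℂ) ^ 2)⁻¹ * q z) * lam⁻¹ +
          (starRingEnd ℂ) (v * (metricFn B z ^ 2 * p z)) * lam), 0] with hα'
  have hT' : mfd (fun w => lamDeriv (F w) lam * (F w lam)⁻¹) z v =
      F z lam * (-Complex.I • α') * (F z lam)⁻¹ := by
    rw [mfd_mul hE (hF.inv hdet), mfd_inv hF hdet, h.frame_eq hr hU hz v (Or.inr rfl) hlam,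
      mfd_lamDeriv hU hFs hz t₀ v (fun t => h.frame_eq hr hU hz v (Or.inr rfl)
        (circleMap_mem_sphere_zero zero_le_one t)) (frameForm_mul_circleMap t₀)]
    have e : lamDeriv (F z) lam * -((F z lam)⁻¹ * (F z lam * α) * (F z lam)⁻¹) =
        -(lamDeriv (F z) lam * ((F z lam)⁻¹ * F z lam) * α * (F z lam)⁻¹) := by
      simp only [mul_assoc, mul_neg]
    rw [e, hinv, mul_one, add_mul, Matrix.smul_mul, Matrix.mul_smul, Matrix.smul_mul]
    abel
  have hsum : ∀ w, symBobenko ε H (F w) lam = (-Complex.I / (2 * (H : ℂ))) •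
      (F w lam * sigma3 * (F w lam)⁻¹ + (2 * (ε : ℂ)) • (lamDeriv (F w) lam * (F w lam)⁻¹)) :=
    fun _ => rfl
  have hfin : mfd (fun w => symBobenko ε H (F w) lam) z v = (-Complex.I / (2 * (H : ℂ))) •
      (mfd (fun w => F w lam * sigma3 * (F w lam)⁻¹) z v +
        (2 * (ε : ℂ)) • mfd (fun w => lamDeriv (F w) lam * (F w lam)⁻¹) z v) := by
    ext i j
    have e := (((hN i j).hasFDerivAt.add ((hT i j).hasFDerivAt.const_mul (2 * (ε : ℂ)))).const_mul
      (-Complex.I / (2 * (H : ℂ)))).fderiv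
    rw [mfd_apply]
    refine (congrArg (fun D : ℂ →L[ℝ] ℂ => D v) e).trans ?_
    simp [mfd_apply]
    ring
  refine ⟨fun i j => ((hN i j).add ((hT i j).const_mul (2 * (ε : ℂ)))).const_mul
      (-Complex.I / (2 * (H : ℂ))), ?_⟩
  rw [hfin, hN', hT', mfd_const, add_zero]
  congr 1
  rw [← Matrix.smul_mul, ← Matrix.mul_smul, ← add_mul, ← mul_add]
  congr 2
  have hconj : (starRingEnd ℂ) lam⁻¹ = lam := by
    rw [inv_eq_conj_of_norm_one hlam, Complex.conj_conj]
  have hII : Complex.I * Complex.I = -1 := Complex.I_mul_I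
  have h4 : (starRingEnd ℂ) 4 = 4 := Complex.conj_ofNat 4
  ext i j
  simp only [Matrix.add_apply, Matrix.sub_apply, mat2_mul_apply, Matrix.smul_apply, smul_eq_mul]
  have hb : (starRingEnd ℂ) ((metricFn B z : ℂ) ^ 2)⁻¹ = ((metricFn B z : ℂ) ^ 2)⁻¹ := by simp
  have hconj' : (starRingEnd ℂ) lam = lam⁻¹ := (inv_eq_conj_of_norm_one hlam).symm
  rcases hε with rfl | rfl
  · fin_cases i <;> fin_cases j <;>
      simp [hα, hα', frameForm, sigma3, hermOff, surfCoeff, -map_inv₀, hconj, h4, hb]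
    · linear_combination (2 * (v * (metricFn B z ^ 2 * p z) * lam⁻¹) + 2 * ((starRingEnd ℂ) v *
        (((metricFn B z : ℂ) ^ 2)⁻¹ * (starRingEnd ℂ) (q z)) * lam)) * hII
    · linear_combination (2 * (v * (((metricFn B z : ℂ) ^ 2)⁻¹ * q z) * lam⁻¹) +
        2 * ((starRingEnd ℂ) v * (metricFn B z ^ 2 * (starRingEnd ℂ) (p z)) * lam)) * hII
  · have hne : ¬ ((-1 : ℝ) = 1) := by norm_num
    fin_cases i <;> fin_cases j <;>
      simp [hα, hα', frameForm, sigma3, hermOff, surfCoeff, -map_inv₀, hconj, hconj', hne, h4, hb]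
    · linear_combination (-2 * (v * (metricFn B z ^ 2 * p z) * lam⁻¹) - 2 * ((starRingEnd ℂ) v *
        (((metricFn B z : ℂ) ^ 2)⁻¹ * (starRingEnd ℂ) (q z)) * lam)) * hII
    · linear_combination (-2 * (v * (((metricFn B z : ℂ) ^ 2)⁻¹ * q z) * lam⁻¹) -
        2 * ((starRingEnd ℂ) v * (metricFn B z ^ 2 * (starRingEnd ℂ) (p z)) * lam)) * hII

end Surface

end DPW

end

noncomputable section

namespace DPW

open Set Metric MeasureTheory

section CMC

variable {r : ℝ} {U : Set ℂ} {p q : ℂ → ℂ} {L F B : ℂ → ℂ → Mat2}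

lemma MDiff.const_smul {g : ℂ → Mat2} {z : ℂ} (hg : MDiff g z) (c : ℂ) :
    MDiff (fun w => c • g w) z := fun i j => (hg i j).const_mul c

lemma mfd_const_smul {g : ℂ → Mat2} {z : ℂ} (hg : MDiff g z) (c v : ℂ) :
    mfd (fun w => c • g w) z v = c • mfd g z v := by
  ext i j
  have := ((hg i j).hasFDerivAt.const_mul c).fderiv
  exact (congrArg (fun D : ℂ →L[ℝ] ℂ => D v) this).trans rfl

lemma mfd_hermOff {k : ℂ → ℂ} {D : ℂ →L[ℝ] ℂ} {z : ℂ} (hk : HasFDerivAt k D z) (v : ℂ) :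
    MDiff (fun w => hermOff (k w)) z ∧ mfd (fun w => hermOff (k w)) z v = hermOff (D v) := by
  have hc : HasFDerivAt (fun w => (starRingEnd ℂ) (k w))
      ((Complex.conjCLE : ℂ →L[ℝ] ℂ).comp D) z :=
    (Complex.conjCLE : ℂ →L[ℝ] ℂ).hasFDerivAt.comp z hk
  constructor
  · intro i j
    fin_cases i <;> fin_cases j
    · exact differentiableAt_const _
    · exact hk.differentiableAt
    · exact hc.differentiableAt
    · exact differentiableAt_const _
  · ext i j
    rw [mfd_apply]
    fin_cases i <;> fin_cases j
    · change fderiv ℝ (fun _ => (0 : ℂ)) z v = 0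
      simp
    · change fderiv ℝ k z v = D v
      rw [hk.fderiv]
    · change fderiv ℝ (fun w => (starRingEnd ℂ) (k w)) z v = (starRingEnd ℂ) (D v)
      rw [hc.fderiv]; rfl
    · change fderiv ℝ (fun _ => (0 : ℂ)) z v = 0
      simp

/-- `|b² p|²` or `|b⁻² q|²`, according to the sign. -/
def surfDensity (ε : ℝ) (b : ℂ → ℝ) (p q : ℂ → ℂ) (z : ℂ) : ℝ :=
  if ε = 1 then Complex.normSq (b z ^ 2 * p z) else Complex.normSq (((b z : ℂ) ^ 2)⁻¹ * q z)

lemma hasFDerivAt_surfCoeff {b : ℂ → ℝ} {z : ℂ} (hb : DifferentiableAt ℝ b z) (hb0 : b z ≠ 0)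
    (hp : DifferentiableAt ℂ p z) (hq : DifferentiableAt ℂ q z) {ε : ℝ} {lam : ℂ}
    (hlam : lam ∈ sphere (0 : ℂ) 1) :
    ∃ D : ℂ → ℂ →L[ℝ] ℂ, (∀ v, HasFDerivAt (fun w => surfCoeff ε b p q lam w v) (D v) z) ∧
      (frameForm b p q z lam 1 * hermOff (surfCoeff ε b p q lam z 1) -
        hermOff (surfCoeff ε b p q lam z 1) * frameForm b p q z lam 1 + hermOff (D 1 1)) +
      (frameForm b p q z lam Complex.I * hermOff (surfCoeff ε b p q lam z Complex.I) -
        hermOff (surfCoeff ε b p q lam z Complex.I) * frameForm b p q z lam Complex.I +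
        hermOff (D Complex.I Complex.I)) = ((-16 * surfDensity ε b p q z : ℝ) : ℂ) • sigma3 := by
  have hbC : HasFDerivAt (fun w => ((b w : ℝ) : ℂ)) (Complex.ofRealCLM.comp (fderiv ℝ b z)) z :=
    Complex.ofRealCLM.hasFDerivAt.comp z hb.hasFDerivAt
  have hbz : (b z : ℂ) ≠ 0 := by exact_mod_cast hb0
  have hpR := hp.hasDerivAt.hasFDerivAt.restrictScalars ℝ
  have hqR := hq.hasDerivAt.hasFDerivAt.restrictScalars ℝ
  have hlam0 : lam ≠ 0 := by rintro rfl; simp at hlam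
  have hconj : (starRingEnd ℂ) lam = lam⁻¹ := (inv_eq_conj_of_norm_one hlam).symm
  have h4 : (starRingEnd ℂ) 4 = 4 := Complex.conj_ofNat 4
  have h2 : (starRingEnd ℂ) 2 = 2 := Complex.conj_ofNat 2
  have hII : Complex.I * Complex.I = -1 := Complex.I_mul_I
  have hneg : fderiv ℝ b z (-1) = -fderiv ℝ b z 1 := map_neg _ _
  by_cases hε : ε = 1
  · have hX : HasFDerivAt (fun w => (b w : ℂ) ^ 2 * p w) _ z := (hbC.pow 2).mul hpR
    have hD : ∀ v : ℂ, HasFDerivAt (fun w => surfCoeff ε b p q lam w v) _ z := fun v => by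
      simp only [surfCoeff, hε, if_true]
      exact ((hX.const_mul v).mul_const lam⁻¹).const_mul (-4)
    refine ⟨_, hD, ?_⟩
    generalize hx : fderiv ℝ b z 1 = bx
    generalize hy : fderiv ℝ b z Complex.I = yb
    rw [hx] at hneg
    ext i j
    simp only [Matrix.add_apply, Matrix.sub_apply, mat2_mul_apply, Matrix.smul_apply, smul_eq_mul]
    fin_cases i <;> fin_cases j <;>
      simp [frameForm, sigma3, hermOff, surfCoeff, surfDensity, hε, hneg, hx, hy, hconj, h4, h2,
        Complex.normSq_eq_conj_mul_self] <;> field_simp <;> ring_nf <;> simp only [Complex.I_sq] <;> ring_nf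
  · have hX : HasFDerivAt (fun w => ((b w : ℂ) ^ 2)⁻¹ * q w) _ z :=
      ((hasDerivAt_inv (pow_ne_zero 2 hbz)).comp_hasFDerivAt_of_eq z (hbC.pow 2) rfl).mul hqR
    have hD : ∀ v : ℂ, HasFDerivAt (fun w => surfCoeff ε b p q lam w v) _ z := fun v => by
      simp only [surfCoeff, hε, if_false]
      exact ((Complex.conjCLE : ℂ →L[ℝ] ℂ).hasFDerivAt.comp z
        ((hX.const_mul v).mul_const lam⁻¹)).const_mul 4
    refine ⟨_, hD, ?_⟩
    generalize hx : fderiv ℝ b z 1 = bx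
    generalize hy : fderiv ℝ b z Complex.I = yb
    rw [hx] at hneg
    ext i j
    simp only [Matrix.add_apply, Matrix.sub_apply, mat2_mul_apply, Matrix.smul_apply, smul_eq_mul]
    fin_cases i <;> fin_cases j <;>
      simp [frameForm, sigma3, hermOff, surfCoeff, surfDensity, hε, hneg, hx, hy, hconj, h4, h2,
        Complex.normSq_eq_conj_mul_self] <;> field_simp <;> ring_nf <;> simp only [Complex.I_sq] <;> ring_nf

lemma toR3_smul_conj (H : ℝ) (X : Mat2) :
    toR3 ((-Complex.I / (2 * (H : ℂ))) • X) = (2 * H)⁻¹ • toR3 (-Complex.I • X) := by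
  rw [← toR3_smul, smul_smul]
  congr 2
  push_cast
  rw [div_eq_mul_inv, mul_comm]

lemma contDiffOn_toR3 {S : ℂ → Mat2} {V : Set ℂ} (h : ∀ i j, ContDiffOn ℝ ∞ (fun w => S w i j) V) :
    ContDiffOn ℝ ∞ (fun w => toR3 (S w)) V := by
  rw [contDiffOn_euclidean]
  intro i
  fin_cases i
  · exact (Complex.imCLM.contDiff.comp_contDiffOn (h 0 1)).neg
  · exact (Complex.reCLM.contDiff.comp_contDiffOn (h 0 1)).neg
  · exact (Complex.imCLM.contDiff.comp_contDiffOn (h 0 0)).neg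

theorem contDiffOn_symBobenko (hU : IsOpen U) (hF : JointlySmooth 1 U F)
    (hdet : ∀ z ∈ U, ∀ lam ∈ sphere (0 : ℂ) 1, (F z lam).det = 1) {lam : ℂ}
    (hlam : lam ∈ sphere (0 : ℂ) 1) (ε H : ℝ) :
    ContDiffOn ℝ ∞ (fun z => toR3 (symBobenko ε H (F z) lam)) U := by
  obtain ⟨t₀, rfl⟩ := exists_circleMap_eq one_pos hlam
  have hF' : ∀ i j, ContDiffOn ℝ ∞ (fun z => F z (circleMap 0 1 t₀) i j) U := fun i j =>
    (hF i j).comp (contDiffOn_id.prodMk (contDiffOn_const (c := t₀))) fun z hz => ⟨hz, mem_univ _⟩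
  have hFi : ∀ i j, ContDiffOn ℝ ∞ (fun z => (F z (circleMap 0 1 t₀))⁻¹ i j) U := by
    intro i j
    have : ∀ z ∈ U, (F z (circleMap 0 1 t₀))⁻¹ i j = !![F z (circleMap 0 1 t₀) 1 1,
        -F z (circleMap 0 1 t₀) 0 1; -F z (circleMap 0 1 t₀) 1 0, F z (circleMap 0 1 t₀) 0 0] i j :=
      fun z hz => by rw [inv_eq_of_det_eq_one (hdet z hz _ hlam)]
    refine ContDiffOn.congr ?_ this
    fin_cases i <;> fin_cases j
    · exact hF' 1 1
    · exact (hF' 0 1).neg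
    · exact (hF' 1 0).neg
    · exact hF' 0 0
  have hmul : ∀ {g k : ℂ → Mat2}, (∀ i j, ContDiffOn ℝ ∞ (fun z => g z i j) U) →
      (∀ i j, ContDiffOn ℝ ∞ (fun z => k z i j) U) →
      ∀ i j, ContDiffOn ℝ ∞ (fun z => (g z * k z) i j) U := by
    intro g k hg hk i j
    simp only [mat2_mul_apply]
    exact ((hg _ _).mul (hk _ _)).add ((hg _ _).mul (hk _ _))
  refine contDiffOn_toR3 fun i j => ?_
  have h1 := hmul (hmul hF' (fun i j => contDiffOn_const (c := sigma3 i j))) hFi i j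
  have h2 := hmul (contDiffOn_lamDeriv hU hF t₀) hFi i j
  exact contDiffOn_const.mul (h1.add (contDiffOn_const.mul h2))

/-- First derivative of the surface, as a vector of `ℝ³`. -/
theorem IsDPWData.fderiv_surface (h : IsDPWData r (offDiag p q) U L F B) (hr : r ∈ Ioc (0 : ℝ) 1)
    (hU : IsOpen U) {z : ℂ} (hz : z ∈ U) {lam : ℂ} (hlam : lam ∈ sphere (0 : ℂ) 1) {ε : ℝ}
    (hε : ε = 1 ∨ ε = -1) (H : ℝ) (v : ℂ) :
    fderiv ℝ (fun w => toR3 (symBobenko ε H (F w) lam)) z v = (2 * H)⁻¹ • toR3 (-Complex.I •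
      (F z lam * hermOff (surfCoeff ε (metricFn B) p q lam z v) * (F z lam)⁻¹)) := by
  obtain ⟨h1, h2⟩ := h.mfd_symBobenko hr hU hz hlam hε H v
  rw [(hasFDerivAt_toR3 h1).2, h2, toR3_smul_conj]

lemma trace_hermOff (k : ℂ) : (hermOff k).trace = 0 := by
  simp [hermOff, Matrix.trace_fin_two]

lemma trace_hermOff_mul (k l : ℂ) :
    (hermOff k * hermOff l).trace.re = 2 * (k * (starRingEnd ℂ) l).re := by
  rw [Matrix.trace_fin_two, mat2_mul_apply, mat2_mul_apply]
  simp [hermOff]; ring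

lemma surfCoeff_mul_conj (ε : ℝ) (b : ℂ → ℝ) {lam : ℂ} (hlam : lam ∈ sphere (0 : ℂ) 1)
    (z v w : ℂ) : (surfCoeff ε b p q lam z v * (starRingEnd ℂ) (surfCoeff ε b p q lam z w)).re =
      16 * surfDensity ε b p q z * inner ℝ v w := by
  have hconj : (starRingEnd ℂ) lam = lam⁻¹ := (inv_eq_conj_of_norm_one hlam).symm
  have hlam0 : lam ≠ 0 := by rintro rfl; simp at hlam
  have h4 : (starRingEnd ℂ) 4 = 4 := Complex.conj_ofNat 4
  have hin : inner ℝ v w = ((starRingEnd ℂ) v * w).re := by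
    simp [Complex.inner, mul_comm]
  have hin' : inner ℝ v w = (v * (starRingEnd ℂ) w).re := by
    rw [hin]; simp
  by_cases hε : ε = 1
  · simp only [surfCoeff, surfDensity, hε, if_true]
    have : -4 * (v * (b z ^ 2 * p z) * lam⁻¹) *
        (starRingEnd ℂ) (-4 * (w * (b z ^ 2 * p z) * lam⁻¹)) =
        ((16 * Complex.normSq (b z ^ 2 * p z) : ℝ) : ℂ) * (v * (starRingEnd ℂ) w) := by
      push_cast
      rw [Complex.normSq_eq_conj_mul_self]
      simp [hconj, h4]
      field_simp
      ring
    rw [this, Complex.re_ofReal_mul, hin']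
  · simp only [surfCoeff, surfDensity, hε, if_false]
    have : 4 * (starRingEnd ℂ) (v * (((b z : ℂ) ^ 2)⁻¹ * q z) * lam⁻¹) *
        (starRingEnd ℂ) (4 * (starRingEnd ℂ) (w * (((b z : ℂ) ^ 2)⁻¹ * q z) * lam⁻¹)) =
        ((16 * Complex.normSq (((b z : ℂ) ^ 2)⁻¹ * q z) : ℝ) : ℂ) * ((starRingEnd ℂ) v * w) := by
      push_cast
      rw [Complex.normSq_eq_conj_mul_self]
      simp [hconj, h4]
      field_simp
      ring
    rw [this, Complex.re_ofReal_mul, hin]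

theorem IsDPWData.inner_fderiv_surface (h : IsDPWData r (offDiag p q) U L F B)
    (hr : r ∈ Ioc (0 : ℝ) 1)
    (hU : IsOpen U) {z : ℂ} (hz : z ∈ U) {lam : ℂ} (hlam : lam ∈ sphere (0 : ℂ) 1) {ε : ℝ}
    (hε : ε = 1 ∨ ε = -1) (H : ℝ) (v w : ℂ) :
    inner ℝ (fderiv ℝ (fun w => toR3 (symBobenko ε H (F w) lam)) z v)
      (fderiv ℝ (fun w => toR3 (symBobenko ε H (F w) lam)) z w) =
      4 * surfDensity ε (metricFn B) p q z * (H ^ 2)⁻¹ * inner ℝ v w := by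
  have h11 : (1 : ℝ) ∈ Icc r 1 := ⟨hr.2, le_rfl⟩
  rw [h.fderiv_surface hr hU hz hlam hε, h.fderiv_surface hr hU hz hlam hε, inner_smul_left,
    inner_smul_right, inner_toR3_conj ((h.unitary z hz).unitary lam hlam)
      (h.det_F hr.1 h11 hz hlam) (star_hermOff _) (trace_hermOff _) (star_hermOff _)
      (trace_hermOff _), trace_hermOff_mul, surfCoeff_mul_conj _ _ hlam]
  simp only [conj_trivial, mul_inv]
  ring

theorem IsDPWData.laplacian_surface (h : IsDPWData r (offDiag p q) U L F B)
    (hr : r ∈ Ioc (0 : ℝ) 1) (hU : IsOpen U) (hp : DifferentiableOn ℂ p U)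
    (hq : DifferentiableOn ℂ q U) {z : ℂ} (hz : z ∈ U) {lam : ℂ} (hlam : lam ∈ sphere (0 : ℂ) 1)
    {ε : ℝ} (hε : ε = 1 ∨ ε = -1) (H : ℝ) :
    Laplacian.laplacian (fun w => toR3 (symBobenko ε H (F w) lam)) z =
      (-16 * surfDensity ε (metricFn B) p q z * (2 * H)⁻¹) •
        toR3 (-Complex.I • (F z lam * sigma3 * (F z lam)⁻¹)) := by
  have h11 : (1 : ℝ) ∈ Icc r 1 := ⟨hr.2, le_rfl⟩
  set f : ℂ → E3 := fun w => toR3 (symBobenko ε H (F w) lam) with hf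
  have hfs : ContDiffOn ℝ ∞ f U := contDiffOn_symBobenko hU (h.smooth_F 1 h11)
    (fun z hz lam hlam => h.det_F hr.1 h11 hz hlam) hlam ε H
  have hfd : DifferentiableAt ℝ (fderiv ℝ f) z :=
    ((hfs.fderiv_of_isOpen hU (m := ∞) (by simp)).differentiableOn (by simp)).differentiableAt
      (hU.mem_nhds hz)
  obtain ⟨D, hD, hsum⟩ := hasFDerivAt_surfCoeff (ε := ε) (h.differentiableAt_metricFn hr hU hz)
    (h.metricFn_pos hz).1.ne' (hp.differentiableAt (hU.mem_nhds hz))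
    (hq.differentiableAt (hU.mem_nhds hz)) hlam
  have hsec : ∀ v, fderiv ℝ (fderiv ℝ f) z v v = toR3 ((-Complex.I / (2 * (H : ℂ))) •
      (F z lam * (frameForm (metricFn B) p q z lam v * hermOff (surfCoeff ε (metricFn B) p q lam z v)
        - hermOff (surfCoeff ε (metricFn B) p q lam z v) * frameForm (metricFn B) p q z lam v
        + hermOff (D v v)) * (F z lam)⁻¹)) := by
    intro v
    have e1 : fderiv ℝ (fun w => fderiv ℝ f w v) z v = fderiv ℝ (fderiv ℝ f) z v v := by
      have := ((ContinuousLinearMap.apply ℝ E3 v).hasFDerivAt.comp z hfd.hasFDerivAt).fderiv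
      exact (congrArg (fun D : ℂ →L[ℝ] E3 => D v) this).trans rfl
    obtain ⟨hK, hK'⟩ := mfd_hermOff (hD v) v
    obtain ⟨hC, hC'⟩ := h.mfd_conj hr hU hz hlam hK v
    have e2 : (fun w => fderiv ℝ f w v) =ᶠ[nhds z] fun w => toR3 ((-Complex.I / (2 * (H : ℂ))) •
      (F w lam * hermOff (surfCoeff ε (metricFn B) p q lam w v) * (F w lam)⁻¹)) := by
      filter_upwards [hU.mem_nhds hz] with w hw
      rw [hf, h.fderiv_surface hr hU hw hlam hε, toR3_smul_conj]
    rw [← e1, e2.fderiv_eq, (hasFDerivAt_toR3 (hC.const_smul _)).2, mfd_const_smul hC, hC', hK']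
  rw [InnerProductSpace.laplacian_eq_iteratedFDeriv_complexPlane]
  simp only [iteratedFDeriv_two_diag]
  rw [hsec, hsec, ← toR3_add, ← smul_add, ← add_mul, ← mul_add, hsum, toR3_smul_conj,
    Matrix.mul_smul, Matrix.smul_mul, smul_comm, toR3_smul, smul_smul, mul_comm]

theorem IsDPWData.isCMCAt (h : IsDPWData r (offDiag p q) U L F B)
    (hr : r ∈ Ioc (0 : ℝ) 1) (hU : IsOpen U) (hp : DifferentiableOn ℂ p U)
    (hq : DifferentiableOn ℂ q U) {z : ℂ} (hz : z ∈ U) {lam : ℂ} (hlam : lam ∈ sphere (0 : ℂ) 1)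
    {ε : ℝ} (hε : ε = 1 ∨ ε = -1) {H : ℝ} (hH : H ≠ 0) (hp0 : ε = 1 → p z ≠ 0)
    (hq0 : ε = -1 → q z ≠ 0) :
    IsCMCAt H (fun w => toR3 (symBobenko ε H (F w) lam)) z := by
  have h11 : (1 : ℝ) ∈ Icc r 1 := ⟨hr.2, le_rfl⟩
  have hb : (metricFn B z : ℂ) ≠ 0 := by exact_mod_cast (h.metricFn_pos hz).1.ne'
  have hm : 0 < surfDensity ε (metricFn B) p q z := by
    rcases hε with rfl | rfl
    · simp only [surfDensity, if_true]
      exact Complex.normSq_pos.2 (mul_ne_zero (pow_ne_zero 2 hb) (hp0 rfl))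
    · simp only [surfDensity, if_neg (show ¬ (-1 : ℝ) = 1 by norm_num)]
      exact Complex.normSq_pos.2 (mul_ne_zero (inv_ne_zero (pow_ne_zero 2 hb)) (hq0 rfl))
  have hun := (h.unitary z hz).unitary lam hlam
  have hdet := h.det_F hr.1 h11 hz hlam
  have hs3 : sigma3.trace = 0 := by simp [sigma3, Matrix.trace_fin_two]
  have hH2 : 0 < H ^ 2 := by positivity
  refine ⟨conformalAt_iff'.2 ⟨4 * surfDensity ε (metricFn B) p q z * (H ^ 2)⁻¹, by positivity,
    fun v w => h.inner_fderiv_surface hr hU hz hlam hε H v w⟩, fun v => ?_, ?_⟩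
  · rw [h.fderiv_surface hr hU hz hlam hε, h.laplacian_surface hr hU hp hq hz hlam hε,
      inner_smul_left, inner_smul_right, inner_toR3_conj hun hdet (star_hermOff _) (trace_hermOff _)
      star_sigma3 hs3]
    have : (hermOff (surfCoeff ε (metricFn B) p q lam z v) * sigma3).trace = 0 := by
      rw [Matrix.trace_fin_two, mat2_mul_apply, mat2_mul_apply]; simp [hermOff, sigma3]
    rw [this]; simp
  · have h1 : ‖fderiv ℝ (fun w => toR3 (symBobenko ε H (F w) lam)) z 1‖ ^ 2 =
        4 * surfDensity ε (metricFn B) p q z * (H ^ 2)⁻¹ := by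
      rw [← real_inner_self_eq_norm_sq, h.inner_fderiv_surface hr hU hz hlam hε]; simp
    have h2 : ‖toR3 (-Complex.I • (F z lam * sigma3 * (F z lam)⁻¹))‖ = 1 := by
      rw [← sq_eq_sq₀ (norm_nonneg _) zero_le_one, ← real_inner_self_eq_norm_sq,
        inner_toR3_conj hun hdet star_sigma3 hs3 star_sigma3 hs3, sigma3_mul_self]
      simp
    rw [h1, h.laplacian_surface hr hU hp hq hz hlam hε, norm_smul, h2, Real.norm_eq_abs, abs_mul,
      abs_mul, abs_inv, abs_mul, abs_of_pos hm, ← sq_abs H]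
    have := abs_pos.2 hH
    norm_num
    field_simp
    norm_num
    ring

end CMC

end DPW

end

noncomputable section

namespace DPW

open Set Metric MeasureTheory

/-! ### Gauges that are holomorphic in both variables -/

lemma contDiff_circleMap_real (s : ℝ) : ContDiff ℝ ∞ (circleMap 0 s) := contDiff_circleMap 0 s

lemma isPosLoop_of_contDiffOn {r : ℝ} (hr : 0 ≤ r) {S : Set ℂ}
    (hrS : closedBall 0 r ⊆ S) {B : ℂ → Mat2} (hB : ∀ i j, ContDiffOn ℂ ∞ (fun lam => B lam i j) S)
    (hdet : ∀ lam ∈ S, (B lam).det = 1) (htw : IsTwistedOn (closedBall 0 r) B) :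
    IsPosLoop r B where
  smooth i j := by
    rw [← contDiffOn_univ]
    exact ((hB i j).restrict_scalars ℝ).comp (contDiff_circleMap_real r).contDiffOn
      fun t _ => hrS (sphere_subset_closedBall (circleMap_mem_sphere_zero hr t))
  continuousOn i j := ((hB i j).continuousOn).mono hrS
  holomorphic i j := ((hB i j).differentiableOn (by simp)).mono (ball_subset_closedBall.trans hrS)
  det_eq_one lam h := hdet lam (hrS h)
  twisted := htw

lemma jointlySmooth_of_contDiffOn {s : ℝ} (hs : 0 ≤ s) {U S : Set ℂ} (hrS : sphere 0 s ⊆ S)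
    {p : ℂ → ℂ → Mat2}
    (hp : ∀ i j, ContDiffOn ℂ ∞ (fun q : ℂ × ℂ => p q.1 q.2 i j) (U ×ˢ S)) :
    JointlySmooth s U p := fun i j =>
  ((hp i j).restrict_scalars ℝ).comp (f := fun q : ℂ × ℝ => (q.1, circleMap 0 s q.2))
    (contDiffOn_fst.prodMk ((contDiff_circleMap_real s).comp_contDiffOn contDiffOn_snd))
    fun q hq => ⟨hq.1, hrS (circleMap_mem_sphere_zero hs q.2)⟩

lemma gaugeEquiv_of_contDiffOn {r : ℝ} (hr : 0 ≤ r) {U S : Set ℂ} {ξ ξ' : Potential}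
    (hrS : closedBall 0 r ⊆ S) {p : ℂ → ℂ → Mat2}
    (hp : ∀ i j, ContDiffOn ℂ ∞ (fun q : ℂ × ℂ => p q.1 q.2 i j) (U ×ˢ S))
    (hdet : ∀ z ∈ U, ∀ lam ∈ S, (p z lam).det = 1)
    (htw : ∀ z ∈ U, IsTwistedOn (closedBall 0 r) (p z))
    (heq : ∀ z ∈ U, ∀ lam ∈ sphere (0 : ℂ) r,
      p z lam * ξ' z lam = ξ z lam * p z lam + zDeriv p z lam) : GaugeEquiv r U ξ ξ' := by
  refine ⟨p, fun z hz => ?_, fun lam hlam i j => ?_, ?_, fun z hz lam hlam => ?_⟩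
  · refine isPosLoop_of_contDiffOn hr hrS (fun i j => ?_) (hdet z hz) (htw z hz)
    exact (hp i j).comp (f := fun lam => (z, lam)) (contDiffOn_const.prodMk contDiffOn_id)
      fun lam hlam => ⟨hz, hlam⟩
  · exact ((hp i j).comp (f := fun z => (z, lam)) (contDiffOn_id.prodMk contDiffOn_const)
      fun z hz => ⟨hz, hrS hlam⟩).differentiableOn (by simp)
  · exact jointlySmooth_of_contDiffOn hr (sphere_subset_closedBall.trans hrS) hp
  · have hd := hdet z hz lam (hrS (sphere_subset_closedBall hlam))
    rw [mul_assoc, ← mul_add, ← heq z hz lam hlam, ← mul_assoc, inv_mul_of_det_eq_one hd, one_mul]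

/-! ### Inversion of the coordinate -/

/-- The gauge that accompanies `z ↦ 1/z`. -/
def inversionGauge (z lam : ℂ) : Mat2 :=
  !![Complex.I * z⁻¹, 0; -Complex.I * lam, -Complex.I * z]

theorem gaugeEquiv_inversion {r : ℝ} (hr : r ∈ Ioc (0 : ℝ) 1) (c : ℂ) (k : ℤ) :
    GaugeEquiv r {0}ᶜ (pullback (fun z => z⁻¹) (xi c k)) (xi c (-k - 4)) := by
  have hmem : ∀ {z : ℂ}, z ∈ ({0}ᶜ : Set ℂ) → z ≠ 0 := fun h => h
  refine gaugeEquiv_of_contDiffOn hr.1.le (S := univ) (subset_univ _) (p := inversionGauge) ?_ ?_ ?_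
    ?_
  · intro i j
    fin_cases i <;> fin_cases j
    · refine contDiffOn_const.mul (contDiffOn_fst.inv ?_)
      exact fun q hq => hmem hq.1
    · exact contDiffOn_const
    · exact contDiffOn_const.mul contDiffOn_snd
    · exact contDiffOn_const.mul contDiffOn_fst
  · intro z hz lam _
    have := hmem hz
    rw [inversionGauge, Matrix.det_fin_two_of]
    field_simp
    simp
  · intro z hz
    rw [isTwistedOn_iff]
    intro lam _
    simp [inversionGauge]
  · intro z hz lam hlam
    have hz := hmem hz
    have hlam0 : lam ≠ 0 := by rintro rfl; simp at hlam; exact hr.1.ne hlam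
    have e1 : z⁻¹ ^ k = (z ^ k)⁻¹ := inv_zpow z k
    have e2 : z ^ (-k - 4) = (z ^ k)⁻¹ * (z ^ 4)⁻¹ := by
      rw [show -k - 4 = -k + -4 by ring, zpow_add₀ hz, zpow_neg, zpow_neg]; norm_cast
    have hk : z ^ k ≠ 0 := zpow_ne_zero k hz
    have hII : Complex.I * Complex.I = -1 := Complex.I_mul_I
    have d00 : deriv (fun w : ℂ => Complex.I * w⁻¹) z = Complex.I * -(z ^ 2)⁻¹ :=
      ((hasDerivAt_inv hz).const_mul _).deriv
    have d11 : deriv (fun w : ℂ => -Complex.I * w) z = -Complex.I :=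
      ((hasDerivAt_id z).const_mul _).deriv.trans (mul_one _)
    have d10 : deriv (fun _ : ℂ => -Complex.I * lam) z = 0 := deriv_const _ _
    have d01 : deriv (fun _ : ℂ => (0 : ℂ)) z = 0 := deriv_const _ _
    have dinv : deriv (fun w : ℂ => w⁻¹) z = -(z ^ 2)⁻¹ := (hasDerivAt_inv hz).deriv
    have hzd : zDeriv inversionGauge z lam =
        !![Complex.I * -(z ^ 2)⁻¹, 0; 0, -Complex.I] := by
      ext i j
      fin_cases i <;> fin_cases j
      · exact d00
      · exact d01
      · exact d10
      · exact d11
    rw [hzd]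
    ext i j
    simp only [Matrix.add_apply, mat2_mul_apply, pullback, xi, dinv, e1, e2]
    fin_cases i <;> fin_cases j <;> simp [inversionGauge] <;> field_simp <;> ring

lemma pullback_neg_pullback_exp (ξ : Potential) (w lam : ℂ) :
    pullback (fun w => -w) (pullback Complex.exp ξ) w lam =
      pullback Complex.exp (pullback (fun z => z⁻¹) ξ) w lam := by
  have h1 : deriv (fun w : ℂ => -w) w = -1 := (hasDerivAt_neg w).deriv
  have h2 : deriv (fun w : ℂ => w⁻¹) (Complex.exp w) = -(Complex.exp w ^ 2)⁻¹ :=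
    (hasDerivAt_inv (Complex.exp_ne_zero w)).deriv
  simp only [pullback, h1, h2, Complex.deriv_exp, Complex.exp_neg, smul_smul]
  congr 1
  field_simp [Complex.exp_ne_zero w]

theorem IsDPWSurface.inversion {r : ℝ} (hr : r ∈ Ioc (0 : ℝ) 1) {ε H : ℝ} {c : ℂ} {k : ℤ} {lam₀ : ℂ}
    {U : Set ℂ} (hU : IsOpen U) {f : ℂ → E3}
    (h : IsDPWSurface r ε H lam₀ (DPW.pullback Complex.exp (xi c k)) U f) :
    IsDPWSurface r ε H lam₀ (DPW.pullback Complex.exp (xi c (-k - 4))) ((fun w => -w) ⁻¹' U)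
      (fun w => f (-w)) := by
  have hV : IsOpen ((fun w : ℂ => -w) ⁻¹' U) := hU.preimage continuous_neg
  refine GaugeEquiv.isDPWSurface hr.1 hV ((gaugeEquiv_inversion hr c k).pullback
    isOpen_compl_singleton hV Complex.differentiable_exp.differentiableOn
    fun w _ => Complex.exp_ne_zero w) ?_
  exact (h.pullback hV differentiable_neg.differentiableOn fun w hw => hw).congr
    (fun w _ lam _ => (pullback_neg_pullback_exp _ w lam).symm) fun _ _ => rfl

theorem isDPWSurface_inversion_iff {r : ℝ} (hr : r ∈ Ioc (0 : ℝ) 1) {ε H : ℝ} {c : ℂ} {k : ℤ}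
    {lam₀ : ℂ} {U : Set ℂ} (hU : IsOpen U) {f : ℂ → E3} :
    IsDPWSurface r ε H lam₀ (pullback Complex.exp (xi c k)) U f ↔
      IsDPWSurface r ε H lam₀ (pullback Complex.exp (xi c (-k - 4))) ((fun w => -w) ⁻¹' U)
        (fun w => f (-w)) := by
  refine ⟨fun h => h.inversion hr hU, fun h => ?_⟩
  have h' := h.inversion hr (hU.preimage continuous_neg)
  have e : -(-k - 4) - 4 = k := by ring
  have eU : (fun w : ℂ => -w) ⁻¹' ((fun w : ℂ => -w) ⁻¹' U) = U := by ext; simp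
  simpa only [e, eU, neg_neg] using h'

lemma coordGaugeEquiv_refl {r : ℝ} (hr : 0 ≤ r) (ξ : Potential) : CoordGaugeEquiv r ξ ξ := by
  refine ⟨fun z => z, differentiableOn_id, bijOn_id _, ?_⟩
  refine gaugeEquiv_of_contDiffOn hr (S := univ) (subset_univ _) (p := fun _ _ => 1)
    (fun i j => contDiffOn_const) (fun _ _ _ _ => Matrix.det_one) (fun z _ lam _ => ?_)
    fun z _ lam _ => ?_
  · rw [mul_one, sigma3_mul_self]
  · have : zDeriv (fun _ _ => (1 : Mat2)) z lam = 0 := by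
      ext i j; simp [zDeriv]
    rw [this, one_mul, mul_one, add_zero, pullback]
    simp

theorem exists_coordGaugeEquiv (c : ℂ) (k : ℤ) : ∃ k' : ℤ, -2 ≤ k' ∧ (k' = k ∨ k' = -k - 4) ∧
    ∀ r ∈ Ioc (0 : ℝ) 1, CoordGaugeEquiv r (xi c k) (xi c k') := by
  by_cases hk : -2 ≤ k
  · exact ⟨k, hk, Or.inl rfl, fun r hr => coordGaugeEquiv_refl hr.1.le _⟩
  · refine ⟨-k - 4, by omega, Or.inr rfl, fun r hr => ⟨fun z => z⁻¹, ?_, ?_,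
      gaugeEquiv_inversion hr c k⟩⟩
    · exact differentiableOn_inv.mono fun z hz => hz
    · refine ⟨fun z hz => inv_ne_zero hz, inv_injective.injOn, fun z hz => ⟨z⁻¹, inv_ne_zero hz, ?_⟩⟩
      exact inv_inv z

end DPW

end

noncomputable section

namespace DPW

open Set Metric MeasureTheory

/-! ### Composition of gauges -/

lemma zDeriv_mul {p q : ℂ → ℂ → Mat2} {z lam : ℂ}
    (hp : ∀ i j, DifferentiableAt ℂ (fun w => p w lam i j) z)
    (hq : ∀ i j, DifferentiableAt ℂ (fun w => q w lam i j) z) :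
    zDeriv (fun w lam => p w lam * q w lam) z lam =
      zDeriv p z lam * q z lam + p z lam * zDeriv q z lam := by
  ext i j
  simp only [zDeriv, Matrix.add_apply, mat2_mul_apply, Matrix.of_apply]
  have h := ((hp i 0).hasDerivAt.mul (hq 0 j).hasDerivAt).add
    ((hp i 1).hasDerivAt.mul (hq 1 j).hasDerivAt)
  refine Eq.trans (HasDerivAt.deriv h) ?_
  ring

lemma GaugeEquiv.trans {r : ℝ} {U : Set ℂ} (hU : IsOpen U) {ξ ξ' ξ'' : Potential}
    (h : GaugeEquiv r U ξ ξ') (h' : GaugeEquiv r U ξ' ξ'') : GaugeEquiv r U ξ ξ'' := by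
  obtain ⟨p, hp, hd, hs, he⟩ := h
  obtain ⟨q, hq, hd', hs', he'⟩ := h'
  refine ⟨fun z lam => p z lam * q z lam, fun z hz => (hp z hz).mul (hq z hz),
    fun lam hlam i j => ?_, hs.mul hs', fun z hz lam hlam => ?_⟩
  · simp only [mat2_mul_apply]
    exact ((hd lam hlam _ _).mul (hd' lam hlam _ _)).add ((hd lam hlam _ _).mul (hd' lam hlam _ _))
  · have hlam' := sphere_subset_closedBall hlam
    have hpd := (hp z hz).det_eq_one lam hlam'
    rw [zDeriv_mul (fun i j => (hd lam hlam' i j).differentiableAt (hU.mem_nhds hz))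
      (fun i j => (hd' lam hlam' i j).differentiableAt (hU.mem_nhds hz)), he' z hz lam hlam,
      he z hz lam hlam, Matrix.mul_inv_rev]
    have e : (q z lam)⁻¹ * (p z lam)⁻¹ * (zDeriv p z lam * q z lam + p z lam * zDeriv q z lam) =
        (q z lam)⁻¹ * (p z lam)⁻¹ * zDeriv p z lam * q z lam +
          (q z lam)⁻¹ * ((p z lam)⁻¹ * p z lam) * zDeriv q z lam := by noncomm_ring
    rw [e, inv_mul_of_det_eq_one hpd]
    noncomm_ring

/-- The involution `[[0, 1], [1, 0]]`. -/
def sigma1 : Mat2 := !![0, 1; 1, 0]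

/-- `exp (θ σ₁)`. -/
def hypRot (θ : ℂ) : Mat2 := !![Complex.cosh θ, Complex.sinh θ; Complex.sinh θ, Complex.cosh θ]

lemma det_hypRot (θ : ℂ) : (hypRot θ).det = 1 := by
  rw [hypRot, Matrix.det_fin_two_of, ← Complex.cosh_sq_sub_sinh_sq θ]; ring

lemma hypRot_add (θ η : ℂ) : hypRot (θ + η) = hypRot θ * hypRot η := by
  ext i j
  rw [mat2_mul_apply]
  fin_cases i <;> fin_cases j <;> simp [hypRot, Complex.cosh_add, Complex.sinh_add] <;> ring

lemma hypRot_mul_sigma1 (θ : ℂ) : hypRot θ * sigma1 = sigma1 * hypRot θ := by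
  ext i j
  rw [mat2_mul_apply, mat2_mul_apply]
  fin_cases i <;> fin_cases j <;> simp [hypRot, sigma1]

lemma hasDerivAt_hypRot {θ : ℂ → ℂ} {θ' z : ℂ} (h : HasDerivAt θ θ' z) (i j : Fin 2) :
    HasDerivAt (fun w => hypRot (θ w) i j) ((θ' • (hypRot (θ z) * sigma1)) i j) z := by
  rw [Matrix.smul_apply, mat2_mul_apply]
  fin_cases i <;> fin_cases j
  · simpa [hypRot, sigma1, mul_comm] using h.ccosh
  · simpa [hypRot, sigma1, mul_comm] using h.csinh
  · simpa [hypRot, sigma1, mul_comm] using h.csinh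
  · simpa [hypRot, sigma1, mul_comm] using h.ccosh

lemma contDiff_hypRot (i j : Fin 2) : ContDiff ℂ ∞ fun θ => hypRot θ i j := by
  fin_cases i <;> fin_cases j
  · exact Complex.contDiff_cosh
  · exact Complex.contDiff_sinh
  · exact Complex.contDiff_sinh
  · exact Complex.contDiff_cosh

lemma hypRot_neg (θ : ℂ) : hypRot (-θ) = sigma3 * hypRot θ * sigma3 := by
  rw [sigma3_conj_apply]; simp [hypRot]

/-- A `z`-independent gauge. -/
lemma gaugeEquiv_of_intertwining {r : ℝ} (hr : 0 ≤ r) {U S : Set ℂ} {A A' P : ℂ → Mat2}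
    (hrS : closedBall 0 r ⊆ S) (hP : ∀ i j, ContDiffOn ℂ ∞ (fun lam => P lam i j) S)
    (hdet : ∀ lam ∈ S, (P lam).det = 1) (htw : IsTwistedOn (closedBall 0 r) P)
    (h : ∀ lam ∈ sphere (0 : ℂ) r, P lam * A' lam = A lam * P lam) :
    GaugeEquiv r U (fun _ => A) (fun _ => A') := by
  refine gaugeEquiv_of_contDiffOn hr hrS (p := fun _ => P)
    (fun i j => (hP i j).comp contDiffOn_snd fun q hq => hq.2) (fun _ _ => hdet) (fun _ _ => htw)
    fun z _ lam hlam => ?_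
  have : zDeriv (fun _ => P) z lam = 0 := by ext i j; simp [zDeriv]
  rw [this, add_zero, h lam hlam]

/-- Gauging `(a g / lam) σ₁` to `(a / lam) σ₁`. -/
lemma gaugeEquiv_rescale {r : ℝ} (hr : 0 < r) {S : Set ℂ} (a : ℂ) {g y : ℂ → ℂ}
    (hrS : closedBall 0 r ⊆ S) (hy : ContDiffOn ℂ ∞ y S)
    (hodd : ∀ lam ∈ closedBall (0 : ℂ) r, y (-lam) = -y lam)
    (h : ∀ lam ∈ sphere (0 : ℂ) r, a * g lam + lam * y lam = a) :
    GaugeEquiv r univ (fun _ lam => (a * g lam * lam⁻¹) • sigma1)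
      (fun _ lam => (a * lam⁻¹) • sigma1) := by
  refine gaugeEquiv_of_contDiffOn hr.le hrS (p := fun z lam => hypRot (z * y lam)) (fun i j => ?_)
    (fun _ _ _ _ => det_hypRot _) (fun z _ lam hlam => ?_) fun z _ lam hlam => ?_
  · exact (contDiff_hypRot i j).comp_contDiffOn
      (contDiffOn_fst.mul (hy.comp contDiffOn_snd fun q hq => hq.2))
  · simp only [hodd lam hlam, mul_neg, hypRot_neg]
  · have hlam0 : lam ≠ 0 := by rintro rfl; simp at hlam; exact hr.ne hlam
    have e : zDeriv (fun z lam => hypRot (z * y lam)) z lam =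
        y lam • (hypRot (z * y lam) * sigma1) := by
      ext i j
      simpa [zDeriv] using (hasDerivAt_hypRot ((hasDerivAt_id z).mul_const (y lam)) i j).deriv
    rw [e, Matrix.mul_smul, Matrix.smul_mul, ← hypRot_mul_sigma1, ← add_smul]
    congr 1
    have := h lam hlam
    field_simp
    linear_combination -this

/-! ### The cylinder -/

lemma pullback_exp_cylinderPotential (a w lam : ℂ) :
    pullback Complex.exp (cylinderPotential a) w lam = (a * lam⁻¹) • sigma1 := by
  simp only [pullback, cylinderPotential, Complex.deriv_exp, smul_smul, sigma1]
  congr 1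
  field_simp [Complex.exp_ne_zero w]

lemma pullback_exp_xi (c : ℂ) (k : ℤ) (w lam : ℂ) : pullback Complex.exp (xi c k) w lam =
    offDiag Complex.exp (fun w => c * Complex.exp ((k + 1) * w)) w lam := by
  have : Complex.exp w * (c * Complex.exp w ^ k) = c * Complex.exp ((k + 1) * w) := by
    rw [← Complex.exp_int_mul, add_mul, Complex.exp_add, one_mul]; ring
  simp only [pullback, xi, offDiag, Complex.deriv_exp, smul_smul, ← this]
  ext i j
  fin_cases i <;> fin_cases j <;> simp <;> ring

/-- Removing the `z`-dependence for `k = -2`. -/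
lemma gaugeEquiv_xi_neg_two_const {r : ℝ} (hr : 0 < r) (c : ℂ) :
    GaugeEquiv r univ (pullback Complex.exp (xi c (-2)))
      (fun _ lam => !![1 / 2, lam⁻¹; c * lam⁻¹, -1 / 2]) := by
  refine gaugeEquiv_of_contDiffOn hr.le (S := univ) (subset_univ _)
    (p := fun w _ => !![Complex.exp (w / 2), 0; 0, Complex.exp (-(w / 2))]) (fun i j => ?_)
    (fun _ _ _ _ => ?_) (fun z _ lam hlam => ?_) fun z _ lam hlam => ?_
  · fin_cases i <;> fin_cases j
    · exact (contDiff_fst.div_const 2).cexp.contDiffOn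
    · exact contDiffOn_const
    · exact contDiffOn_const
    · exact (contDiff_fst.div_const 2).neg.cexp.contDiffOn
  · rw [Matrix.det_fin_two_of, ← Complex.exp_add]; simp
  · rw [sigma3_conj_apply]; simp
  · have hlam0 : lam ≠ 0 := by rintro rfl; simp at hlam; exact hr.ne hlam
    have d1 : HasDerivAt (fun w : ℂ => Complex.exp (w / 2)) (Complex.exp (z / 2) * (1 / 2)) z :=
      ((hasDerivAt_id z).div_const 2).cexp
    have d2 : HasDerivAt (fun w : ℂ => Complex.exp (-(w / 2)))
      (Complex.exp (-(z / 2)) * (-(1 / 2))) z := ((hasDerivAt_id z).div_const 2).neg.cexp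
    have e : zDeriv (fun w _ => !![Complex.exp (w / 2), 0; 0, Complex.exp (-(w / 2))]) z lam =
        !![Complex.exp (z / 2) * (1 / 2), 0; 0, Complex.exp (-(z / 2)) * (-(1 / 2))] := by
      ext i j
      fin_cases i <;> fin_cases j
      · exact d1.deriv
      · exact deriv_const _ _
      · exact deriv_const _ _
      · exact d2.deriv
    have e1 : Complex.exp z * Complex.exp (-(z / 2)) = Complex.exp (z / 2) := by
      rw [← Complex.exp_add]; ring_nf
    have e2 : Complex.exp (-z) * Complex.exp (z / 2) = Complex.exp (-(z / 2)) := by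
      rw [← Complex.exp_add]; ring_nf
    have e3 : Complex.exp (((-2 : ℤ) + 1) * z) = Complex.exp (-z) := by
      congr 1; push_cast; ring
    rw [pullback_exp_xi, e]
    ext i j
    simp only [Matrix.add_apply, mat2_mul_apply, offDiag, e3]
    fin_cases i <;> fin_cases j <;> simp
    · linear_combination (-lam⁻¹) * e1
    · linear_combination (-lam⁻¹ * c) * e2
    · ring

theorem gaugeEquiv_xi_neg_two {r : ℝ} (hr : 0 < r) {a c : ℂ} (hc : c ≠ 0) (ha : a ^ 2 = c)
    (hrc : r ^ 2 < 4 * ‖c‖) : GaugeEquiv r univ (pullback Complex.exp (xi c (-2)))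
      (pullback Complex.exp (cylinderPotential a)) := by
  have ha0 : a ≠ 0 := by rintro rfl; simp at ha; exact hc ha.symm
  set u : ℂ → ℂ := fun lam => 1 + lam ^ 2 / (4 * c) with hu
  set S : Set ℂ := {lam | 0 < (u lam).re} with hS
  have hrS : closedBall (0 : ℂ) r ⊆ S := by
    intro lam hlam
    have hl : ‖lam‖ ≤ r := by simpa using hlam
    have h1 : ‖lam ^ 2 / (4 * c)‖ < 1 := by
      rw [norm_div, norm_pow, norm_mul, div_lt_one (by simpa using hc)]
      have : ‖lam‖ ^ 2 ≤ r ^ 2 := by gcongr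
      have h4 : ‖(4 : ℂ)‖ = 4 := by simp
      rw [h4]; linarith
    have h2 := (abs_le.1 (Complex.abs_re_le_norm (lam ^ 2 / (4 * c)))).1
    change 0 < (1 + lam ^ 2 / (4 * c)).re
    rw [Complex.add_re, Complex.one_re]
    linarith
  have huc : ContDiffOn ℂ ∞ u S :=
    (contDiff_const.add ((contDiff_id.pow 2).div_const _)).contDiffOn
  set l : ℂ → ℂ := fun lam => Complex.log (u lam) with hl
  have hlc : ContDiffOn ℂ ∞ l S := fun lam hlam =>
    (Complex.contDiffAt_log (Or.inl hlam)).comp_contDiffWithinAt lam (huc lam hlam)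
  have heven : ∀ lam, l (-lam) = l lam := fun lam => by simp [hl, hu]
  set g : ℂ → ℂ := fun lam => Complex.exp (l lam / 2) with hg
  have hgc : ContDiffOn ℂ ∞ g S := (hlc.div_const 2).cexp
  have hg2 : ∀ lam ∈ S, g lam ^ 2 = u lam := by
    intro lam hlam
    have h0 : u lam ≠ 0 := fun h => by
      have : 0 < (u lam).re := hlam
      rw [h] at this; simp at this
    rw [hg, ← Complex.exp_nat_mul]
    rw [show ((2 : ℕ) : ℂ) * (l lam / 2) = l lam by push_cast; ring, hl, Complex.exp_log h0]
  have hg1 : ∀ lam ∈ S, 1 + g lam ≠ 0 := by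
    intro lam hlam h
    have h1 : g lam = -1 := by linear_combination h
    have h2 := hg2 lam hlam
    rw [h1] at h2
    have h3 : u lam = 1 := by rw [← h2]; norm_num
    have h4 : g lam = 1 := by simp [hg, hl, h3]
    rw [h4] at h1; norm_num at h1
  have hg0 : ∀ lam, g lam ≠ 0 := fun lam => Complex.exp_ne_zero _
  obtain ⟨d₀, hd₀⟩ := IsAlgClosed.exists_pow_nat_eq (a⁻¹) (n := 2) (by norm_num)
  have hd00 : d₀ ≠ 0 := by rintro rfl; simp at hd₀; exact ha0 hd₀.symm
  set d : ℂ → ℂ := fun lam => d₀ * Complex.exp (l lam / 4) with hd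
  have hd0 : ∀ lam, d lam ≠ 0 := fun lam => mul_ne_zero hd00 (Complex.exp_ne_zero _)
  have hdc : ContDiffOn ℂ ∞ d S := contDiffOn_const.mul (hlc.div_const 4).cexp
  have hd2 : ∀ lam, a * d lam ^ 2 = g lam := by
    intro lam
    rw [hd]; simp only
    rw [mul_pow, hd₀, ← Complex.exp_nat_mul, hg]
    field_simp
    congr 1; push_cast; ring
  have hA := gaugeEquiv_xi_neg_two_const hr c
  have hB : GaugeEquiv r univ (fun _ lam => !![1 / 2, lam⁻¹; c * lam⁻¹, -1 / 2])
      (fun _ lam => (a * g lam * lam⁻¹) • sigma1) := by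
    refine gaugeEquiv_of_intertwining hr.le hrS
      (P := fun lam => !![d lam, lam * d lam / (2 * a * g lam); 0, (d lam)⁻¹]) (fun i j => ?_)
      (fun lam _ => ?_) ?_ fun lam hlam => ?_
    · fin_cases i <;> fin_cases j
      · exact hdc
      · exact (contDiffOn_id.mul hdc).div (contDiffOn_const.mul hgc)
          fun lam _ => mul_ne_zero (mul_ne_zero two_ne_zero ha0) (hg0 lam)
      · exact contDiffOn_const
      · exact hdc.inv fun lam _ => hd0 lam
    · rw [Matrix.det_fin_two_of]; simp [hd0 lam]
    · rw [isTwistedOn_iff]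
      intro lam _
      simp [hd, hg, heven, neg_div]
    · have hlam0 : lam ≠ 0 := by rintro rfl; simp at hlam; exact hr.ne hlam
      have h1 := hg2 lam (hrS (sphere_subset_closedBall hlam))
      have h2 := hd2 lam
      have h3 := hd0 lam
      have h4 := hg0 lam
      have hcc : c = a ^ 2 := ha.symm
      ext i j
      simp only [mat2_mul_apply]
      rw [hu] at h1
      fin_cases i <;> fin_cases j <;> simp [sigma1] <;> field_simp
      · rw [hcc] at h1
        field_simp at h1
        linear_combination 4 * a * h2 + d lam ^ 2 * h1
      · rw [hcc]; linear_combination (-a) * h2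
      · rw [hcc]; linear_combination (-a) * h2
  set y : ℂ → ℂ := fun lam => -(a * lam) / (4 * c * (1 + g lam)) with hy
  have hC : GaugeEquiv r univ (fun _ lam => (a * g lam * lam⁻¹) • sigma1)
      (fun _ lam => (a * lam⁻¹) • sigma1) := by
    refine gaugeEquiv_rescale hr a hrS (y := y) ?_ (fun lam _ => ?_) fun lam hlam => ?_
    · exact (contDiffOn_const.mul contDiffOn_id).neg.div
        (contDiffOn_const.mul (contDiffOn_const.add hgc))
        fun lam hlam => mul_ne_zero (mul_ne_zero (by norm_num) hc) (hg1 lam hlam)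
    · simp [hy, hg, heven, neg_div]
    · have hS' := hrS (sphere_subset_closedBall hlam)
      have h1 := hg2 lam hS'
      have h2 := hg1 lam hS'
      rw [hu] at h1
      simp only [hy]
      field_simp at h1 ⊢
      linear_combination h1
  exact ((hA.trans isOpen_univ hB).trans isOpen_univ hC).congr (fun _ _ _ _ => rfl)
    fun w _ lam _ => pullback_exp_cylinderPotential a w lam

/-- The angle of the cylinder frame. -/
def cylAngle (a w lam : ℂ) : ℂ := w * a * lam⁻¹ - (starRingEnd ℂ) (w * a) * lam

lemma contDiffOn_cylAngle (a : ℂ) :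
    ContDiffOn ℝ ∞ (fun q : ℂ × ℂ => cylAngle a q.1 q.2) (univ ×ˢ {0}ᶜ) := by
  have h1 : ContDiffOn ℝ ∞ (fun q : ℂ × ℂ => q.1 * a) (univ ×ˢ {0}ᶜ) :=
    contDiffOn_fst.mul contDiffOn_const
  exact (h1.mul (contDiffOn_snd.inv fun q hq => hq.2)).sub
    (((Complex.conjCLE : ℂ →L[ℝ] ℂ).contDiff.comp_contDiffOn h1).mul contDiffOn_snd)

lemma jointlySmooth_hypRot_comp {s : ℝ} (hs : 0 < s) {θ : ℂ → ℂ → ℂ}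
    (hθ : ContDiffOn ℝ ∞ (fun q : ℂ × ℂ => θ q.1 q.2) (univ ×ˢ {0}ᶜ)) :
    JointlySmooth s univ fun w lam => hypRot (θ w lam) := fun i j =>
  ((contDiff_hypRot i j).restrict_scalars ℝ).comp_contDiffOn
    (hθ.comp (f := fun q : ℂ × ℝ => (q.1, circleMap 0 s q.2))
      (contDiffOn_fst.prodMk ((contDiff_circleMap_real s).comp_contDiffOn contDiffOn_snd))
      fun q _ => ⟨mem_univ _, circleMap_zero_ne_zero hs q.2⟩)

lemma JointlySmooth.smooth_apply {s : ℝ} {U : Set ℂ} {g : ℂ → ℂ → Mat2} (h : JointlySmooth s U g)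
    {z : ℂ} (hz : z ∈ U) (i j : Fin 2) : ContDiff ℝ ∞ fun t : ℝ => g z (circleMap 0 s t) i j := by
  rw [← contDiffOn_univ]
  exact (h i j).comp (f := fun t : ℝ => (z, t)) (contDiffOn_const.prodMk contDiffOn_id)
    fun t _ => ⟨hz, mem_univ _⟩

lemma hypRot_mem_unitaryGroup {θ : ℂ} (h : (starRingEnd ℂ) θ = -θ) :
    hypRot θ ∈ Matrix.unitaryGroup (Fin 2) ℂ := by
  rw [Matrix.mem_unitaryGroup_iff]
  have : star (hypRot θ) = hypRot (-θ) := by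
    ext i j
    rw [Matrix.star_apply]
    fin_cases i <;> fin_cases j <;>
      simp [hypRot, ← Complex.cosh_conj, ← Complex.sinh_conj, h]
  rw [this, ← hypRot_add, add_neg_cancel]
  ext i j; fin_cases i <;> fin_cases j <;> simp [hypRot]

theorem isDPWData_cylinder {r : ℝ} (hr : r ∈ Ioc (0 : ℝ) 1) (a : ℂ) :
    IsDPWData r (fun _ lam => (a * lam⁻¹) • sigma1) univ (fun w lam => hypRot (w * a * lam⁻¹))
      (fun w lam => hypRot (cylAngle a w lam))
      (fun w lam => hypRot ((starRingEnd ℂ) (w * a) * lam)) := by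
  have hne : ∀ {s : ℝ} {lam : ℂ}, 0 < s → lam ∈ sphere (0 : ℂ) s → lam ≠ 0 := by
    rintro s lam hs hlam rfl; simp at hlam; exact hs.ne hlam
  have hLs : JointlySmooth r univ (fun w lam => hypRot (w * a * lam⁻¹)) :=
    jointlySmooth_hypRot_comp hr.1 (θ := fun w lam => w * a * lam⁻¹)
      ((contDiffOn_fst.mul contDiffOn_const).mul (contDiffOn_snd.inv fun q hq => hq.2))
  have hFs : ∀ s, 0 < s → JointlySmooth s univ (fun w lam => hypRot (cylAngle a w lam)) :=
    fun s hs => jointlySmooth_hypRot_comp hs (contDiffOn_cylAngle a)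
  have hann : ∀ lam ∈ closedAnnulus r, lam ≠ 0 := by
    rintro lam hlam rfl
    have := hlam.1; rw [norm_zero] at this; linarith [hr.1]
  have hcyl : ∀ w lam, cylAngle a w (-lam) = -cylAngle a w lam := by
    intro w lam; simp only [cylAngle, inv_neg]; ring
  have hcd : ∀ w, DifferentiableOn ℂ (cylAngle a w) {0}ᶜ := fun w =>
    (DifferentiableOn.mul (differentiableOn_const _) (differentiableOn_inv.mono fun _ h => h)).sub
      (differentiableOn_id.const_mul _)
  have hhyp : ∀ i j, Differentiable ℂ fun θ => hypRot θ i j := fun i j =>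
    (contDiff_hypRot i j).differentiable (by simp)
  constructor
  · intro w _
    exact ⟨hLs.smooth_apply (mem_univ w), fun _ _ => det_hypRot _, fun lam _ => by
      rw [← hypRot_neg]; congr 1; rw [inv_neg]; ring⟩
  · intro w _ lam _ i j
    have h := hasDerivAt_hypRot (((hasDerivAt_id w).mul_const a).mul_const lam⁻¹) i j
    rw [Matrix.mul_smul]
    simpa using h
  · exact hLs
  · intro w _
    exact ⟨(hFs r hr.1).smooth_apply (mem_univ w),
      fun i j => ((hhyp i j).continuous.comp_continuousOn (hcd w).continuousOn).mono hann,
      fun i j => ((hhyp i j).comp_differentiableOn (hcd w)).mono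
        fun lam hlam => hann lam ⟨hlam.1.le, hlam.2.le⟩,
      fun _ _ => det_hypRot _, fun lam _ => by rw [hcyl, hypRot_neg],
      fun lam hlam => hypRot_mem_unitaryGroup (by
        have h1 := (inv_eq_conj_of_norm_one hlam).symm
        simp only [cylAngle, map_sub, map_mul, Complex.conj_conj, map_inv₀, h1, inv_inv]
        ring)⟩
  · exact fun s hs => hFs s (hr.1.trans_le hs.1)
  · intro w _
    refine isPosLoop_of_contDiffOn hr.1.le (subset_univ _) (fun i j => ?_)
      (fun _ _ => det_hypRot _) fun lam _ => ?_
    · exact ((contDiff_hypRot i j).comp (contDiff_const.mul contDiff_id)).contDiffOn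
    · rw [mul_neg, hypRot_neg]
  · intro w _
    exact ⟨1, one_pos, by ext i j; fin_cases i <;> fin_cases j <;> simp [hypRot]⟩
  · intro w _ lam _
    rw [← hypRot_add, cylAngle, sub_add_cancel]

lemma symBobenko_cylinder (ε H : ℝ) (a w : ℂ) {lam : ℂ} (hlam : lam ∈ sphere (0 : ℂ) 1) :
    toR3 (symBobenko ε H (fun l => hypRot (cylAngle a w l)) lam) =
      (2 * H)⁻¹ • !₂[-4 * ε * (w * a * lam⁻¹).re, Real.sin (4 * (w * a * lam⁻¹).im),
        Real.cos (4 * (w * a * lam⁻¹).im)] := by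
  have hlam0 : lam ≠ 0 := by rintro rfl; simp at hlam
  set u := w * a * lam⁻¹ with hu
  have hconj : (starRingEnd ℂ) u = (starRingEnd ℂ) (w * a) * lam := by
    rw [hu, map_mul, map_inv₀, ← inv_eq_conj_of_norm_one hlam, inv_inv]
  have hθ : cylAngle a w lam = 2 * u.im * Complex.I := by
    rw [cylAngle, ← hconj, ← hu, Complex.sub_conj]
    push_cast; ring
  have hder : lamDeriv (fun l => hypRot (cylAngle a w l)) lam =
      (-2 * u.re : ℂ) • (hypRot (cylAngle a w lam) * sigma1) := by
    have h1 : HasDerivAt (fun l => cylAngle a w l)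
        (-(w * a) * (lam ^ 2)⁻¹ - (starRingEnd ℂ) (w * a)) (lam * circleMap 0 1 0) := by
      have e : lam * circleMap 0 1 0 = lam := by simp [circleMap]
      rw [e]
      refine (((hasDerivAt_inv hlam0).const_mul (w * a)).sub
        ((hasDerivAt_id lam).const_mul ((starRingEnd ℂ) (w * a)))).congr_deriv ?_
      ring
    have h2 : HasDerivAt (fun t : ℝ => lam * circleMap 0 1 t) (lam * Complex.I) 0 := by
      have := (hasDerivAt_circleMap 0 1 0).const_mul lam
      simpa [circleMap] using this
    ext i j
    have h3 := ((hasDerivAt_hypRot h1 i j).comp (0 : ℝ) h2).deriv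
    rw [lamDeriv, Matrix.of_apply]
    have e : lam * circleMap 0 1 0 = lam := by simp [circleMap]
    rw [e] at h3
    have h4 : deriv (fun t : ℝ => hypRot (cylAngle a w (lam * circleMap 0 1 t)) i j) 0 = _ := h3
    rw [h4, Matrix.smul_apply, Matrix.smul_apply, smul_eq_mul, smul_eq_mul]
    have h5 : (-2 * u.re : ℂ) = -(u + (starRingEnd ℂ) u) := by
      rw [Complex.add_conj]; push_cast; ring
    rw [h5, hconj, hu]
    have hII := Complex.I_mul_I
    field_simp
    linear_combination (w * a + lam ^ 2 * (starRingEnd ℂ) (w * a)) *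
      (hypRot (cylAngle a w lam) * sigma1) i j * hII
  have hinv : (hypRot (cylAngle a w lam))⁻¹ = hypRot (-cylAngle a w lam) := by
    rw [inv_eq_of_det_eq_one (det_hypRot _)]
    ext i j; fin_cases i <;> fin_cases j <;> simp [hypRot]
  have h6 : hypRot (cylAngle a w lam) * sigma1 * hypRot (-cylAngle a w lam) = sigma1 := by
    rw [hypRot_mul_sigma1, mul_assoc, ← hypRot_add, add_neg_cancel]
    ext i j; rw [mat2_mul_apply]; fin_cases i <;> fin_cases j <;> simp [hypRot, sigma1]
  have h7 : hypRot (cylAngle a w lam) * sigma3 * hypRot (-cylAngle a w lam) =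
      !![(Real.cos (4 * u.im) : ℂ), -(Real.sin (4 * u.im) * Complex.I);
        Real.sin (4 * u.im) * Complex.I, -Real.cos (4 * u.im)] := by
    have : hypRot (-cylAngle a w lam) = sigma3 * hypRot (cylAngle a w lam) * sigma3 := hypRot_neg _
    rw [this]
    have e : hypRot (cylAngle a w lam) * sigma3 * (sigma3 * hypRot (cylAngle a w lam) * sigma3) =
        hypRot (cylAngle a w lam) * (sigma3 * sigma3) * hypRot (cylAngle a w lam) * sigma3 := by
      simp only [mul_assoc]
    have e4 : cylAngle a w lam + cylAngle a w lam = ((4 * u.im : ℝ) : ℂ) * Complex.I := by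
      rw [hθ]; push_cast; ring
    rw [e, sigma3_mul_self, mul_one, ← hypRot_add, e4]
    ext i j
    rw [mat2_mul_apply]
    fin_cases i <;> fin_cases j <;> simp [hypRot, sigma3, Complex.cosh_mul_I, Complex.sinh_mul_I]
  rw [symBobenko, hder, hinv, Matrix.smul_mul, h6, h7, toR3_smul_conj]
  congr 1
  generalize Real.sin (4 * u.im) = sn
  generalize Real.cos (4 * u.im) = cs
  ext i
  fin_cases i
  · simp [toR3, sigma1]; ring
  · simp [toR3, sigma1]
  · simp [toR3, sigma1]

lemma isRoundCylinder_range {H ε : ℝ} (hH : H ≠ 0) (hε : ε = 1 ∨ ε = -1) {s : ℂ} (hs : s ≠ 0) :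
    IsRoundCylinder (1 / (2 * |H|)) (range fun w : ℂ => (2 * H)⁻¹ •
      (!₂[-4 * ε * (w * s).re, Real.sin (4 * (w * s).im), Real.cos (4 * (w * s).im)] : E3)) := by
  have hε2 : ε * ε = 1 := by rcases hε with rfl | rfl <;> norm_num
  refine ⟨0, !₂[1, 0, 0], ?_, ?_⟩
  · rw [EuclideanSpace.norm_eq]; simp [Fin.sum_univ_three]
  · have hnorm : ∀ x : E3, ‖(x - 0) - (inner ℝ (!₂[1, 0, 0] : E3) (x - 0)) • (!₂[1, 0, 0] : E3)‖ ^ 2 =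
        x 1 ^ 2 + x 2 ^ 2 := by
      intro x
      rw [EuclideanSpace.norm_sq_eq]
      simp [Fin.sum_univ_three, PiLp.inner_apply]
    have hR : (0 : ℝ) < 1 / (2 * |H|) := by have := abs_pos.2 hH; positivity
    have hiff : ∀ x : E3, ‖(x - 0) - (inner ℝ (!₂[1, 0, 0] : E3) (x - 0)) • (!₂[1, 0, 0] : E3)‖ =
        1 / (2 * |H|) ↔ (2 * H * x 1) ^ 2 + (2 * H * x 2) ^ 2 = 1 := by
      intro x
      rw [← sq_eq_sq₀ (norm_nonneg _) hR.le, hnorm, div_pow, mul_pow, sq_abs, one_pow,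
        eq_div_iff (by positivity)]
      constructor <;> intro h <;> linear_combination h
    ext x
    rw [mem_ofPred_eq, hiff]
    constructor
    · rintro ⟨w, rfl⟩
      simp only [PiLp.smul_apply]
      simp
      field_simp
      exact Real.sin_sq_add_cos_sq _
    · intro h
      have h1 : ‖(⟨2 * H * x 2, 2 * H * x 1⟩ : ℂ)‖ = 1 := by
        rw [← sq_eq_sq₀ (norm_nonneg _) zero_le_one, ← Complex.normSq_eq_norm_sq,
          Complex.normSq_apply]
        linear_combination h
      set ζ : ℂ := ⟨2 * H * x 2, 2 * H * x 1⟩ with hζ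
      set φ := Complex.arg ζ
      have hζ0 : ζ ≠ 0 := by intro h0; rw [h0] at h1; simp at h1
      have hcos : Real.cos φ = 2 * H * x 2 := by rw [Complex.cos_arg hζ0, h1]; simp [hζ]
      have hsin : Real.sin φ = 2 * H * x 1 := by rw [Complex.sin_arg, h1]; simp [hζ]
      refine ⟨(⟨-(ε * (2 * H) * x 0 / 4), φ / 4⟩ : ℂ) * s⁻¹, ?_⟩
      simp only [inv_mul_cancel_right₀ hs]
      have e4 : 4 * (φ / 4) = φ := by ring
      ext i
      fin_cases i
      · simp
        field_simp
        linear_combination (x 0) * hε2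
      · simp [e4, hsin]
        field_simp
      · simp [e4, hcos]
        field_simp

theorem exists_cylinder_surface {r : ℝ} (hr : r ∈ Ioc (0 : ℝ) 1) {ε H : ℝ} (hε : ε = 1 ∨ ε = -1)
    (hH : H ≠ 0) {a c : ℂ} (hc : c ≠ 0) (ha : a ^ 2 = c) (hrc : r ^ 2 < 4 * ‖c‖) {lam₀ : ℂ}
    (hlam : lam₀ ∈ sphere (0 : ℂ) 1) : ∃ f : ℂ → E3,
      IsDPWSurface r ε H lam₀ (pullback Complex.exp (cylinderPotential a)) univ f ∧
      IsDPWSurface r ε H lam₀ (pullback Complex.exp (xi c (-2))) univ f ∧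
      IsConformalCMC H univ f ∧ IsRoundCylinder (1 / (2 * |H|)) (range f) := by
  have ha0 : a ≠ 0 := by rintro rfl; simp at ha; exact hc ha.symm
  have hlam0 : lam₀ ≠ 0 := by rintro rfl; simp at hlam
  have hdata := isDPWData_cylinder hr a
  have hS : IsDPWSurface r ε H lam₀ (pullback Complex.exp (cylinderPotential a)) univ
      fun w => toR3 (symBobenko ε H (fun l => hypRot (cylAngle a w l)) lam₀) :=
    ⟨_, _, _, hdata.congr fun w _ lam _ => pullback_exp_cylinderPotential a w lam, fun _ _ => rfl⟩
  have hdata' : IsDPWData r (offDiag (fun _ => a) (fun _ => a)) univ _ _ _ :=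
    hdata.congr fun w _ lam _ => by
      ext i j; fin_cases i <;> fin_cases j <;> simp [offDiag, sigma1, mul_comm]
  refine ⟨_, hS, GaugeEquiv.isDPWSurface hr.1 isOpen_univ
    ((gaugeEquiv_xi_neg_two hr.1 hc ha hrc).symm hr.1.le isOpen_univ) hS, ?_, ?_⟩
  · refine isConformalCMC_of_isCMCAt hH isOpen_univ ?_ fun z hz =>
      hdata'.isCMCAt hr isOpen_univ (differentiableOn_const _) (differentiableOn_const _) hz hlam hε
        hH (fun _ => ha0) fun _ => ha0
    have h11 : (1 : ℝ) ∈ Icc r 1 := ⟨hr.2, le_rfl⟩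
    exact contDiffOn_symBobenko isOpen_univ (hdata.smooth_F 1 h11)
      (fun _ _ _ _ => det_hypRot _) hlam ε H
  · have e : (fun w => toR3 (symBobenko ε H (fun l => hypRot (cylAngle a w l)) lam₀)) =
        fun w : ℂ => (2 * H)⁻¹ • (!₂[-4 * ε * (w * (a * lam₀⁻¹)).re,
          Real.sin (4 * (w * (a * lam₀⁻¹)).im), Real.cos (4 * (w * (a * lam₀⁻¹)).im)] : E3) := by
      funext w; rw [symBobenko_cylinder ε H a w hlam, mul_assoc w]
    rw [e]
    exact isRoundCylinder_range hH hε (mul_ne_zero ha0 (inv_ne_zero hlam0))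

end DPW

end

noncomputable section

namespace DPW

open Set Metric MeasureTheory

/-! ### Entire functions given by rapidly decreasing coefficients -/

/-- The coefficients are `O(1 / n!)`. -/
def FactBounded (a : ℕ → ℂ) : Prop := ∃ C : ℝ, ∀ n : ℕ, ‖a n‖ ≤ C / n.factorial

/-- The entire function with coefficients `a`. -/
def ent (a : ℕ → ℂ) (x : ℂ) : ℂ := ∑' n, a n * x ^ n

/-- The coefficients of the derivative. -/
def dcoef (a : ℕ → ℂ) (n : ℕ) : ℂ := (n + 1) * a (n + 1)

lemma FactBounded.dcoef {a : ℕ → ℂ} (h : FactBounded a) : FactBounded (dcoef a) := by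
  obtain ⟨C, hC⟩ := h
  refine ⟨C, fun n => ?_⟩
  have h1 := hC (n + 1)
  have h2 : ‖((n : ℂ) + 1)‖ = n + 1 := by
    rw [← Nat.cast_succ, Complex.norm_natCast]; push_cast; ring
  rw [DPW.dcoef, norm_mul, h2]
  rw [Nat.factorial_succ] at h1
  push_cast at h1
  have h3 : (0 : ℝ) < n.factorial := by exact_mod_cast n.factorial_pos
  calc ((n : ℝ) + 1) * ‖a (n + 1)‖ ≤ (n + 1) * (C / ((n + 1) * n.factorial)) := by gcongr
    _ = C / n.factorial := by field_simp

lemma FactBounded.summable {a : ℕ → ℂ} (h : FactBounded a) (x : ℂ) :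
    Summable fun n => a n * x ^ n := by
  obtain ⟨C, hC⟩ := h
  refine Summable.of_norm_bounded ((Real.summable_pow_div_factorial ‖x‖).mul_left C) fun n => ?_
  rw [norm_mul, norm_pow]
  calc ‖a n‖ * ‖x‖ ^ n ≤ C / n.factorial * ‖x‖ ^ n := by gcongr; exact hC n
    _ = _ := by ring

lemma FactBounded.hasSum {a : ℕ → ℂ} (h : FactBounded a) (x : ℂ) :
    HasSum (fun n => a n * x ^ n) (ent a x) := (h.summable x).hasSum

lemma ent_zero (a : ℕ → ℂ) : ent a 0 = a 0 := by
  rw [ent, tsum_eq_single 0]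
  · simp
  · intro n hn; simp [hn]

lemma FactBounded.hasDerivAt {a : ℕ → ℂ} (h : FactBounded a) (x : ℂ) :
    HasDerivAt (ent a) (ent (DPW.dcoef a) x) x := by
  obtain ⟨C, hC⟩ := id h
  have hx : x ∈ ball (0 : ℂ) (‖x‖ + 1) := by simp
  have hu : Summable fun n : ℕ => C / n.factorial * (n * (‖x‖ + 1) ^ (n - 1)) := by
    rw [← summable_nat_add_iff 1]
    refine ((Real.summable_pow_div_factorial (‖x‖ + 1)).mul_left C).congr fun n => ?_
    rw [Nat.factorial_succ, Nat.add_sub_cancel]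
    push_cast
    have h3 : (0 : ℝ) < n.factorial := by exact_mod_cast n.factorial_pos
    field_simp
  have key := hasDerivAt_tsum_of_isPreconnected (g := fun n y => a n * y ^ n)
    (g' := fun n y => a n * (n * y ^ (n - 1))) hu isOpen_ball
    (convex_ball (0 : ℂ) (‖x‖ + 1)).isPreconnected
    (fun n y _ => (hasDerivAt_pow n y).const_mul (a n)) (fun n y hy => ?_) hx (h.summable x) hx
  · refine HasDerivAt.congr_deriv key ?_
    rw [Summable.tsum_eq_zero_add (Summable.of_norm_bounded hu fun n => ?_)]
    · simp only [ent, DPW.dcoef, Nat.add_sub_cancel]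
      simp only [Nat.cast_zero, zero_mul, mul_zero, zero_add]
      refine tsum_congr fun n => ?_
      push_cast; ring
    · rw [norm_mul, norm_mul, norm_pow, Complex.norm_natCast]
      gcongr
      · exact (norm_nonneg _).trans (hC n)
      · exact hC n
      · linarith
  · have hy' : ‖y‖ ≤ ‖x‖ + 1 := by simpa using (mem_ball_zero_iff.1 hy).le
    rw [norm_mul, norm_mul, norm_pow, Complex.norm_natCast]
    gcongr
    · exact (norm_nonneg _).trans (hC n)
    · exact hC n

lemma FactBounded.differentiable {a : ℕ → ℂ} (h : FactBounded a) : Differentiable ℂ (ent a) :=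
  fun x => (h.hasDerivAt x).differentiableAt

lemma FactBounded.contDiff {a : ℕ → ℂ} (h : FactBounded a) : ContDiff ℂ ∞ (ent a) :=
  h.differentiable.contDiff

lemma FactBounded.mul_ent_dcoef {a : ℕ → ℂ} (h : FactBounded a) (x : ℂ) :
    HasSum (fun n => (n * a n) * x ^ n) (x * ent (DPW.dcoef a) x) := by
  rw [← hasSum_nat_add_iff' 1]
  simp only [Finset.sum_range_one, Nat.cast_zero, zero_mul, sub_zero]
  refine ((h.dcoef.hasSum x).mul_left x).congr_fun fun n => ?_
  simp only [DPW.dcoef]; push_cast; ring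

/-- Solutions of the confluent hypergeometric limit equation `α g' + β x g'' = g + e`. -/
theorem exists_entire_solution {α β : ℝ} (hα : 1 ≤ α) (hβ : 1 ≤ β) (a₀ : ℂ) {b : ℕ → ℂ}
    (hb : FactBounded b) : ∃ a : ℕ → ℂ, FactBounded a ∧ a 0 = a₀ ∧
      ∀ x, α * ent (dcoef a) x + β * (x * ent (dcoef (dcoef a)) x) = ent a x + ent b x := by
  obtain ⟨C, hC⟩ := id hb
  have hC0 : 0 ≤ C := by
    have := (norm_nonneg _).trans (hC 0); simpa using this
  let a : ℕ → ℂ := fun n => Nat.rec a₀ (fun n x => (x + b n) / ((n + 1) * (α + β * n))) n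
  have ha0 : a 0 = a₀ := rfl
  have has : ∀ n, a (n + 1) = (a n + b n) / ((n + 1) * (α + β * n)) := fun n => rfl
  have hden : ∀ n : ℕ, (n : ℝ) + 1 ≤ α + β * n := fun n => by
    have : (n : ℝ) ≤ β * n := le_mul_of_one_le_left n.cast_nonneg hβ
    linarith
  have hnorm : ∀ n : ℕ, ‖((n : ℂ) + 1) * (α + β * n)‖ = ((n : ℝ) + 1) * (α + β * n) := fun n => by
    have h0 : (0 : ℝ) ≤ (n + 1) * (α + β * n) := by
      have := hden n; have := n.cast_nonneg (α := ℝ); positivity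
    rw [← Complex.norm_of_nonneg h0]; push_cast; rfl
  have hbd : ∀ n, ‖a (n + 1)‖ ≤ (‖a n‖ + ‖b n‖) / ((n + 1) * (n + 1)) := fun n => by
    rw [has, norm_div, hnorm]
    exact div_le_div₀ (by positivity) (norm_add_le _ _) (by positivity)
      (mul_le_mul_of_nonneg_left (hden n) (by positivity))
  have hfa : FactBounded a := by
    refine ⟨‖a₀‖ + C, fun n => ?_⟩
    induction n with
    | zero => simp [ha0, hC0]
    | succ n ih =>
      have h3 : (0 : ℝ) < n.factorial := by exact_mod_cast n.factorial_pos
      refine (hbd n).trans ?_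
      rw [Nat.factorial_succ]
      push_cast
      rw [div_le_div_iff₀ (by positivity) (by positivity)]
      rcases Nat.eq_zero_or_pos n with rfl | hn
      · have := hC 0
        simp at this ⊢
        rw [ha0]; linarith
      · have h1 : ‖a n‖ * n.factorial ≤ ‖a₀‖ + C := by
          rw [← le_div_iff₀ h3]; exact ih
        have h2 : ‖b n‖ * n.factorial ≤ C := by rw [← le_div_iff₀ h3]; exact hC n
        have h4 : (1 : ℝ) ≤ n := by exact_mod_cast hn
        have h5 : (‖a n‖ + ‖b n‖) * n.factorial ≤ (‖a₀‖ + C) * (n + 1) := by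
          have : 0 ≤ (‖a₀‖ + C) * (n - 1) := mul_nonneg (by positivity) (by linarith)
          nlinarith [norm_nonneg a₀]
        calc (‖a n‖ + ‖b n‖) * (((n : ℝ) + 1) * n.factorial)
            = ((‖a n‖ + ‖b n‖) * n.factorial) * (n + 1) := by ring
          _ ≤ ((‖a₀‖ + C) * (n + 1)) * (n + 1) := by gcongr
          _ = _ := by ring
  refine ⟨a, hfa, ha0, fun x => ?_⟩
  have h1 := ((hfa.dcoef.hasSum x).mul_left (α : ℂ)).add
    ((hfa.dcoef.mul_ent_dcoef x).mul_left (β : ℂ))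
  have h2 := (hfa.hasSum x).add (hb.hasSum x)
  refine h1.unique (h2.congr_fun ?_)
  intro n
  have hne : ((n : ℂ) + 1) * (α + β * n) ≠ 0 := by
    rw [← norm_pos_iff, hnorm]
    have := hden n; have := n.cast_nonneg (α := ℝ); positivity
  simp only [dcoef, has]
  have h6 : ((n : ℂ) + 1) ≠ 0 := left_ne_zero_of_mul hne
  have h7 : (α + β * n : ℂ) ≠ 0 := right_ne_zero_of_mul hne
  have h8 : (α + n * β : ℂ) ≠ 0 := by rwa [mul_comm (n : ℂ)]
  field_simp

/-! ### The holomorphic frames of the Smyth surfaces -/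

lemma factBounded_zero : FactBounded 0 := ⟨0, fun n => by simp⟩

lemma ent_zero_fun (x : ℂ) : ent 0 x = 0 := by simp [ent]

/-- Solutions of `dL = L ξ` have constant determinant if `ξ` is trace free. -/
lemma hasDerivAt_det {L A : ℂ → Mat2} {z : ℂ}
    (h : ∀ i j, HasDerivAt (fun w => L w i j) ((L z * A z) i j) z) (hA : (A z).trace = 0) :
    HasDerivAt (fun w => (L w).det) 0 z := by
  simp only [Matrix.det_fin_two]
  refine (((h 0 0).mul (h 1 1)).sub ((h 0 1).mul (h 1 0))).congr_deriv ?_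
  rw [Matrix.trace_fin_two] at hA
  simp only [mat2_mul_apply]
  linear_combination (L z 0 0 * L z 1 1 - L z 0 1 * L z 1 0) * hA

theorem exists_smyth_frame (c : ℂ) (k : ℕ) : ∃ L : ℂ → ℂ → Mat2, (∀ lam, L 0 lam = 1) ∧
    (∀ i j, ContDiffOn ℂ ∞ (fun q : ℂ × ℂ => L q.1 q.2 i j) (univ ×ˢ {0}ᶜ)) ∧
    (∀ z lam, ∀ i j, HasDerivAt (fun w => L w lam i j) ((L z lam * xi c k z lam) i j) z) ∧
    (∀ z, IsTwistedOn univ (L z)) ∧ ∀ z lam, (L z lam).det = 1 := by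
  set m : ℝ := k + 2 with hm
  have hm2 : 2 ≤ m := by have := k.cast_nonneg (α := ℝ); linarith
  obtain ⟨β, hβ, hβ0, hβe⟩ := exists_entire_solution (α := m * (1 + m)) (β := m * m) (by nlinarith)
    (by nlinarith) 1 factBounded_zero
  obtain ⟨γ, hγ, hγ0, hγe⟩ := exists_entire_solution (α := m * (m - 1)) (β := m * m) (by nlinarith)
    (by nlinarith) 1 factBounded_zero
  simp only [ent_zero_fun, add_zero] at hβe hγe
  set X : ℂ → ℂ → ℂ := fun z lam => c * lam⁻¹ ^ 2 * z ^ (k + 2) with hX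
  have hmC : (m : ℂ) = k + 2 := by rw [hm]; push_cast; ring
  set L : ℂ → ℂ → Mat2 := fun z lam =>
    !![ent β (X z lam) + m * (X z lam * ent (dcoef β) (X z lam)), lam⁻¹ * z * ent β (X z lam);
      c * lam⁻¹ * z ^ (k + 1) * (m * ent (dcoef γ) (X z lam)), ent γ (X z lam)] with hL
  have hsolve : ∀ z lam, ∀ i j,
      HasDerivAt (fun w => L w lam i j) ((L z lam * xi c k z lam) i j) z := by
    intro z lam i j
    have hXd : HasDerivAt (fun w => X w lam) (c * lam⁻¹ ^ 2 * (m * z ^ (k + 1))) z := by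
      refine ((hasDerivAt_pow (k + 2) z).const_mul (c * lam⁻¹ ^ 2)).congr_deriv ?_
      rw [hmC]; push_cast; rfl
    have hb0 := (hβ.hasDerivAt (X z lam)).comp z hXd
    have hb1 := (hβ.dcoef.hasDerivAt (X z lam)).comp z hXd
    have hg0 := (hγ.hasDerivAt (X z lam)).comp z hXd
    have hg1 := (hγ.dcoef.hasDerivAt (X z lam)).comp z hXd
    have e1 := hβe (X z lam)
    have e2 := hγe (X z lam)
    push_cast at e1 e2
    have eX : X z lam = c * lam⁻¹ ^ 2 * z ^ (k + 2) := rfl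
    have hzk : z ^ (k : ℤ) = z ^ k := zpow_natCast z k
    simp only [mat2_mul_apply, xi, hzk]
    fin_cases i <;> fin_cases j
    · refine (hb0.add ((hXd.mul hb1).const_mul (m : ℂ))).congr_deriv ?_
      simp [hL]
      rw [← e1, eX]
      ring
    · refine (((hasDerivAt_id z).const_mul lam⁻¹).mul hb0).congr_deriv ?_
      simp [hL]
      rw [eX]
      ring
    · refine (((hasDerivAt_pow (k + 1) z).const_mul (c * lam⁻¹)).mul
        (hg1.const_mul (m : ℂ))).congr_deriv ?_
      simp [hL]
      rw [← e2, eX, hmC]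
      ring
    · refine hg0.congr_deriv ?_
      simp [hL]
      ring
  have h0 : ∀ lam, L 0 lam = 1 := by
    intro lam
    have : X 0 lam = 0 := by simp [hX]
    ext i j
    fin_cases i <;> fin_cases j <;> simp [hL, this, ent_zero, hβ0, hγ0]
  refine ⟨L, h0, fun i j => ?_, hsolve, fun z => ?_, fun z lam => ?_⟩
  · have hinv : ContDiffOn ℂ ∞ (fun q : ℂ × ℂ => q.2⁻¹) (univ ×ˢ {0}ᶜ) :=
      contDiffOn_snd.inv fun q hq => hq.2
    have hXs : ContDiffOn ℂ ∞ (fun q : ℂ × ℂ => X q.1 q.2) (univ ×ˢ {0}ᶜ) :=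
      (contDiffOn_const.mul (hinv.pow 2)).mul (contDiffOn_fst.pow (k + 2))
    have h1 := hβ.contDiff.comp_contDiffOn hXs
    have h2 := hβ.dcoef.contDiff.comp_contDiffOn hXs
    have h3 := hγ.contDiff.comp_contDiffOn hXs
    have h4 := hγ.dcoef.contDiff.comp_contDiffOn hXs
    fin_cases i <;> fin_cases j
    · exact h1.add (contDiffOn_const.mul (hXs.mul h2))
    · exact (hinv.mul contDiffOn_fst).mul h1
    · exact ((contDiffOn_const.mul hinv).mul (contDiffOn_fst.pow (k + 1))).mul
        (contDiffOn_const.mul h4)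
    · exact h3
  · rw [isTwistedOn_iff]
    intro lam _
    have : X z (-lam) = X z lam := by simp [hX]
    simp [hL, this]
  · have hd : ∀ w, HasDerivAt (fun w => (L w lam).det) 0 w := fun w =>
      hasDerivAt_det (A := fun z => xi c k z lam) (hsolve w lam) (by
        simp [xi, Matrix.trace_fin_two])
    have := is_const_of_deriv_eq_zero (fun w => (hd w).differentiableAt) (fun w => (hd w).deriv) z 0
    rw [this, h0, Matrix.det_one]

end DPW

end

noncomputable section

namespace DPW

open Set Metric MeasureTheory

/-! ### Smooth families of functions on the circle -/

/-- The circle `ℝ / 2πℤ`. -/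
abbrev Circ := AddCircle (2 * Real.pi)

section Hat

variable {Q V : Type} [NormedAddCommGroup Q] [NormedAddCommGroup V]

/-- A continuous periodic function as a function on the circle. -/
def circleHat (G : ℝ → V) (hc : Continuous G) (hp : Function.Periodic G (2 * Real.pi)) :
    C(Circ, V) where
  toFun := hp.lift
  continuous_toFun := continuous_coinduced_dom.2 hc

@[simp] lemma circleHat_coe (G : ℝ → V) (hc : Continuous G)
    (hp : Function.Periodic G (2 * Real.pi)) (t : ℝ) : circleHat G hc hp (t : Circ) = G t :=
  hp.lift_coe t

lemma continuous_slice {G : Q → ℝ → V} (hG : Continuous (Function.uncurry G)) (q : Q) :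
    Continuous (G q) := hG.comp (Continuous.prodMk_right q)

lemma continuous_circleHat {G : Q → ℝ → V} (hG : Continuous (Function.uncurry G))
    (hp : ∀ q, Function.Periodic (G q) (2 * Real.pi)) :
    Continuous fun q => circleHat (G q) (continuous_slice hG q) (hp q) := by
  refine ContinuousMap.continuous_of_continuous_uncurry _ ?_
  have hq : IsOpenQuotientMap (Prod.map (id : Q → Q) (fun t : ℝ => (t : Circ))) :=
    IsOpenQuotientMap.id.prodMap QuotientAddGroup.isOpenQuotientMap_mk
  rw [← hq.continuous_comp_iff]
  exact hG

/-- Families of linear maps as linear maps into families. -/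
def flipCirc (Q V : Type) [NormedAddCommGroup Q] [NormedSpace ℝ Q] [NormedAddCommGroup V]
    [NormedSpace ℝ V] : C(Circ, Q →L[ℝ] V) →L[ℝ] (Q →L[ℝ] C(Circ, V)) :=
  LinearMap.mkContinuous₂ (LinearMap.mk₂ ℝ
    (fun (f : C(Circ, Q →L[ℝ] V)) (v : Q) =>
      (⟨fun s => f s v, by fun_prop⟩ : C(Circ, V)))
    (fun f g v => by ext; simp) (fun c f v => by ext; simp)
    (fun f v w => by ext; simp) (fun c f v => by ext; simp)) 1 fun f v => by
      rw [one_mul, ContinuousMap.norm_le _ (by positivity)]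
      exact fun s => (f s).le_of_opNorm_le (f.norm_coe_le_norm s) v

variable [NormedSpace ℝ Q] [NormedSpace ℝ V]

lemma hasFDerivAt_circleHat {G : Q → ℝ → V} {G' : Q → ℝ → Q →L[ℝ] V}
    (hG : Continuous (Function.uncurry G)) (hp : ∀ q, Function.Periodic (G q) (2 * Real.pi))
    (hG' : Continuous (Function.uncurry G')) (hp' : ∀ q, Function.Periodic (G' q) (2 * Real.pi))
    (hd : ∀ q s, HasFDerivAt (fun q => G q s) (G' q s) q) (q : Q) :
    HasFDerivAt (fun q => circleHat (G q) (continuous_slice hG q) (hp q))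
      (flipCirc Q V (circleHat (G' q) (continuous_slice hG' q) (hp' q))) q := by
  rw [hasFDerivAt_iff_isLittleO, Asymptotics.isLittleO_iff]
  intro δ hδ
  obtain ⟨ρ, hρ, hball⟩ := Metric.continuous_iff.1 (continuous_circleHat hG' hp') q δ hδ
  filter_upwards [Metric.ball_mem_nhds q hρ] with q' hq'
  rw [ContinuousMap.norm_le _ (by positivity)]
  intro s
  induction s using QuotientAddGroup.induction_on with
  | H s =>
    refine Convex.norm_image_sub_le_of_norm_hasFDerivWithin_le' (f := fun q => G q s)
      (f' := fun q => G' q s) (φ := G' q s) (s := ball q ρ)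
      (fun x _ => (hd x s).hasFDerivWithinAt) (fun x hx => ?_) (convex_ball q ρ)
      (mem_ball_self hρ) hq'
    have h1 := (hball x hx).le
    rw [dist_eq_norm] at h1
    have h2 := (ContinuousMap.norm_coe_le_norm _ (s : Circ)).trans h1
    simpa using h2

theorem contDiff_circleHat_nat (n : ℕ) : ∀ {V : Type} [NormedAddCommGroup V] [NormedSpace ℝ V]
    {G : Q → ℝ → V} (hG : ContDiff ℝ n (Function.uncurry G))
    (hp : ∀ q, Function.Periodic (G q) (2 * Real.pi)),
    ContDiff ℝ n fun q => circleHat (G q) (continuous_slice hG.continuous q) (hp q) := by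
  induction n with
  | zero =>
    intro V _ _ G hG hp
    exact contDiff_zero.2 (continuous_circleHat hG.continuous hp)
  | succ n ih =>
    intro V _ _ G hG hp
    have hG1 : ContDiff ℝ (n + 1) (Function.uncurry G) := by exact_mod_cast hG
    have hGd : Differentiable ℝ (Function.uncurry G) := hG1.differentiable (by simp)
    set G' : Q → ℝ → Q →L[ℝ] V := fun q s =>
      (fderiv ℝ (Function.uncurry G) (q, s)).comp (ContinuousLinearMap.inl ℝ Q ℝ) with hG'
    have hG's : ContDiff ℝ n (Function.uncurry G') := by
      have h1 : ContDiff ℝ n (fderiv ℝ (Function.uncurry G)) := hG1.fderiv_right le_rfl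
      exact h1.clm_comp contDiff_const
    have hd : ∀ q s, HasFDerivAt (fun q => G q s) (G' q s) q := fun q s =>
      HasFDerivAt.comp (g := Function.uncurry G) (f := fun q : Q => (q, s)) q
        (hGd (q, s)).hasFDerivAt (hasFDerivAt_prodMk_left q s)
    have hp' : ∀ q, Function.Periodic (G' q) (2 * Real.pi) := fun q s => by
      refine (hd q (s + 2 * Real.pi)).unique ?_
      have : (fun q => G q (s + 2 * Real.pi)) = fun q => G q s := funext fun q => hp q s
      rw [this]; exact hd q s
    have : ContDiff ℝ ((n : WithTop ℕ∞) + 1)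
        fun q => circleHat (G q) (continuous_slice hG.continuous q) (hp q) := by
      have hflip : ContDiff ℝ n (fun f => flipCirc Q V f) :=
        ContinuousLinearMap.contDiff (𝕜 := ℝ) (E := C(Circ, Q →L[ℝ] V)) (F := Q →L[ℝ] C(Circ, V))
          (flipCirc Q V)
      rw [contDiff_succ_iff_hasFDerivAt]
      exact ⟨fun q => flipCirc Q V (circleHat (G' q) (continuous_slice hG's.continuous q) (hp' q)),
        hflip.comp (ih hG's hp'),
        fun q => hasFDerivAt_circleHat hG.continuous hp hG's.continuous hp' hd q⟩
    exact_mod_cast this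

theorem contDiff_circleHat {G : Q → ℝ → V} (hG : ContDiff ℝ ∞ (Function.uncurry G))
    (hp : ∀ q, Function.Periodic (G q) (2 * Real.pi)) :
    ContDiff ℝ ∞ fun q => circleHat (G q) (continuous_slice hG.continuous q) (hp q) :=
  contDiff_infty.2 fun n => contDiff_circleHat_nat n (contDiff_infty.1 hG n) hp

end Hat

end DPW

end

noncomputable section

namespace DPW

open Set Metric MeasureTheory AddCircle

/-! ### Multiplication and Toeplitz operators on the circle -/

/-- `ℂ²` with its Hermitian inner product. -/
abbrev V2 := EuclideanSpace ℂ (Fin 2)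

/-- Square integrable `ℂ²`-valued functions on the circle. -/
abbrev LV := Lp V2 2 (haarAddCircle : Measure Circ)

/-- The operator of multiplication by a continuous function. -/
def mulOp : C(Circ, V2 →L[ℂ] V2) →L[ℂ] LV →L[ℂ] LV :=
  ((ContinuousLinearMap.id ℂ (V2 →L[ℂ] V2)).holderL haarAddCircle ⊤ 2 2) ∘L
    (ContinuousMap.toLp ⊤ haarAddCircle ℂ)

lemma mulOp_ae (A : C(Circ, V2 →L[ℂ] V2)) (f : LV) :
    mulOp A f =ᵐ[haarAddCircle] fun s => A s (f s) := by
  refine (ContinuousLinearMap.coeFn_holder (ContinuousLinearMap.id ℂ (V2 →L[ℂ] V2)) (r := 2)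
    (ContinuousMap.toLp ⊤ haarAddCircle ℂ A) f).trans ?_
  filter_upwards [ContinuousMap.coeFn_toLp (p := ⊤) (𝕜 := ℂ) haarAddCircle A] with s hs
  rw [hs]; rfl

lemma mulOp_mul (A B : C(Circ, V2 →L[ℂ] V2)) (f : LV) : mulOp (A * B) f = mulOp A (mulOp B f) := by
  apply Lp.ext
  filter_upwards [mulOp_ae (A * B) f, mulOp_ae A (mulOp B f), mulOp_ae B f] with s h1 h2 h3
  rw [h1, h2, h3]; rfl

lemma mulOp_one (f : LV) : mulOp 1 f = f := by
  apply Lp.ext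
  filter_upwards [mulOp_ae 1 f] with s h1
  rw [h1]; rfl

lemma inner_mulOp (A B : C(Circ, V2 →L[ℂ] V2)) (h : ∀ s, B s = ContinuousLinearMap.adjoint (A s))
    (f g : LV) : inner ℂ (mulOp B f) g = inner ℂ f (mulOp A g) := by
  rw [L2.inner_def, L2.inner_def]
  refine integral_congr_ae ?_
  filter_upwards [mulOp_ae B f, mulOp_ae A g] with s h1 h2
  rw [h1, h2, h, ContinuousLinearMap.adjoint_inner_left]

/-- The Fourier coefficients. -/
def coef (n : ℤ) : LV →L[ℂ] V2 :=
  (ContinuousLinearMap.lsmul ℂ ℂ).lpPairing haarAddCircle 2 2 (fourierLp 2 (-n))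

lemma coef_apply (n : ℤ) (f : LV) :
    coef n f = ∫ s, fourier (-n) s • (f s : V2) ∂(haarAddCircle : Measure Circ) := by
  rw [coef, ContinuousLinearMap.lpPairing_eq_integral]
  refine integral_congr_ae ?_
  filter_upwards [coeFn_fourierLp (T := 2 * Real.pi) 2 (-n)] with s hs
  rw [hs]; rfl

lemma exists_norm_coef_le : ∃ C : ℝ, ∀ n : ℤ, ‖coef n‖ ≤ C := by
  refine ⟨‖(ContinuousLinearMap.lsmul ℂ ℂ).lpPairing (G := V2) (haarAddCircle : Measure Circ) 2 2‖,
    fun n => ?_⟩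
  refine (ContinuousLinearMap.le_opNorm _ _).trans ?_
  rw [orthonormal_fourier.1, mul_one]

lemma integrable_LV (f : LV) : Integrable (fun s => (f s : V2)) haarAddCircle :=
  (Lp.memLp f).integrable one_le_two

lemma integrable_fourier_smul (n : ℤ) (f : LV) :
    Integrable (fun s => fourier n s • (f s : V2)) haarAddCircle :=
  (integrable_LV f).fourier_smul n

lemma eq_zero_of_coef_eq_zero {f : LV} (h : ∀ n, coef n f = 0) : f = 0 := by
  have hi : ∀ i : Fin 2, (EuclideanSpace.proj i : V2 →L[ℂ] ℂ).compLp f = 0 := by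
    intro i
    have hc : ∀ n, fourierCoeff ((EuclideanSpace.proj i : V2 →L[ℂ] ℂ).compLp f) n = 0 := by
      intro n
      have h1 : fourierCoeff ((EuclideanSpace.proj i : V2 →L[ℂ] ℂ).compLp f) n =
          ∫ s, (EuclideanSpace.proj i : V2 →L[ℂ] ℂ) (fourier (-n) s • (f s : V2))
            ∂(haarAddCircle : Measure Circ) := by
        rw [fourierCoeff]
        refine integral_congr_ae ?_
        filter_upwards [(EuclideanSpace.proj i : V2 →L[ℂ] ℂ).coeFn_compLp f] with s hs
        rw [hs, map_smul]
      rw [h1, ContinuousLinearMap.integral_comp_comm _ (integrable_fourier_smul _ f),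
        ← coef_apply, h, map_zero]
    apply fourierBasis.repr.injective
    ext n
    rw [fourierBasis_repr, hc, map_zero]; rfl
  apply Lp.ext
  filter_upwards [(EuclideanSpace.proj 0 : V2 →L[ℂ] ℂ).coeFn_compLp f,
    (EuclideanSpace.proj 1 : V2 →L[ℂ] ℂ).coeFn_compLp f, Lp.coeFn_zero V2 2 haarAddCircle,
    Lp.coeFn_zero ℂ 2 (haarAddCircle : Measure Circ)] with s h0 h1 hz hz'
  rw [hi, hz'] at h0 h1
  rw [hz]
  ext i
  fin_cases i
  · exact h0.symm
  · exact h1.symm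

/-- The function `e^{ins} v`. -/
def character (n : ℤ) (v : V2) : C(Circ, V2) := ⟨fun s => fourier n s • v, by fun_prop⟩

/-- A continuous function as an element of `L²`. -/
abbrev toLV : C(Circ, V2) →L[ℂ] LV := ContinuousMap.toLp 2 haarAddCircle ℂ

lemma toLV_ae (f : C(Circ, V2)) : toLV f =ᵐ[haarAddCircle] f := ContinuousMap.coeFn_toLp _ f

lemma coef_toLV (n : ℤ) (f : C(Circ, V2)) :
    coef n (toLV f) = ∫ s, fourier (-n) s • f s ∂(haarAddCircle : Measure Circ) := by
  rw [coef_apply]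
  refine integral_congr_ae ?_
  filter_upwards [toLV_ae f] with s hs
  rw [hs]

lemma coef_character (m n : ℤ) (v : V2) :
    coef m (toLV (character n v)) = if m = n then v else 0 := by
  rw [coef_toLV]
  have h1 : ∀ s : Circ, fourier (-m) s • character n v s = (fourier (-m) s • fourier n s) • v :=
    fun s => by simp [character, smul_smul]
  simp only [h1]
  have h2 := congrFun (fourierCoeff_fourier (T := 2 * Real.pi) n) m
  rw [fourierCoeff] at h2
  rw [integral_smul_const, h2, Pi.single_apply]
  split_ifs <;> simp

lemma inner_character (n : ℤ) (v : V2) (f : LV) :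
    inner ℂ (toLV (character n v)) f = inner ℂ v (coef n f) := by
  rw [L2.inner_def, coef_apply, ← integral_inner (integrable_fourier_smul _ f)]
  refine integral_congr_ae ?_
  filter_upwards [toLV_ae (character n v)] with s hs
  rw [hs]
  simp [character, inner_smul_left, inner_smul_right]

/-- Square integrable functions without negative frequencies. -/
def hardy : Submodule ℂ LV := ⨅ n : {n : ℤ // n < 0}, (coef n).ker

lemma mem_hardy {f : LV} : f ∈ hardy ↔ ∀ n < 0, coef n f = 0 := by
  simp [hardy, Submodule.mem_iInf]

lemma isClosed_hardy : IsClosed (hardy : Set LV) := by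
  rw [hardy, Submodule.coe_iInf]
  exact isClosed_iInter fun n => (coef n).isClosed_ker

instance completeSpace_hardy : CompleteSpace hardy := isClosed_hardy.completeSpace_coe

lemma character_mem_hardy {n : ℤ} (hn : 0 ≤ n) (v : V2) : toLV (character n v) ∈ hardy := by
  rw [mem_hardy]
  intro m hm
  rw [coef_character, if_neg (by omega)]

/-- The Toeplitz operator with continuous symbol. -/
def toeplitz : C(Circ, V2 →L[ℂ] V2) →L[ℂ] hardy →L[ℂ] hardy :=
  (hardy.orthogonalProjectionOnto.postcomp hardy) ∘L (hardy.subtypeL.precomp LV) ∘L mulOp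

lemma toeplitz_apply (A : C(Circ, V2 →L[ℂ] V2)) (f : hardy) :
    toeplitz A f = hardy.orthogonalProjectionOnto (mulOp A f) := rfl

lemma inner_toeplitz (A : C(Circ, V2 →L[ℂ] V2)) (f g : hardy) :
    inner ℂ (toeplitz A f) g = inner ℂ (mulOp A f) (g : LV) := by
  rw [toeplitz_apply]
  exact hardy.inner_orthogonalProjectionOnto_eq_of_mem_right g (mulOp A f)

theorem isUnit_toeplitz {G G' : C(Circ, V2 →L[ℂ] V2)} (hG : G' * G = 1)
    {S : C(Circ, V2 →L[ℂ] V2)} (hS : ∀ s, S s = ContinuousLinearMap.adjoint (G s)) :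
    IsUnit (toeplitz (S * G)) := by
  have hpos : (0 : ℝ) < (‖mulOp G'‖ + 1)⁻¹ ^ 2 := by positivity
  refine ContinuousLinearMap.isUnit_of_forall_le_norm_inner_map _
    (c := ⟨(‖mulOp G'‖ + 1)⁻¹ ^ 2, hpos.le⟩) hpos fun x => ?_
  rw [inner_toeplitz, mulOp_mul, inner_mulOp _ _ hS, inner_self_eq_norm_sq_to_K, norm_pow,
    RCLike.norm_ofReal, abs_norm]
  change ‖x‖ ^ 2 * (‖mulOp G'‖ + 1)⁻¹ ^ 2 ≤ _
  rw [← mul_pow]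
  gcongr
  rw [← div_eq_mul_inv, div_le_iff₀ (by positivity)]
  have h1 : (x : LV) = mulOp G' (mulOp G x) := by rw [← mulOp_mul, hG, mulOp_one]
  calc ‖x‖ = ‖mulOp G' (mulOp G x)‖ := by rw [← h1]; rfl
    _ ≤ ‖mulOp G'‖ * ‖mulOp G x‖ := (mulOp G').le_opNorm _
    _ ≤ ‖mulOp G (x : LV)‖ * (‖mulOp G'‖ + 1) := by nlinarith [norm_nonneg (mulOp G (x : LV))]

lemma coef_toeplitz (A : C(Circ, V2 →L[ℂ] V2)) (f : hardy) {n : ℤ} (hn : 0 ≤ n) :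
    coef n (toeplitz A f) = coef n (mulOp A f) := by
  refine ext_inner_left ℂ fun w => ?_
  rw [← inner_character, ← inner_character]
  exact hardy.inner_orthogonalProjectionOnto_eq_of_mem_left
    ⟨toLV (character n w), character_mem_hardy hn w⟩ (mulOp A f)

/-- The constant function `v` as an element of the Hardy space. -/
def hardyConst (v : V2) : hardy := ⟨toLV (character 0 v), character_mem_hardy le_rfl v⟩

lemma coef_hardyConst (v : V2) (n : ℤ) : coef n (hardyConst v) = if n = 0 then v else 0 :=
  coef_character n 0 v

lemma toeplitz_eq_hardyConst_iff {A : C(Circ, V2 →L[ℂ] V2)} {f : hardy} {v : V2} :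
    toeplitz A f = hardyConst v ↔
      ∀ n : ℤ, 0 ≤ n → coef n (mulOp A f) = if n = 0 then v else 0 := by
  constructor
  · intro h n hn
    rw [← coef_toeplitz A f hn, h, coef_hardyConst]
  · intro h
    rw [← sub_eq_zero, ← Submodule.coe_eq_zero]
    refine eq_zero_of_coef_eq_zero fun n => ?_
    rcases lt_or_ge n 0 with hn | hn
    · exact mem_hardy.1 (toeplitz A f - hardyConst v).2 n hn
    · rw [Submodule.coe_sub, map_sub, coef_toeplitz A f hn, h n hn, coef_hardyConst, sub_self]

/-- Rotation of functions on the circle. -/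
def rot (t : Circ) : LV →+ LV :=
  Lp.compMeasurePreserving (fun s => s + t) (measurePreserving_add_right haarAddCircle t)

lemma rot_ae (t : Circ) (f : LV) : rot t f =ᵐ[haarAddCircle] fun s => f (s + t) :=
  Lp.coeFn_compMeasurePreserving f _

lemma coef_rot (n : ℤ) (t : Circ) (f : LV) : coef n (rot t f) = fourier n t • coef n f := by
  rw [coef_apply, coef_apply, ← integral_smul,
    ← integral_add_right_eq_self (fun s => fourier n t • fourier (-n) s • (f s : V2)) t]
  refine integral_congr_ae ?_
  filter_upwards [rot_ae t f] with s hs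
  rw [hs, smul_smul]
  congr 1
  simp only [fourier_apply, smul_add, toCircle_add, neg_smul, Circle.coe_mul]
  have : (toCircle (n • t) : ℂ) * toCircle (-(n • t)) = 1 := by
    rw [← Circle.coe_mul, ← toCircle_add, add_neg_cancel, toCircle_zero, Circle.coe_one]
  linear_combination (-(toCircle (-(n • s)) : ℂ)) * this

lemma mulOp_rot (A A' : C(Circ, V2 →L[ℂ] V2)) {t : Circ} (h : ∀ s, A' s = A (s + t)) (f : LV) :
    mulOp A' (rot t f) = rot t (mulOp A f) := by
  apply Lp.ext
  have h4 := (measurePreserving_add_right haarAddCircle t).quasiMeasurePreserving.ae_eq_comp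
    (mulOp_ae A f)
  filter_upwards [mulOp_ae A' (rot t f), rot_ae t f, rot_ae t (mulOp A f), h4] with s h1 h2 h3 h4
  rw [h1, h2, h3, h]
  exact h4.symm


/-- The solution of the Toeplitz equation rotates with the symbol. -/
lemma coef_eq_of_rot {A A' : C(Circ, V2 →L[ℂ] V2)} {t : Circ} (h : ∀ s, A' s = A (s + t))
    (hu : IsUnit (toeplitz A')) {f f' : hardy} {v : V2} (hf : toeplitz A f = hardyConst v)
    (hf' : toeplitz A' f' = hardyConst v) (n : ℤ) : coef n f' = fourier n t • coef n f := by
  have hmem : rot t f ∈ hardy := by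
    rw [mem_hardy]
    intro n hn
    rw [coef_rot, mem_hardy.1 f.2 n hn, smul_zero]
  have h1 : toeplitz A' ⟨rot t f, hmem⟩ = hardyConst v := by
    rw [toeplitz_eq_hardyConst_iff]
    intro n hn
    rw [mulOp_rot A A' h, coef_rot, toeplitz_eq_hardyConst_iff.1 hf n hn]
    split_ifs with h0
    · rw [h0]; simp
    · simp
  have h2 : Function.Injective (toeplitz A') := by
    obtain ⟨u, hu⟩ := hu
    intro x y hxy
    have h3 := congrArg (fun w => (↑u⁻¹ : hardy →L[ℂ] hardy) w) hxy
    rw [← hu] at h3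
    have h4 : ∀ x, (↑u⁻¹ : hardy →L[ℂ] hardy) ((u : hardy →L[ℂ] hardy) x) = x := fun x =>
      congrArg (fun T : hardy →L[ℂ] hardy => T x) u.inv_mul
    simpa only [h4] using h3
  have h3 : f' = ⟨rot t f, hmem⟩ := h2 (hf'.trans h1.symm)
  rw [h3]
  exact coef_rot n t f

end DPW

end

noncomputable section

namespace DPW

open Set Metric MeasureTheory AddCircle

/-! ### Smooth families of Toeplitz equations -/

lemma contDiff_ringInverse_comp {R : Type} [NormedRing R] [NormedAlgebra ℂ R] [CompleteSpace R]
    {Q : Type} [NormedAddCommGroup Q] [NormedSpace ℝ Q] {f : Q → R} (hf : ContDiff ℝ ∞ f)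
    (hu : ∀ q, IsUnit (f q)) : ContDiff ℝ ∞ fun q => Ring.inverse (f q) := by
  rw [contDiff_iff_contDiffAt]
  intro q
  obtain ⟨u, hu⟩ := hu q
  have h := (contDiffAt_ringInverse ℂ (n := ∞) u).restrict_scalars ℝ
  rw [hu] at h
  exact h.comp q hf.contDiffAt

lemma contDiff_clm_comp {Q E F : Type} [NormedAddCommGroup Q] [NormedSpace ℝ Q]
    [NormedAddCommGroup E] [NormedSpace ℂ E] [NormedAddCommGroup F]
    [NormedSpace ℂ F] (T : E →L[ℂ] F) {f : Q → E} (hf : ContDiff ℝ ∞ f) :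
    ContDiff ℝ ∞ fun q => T (f q) :=
  (ContinuousLinearMap.contDiff (𝕜 := ℝ) (E := E) (F := F) (T.restrictScalars ℝ)).comp hf

/-- The derivative in the angular direction. -/
def angDeriv {E : Type} [NormedAddCommGroup E] [NormedSpace ℝ E] (f : ℂ × ℝ → E) (q : ℂ × ℝ) : E :=
  fderiv ℝ f q (0, 1)

lemma contDiff_angDeriv {E : Type} [NormedAddCommGroup E] [NormedSpace ℝ E] {f : ℂ × ℝ → E}
    (hf : ContDiff ℝ ∞ f) : ContDiff ℝ ∞ (angDeriv f) :=
  (hf.fderiv_right (m := ∞) (by simp)).clm_apply contDiff_const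

lemma hasDerivAt_angDeriv {E : Type} [NormedAddCommGroup E] [NormedSpace ℝ E] {f : ℂ × ℝ → E}
    (hf : ContDiff ℝ ∞ f) (z : ℂ) (t : ℝ) :
    HasDerivAt (fun t => f (z, t)) (angDeriv f (z, t)) t := by
  have h1 : HasDerivAt (fun t : ℝ => (z, t)) ((0 : ℂ), (1 : ℝ)) t :=
    (hasDerivAt_const _ _).prodMk (hasDerivAt_id _)
  exact ((hf.differentiable (by simp)) (z, t)).hasFDerivAt.comp_hasDerivAt t h1

/-- The Fourier coefficients on the Hardy space. -/
def hcoef (n : ℤ) : hardy →L[ℂ] V2 := coef n ∘L hardy.subtypeL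

/-- If the coefficients of `f` rotate, then those of its angular derivative are multiplied by
`in`. -/
lemma hcoef_angDeriv {f : ℂ × ℝ → hardy} (hf : ContDiff ℝ ∞ f) {n : ℤ} {z : ℂ} {a : V2}
    (h : ∀ t : ℝ, hcoef n (f (z, t)) = Complex.exp (n * t * Complex.I) • a) (t : ℝ) :
    hcoef n (angDeriv f (z, t)) = Complex.exp (n * t * Complex.I) • ((n * Complex.I) • a) := by
  have h1 : HasDerivAt (fun t => hcoef n (f (z, t))) (hcoef n (angDeriv f (z, t))) t :=
    ((hcoef n).restrictScalars ℝ).hasFDerivAt.comp_hasDerivAt t (hasDerivAt_angDeriv hf z t)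
  have h2 : HasDerivAt (fun t : ℝ => Complex.exp (n * t * Complex.I))
      (Complex.exp (n * t * Complex.I) * (n * 1 * Complex.I)) t :=
    (((Complex.ofRealCLM.hasDerivAt (x := t)).const_mul (n : ℂ)).mul_const Complex.I).cexp
  have h3 := h2.smul_const a
  rw [funext h] at h1
  rw [h1.unique h3, smul_smul, mul_one]

lemma summable_one_add_sq_inv : Summable fun n : ℕ => ((1 : ℝ) + (n : ℝ) ^ 2)⁻¹ := by
  refine Summable.of_norm_bounded_eventually_nat (Real.summable_nat_pow_inv.2 one_lt_two) ?_
  filter_upwards [Filter.eventually_gt_atTop 0] with n hn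
  have : (0 : ℝ) < n := by exact_mod_cast hn
  rw [Real.norm_of_nonneg (by positivity)]
  gcongr
  linarith

lemma norm_one_add_sq_inv (n : ℕ) : ‖((1 : ℂ) + (n : ℂ) ^ 2)⁻¹‖ = ((1 : ℝ) + (n : ℝ) ^ 2)⁻¹ := by
  have : ((1 : ℂ) + (n : ℂ) ^ 2)⁻¹ = (((1 : ℝ) + (n : ℝ) ^ 2)⁻¹ : ℝ) := by push_cast; rfl
  rw [this, Complex.norm_real, Real.norm_of_nonneg (by positivity)]

lemma exists_norm_hcoef_le : ∃ C : ℝ, 0 ≤ C ∧ ∀ (n : ℤ) (f : hardy), ‖hcoef n f‖ ≤ C * ‖f‖ := by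
  obtain ⟨C, hC⟩ := exists_norm_coef_le
  exact ⟨C, (norm_nonneg _).trans (hC 0), fun n f => (coef n).le_of_opNorm_le (hC n) f⟩

lemma hasSum_clm_apply {E F : Type} [NormedAddCommGroup E] [NormedSpace ℂ E]
    [NormedAddCommGroup F] [NormedSpace ℂ F] {ℓ : ℕ → E →L[ℂ] F} {T : E →L[ℂ] F}
    (hs : HasSum ℓ T) (f : E) : HasSum (fun n : ℕ => ℓ n f) (T f) := by
  have h := hs.map (ContinuousLinearMap.apply ℂ F f) (ContinuousLinearMap.continuous _)
  exact h

lemma exists_weighted_sum {E F : Type} [NormedAddCommGroup E] [NormedSpace ℂ E]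
    [NormedAddCommGroup F] [NormedSpace ℂ F] [CompleteSpace F] {ℓ : ℕ → E →L[ℂ] F} {C : ℝ}
    (hC0 : 0 ≤ C) (hC : ∀ n f, ‖ℓ n f‖ ≤ C * ‖f‖) : ∃ T : E →L[ℂ] F, ∀ f,
      HasSum (fun n : ℕ => ((1 : ℂ) + (n : ℂ) ^ 2)⁻¹ • ℓ n f) (T f) := by
  have hs : Summable fun n : ℕ => ((1 : ℂ) + (n : ℂ) ^ 2)⁻¹ • ℓ n := by
    refine Summable.of_norm_bounded (summable_one_add_sq_inv.mul_right C) fun n => ?_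
    rw [norm_smul, norm_one_add_sq_inv]
    gcongr
    exact ContinuousLinearMap.opNorm_le_bound _ hC0 (hC n)
  exact ⟨∑' n : ℕ, ((1 : ℂ) + (n : ℂ) ^ 2)⁻¹ • ℓ n, fun f => hasSum_clm_apply hs.hasSum f⟩

lemma exists_sumFunctional : ∃ T : hardy →L[ℂ] V2, ∀ f,
    HasSum (fun n : ℕ => ((1 : ℂ) + (n : ℂ) ^ 2)⁻¹ • hcoef n f) (T f) := by
  obtain ⟨C, hC0, hC⟩ := exists_norm_hcoef_le
  exact exists_weighted_sum (ℓ := fun n : ℕ => hcoef n) hC0 fun n f => hC n f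

/-- The functional `∑ (1 + n²)⁻¹ fₙ` of the nonnegative Fourier coefficients. -/
def sumFunctional : hardy →L[ℂ] V2 := exists_sumFunctional.choose

lemma hasSum_sumFunctional (f : hardy) :
    HasSum (fun n : ℕ => ((1 : ℂ) + (n : ℂ) ^ 2)⁻¹ • hcoef n f) (sumFunctional f) :=
  exists_sumFunctional.choose_spec f

section Family

variable {W : ℂ → ℝ → V2 →L[ℂ] V2}

lemma periodic_comp_add {V : Type} {f : ℝ → V} {c : ℝ} (h : Function.Periodic f c) (t : ℝ) :
    Function.Periodic (fun s => f (s + t)) c := fun s => by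
  simp only [add_right_comm s c t]; exact h _

/-- The rotated symbols of a family. -/
def symbolFamily (hW : ContDiff ℝ ∞ (Function.uncurry W))
    (hp : ∀ z, Function.Periodic (W z) (2 * Real.pi)) (q : ℂ × ℝ) : C(Circ, V2 →L[ℂ] V2) :=
  circleHat (fun s => W q.1 (s + q.2))
    ((continuous_slice hW.continuous q.1).comp (continuous_add_const q.2))
    (periodic_comp_add (hp q.1) q.2)

lemma contDiff_symbolFamily (hW : ContDiff ℝ ∞ (Function.uncurry W))
    (hp : ∀ z, Function.Periodic (W z) (2 * Real.pi)) : ContDiff ℝ ∞ (symbolFamily hW hp) := by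
  have hG : ContDiff ℝ ∞ (Function.uncurry fun (q : ℂ × ℝ) (s : ℝ) => W q.1 (s + q.2)) :=
    hW.comp (f := fun x : (ℂ × ℝ) × ℝ => (x.1.1, x.2 + x.1.2))
      (contDiff_fst.fst.prodMk (contDiff_snd.add contDiff_fst.snd))
  exact contDiff_circleHat hG _

lemma symbolFamily_rot (hW : ContDiff ℝ ∞ (Function.uncurry W))
    (hp : ∀ z, Function.Periodic (W z) (2 * Real.pi)) (z : ℂ) (t : ℝ) (s : Circ) :
    symbolFamily hW hp (z, t) s = symbolFamily hW hp (z, 0) (s + (t : Circ)) := by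
  induction s using QuotientAddGroup.induction_on with
  | H s =>
    have : ((s : ℝ) : Circ) + (t : Circ) = ((s + t : ℝ) : Circ) := rfl
    change symbolFamily hW hp (z, t) (s : Circ) = symbolFamily hW hp (z, 0) ((s : Circ) + (t : Circ))
    rw [this, symbolFamily, symbolFamily, circleHat_coe, circleHat_coe, add_zero]

variable (hW : ContDiff ℝ ∞ (Function.uncurry W)) (hp : ∀ z, Function.Periodic (W z) (2 * Real.pi))

/-- The solution of the Toeplitz equation. -/
def toepSol (v : V2) (q : ℂ × ℝ) : hardy :=
  Ring.inverse (toeplitz (symbolFamily hW hp q)) (hardyConst v)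

variable {hW hp} (hu : ∀ q, IsUnit (toeplitz (symbolFamily hW hp q)))
include hu

lemma toeplitz_toepSol (v : V2) (q : ℂ × ℝ) :
    toeplitz (symbolFamily hW hp q) (toepSol hW hp v q) = hardyConst v :=
  congrArg (fun T : hardy →L[ℂ] hardy => T (hardyConst v)) (Ring.mul_inverse_cancel _ (hu q))

lemma contDiff_toepSol (v : V2) : ContDiff ℝ ∞ (toepSol hW hp v) := by
  have h1 : ContDiff ℝ ∞ fun q => toeplitz (symbolFamily hW hp q) :=
    contDiff_clm_comp (E := C(Circ, V2 →L[ℂ] V2)) (F := hardy →L[ℂ] hardy) toeplitz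
      (contDiff_symbolFamily hW hp)
  exact contDiff_clm_comp (ContinuousLinearMap.apply ℂ hardy (hardyConst v))
    (contDiff_ringInverse_comp (R := hardy →L[ℂ] hardy) h1 hu)

lemma hcoef_toepSol (v : V2) (n : ℤ) (z : ℂ) (t : ℝ) : hcoef n (toepSol hW hp v (z, t)) =
    Complex.exp (n * t * Complex.I) • hcoef n (toepSol hW hp v (z, 0)) := by
  have h := coef_eq_of_rot (t := (t : Circ)) (symbolFamily_rot hW hp z t) (hu (z, t))
    (toeplitz_toepSol hu v (z, 0)) (toeplitz_toepSol hu v (z, t)) n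
  have e : fourier n (t : Circ) = Complex.exp (n * t * Complex.I) := by
    rw [fourier_two_pi_coe, circleMap_zero, Complex.ofReal_one, one_mul, ← Complex.exp_int_mul,
      mul_assoc]
  rw [e] at h
  exact h

/-- The solution with two angular derivatives gained. -/
lemma hcoef_gain (v : V2) (n : ℤ) (z : ℂ) (t : ℝ) :
    hcoef n (toepSol hW hp v (z, t) - angDeriv (angDeriv (toepSol hW hp v)) (z, t)) =
      ((1 : ℂ) + (n : ℂ) ^ 2) • Complex.exp (n * t * Complex.I) •
        hcoef n (toepSol hW hp v (z, 0)) := by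
  have hx := contDiff_toepSol hu v
  have h1 := hcoef_angDeriv hx (hcoef_toepSol hu v n z)
  have h2 := hcoef_angDeriv (contDiff_angDeriv hx) h1 t
  rw [map_sub, h2, hcoef_toepSol hu, smul_smul, smul_smul, smul_smul, ← sub_smul]
  congr 1
  linear_combination (-Complex.exp (n * t * Complex.I) * n ^ 2) * Complex.I_mul_I

/-- The holomorphic extension of the solution to the disc. -/
def toepSeries (_ : ∀ q, IsUnit (toeplitz (symbolFamily hW hp q))) (v : V2) (z lam : ℂ) : V2 :=
  ∑' n : ℕ, lam ^ n • hcoef n (toepSol hW hp v (z, 0))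

lemma exists_hcoef_bound (v : V2) (z : ℂ) : ∃ C : ℝ, ∀ n : ℕ,
    ‖hcoef n (toepSol hW hp v (z, 0))‖ ≤ C * ((1 : ℝ) + (n : ℝ) ^ 2)⁻¹ := by
  obtain ⟨C, hC0, hC⟩ := exists_norm_hcoef_le
  refine ⟨C * ‖toepSol hW hp v (z, 0) - angDeriv (angDeriv (toepSol hW hp v)) (z, 0)‖, fun n => ?_⟩
  have h1 := hC n (toepSol hW hp v (z, 0) - angDeriv (angDeriv (toepSol hW hp v)) (z, 0))
  rw [hcoef_gain hu] at h1
  simp only [Complex.ofReal_zero, mul_zero, zero_mul, Complex.exp_zero, one_smul, norm_smul,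
    Int.cast_natCast] at h1
  have h2 : ‖(1 : ℂ) + (n : ℂ) ^ 2‖ = 1 + (n : ℝ) ^ 2 := by
    have := norm_one_add_sq_inv n
    rw [norm_inv, inv_inj] at this
    exact this
  rw [h2] at h1
  rw [← div_eq_mul_inv, le_div_iff₀ (by positivity)]
  linarith

lemma toepSeries_circleMap (v : V2) (z : ℂ) (t : ℝ) : toepSeries hu v z (circleMap 0 1 t) =
    sumFunctional (toepSol hW hp v (z, t) - angDeriv (angDeriv (toepSol hW hp v)) (z, t)) := by
  rw [← (hasSum_sumFunctional _).tsum_eq, toepSeries]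
  refine tsum_congr fun n => ?_
  have h0 : (1 : ℂ) + (n : ℂ) ^ 2 ≠ 0 := by
    have : (0 : ℝ) < 1 + (n : ℝ) ^ 2 := by positivity
    exact_mod_cast this.ne'
  rw [hcoef_gain hu, smul_smul, smul_smul]
  congr 1
  rw [Int.cast_natCast, inv_mul_cancel₀ h0, one_mul, circleMap_zero, Complex.ofReal_one, one_mul,
    ← Complex.exp_nat_mul, mul_assoc]

lemma contDiff_toepSeries (v : V2) :
    ContDiff ℝ ∞ fun q : ℂ × ℝ => toepSeries hu v q.1 (circleMap 0 1 q.2) := by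
  have hx := contDiff_toepSol hu v
  have h := contDiff_clm_comp sumFunctional (hx.sub (contDiff_angDeriv (contDiff_angDeriv hx)))
  refine Eq.subst (motive := ContDiff ℝ ∞) ?_ h
  exact funext fun q => (toepSeries_circleMap hu v q.1 q.2).symm

lemma continuousOn_toepSeries (v : V2) (z : ℂ) :
    ContinuousOn (toepSeries hu v z) (closedBall 0 1) := by
  obtain ⟨C, hC⟩ := exists_hcoef_bound hu v z
  refine continuousOn_tsum (fun n => by fun_prop) (summable_one_add_sq_inv.mul_left C)
    fun n lam hlam => ?_
  rw [norm_smul, norm_pow]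
  have h1 : ‖lam‖ ^ n ≤ 1 := pow_le_one₀ (norm_nonneg _) (by simpa using hlam)
  calc _ ≤ 1 * ‖hcoef n (toepSol hW hp v (z, 0))‖ := by gcongr
    _ ≤ _ := by rw [one_mul]; exact hC n

lemma differentiableOn_toepSeries (v : V2) (z : ℂ) :
    DifferentiableOn ℂ (toepSeries hu v z) (ball 0 1) := by
  obtain ⟨C, hC⟩ := exists_hcoef_bound hu v z
  refine Complex.differentiableOn_tsum_of_summable_norm (summable_one_add_sq_inv.mul_left C)
    (fun n => by fun_prop) isOpen_ball fun n lam hlam => ?_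
  rw [norm_smul, norm_pow]
  have h1 : ‖lam‖ ^ n ≤ 1 := pow_le_one₀ (norm_nonneg _) (by simpa using (mem_ball_zero_iff.1 hlam).le)
  calc _ ≤ 1 * ‖hcoef n (toepSol hW hp v (z, 0))‖ := by gcongr
    _ ≤ _ := by rw [one_mul]; exact hC n

/-- The solution is represented by a continuous function. -/
lemma exists_continuous_toepSol (v : V2) (z : ℂ) : ∃ X : C(Circ, V2),
    (∀ t : ℝ, X (t : Circ) = toepSeries hu v z (circleMap 0 1 t)) ∧
      toLV X = toepSol hW hp v (z, 0) := by
  obtain ⟨C, hC⟩ := exists_hcoef_bound hu v z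
  set a : ℕ → V2 := fun n => hcoef n (toepSol hW hp v (z, 0)) with ha
  have hs : Summable fun n : ℕ => character n (a n) := by
    refine Summable.of_norm_bounded (summable_one_add_sq_inv.mul_left C) fun n => ?_
    refine le_trans ?_ (hC n)
    rw [ContinuousMap.norm_le _ (norm_nonneg _)]
    intro s
    have : ‖(fourier (n : ℤ) s : ℂ)‖ = 1 := by rw [fourier_apply]; exact Circle.norm_coe _
    simp only [character, ContinuousMap.coe_mk, norm_smul, this, one_mul]
    exact le_rfl
  refine ⟨∑' n : ℕ, character n (a n), fun t => ?_, ?_⟩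
  · have h1 := (ContinuousMap.evalCLM ℂ (t : Circ) : C(Circ, V2) →L[ℂ] V2).map_tsum hs
    refine Eq.trans h1 (tsum_congr fun n => ?_)
    change fourier (n : ℤ) (t : Circ) • a n = _
    rw [fourier_two_pi_coe, zpow_natCast]
  · rw [← sub_eq_zero]
    refine eq_zero_of_coef_eq_zero fun m => ?_
    have h1 := (coef m ∘L toLV).map_tsum hs
    have h2 : coef m (toLV (∑' n : ℕ, character n (a n))) =
        ∑' n : ℕ, if m = (n : ℤ) then a n else 0 := by
      refine Eq.trans h1 (tsum_congr fun n => ?_)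
      exact coef_character m n (a n)
    rw [map_sub, h2]
    rcases lt_or_ge m 0 with hm | hm
    · rw [mem_hardy.1 (toepSol hW hp v (z, 0)).2 m hm, sub_zero]
      refine (tsum_congr fun n : ℕ => if_neg ?_).trans tsum_zero
      omega
    · obtain ⟨k, rfl⟩ := Int.eq_ofNat_of_zero_le hm
      rw [tsum_eq_single k]
      · simp [ha, hcoef]
      · intro n hn
        rw [if_neg (by simpa using hn.symm)]

end Family

end DPW

end

noncomputable section

namespace DPW

open Set Metric MeasureTheory AddCircle

/-! ### Matrix symbols -/

/-- Matrices as operators. -/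
abbrev matCLM (M : Mat2) : V2 →L[ℂ] V2 := Matrix.toEuclideanCLM (n := Fin 2) (𝕜 := ℂ) M

lemma matCLM_eq_sum (M : Mat2) :
    matCLM M = ∑ i, ∑ j, M i j • matCLM (Matrix.single i j 1) := by
  ext v i
  have h : ∀ (N : Mat2) (v : V2), matCLM N v i = N i 0 * v 0 + N i 1 * v 1 := fun N v => by
    have : matCLM N v i = (N.mulVec v.ofLp) i := rfl
    rw [this, Matrix.mulVec, dotProduct, Fin.sum_univ_two]
  simp only [Fin.sum_univ_two, add_apply, smul_apply,
    PiLp.add_apply, PiLp.smul_apply, h]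
  fin_cases i <;> simp [Matrix.single]

lemma contDiff_matCLM {Q : Type} [NormedAddCommGroup Q] [NormedSpace ℝ Q] {M : Q → Mat2}
    (h : ∀ i j, ContDiff ℝ ∞ fun q => M q i j) : ContDiff ℝ ∞ fun q => matCLM (M q) := by
  simp_rw [fun q => matCLM_eq_sum (M q)]
  exact ContDiff.sum fun i _ => ContDiff.sum fun j _ => (h i j).smul contDiff_const

lemma continuous_matCLM {Q : Type} [TopologicalSpace Q] {M : Q → Mat2}
    (h : ∀ i j, Continuous fun q => M q i j) : Continuous fun q => matCLM (M q) := by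
  simp_rw [fun q => matCLM_eq_sum (M q)]
  exact continuous_finsetSum _ fun i _ => continuous_finsetSum _ fun j _ =>
    (h i j).smul continuous_const

lemma matCLM_apply (M : Mat2) (v : V2) (i : Fin 2) :
    matCLM M v i = M i 0 * v 0 + M i 1 * v 1 := by
  have : matCLM M v i = (M.mulVec v.ofLp) i := rfl
  rw [this, Matrix.mulVec, dotProduct, Fin.sum_univ_two]

/-- A continuous periodic matrix function as a symbol. -/
def matHat (M : ℝ → Mat2) (hc : ∀ i j, Continuous fun t => M t i j)
    (hp : Function.Periodic M (2 * Real.pi)) : C(Circ, V2 →L[ℂ] V2) :=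
  circleHat (fun t => matCLM (M t)) (continuous_matCLM hc) fun t => by simp only [hp t]

lemma matHat_coe (M : ℝ → Mat2) (hc : ∀ i j, Continuous fun t => M t i j)
    (hp : Function.Periodic M (2 * Real.pi)) (t : ℝ) :
    matHat M hc hp (t : Circ) = matCLM (M t) := circleHat_coe _ _ _ t

lemma circ_ext {V : Type} {f g : Circ → V} (h : ∀ t : ℝ, f (t : Circ) = g (t : Circ)) (s : Circ) :
    f s = g s := by
  induction s using QuotientAddGroup.induction_on with
  | H s => exact h s

lemma star_mul_apply (M : Mat2) (i j : Fin 2) :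
    (star M * M) i j = (starRingEnd ℂ) (M 0 i) * M 0 j + (starRingEnd ℂ) (M 1 i) * M 1 j := by
  rw [mat2_mul_apply]; rfl

section Gram

variable {L : ℂ → ℂ → Mat2}

/-- The operator of the Gram matrix. -/
def gramSymbol (L : ℂ → ℂ → Mat2) (z : ℂ) (t : ℝ) : V2 →L[ℂ] V2 :=
  matCLM (star (L z (circleMap 0 1 t)) * L z (circleMap 0 1 t))

lemma contDiff_gramSymbol (hs : JointlySmooth 1 univ L) :
    ContDiff ℝ ∞ (Function.uncurry (gramSymbol L)) := by
  have h : ∀ i j, ContDiff ℝ ∞ fun q : ℂ × ℝ => L q.1 (circleMap 0 1 q.2) i j := fun i j => by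
    have := hs i j
    rwa [univ_prod_univ, contDiffOn_univ] at this
  have hc : ∀ i j, ContDiff ℝ ∞ fun q : ℂ × ℝ =>
      (starRingEnd ℂ) (L q.1 (circleMap 0 1 q.2) i j) := fun i j =>
    (Complex.conjCLE : ℂ →L[ℝ] ℂ).contDiff.comp (h i j)
  refine contDiff_matCLM (M := fun q : ℂ × ℝ => star (L q.1 (circleMap 0 1 q.2)) *
    L q.1 (circleMap 0 1 q.2)) fun i j => ?_
  simp only [star_mul_apply]
  exact ((hc _ _).mul (h _ _)).add ((hc _ _).mul (h _ _))

lemma periodic_gramSymbol (L : ℂ → ℂ → Mat2) (z : ℂ) :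
    Function.Periodic (gramSymbol L z) (2 * Real.pi) := fun t => by
  rw [gramSymbol, gramSymbol, periodic_circleMap 0 1 t]

lemma isUnit_toeplitz_gram (hs : JointlySmooth 1 univ L)
    (hdet : ∀ z, ∀ lam ∈ sphere (0 : ℂ) 1, (L z lam).det = 1) (q : ℂ × ℝ) :
    IsUnit (toeplitz (symbolFamily (contDiff_gramSymbol hs) (periodic_gramSymbol L) q)) := by
  obtain ⟨z, t⟩ := q
  set M : ℝ → Mat2 := fun s => L z (circleMap 0 1 (s + t)) with hM
  have hMc : ∀ i j, Continuous fun s => M s i j := fun i j =>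
    (hs.smooth_apply (mem_univ z) i j).continuous.comp (continuous_add_const t)
  have hMp : Function.Periodic M (2 * Real.pi) := fun s => by
    simp only [hM, add_right_comm s (2 * Real.pi) t]
    rw [periodic_circleMap 0 1 (s + t)]
  have hMd : ∀ s, (M s).det = 1 := fun s =>
    hdet z _ (circleMap_mem_sphere_zero zero_le_one _)
  set N : ℝ → Mat2 := fun s => !![M s 1 1, -M s 0 1; -M s 1 0, M s 0 0] with hN
  have hNc : ∀ i j, Continuous fun s => N s i j := fun i j => by
    fin_cases i <;> fin_cases j
    · exact hMc 1 1
    · exact (hMc 0 1).neg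
    · exact (hMc 1 0).neg
    · exact hMc 0 0
  have hNp : Function.Periodic N (2 * Real.pi) := fun s => by simp only [hN, hMp s]
  have hSc : ∀ i j, Continuous fun s => (star (M s)) i j := fun i j =>
    Complex.continuous_conj.comp (hMc j i)
  have hSp : Function.Periodic (fun s => star (M s)) (2 * Real.pi) := fun s => by simp only [hMp s]
  have h1 : matHat N hNc hNp * matHat M hMc hMp = 1 := by
    ext1 s
    refine circ_ext (f := matHat N hNc hNp * matHat M hMc hMp)
      (g := (1 : C(Circ, V2 →L[ℂ] V2))) (fun s => ?_) s
    rw [ContinuousMap.mul_apply, matHat_coe, matHat_coe, ← map_mul, hN]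
    simp only
    rw [← inv_eq_of_det_eq_one (hMd s), inv_mul_of_det_eq_one (hMd s), map_one]
    rfl
  have h2 : ∀ s, matHat _ hSc hSp s = ContinuousLinearMap.adjoint (matHat M hMc hMp s) :=
    circ_ext (f := matHat _ hSc hSp)
      (g := fun s => ContinuousLinearMap.adjoint (matHat M hMc hMp s)) fun s => by
      rw [matHat_coe, matHat_coe]
      exact map_star (Matrix.toEuclideanCLM (n := Fin 2) (𝕜 := ℂ)) (M s)
  have h3 : symbolFamily (contDiff_gramSymbol hs) (periodic_gramSymbol L) (z, t) =
      matHat _ hSc hSp * matHat M hMc hMp := by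
    ext1 s
    refine circ_ext (f := symbolFamily (contDiff_gramSymbol hs) (periodic_gramSymbol L) (z, t))
      (g := (matHat _ hSc hSp * matHat M hMc hMp : C(Circ, V2 →L[ℂ] V2))) (fun s => ?_) s
    rw [ContinuousMap.mul_apply, matHat_coe, matHat_coe, ← map_mul, symbolFamily, circleHat_coe]
    rfl
  rw [h3]
  exact isUnit_toeplitz h1 h2

/-- A family of nonnegative loops `X` for which `L* L X` is nonpositive, with constant term `1`. -/
theorem exists_gram_solution (hs : JointlySmooth 1 univ L)
    (hdet : ∀ z, ∀ lam ∈ sphere (0 : ℂ) 1, (L z lam).det = 1) :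
    ∃ X : ℂ → ℂ → Mat2, JointlySmooth 1 univ X ∧
      (∀ z i j, ContinuousOn (fun lam => X z lam i j) (closedBall 0 1)) ∧
      (∀ z i j, DifferentiableOn ℂ (fun lam => X z lam i j) (ball 0 1)) ∧
      ∀ z i j, ∀ n : ℤ, n ≤ 0 →
        mode 1 n (fun lam => (star (L z lam) * L z lam * X z lam) i j) =
          if n = 0 then 2 * Real.pi * (1 : Mat2) i j else 0 := by
  set hu := isUnit_toeplitz_gram hs hdet
  set X : ℂ → ℂ → Mat2 := fun z lam =>
    Matrix.of fun i j => toepSeries hu (EuclideanSpace.single j 1) z lam i with hX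
  have hpr : ∀ i : Fin 2, ContDiff ℝ ∞ fun v : V2 => v i := fun i =>
    contDiff_clm_comp (EuclideanSpace.proj i : V2 →L[ℂ] ℂ) contDiff_id
  have hXs : ∀ i j, ContDiff ℝ ∞ fun q : ℂ × ℝ => X q.1 (circleMap 0 1 q.2) i j := fun i j =>
    (hpr i).comp (contDiff_toepSeries hu (EuclideanSpace.single j 1))
  refine ⟨X, fun i j => (hXs i j).contDiffOn, fun z i j => ?_, fun z i j => ?_,
    fun z i j n hn => ?_⟩
  · exact (EuclideanSpace.proj i : V2 →L[ℂ] ℂ).continuous.comp_continuousOn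
      (continuousOn_toepSeries hu _ z)
  · exact (EuclideanSpace.proj i : V2 →L[ℂ] ℂ).differentiable.comp_differentiableOn
      (differentiableOn_toepSeries hu _ z)
  · obtain ⟨Xc, hXc, hXL⟩ := exists_continuous_toepSol hu (EuclideanSpace.single j 1) z
    set A := symbolFamily (contDiff_gramSymbol hs) (periodic_gramSymbol L) (z, 0) with hA
    have h1 := toeplitz_eq_hardyConst_iff.1
      (toeplitz_toepSol hu (EuclideanSpace.single j 1) (z, 0)) (-n) (by omega)
    set Yc : C(Circ, V2) := ⟨fun s => A s (Xc s), by fun_prop⟩ with hYc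
    have h2 : mulOp A (toLV Xc) = toLV Yc := by
      apply Lp.ext
      filter_upwards [mulOp_ae A (toLV Xc), toLV_ae Xc, toLV_ae Yc] with s e1 e2 e3
      rw [e1, e2, e3]; rfl
    rw [← hXL, h2, coef_toLV] at h1
    set g : ℂ → ℂ := fun lam => (star (L z lam) * L z lam * X z lam) i j with hg
    have hgt : ∀ t : ℝ, Yc (t : Circ) i = g (circleMap 0 1 t) := fun t => by
      have e : Yc (t : Circ) = gramSymbol L z (t + 0) (Xc (t : Circ)) := by
        change A (t : Circ) (Xc (t : Circ)) = _
        rw [hA, symbolFamily, circleHat_coe]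
      rw [e, add_zero, hXc, gramSymbol, matCLM_apply, hg]
      exact (mat2_mul_apply (star (L z (circleMap 0 1 t)) * L z (circleMap 0 1 t))
        (X z (circleMap 0 1 t)) i j).symm
    have hgc : ContinuousOn g (sphere 0 1) := by
      refine continuousOn_sphere_of_comp one_pos ?_
      have : (fun t : ℝ => g (circleMap 0 1 t)) = fun t : ℝ => Yc (t : Circ) i :=
        funext fun t => (hgt t).symm
      rw [this]
      exact (EuclideanSpace.proj i : V2 →L[ℂ] ℂ).continuous.comp
        (Yc.continuous.comp (AddCircle.continuous_mk' _))
    have h3 := fourierCoeff_onAddCircle one_pos hgc (-n)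
    have h4 : fourierCoeff (onAddCircle 1 g zero_le_one hgc) (-n) =
        (EuclideanSpace.proj i : V2 →L[ℂ] ℂ) (∫ s, fourier (- -n) s • Yc s
          ∂(haarAddCircle : Measure Circ)) := by
      rw [← ContinuousLinearMap.integral_comp_comm]
      · rw [fourierCoeff]
        congr 1
        funext s
        refine circ_ext (f := fun s => fourier (- -n) s • onAddCircle 1 g zero_le_one hgc s)
          (g := fun s => (EuclideanSpace.proj i : V2 →L[ℂ] ℂ) (fourier (- -n) s • Yc s))
          (fun t => ?_) s
        rw [onAddCircle_coe, map_smul]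
        exact congrArg _ (hgt t).symm
      · exact ((map_continuous (fourier (- -n))).smul Yc.continuous).integrable_of_hasCompactSupport
          (HasCompactSupport.of_compactSpace _)
    rw [h4, h1] at h3
    have hpi : (2 * Real.pi : ℂ) ≠ 0 := by exact_mod_cast Real.two_pi_pos.ne'
    rw [neg_neg, Complex.ofReal_one, one_zpow, one_mul] at h3
    have h5 : mode 1 n g = 2 * Real.pi * (EuclideanSpace.proj i : V2 →L[ℂ] ℂ)
        (if -n = 0 then EuclideanSpace.single j 1 else 0) := by
      rw [h3, mul_inv_cancel_left₀ hpi]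
    rw [h5]
    by_cases hn0 : n = 0
    · simp [hn0, Matrix.one_apply]
    · simp [hn0]

end Gram

end DPW

end

noncomputable section

namespace DPW

open Set Metric MeasureTheory AddCircle

/-! ### Products of loops without positive powers -/

lemma integral_fourier_mul_mul (f g : C(Circ, ℂ)) (m : ℤ) :
    HasSum (fun i => fourierCoeff f (m - i) * fourierCoeff g i) (fourierCoeff (f * g : C(Circ, ℂ)) m) := by
  set x : C(Circ, ℂ) := star (fourier (-m) * f) with hx
  have h := fourierBasis.hasSum_inner_mul_inner
    (ContinuousMap.toLp (E := ℂ) 2 (haarAddCircle : Measure Circ) ℂ x)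
    (ContinuousMap.toLp (E := ℂ) 2 (haarAddCircle : Measure Circ) ℂ g)
  have e1 : ∀ i, inner ℂ (fourierBasis i)
      (ContinuousMap.toLp (E := ℂ) 2 (haarAddCircle : Measure Circ) ℂ g) = fourierCoeff g i :=
    fun i => by rw [← HilbertBasis.repr_apply_apply, fourierBasis_repr, fourierCoeff_toLp]
  have e2 : ∀ i, inner ℂ (ContinuousMap.toLp (E := ℂ) 2 (haarAddCircle : Measure Circ) ℂ x)
      (fourierBasis i) = fourierCoeff f (m - i) := fun i => by
    rw [coe_fourierBasis, fourierLp, ContinuousMap.inner_toLp, fourierCoeff]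
    congr 1
    funext s
    have e3 : (starRingEnd ℂ) (x s) = fourier (-m) s * f s := by
      simp only [hx, ContinuousMap.star_apply, ContinuousMap.mul_apply]
      exact star_star _
    rw [e3, neg_sub, sub_eq_add_neg, fourier_add, smul_eq_mul, mul_assoc]
  have e4 : inner ℂ (ContinuousMap.toLp (E := ℂ) 2 (haarAddCircle : Measure Circ) ℂ x)
      (ContinuousMap.toLp (E := ℂ) 2 (haarAddCircle : Measure Circ) ℂ g) =
      fourierCoeff (f * g : C(Circ, ℂ)) m := by
    rw [ContinuousMap.inner_toLp, fourierCoeff]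
    congr 1
    funext s
    have e3 : (starRingEnd ℂ) (x s) = fourier (-m) s * f s := by
      simp only [hx, ContinuousMap.star_apply, ContinuousMap.mul_apply]
      exact star_star _
    rw [e3, smul_eq_mul, ContinuousMap.mul_apply]; ring
  simp only [e1, e2, e4] at h
  exact h

/-- `u` is continuous on the unit circle, without positive powers of `lam`, and has the
constant term `a`. -/
structure NonPos (u : ℂ → ℂ) (a : ℂ) : Prop where
  cont : ContinuousOn u (sphere 0 1)
  neg : ∀ n : ℤ, n < 0 → mode 1 n u = 0
  zero : mode 1 0 u = 2 * Real.pi * a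

namespace NonPos

variable {u v : ℂ → ℂ} {a b : ℂ}

lemma add (hu : NonPos u a) (hv : NonPos v b) : NonPos (fun lam => u lam + v lam) (a + b) where
  cont := hu.cont.add hv.cont
  neg n hn := by rw [mode_add one_pos hu.cont hv.cont, hu.neg n hn, hv.neg n hn, add_zero]
  zero := by rw [mode_add one_pos hu.cont hv.cont, hu.zero, hv.zero, mul_add]

lemma const_mul (hu : NonPos u a) (k : ℂ) : NonPos (fun lam => k * u lam) (k * a) where
  cont := continuousOn_const.mul hu.cont
  neg n hn := by rw [mode_const_mul, hu.neg n hn, mul_zero]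
  zero := by rw [mode_const_mul, hu.zero]; ring

lemma sub (hu : NonPos u a) (hv : NonPos v b) : NonPos (fun lam => u lam - v lam) (a - b) := by
  simpa [sub_eq_add_neg] using hu.add (hv.const_mul (-1))

lemma congr (hu : NonPos u a) (h : ∀ lam ∈ sphere (0 : ℂ) 1, v lam = u lam) : NonPos v a where
  cont := hu.cont.congr h
  neg n hn := by rw [mode_congr zero_le_one h, hu.neg n hn]
  zero := by rw [mode_congr zero_le_one h, hu.zero]

lemma mul (hu : NonPos u a) (hv : NonPos v b) : NonPos (fun lam => u lam * v lam) (a * b) := by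
  have hpi : (2 * Real.pi : ℂ) ≠ 0 := by exact_mod_cast Real.two_pi_pos.ne'
  have hc : ContinuousOn (fun lam => u lam * v lam) (sphere 0 1) := hu.cont.mul hv.cont
  have key := integral_fourier_mul_mul (onAddCircle 1 u zero_le_one hu.cont)
    (onAddCircle 1 v zero_le_one hv.cont)
  have e : onAddCircle 1 u zero_le_one hu.cont * onAddCircle 1 v zero_le_one hv.cont =
    onAddCircle 1 _ zero_le_one hc := rfl
  rw [e] at key
  have hf : ∀ {g : ℂ → ℂ} (hg : ContinuousOn g (sphere 0 1)) (n : ℤ),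
      fourierCoeff (onAddCircle 1 g zero_le_one hg) n = (2 * Real.pi : ℂ)⁻¹ * mode 1 (-n) g :=
    fun hg n => by
      rw [fourierCoeff_onAddCircle one_pos hg, Complex.ofReal_one, one_zpow, one_mul]
  simp only [hf] at key
  have z : ∀ m i : ℤ, 0 ≤ m → i ≠ 0 ∨ 0 < m → (2 * Real.pi : ℂ)⁻¹ * mode 1 (-(m - i)) u *
      ((2 * Real.pi : ℂ)⁻¹ * mode 1 (-i) v) = 0 := fun m i hm h => by
    rcases lt_or_ge 0 i with hi | hi
    · rw [hv.neg (-i) (by omega)]; ring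
    · rw [hu.neg (-(m - i)) (by omega)]; ring
  refine ⟨hc, fun n hn => ?_, ?_⟩
  · have h1 := key (-n)
    have h2 := h1.unique ((hasSum_zero).congr_fun fun i => (z (-n) i (by omega) (Or.inr (by omega))))
    rw [neg_neg] at h2
    exact (mul_eq_zero.1 h2).resolve_left (inv_ne_zero hpi)
  · have h1 := key 0
    have h2 := h1.unique (hasSum_single 0 fun i hi => z 0 i le_rfl (Or.inl hi))
    simp only [sub_zero, neg_zero, hu.zero, hv.zero] at h2
    field_simp at h2
    rw [h2]; ring

lemma conj_of_holomorphic (hc : ContinuousOn u (closedBall 0 1)) (hd : DifferentiableOn ℂ u (ball 0 1)) :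
    NonPos (fun lam => (starRingEnd ℂ) (u lam)) ((starRingEnd ℂ) (u 0)) where
  cont := Complex.continuous_conj.comp_continuousOn (hc.mono sphere_subset_closedBall)
  neg n hn := by rw [mode_conj, mode_disc_pos one_pos (by omega) hc hd, map_zero]
  zero := by
    rw [mode_conj, neg_zero, mode_disc_zero one_pos hc hd, map_mul, map_mul, Complex.conj_ofReal,
      Complex.conj_ofNat]

lemma comp_neg (hu : NonPos u a) : NonPos (fun lam => u (-lam)) a where
  cont := hu.cont.comp continuousOn_neg fun lam h => by simpa using h
  neg n hn := by rw [mode_comp_neg, hu.neg n hn, mul_zero]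
  zero := by rw [mode_comp_neg, hu.zero, zpow_zero, one_mul]

lemma eq_const (hu : NonPos u a) (h : ∀ n : ℤ, 0 < n → mode 1 n u = 0) :
    ∀ lam ∈ sphere (0 : ℂ) 1, u lam = a := by
  refine eq_of_mode_eq one_pos hu.cont continuousOn_const fun n => ?_
  have h0 : mode 1 0 (fun _ => a) = 2 * Real.pi * a :=
    mode_disc_zero one_pos continuousOn_const (differentiableOn_const _)
  have h1 : ∀ n : ℤ, 0 < n → mode 1 n (fun _ => a) = 0 := fun n hn =>
    mode_disc_pos one_pos hn continuousOn_const (differentiableOn_const _)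
  rcases lt_trichotomy n 0 with hn | rfl | hn
  · rw [hu.neg n hn]
    have := mode_conj n (fun _ => (starRingEnd ℂ) a)
    rw [mode_disc_pos (g := fun _ => (starRingEnd ℂ) a) one_pos (by omega : 0 < -n)
      continuousOn_const (differentiableOn_const _), map_zero] at this
    simpa using this.symm
  · rw [hu.zero, h0]
  · rw [h n hn, h1 n hn]

lemma eq_const_of_holomorphic (hu : NonPos u a) (hc : ContinuousOn v (closedBall 0 1))
    (hd : DifferentiableOn ℂ v (ball 0 1)) (h : ∀ lam ∈ sphere (0 : ℂ) 1, v lam = u lam) :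
    ∀ lam ∈ closedBall (0 : ℂ) 1, v lam = a := by
  have h1 : ∀ lam ∈ sphere (0 : ℂ) 1, v lam = a := fun lam hlam => (h lam hlam).trans <|
    hu.eq_const (fun n hn => by
      rw [← mode_congr zero_le_one h, mode_disc_pos one_pos hn hc hd]) lam hlam
  have h2 := Complex.eqOn_closure_of_eqOn_frontier (isBounded_ball (x := (0 : ℂ)) (r := 1))
    (f := v) (g := fun _ => a) ⟨hd, by rwa [closure_ball _ one_ne_zero]⟩ diffContOnCl_const
    (by rw [frontier_ball _ one_ne_zero]; exact h1)
  rw [closure_ball _ one_ne_zero] at h2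
  exact h2

end NonPos

/-! ### The splitting of a single loop -/

section Single

variable {L X : ℂ → Mat2}

lemma det_star_mul_self {M : Mat2} (h : M.det = 1) : (star M * M).det = 1 := by
  rw [Matrix.det_mul, h, mul_one, Matrix.star_eq_conjTranspose, Matrix.det_conjTranspose, h, star_one]

/-- `X` is holomorphic in the disk, and `L* L X` has no positive powers and constant term `1`. -/
structure IsGramSolution (L X : ℂ → Mat2) : Prop where
  det_eq_one : ∀ lam ∈ sphere (0 : ℂ) 1, (L lam).det = 1
  cont : ∀ i j, ContinuousOn (fun lam => X lam i j) (closedBall 0 1)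
  holo : ∀ i j, DifferentiableOn ℂ (fun lam => X lam i j) (ball 0 1)
  nonPos : ∀ i j, NonPos (fun lam => (star (L lam) * L lam * X lam) i j) ((1 : Mat2) i j)

namespace IsGramSolution

lemma det_X (h : IsGramSolution L X) : ∀ lam ∈ closedBall (0 : ℂ) 1, (X lam).det = 1 := by
  have h1 := ((h.nonPos 0 0).mul (h.nonPos 1 1)).sub ((h.nonPos 0 1).mul (h.nonPos 1 0))
  have e : (1 : Mat2) 0 0 * (1 : Mat2) 1 1 - (1 : Mat2) 0 1 * (1 : Mat2) 1 0 = 1 := by simp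
  rw [e] at h1
  refine h1.eq_const_of_holomorphic ?_ ?_ fun lam hlam => ?_
  · simp only [Matrix.det_fin_two]
    exact ((h.cont _ _).mul (h.cont _ _)).sub ((h.cont _ _).mul (h.cont _ _))
  · simp only [Matrix.det_fin_two]
    exact ((h.holo _ _).mul (h.holo _ _)).sub ((h.holo _ _).mul (h.holo _ _))
  · rw [← Matrix.det_fin_two, Matrix.det_mul, det_star_mul_self (h.det_eq_one lam hlam), one_mul]

lemma unique {X' : ℂ → Mat2} (h : IsGramSolution L X) (h' : IsGramSolution L X') :
    ∀ lam ∈ closedBall (0 : ℂ) 1, X' lam = X lam := by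
  have key : ∀ i j, ∀ lam ∈ closedBall (0 : ℂ) 1,
      (!![X lam 1 1, -X lam 0 1; -X lam 1 0, X lam 0 0] * X' lam) i j = (1 : Mat2) i j := by
    intro i j
    set Y : ℂ → Mat2 := fun lam => star (L lam) * L lam * X lam with hY
    set Y' : ℂ → Mat2 := fun lam => star (L lam) * L lam * X' lam with hY'
    have hA : ∀ i k, NonPos (fun lam => !![Y lam 1 1, -Y lam 0 1; -Y lam 1 0, Y lam 0 0] i k)
        ((1 : Mat2) i k) := by
      intro i k
      fin_cases i <;> fin_cases k
      · simpa using h.nonPos 1 1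
      · simpa using (h.nonPos 0 1).const_mul (-1)
      · simpa using (h.nonPos 1 0).const_mul (-1)
      · simpa using h.nonPos 0 0
    have h1 := ((hA i 0).mul (h'.nonPos 0 j)).add ((hA i 1).mul (h'.nonPos 1 j))
    rw [← mat2_mul_apply, one_mul] at h1
    have hX : ∀ i k, ContinuousOn (fun lam => !![X lam 1 1, -X lam 0 1; -X lam 1 0, X lam 0 0] i k)
        (closedBall 0 1) := by
      intro i k
      fin_cases i <;> fin_cases k
      · simpa using h.cont 1 1
      · exact (h.cont 0 1).neg
      · exact (h.cont 1 0).neg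
      · simpa using h.cont 0 0
    have hXd : ∀ i k, DifferentiableOn ℂ
        (fun lam => !![X lam 1 1, -X lam 0 1; -X lam 1 0, X lam 0 0] i k) (ball 0 1) := by
      intro i k
      fin_cases i <;> fin_cases k
      · simpa using h.holo 1 1
      · simpa using (h.holo 0 1).neg
      · simpa using (h.holo 1 0).neg
      · simpa using h.holo 0 0
    refine h1.eq_const_of_holomorphic ?_ ?_ fun lam hlam => ?_
    · simp only [mat2_mul_apply]
      exact ((hX _ _).mul (h'.cont _ _)).add ((hX _ _).mul (h'.cont _ _))
    · simp only [mat2_mul_apply]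
      exact ((hXd _ _).mul (h'.holo _ _)).add ((hXd _ _).mul (h'.holo _ _))
    · have hl := sphere_subset_closedBall hlam
      have hdW := det_star_mul_self (h.det_eq_one lam hlam)
      have hdY : (Y lam).det = 1 := by rw [hY, Matrix.det_mul, hdW, h.det_X lam hl, one_mul]
      rw [← mat2_mul_apply, ← inv_eq_of_det_eq_one (h.det_X lam hl), ← inv_eq_of_det_eq_one hdY,
        hY]
      simp only
      rw [Matrix.mul_inv_rev, mul_assoc, ← mul_assoc (star (L lam) * L lam)⁻¹,
        inv_mul_of_det_eq_one hdW, one_mul]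
  intro lam hlam
  have h1 : (X lam)⁻¹ * X' lam = 1 := by
    rw [inv_eq_of_det_eq_one (h.det_X lam hlam)]
    ext i j; exact key i j lam hlam
  calc X' lam = X lam * ((X lam)⁻¹ * X' lam) := by
        rw [← mul_assoc, mul_inv_of_det_eq_one (h.det_X lam hlam), one_mul]
    _ = X lam := by rw [h1, mul_one]

lemma twisted (h : IsGramSolution L X) (hL : IsTwistedOn (sphere 0 1) L) :
    IsTwistedOn (closedBall 0 1) X := by
  have hneg : MapsTo (fun lam : ℂ => -lam) (closedBall 0 1) (closedBall 0 1) :=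
    fun lam h => by simpa using h
  have hneg' : MapsTo (fun lam : ℂ => -lam) (ball 0 1) (ball 0 1) :=
    fun lam h => by simpa using h
  have h' : IsGramSolution L fun lam => sigma3 * X (-lam) * sigma3 := by
    have hc : ∀ i j, ContinuousOn (fun lam => X (-lam) i j) (closedBall 0 1) := fun i j =>
      (h.cont i j).comp continuousOn_neg hneg
    have hd : ∀ i j, DifferentiableOn ℂ (fun lam => X (-lam) i j) (ball 0 1) := fun i j =>
      (h.holo i j).comp differentiable_neg.differentiableOn hneg'
    refine ⟨h.det_eq_one, fun i j => ?_, fun i j => ?_, fun i j => ?_⟩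
    · simp only [sigma3_conj_apply]
      fin_cases i <;> fin_cases j
      · simpa using hc 0 0
      · exact (hc 0 1).neg
      · exact (hc 1 0).neg
      · simpa using hc 1 1
    · simp only [sigma3_conj_apply]
      fin_cases i <;> fin_cases j
      · simpa using hd 0 0
      · simpa using (hd 0 1).neg
      · simpa using (hd 1 0).neg
      · simpa using hd 1 1
    · have key : ∀ lam ∈ sphere (0 : ℂ) 1, star (L lam) * L lam * (sigma3 * X (-lam) * sigma3) =
          sigma3 * (star (L (-lam)) * L (-lam) * X (-lam)) * sigma3 := fun lam hlam => by
        have e : star sigma3 = sigma3 := by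
          ext i j; fin_cases i <;> fin_cases j <;> simp [sigma3, Matrix.star_apply]
        have := hL lam hlam
        rw [this, star_mul, star_mul, e]
        simp only [← mul_assoc, sigma3_mul_self, one_mul]
        rw [mul_assoc (star (L lam)) sigma3 sigma3, sigma3_mul_self, mul_one]
      have hn := fun i j => (h.nonPos i j).comp_neg
      refine NonPos.congr (u := fun lam =>
        (sigma3 * (star (L (-lam)) * L (-lam) * X (-lam)) * sigma3) i j) ?_
        fun lam hlam => by rw [key lam hlam]
      simp only [sigma3_conj_apply]
      fin_cases i <;> fin_cases j
      · simpa using hn 0 0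
      · simpa using (hn 0 1).const_mul (-1)
      · simpa using (hn 1 0).const_mul (-1)
      · simpa using hn 1 1
  intro lam hlam
  have := h.unique h' lam hlam
  rw [← this]
  simp only [← mul_assoc, sigma3_mul_self, one_mul]
  rw [mul_assoc, sigma3_mul_self, mul_one]

lemma gram_eq (h : IsGramSolution L X) :
    ∀ lam ∈ sphere (0 : ℂ) 1, star (L lam * X lam) * (L lam * X lam) = X 0 := by
  have e : ∀ lam, star (L lam * X lam) * (L lam * X lam) =
      star (X lam) * (star (L lam) * L lam * X lam) := fun lam => by
    rw [star_mul]; simp only [mul_assoc]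
  have hn : ∀ i j, NonPos (fun lam => (star (L lam * X lam) * (L lam * X lam)) i j)
      ((starRingEnd ℂ) (X 0 j i)) := by
    intro i j
    have hX := fun k => NonPos.conj_of_holomorphic (h.cont k i) (h.holo k i)
    have h1 := ((hX 0).mul (h.nonPos 0 j)).add ((hX 1).mul (h.nonPos 1 j))
    have e2 : ∀ j, (starRingEnd ℂ) (X 0 0 i) * (1 : Mat2) 0 j + (starRingEnd ℂ) (X 0 1 i) *
        (1 : Mat2) 1 j = (starRingEnd ℂ) (X 0 j i) := by simp [Fin.forall_fin_two]
    rw [e2] at h1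
    refine h1.congr fun lam _ => ?_
    rw [e, mat2_mul_apply]
    rfl
  have hh : ∀ lam i j, (starRingEnd ℂ) ((star (L lam * X lam) * (L lam * X lam)) j i) =
      (star (L lam * X lam) * (L lam * X lam)) i j := fun lam i j => by
    have : star (star (L lam * X lam) * (L lam * X lam)) = star (L lam * X lam) * (L lam * X lam) := by
      rw [star_mul, star_star]
    conv_rhs => rw [← this]
    rfl
  have hc : ∀ i j, ∀ lam ∈ sphere (0 : ℂ) 1,
      (star (L lam * X lam) * (L lam * X lam)) i j = (starRingEnd ℂ) (X 0 j i) := fun i j =>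
    (hn i j).eq_const fun n hn0 => by
      have := mode_conj n (fun lam => (star (L lam * X lam) * (L lam * X lam)) j i)
      rw [(hn j i).neg (-n) (by omega), map_zero] at this
      simpa only [hh] using this
  intro lam hlam
  ext i j
  rw [← hh, hc j i lam hlam, Complex.conj_conj]

lemma exists_pos (h : IsGramSolution L X) (hL : IsTwistedOn (sphere 0 1) L) :
    0 < (X 0 0 0).re ∧ X 0 = !![((X 0 0 0).re : ℂ), 0; 0, ((X 0 0 0).re : ℂ)⁻¹] := by
  have h0 : (0 : ℂ) ∈ closedBall (0 : ℂ) 1 := by simp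
  have h1 : (1 : ℂ) ∈ sphere (0 : ℂ) 1 := by simp
  obtain ⟨-, t1, t2, -⟩ := isTwistedOn_iff.1 (h.twisted hL) 0 h0
  rw [neg_zero] at t1 t2
  have t1 : X 0 0 1 = 0 := by linear_combination t1 / 2
  have t2 : X 0 1 0 = 0 := by linear_combination t2 / 2
  have hd := h.det_X 0 h0
  rw [Matrix.det_fin_two, t1, zero_mul, sub_zero] at hd
  have hg := congrFun (congrFun (h.gram_eq 1 h1) 0) 0
  rw [star_mul_apply, ← Complex.normSq_eq_conj_mul_self, ← Complex.normSq_eq_conj_mul_self,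
    ← Complex.ofReal_add] at hg
  have hre : X 0 0 0 = ((X 0 0 0).re : ℂ) := by rw [← hg, Complex.ofReal_re]
  have hne : X 0 0 0 ≠ 0 := left_ne_zero_of_mul_eq_one hd
  refine ⟨lt_of_le_of_ne ?_ fun e => hne (by rw [hre, ← e, Complex.ofReal_zero]), ?_⟩
  · rw [← hg, Complex.ofReal_re]; exact add_nonneg (Complex.normSq_nonneg _) (Complex.normSq_nonneg _)
  · rw [← hre]
    ext i j
    fin_cases i <;> fin_cases j
    · rfl
    · simpa using t1
    · simpa using t2
    · simpa using eq_inv_of_mul_eq_one_right hd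

end IsGramSolution

end Single

end DPW

end

noncomputable section

namespace DPW

open Set Metric MeasureTheory AddCircle

/-! ### The Iwasawa splitting on the unit circle -/

lemma closedAnnulus_one : closedAnnulus 1 = sphere (0 : ℂ) 1 := by
  ext lam
  simp only [closedAnnulus, inv_one, mem_ofPred_eq, mem_sphere_zero_iff_norm]
  exact ⟨fun h => le_antisymm h.2 h.1, fun h => ⟨h.ge, h.le⟩⟩

/-- A positive diagonal matrix of determinant one. -/
def posDiag (ρ : ℝ) : Mat2 := !![(ρ : ℂ), 0; 0, (ρ : ℂ)⁻¹]

lemma posDiag_mul (ρ σ : ℝ) : posDiag ρ * posDiag σ = posDiag (ρ * σ) := by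
  ext i j
  rw [mat2_mul_apply]
  fin_cases i <;> fin_cases j <;> simp [posDiag, mul_comm]

lemma det_posDiag {ρ : ℝ} (h : 0 < ρ) : (posDiag ρ).det = 1 := by
  have : (ρ : ℂ) ≠ 0 := by exact_mod_cast h.ne'
  simp [posDiag, Matrix.det_fin_two, this]

lemma posDiag_one : posDiag 1 = 1 := by
  ext i j; fin_cases i <;> fin_cases j <;> simp [posDiag]

lemma posDiag_inv {ρ : ℝ} (h : 0 < ρ) : (posDiag ρ)⁻¹ = posDiag ρ⁻¹ :=
  Matrix.inv_eq_right_inv (by rw [posDiag_mul, mul_inv_cancel₀ h.ne', posDiag_one])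

lemma star_posDiag (ρ : ℝ) : star (posDiag ρ) = posDiag ρ := by
  ext i j; fin_cases i <;> fin_cases j <;> simp [posDiag, Matrix.star_apply]

lemma posDiag_twisted (ρ : ℝ) : sigma3 * posDiag ρ * sigma3 = posDiag ρ := by
  rw [sigma3_conj_apply]; simp [posDiag]

lemma contDiff_posDiag {Q : Type} [NormedAddCommGroup Q] [NormedSpace ℝ Q] {ρ : Q → ℝ}
    (h : ContDiff ℝ ∞ ρ) (h0 : ∀ q, 0 < ρ q) (i j : Fin 2) :
    ContDiff ℝ ∞ fun q => posDiag (ρ q) i j := by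
  have h1 : ContDiff ℝ ∞ fun q => (ρ q : ℂ) := Complex.ofRealCLM.contDiff.comp h
  fin_cases i <;> fin_cases j
  · exact h1
  · exact contDiff_const
  · exact contDiff_const
  · exact h1.inv fun q => by exact_mod_cast (h0 q).ne'

/-- Smooth families of loops on the unit circle split smoothly. -/
theorem exists_iwasawa {L : ℂ → ℂ → Mat2} (hL : ∀ z, IsLoop 1 (L z))
    (hs : JointlySmooth 1 univ L) :
    ∃ F B : ℂ → ℂ → Mat2, (∀ z, IsUnitaryLoop 1 (F z)) ∧ JointlySmooth 1 univ F ∧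
      (∀ z, IsPosLoop 1 (B z)) ∧ (∀ z, IsNormalized (B z)) ∧
      (∀ z, ∀ lam ∈ sphere (0 : ℂ) 1, L z lam = F z lam * B z lam) ∧
      ∀ z z', (∀ lam ∈ sphere (0 : ℂ) 1, star (L z' lam) * L z' lam = star (L z lam) * L z lam) →
        ∀ lam ∈ closedBall (0 : ℂ) 1, B z' lam = B z lam := by
  obtain ⟨X, hXs, hXc, hXd, hXm⟩ := exists_gram_solution hs fun z => (hL z).det_eq_one
  have hLc : ∀ z i j, ContinuousOn (fun lam => L z lam i j) (sphere 0 1) := fun z i j =>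
    continuousOn_sphere_of_comp one_pos ((hL z).smooth i j).continuous
  have hLcc : ∀ z i j, ContinuousOn (fun lam => star (L z lam) i j) (sphere 0 1) := fun z i j =>
    Complex.continuous_conj.comp_continuousOn (hLc z j i)
  have hG : ∀ z, IsGramSolution (L z) (X z) := fun z => by
    refine ⟨(hL z).det_eq_one, hXc z, hXd z, fun i j => ⟨?_, fun n hn => ?_, ?_⟩⟩
    · have h1 := fun k => (hXc z k j).mono sphere_subset_closedBall
      have h2 : ∀ i k, ContinuousOn (fun lam => (star (L z lam) * L z lam) i k) (sphere 0 1) :=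
        fun i k => by
          simp only [mat2_mul_apply]
          exact ((hLcc z _ _).mul (hLc z _ _)).add ((hLcc z _ _).mul (hLc z _ _))
      simp only [fun lam => mat2_mul_apply (star (L z lam) * L z lam) (X z lam)]
      exact ((h2 _ _).mul (h1 _)).add ((h2 _ _).mul (h1 _))
    · rw [hXm z i j n hn.le, if_neg hn.ne]
    · rw [hXm z i j 0 le_rfl, if_pos rfl]
  set ρ : ℂ → ℝ := fun z => (X z 0 0 0).re with hρ
  have hρ0 : ∀ z, 0 < ρ z := fun z => ((hG z).exists_pos (hL z).twisted).1
  have hX0 : ∀ z, X z 0 = posDiag (ρ z) := fun z => ((hG z).exists_pos (hL z).twisted).2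
  have hgram := fun z => (hG z).gram_eq
  have hLX : ∀ i j, ContDiff ℝ ∞ fun z => (L z 1 * X z 1) i j := fun i j => by
    have h1 := (hs.mul hXs) i j
    rw [univ_prod_univ, contDiffOn_univ] at h1
    have h2 := h1.comp (contDiff_id.prodMk (contDiff_const (c := (0 : ℝ))) : ContDiff ℝ ∞ fun z : ℂ => (z, (0 : ℝ)))
    simpa [Function.comp_def, circleMap] using h2
  have hρs : ContDiff ℝ ∞ ρ := by
    have h1 : ∀ z, X z 0 0 0 = (star (L z 1 * X z 1) * (L z 1 * X z 1)) 0 0 := fun z => by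
      rw [hgram z 1 (by simp)]
    have h2 : ContDiff ℝ ∞ fun z => X z 0 0 0 := by
      simp only [h1, star_mul_apply]
      have hc := fun i j => (Complex.conjCLE : ℂ →L[ℝ] ℂ).contDiff.comp (hLX i j)
      exact ((hc _ _).mul (hLX _ _)).add ((hc _ _).mul (hLX _ _))
    exact Complex.reCLM.contDiff.comp h2
  set σ : ℂ → ℝ := fun z => √(ρ z) with hσ
  have hσ0 : ∀ z, 0 < σ z := fun z => Real.sqrt_pos.2 (hρ0 z)
  have hσs : ContDiff ℝ ∞ σ := hρs.sqrt fun z => (hρ0 z).ne'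
  have hσρ : ∀ z, σ z * σ z = ρ z := fun z => Real.mul_self_sqrt (hρ0 z).le
  have hσi : ∀ z, (σ z)⁻¹ * ρ z * (σ z)⁻¹ = 1 := fun z => by
    rw [← hσρ]; field_simp [(hσ0 z).ne']
  have hXpos : ∀ z, IsPosLoop 1 (X z) := fun z =>
    ⟨fun i j => hXs.smooth_apply (mem_univ z) i j, hXc z, hXd z, (hG z).det_X,
      (hG z).twisted (hL z).twisted⟩
  have hRi : JointlySmooth 1 univ fun z _ => posDiag (σ z)⁻¹ :=
    jointlySmooth_of_fst fun i j => (contDiff_posDiag (hσs.inv fun z => (hσ0 z).ne')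
      (fun z => inv_pos.2 (hσ0 z)) i j).contDiffOn
  set F : ℂ → ℂ → Mat2 := fun z lam => L z lam * X z lam * posDiag (σ z)⁻¹ with hF
  have hFs : JointlySmooth 1 univ F := (hs.mul hXs).mul hRi
  have hFdet : ∀ z, ∀ lam ∈ sphere (0 : ℂ) 1, (F z lam).det = 1 := fun z lam hlam => by
    rw [hF]
    simp only
    rw [Matrix.det_mul, Matrix.det_mul, (hL z).det_eq_one lam hlam,
      (hG z).det_X lam (sphere_subset_closedBall hlam), det_posDiag (inv_pos.2 (hσ0 z)), one_mul,
      one_mul]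
  refine ⟨F, fun z lam => posDiag (σ z) * (X z lam)⁻¹, fun z => ?_, hFs, fun z => ?_, fun z => ?_,
    fun z lam hlam => ?_, fun z z' hzz lam hlam => ?_⟩
  · refine ⟨fun i j => hFs.smooth_apply (mem_univ z) i j, fun i j => ?_, fun i j => ?_, ?_, ?_,
      fun lam hlam => ?_⟩
    · rw [closedAnnulus_one]
      exact continuousOn_sphere_of_comp one_pos (hFs.smooth_apply (mem_univ z) i j).continuous
    · intro lam h
      rw [inv_one] at h
      exact absurd (h.1.trans h.2) (lt_irrefl _)
    · rw [closedAnnulus_one]; exact hFdet z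
    · rw [closedAnnulus_one]
      exact ((hL z).twisted.mul ((hXpos z).twisted.mono sphere_subset_closedBall)).mul
        fun _ _ => (posDiag_twisted _).symm
    · rw [Matrix.mem_unitaryGroup_iff']
      simp only [hF]
      rw [star_mul, star_posDiag, mul_assoc, ← mul_assoc _ _ (posDiag (σ z)⁻¹), hgram z lam hlam,
        hX0, posDiag_mul, posDiag_mul, ← mul_assoc, hσi, posDiag_one]
  · exact (IsPosLoop.const (det_posDiag (hσ0 z)) (posDiag_twisted _)).mul
      ((hXpos z).inv zero_le_one)
  · refine ⟨(σ z)⁻¹, inv_pos.2 (hσ0 z), ?_⟩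
    have : σ z * (ρ z)⁻¹ = (σ z)⁻¹ := by rw [← hσρ]; field_simp [(hσ0 z).ne']
    simp only
    rw [hX0, posDiag_inv (hρ0 z), posDiag_mul, this, posDiag]
  · have hX1 := (hG z).det_X lam (sphere_subset_closedBall hlam)
    simp only [hF]
    calc L z lam = L z lam * (X z lam * ((posDiag (σ z)⁻¹ * posDiag (σ z)) * (X z lam)⁻¹)) := by
          rw [posDiag_mul, inv_mul_cancel₀ (hσ0 z).ne', posDiag_one, one_mul,
            mul_inv_of_det_eq_one hX1, mul_one]
      _ = _ := by simp only [mul_assoc]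
  · have h1 : IsGramSolution (L z) (X z') := ⟨(hL z).det_eq_one, hXc z', hXd z', fun i j =>
      ((hG z').nonPos i j).congr fun lam hlam => by rw [hzz lam hlam]⟩
    have h2 := (hG z).unique h1
    have h3 : σ z' = σ z := by simp only [hσ, hρ, h2 0 (by simp)]
    simp only [h3, h2 lam hlam]

end DPW

end

noncomputable section

namespace DPW

open Set Metric MeasureTheory AddCircle

/-! ### Smyth surfaces -/

lemma jointlySmooth_Icc_one {U : Set ℂ} {F : ℂ → ℂ → Mat2} (hF : JointlySmooth 1 U F) :
    ∀ s ∈ Icc (1 : ℝ) 1, JointlySmooth s U F := fun s hs => by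
  rwa [show s = 1 from le_antisymm hs.2 hs.1]

theorem exists_isSmythSurface (ε H : ℝ) (lam₀ c : ℂ) (k : ℕ) :
    ∃ f : ℂ → E3, IsSmythSurface ε H lam₀ c k f := by
  obtain ⟨L, hL0, hLs, hLd, hLt, hLdet⟩ := exists_smyth_frame c k
  have hne : sphere (0 : ℂ) 1 ⊆ {0}ᶜ := fun lam h => by
    rintro rfl; simp at h
  have hs : JointlySmooth 1 univ L := jointlySmooth_of_contDiffOn zero_le_one hne hLs
  have hl : ∀ z, IsLoop 1 (L z) := fun z =>
    ⟨fun i j => hs.smooth_apply (mem_univ z) i j, fun lam _ => hLdet z lam,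
      (hLt z).mono (subset_univ _)⟩
  obtain ⟨F, B, hFu, hFs, hBp, hBn, hsp, -⟩ := exists_iwasawa hl hs
  exact ⟨_, L, F, B, ⟨fun z _ => hl z, fun z _ lam _ => hLd z lam, hs, fun z _ => hFu z,
    jointlySmooth_Icc_one hFs, fun z _ => hBp z, fun z _ => hBn z, fun z _ => hsp z⟩,
    fun lam _ => hL0 lam, fun z => rfl⟩

lemma xi_eq_offDiag (c : ℂ) (k : ℤ) : xi c k = offDiag (fun _ => 1) fun z => c * z ^ k := rfl

section

variable {ε H : ℝ} {lam₀ c : ℂ} {k : ℕ} {f : ℂ → E3}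

lemma IsSmythSurface.contDiff (h : IsSmythSurface ε H lam₀ c k f) (hlam : lam₀ ∈ sphere (0 : ℂ) 1) :
    ContDiffOn ℝ ∞ f univ := by
  obtain ⟨L, F, B, hd, -, hf⟩ := h
  have e : f = fun z => toR3 (symBobenko ε H (F z) lam₀) := funext hf
  rw [e]
  exact contDiffOn_symBobenko isOpen_univ (hd.smooth_F 1 ⟨le_rfl, le_rfl⟩)
    (fun z hz lam hl => hd.det_F one_pos ⟨le_rfl, le_rfl⟩ hz hl) hlam ε H

lemma IsSmythSurface.isCMCAt (h : IsSmythSurface ε H lam₀ c k f) (hlam : lam₀ ∈ sphere (0 : ℂ) 1)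
    (hε : ε = 1 ∨ ε = -1) (hH : H ≠ 0) (hc : c ≠ 0) {z : ℂ} (hz : ε = -1 → z ≠ 0) :
    IsCMCAt H f z := by
  obtain ⟨L, F, B, hd, -, hf⟩ := h
  have e : f = fun z => toR3 (symBobenko ε H (F z) lam₀) := funext hf
  rw [e]
  rw [xi_eq_offDiag] at hd
  refine hd.isCMCAt ⟨one_pos, le_rfl⟩ isOpen_univ (differentiableOn_const _) ?_ (mem_univ z) hlam hε
    hH (fun _ => one_ne_zero) fun h => mul_ne_zero hc (zpow_ne_zero _ (hz h))
  simp only [zpow_natCast]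
  exact (differentiableOn_id.pow k).const_mul c

theorem IsSmythSurface.isConformalCMC_compl (h : IsSmythSurface ε H lam₀ c k f)
    (hlam : lam₀ ∈ sphere (0 : ℂ) 1) (hε : ε = 1 ∨ ε = -1) (hH : H ≠ 0) (hc : c ≠ 0) :
    IsConformalCMC H {0}ᶜ f :=
  isConformalCMC_of_isCMCAt hH isOpen_compl_singleton ((h.contDiff hlam).mono (subset_univ _))
    fun _ hz => h.isCMCAt hlam hε hH hc fun _ => hz

theorem IsSmythSurface.isConformalCMC_univ (h : IsSmythSurface ε H lam₀ c k f)
    (hlam : lam₀ ∈ sphere (0 : ℂ) 1) (hε : ε = 1) (hH : H ≠ 0) (hc : c ≠ 0) :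
    IsConformalCMC H univ f :=
  isConformalCMC_of_isCMCAt hH isOpen_univ (h.contDiff hlam)
    fun _ _ => h.isCMCAt hlam (Or.inl hε) hH hc fun e => by rw [hε] at e; norm_num at e

theorem IsSmythSurface.isClosedDPWSurface (h : IsSmythSurface ε H lam₀ c k f) {Ω : Set ℂ}
    (hΩ : IsOpen Ω) : IsClosedDPWSurface 1 ε H lam₀ (xi c k) Ω f := by
  obtain ⟨L, F, B, hd, -, hf⟩ := h
  have h1 : IsDPWSurface 1 ε H lam₀ (xi c k) univ f := ⟨L, F, B, hd, fun z _ => hf z⟩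
  exact h1.pullback (hΩ.preimage Complex.continuous_exp) Complex.differentiable_exp.differentiableOn
    (mapsTo_univ _ _)

end

lemma IsConformalCMC.mono {H : ℝ} {U V : Set ℂ} {f : ℂ → E3} (h : IsConformalCMC H U f)
    (hV : V ⊆ U) : IsConformalCMC H V f := by
  obtain ⟨h1, h2, N, hN, h3⟩ := h
  exact ⟨h1.mono hV, fun z hz => h2 z (hV hz), N, hN.mono hV, fun z hz => h3 z (hV hz)⟩

lemma IsWindingAnnulus.subset {Ω : Set ℂ} (h : IsWindingAnnulus Ω) : Ω ⊆ {0}ᶜ := fun z hz => by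
  rintro rfl; exact h.zero_notMem hz

end DPW

end

noncomputable section

namespace DPW

open Set Metric MeasureTheory AddCircle

/-! ### Cauchy integrals depending on a parameter -/

lemma fourierCoeff_clm (n : ℤ) : ∃ Λ : C(Circ, ℂ) →L[ℂ] ℂ, ∀ f, Λ f = fourierCoeff f n :=
  ⟨(innerSL ℂ (fourierBasis (T := 2 * Real.pi) n)).comp
    (ContinuousMap.toLp (E := ℂ) 2 (haarAddCircle : Measure Circ) ℂ), fun f => by
    rw [ContinuousLinearMap.comp_apply, innerSL_apply_apply, ← HilbertBasis.repr_apply_apply,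
      fourierBasis_repr, fourierCoeff_toLp]⟩

lemma cauchy_circleMap {g : ℂ → ℂ} (hc : ContinuousOn g (closedBall 0 1))
    (hd : DifferentiableOn ℂ g (ball 0 1)) {lam : ℂ} (hlam : lam ∈ ball (0 : ℂ) 1) :
    g lam = (2 * Real.pi : ℂ)⁻¹ * ∫ t in (0 : ℝ)..2 * Real.pi,
      circleMap 0 1 t * (circleMap 0 1 t - lam)⁻¹ * g (circleMap 0 1 t) := by
  have h := Complex.two_pi_I_inv_smul_circleIntegral_sub_inv_smul_of_differentiable_on_off_countable
    (c := 0) (R := 1) (f := g) (s := ∅) countable_empty hlam hc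
    fun z hz => hd.differentiableAt (isOpen_ball.mem_nhds hz.1)
  rw [← h, circleIntegral]
  have e : (fun t : ℝ => deriv (circleMap 0 1) t •
      ((circleMap 0 1 t - lam)⁻¹ • g (circleMap 0 1 t))) = fun t : ℝ => Complex.I *
      (circleMap 0 1 t * (circleMap 0 1 t - lam)⁻¹ * g (circleMap 0 1 t)) := by
    funext t
    simp only [deriv_circleMap, smul_eq_mul]; ring
  rw [e, intervalIntegral.integral_const_mul, smul_eq_mul, mul_inv, ← mul_assoc, mul_assoc _ _ Complex.I,
    inv_mul_cancel₀ Complex.I_ne_zero, mul_one]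

/-- Smoothness on the unit circle of a family of functions holomorphic in the disk implies
smoothness on the smaller circles. -/
theorem contDiff_of_boundary {g : ℂ → ℂ → ℂ}
    (hs : ContDiff ℝ ∞ fun q : ℂ × ℝ => g q.1 (circleMap 0 1 q.2))
    (hc : ∀ z, ContinuousOn (g z) (closedBall 0 1))
    (hd : ∀ z, DifferentiableOn ℂ (g z) (ball 0 1)) {s : ℝ} (hs0 : 0 ≤ s) (hs1 : s < 1) :
    ContDiff ℝ ∞ fun q : ℂ × ℝ => g q.1 (circleMap 0 s q.2) := by
  have hmem : ∀ t, circleMap 0 s t ∈ ball (0 : ℂ) 1 := fun t =>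
    mem_ball_zero_iff.2 (by simpa [abs_of_nonneg hs0] using hs1)
  set G : ℂ × ℝ → ℝ → ℂ := fun q θ =>
    circleMap 0 1 θ * (circleMap 0 1 θ - circleMap 0 s q.2)⁻¹ * g q.1 (circleMap 0 1 θ) with hG
  have hne : ∀ θ t, circleMap 0 1 θ - circleMap 0 s t ≠ 0 := fun θ t h => by
    have h1 := circleMap_mem_sphere_zero zero_le_one θ
    rw [sub_eq_zero.1 h, mem_sphere_zero_iff_norm] at h1
    have h2 := mem_ball_zero_iff.1 (hmem t)
    exact h2.ne h1
  have hGs : ContDiff ℝ ∞ (Function.uncurry G) := by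
    have h1 : ContDiff ℝ ∞ fun p : (ℂ × ℝ) × ℝ => circleMap 0 1 p.2 :=
      (contDiff_circleMap_real 1).comp contDiff_snd
    have h2 : ContDiff ℝ ∞ fun p : (ℂ × ℝ) × ℝ => circleMap 0 s p.1.2 :=
      (contDiff_circleMap_real s).comp (contDiff_snd.comp contDiff_fst)
    have h3 : ContDiff ℝ ∞ fun p : (ℂ × ℝ) × ℝ => g p.1.1 (circleMap 0 1 p.2) :=
      hs.comp ((contDiff_fst.comp contDiff_fst).prodMk contDiff_snd)
    exact (h1.mul ((h1.sub h2).inv fun p => hne _ _)).mul h3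
  have hGp : ∀ q, Function.Periodic (G q) (2 * Real.pi) := fun q θ => by
    simp only [hG, periodic_circleMap 0 1 θ]
  obtain ⟨Λ, hΛ⟩ := fourierCoeff_clm 0
  have h1 := contDiff_clm_comp Λ (contDiff_circleHat hGs hGp)
  have e : (fun q : ℂ × ℝ => g q.1 (circleMap 0 s q.2)) = fun q =>
      Λ (circleHat (G q) (continuous_slice hGs.continuous q) (hGp q)) := by
    funext q
    rw [hΛ, fourierCoeff_eq_intervalIntegral _ 0 0, zero_add, cauchy_circleMap (hc q.1) (hd q.1) (hmem q.2)]
    simp only [neg_zero, fourier_zero, one_smul, circleHat_coe, hG, one_div, Complex.real_smul]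
    push_cast
    rfl
  rw [e]
  exact h1

/-! ### Reflection in the unit circle -/

lemma norm_mode_le_of_le {s : ℝ} (hs : 0 < s) {g : ℂ → ℂ} {M : ℝ}
    (hM : ∀ lam ∈ sphere (0 : ℂ) s, ‖g lam‖ ≤ M) (n : ℤ) :
    ‖mode s n g‖ ≤ s ^ n * M * (2 * Real.pi) := by
  have h := intervalIntegral.norm_integral_le_of_norm_le_const (a := 0) (b := 2 * Real.pi)
    (C := s ^ n * M) (f := fun t => (circleMap 0 s t) ^ n * g (circleMap 0 s t)) fun t _ => by
      rw [norm_mul, norm_zpow, norm_circleMap_zero, abs_of_pos hs]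
      gcongr
      exact hM _ (circleMap_mem_sphere_zero hs.le t)
  rwa [sub_zero, abs_of_pos Real.two_pi_pos] at h

lemma norm_mode_le {s : ℝ} (hs : 0 < s) {g : ℂ → ℂ} (hg : ContinuousOn g (sphere 0 s)) :
    ∃ C, 0 ≤ C ∧ ∀ n : ℤ, ‖mode s n g‖ ≤ C * s ^ n := by
  obtain ⟨M, hM⟩ := (isCompact_sphere (0 : ℂ) s).exists_bound_of_continuousOn hg
  have hM0 : 0 ≤ M := (norm_nonneg _).trans (hM _ (circleMap_mem_sphere_zero hs.le 0))
  exact ⟨M * (2 * Real.pi), by positivity, fun n => (norm_mode_le_of_le hs hM n).trans_eq (by ring)⟩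

lemma eq_zero_of_eq_zero_on_sphere {g : ℂ → ℂ} (hg : DifferentiableOn ℂ g {0}ᶜ)
    (h : ∀ lam ∈ sphere (0 : ℂ) 1, g lam = 0) {lam : ℂ} (hlam : lam ≠ 0) : g lam = 0 := by
  have hl : 0 < ‖lam‖ := norm_pos_iff.2 hlam
  have hsub : ∀ {r R : ℝ}, 0 < r → {lam : ℂ | r ≤ ‖lam‖ ∧ ‖lam‖ ≤ R} ⊆ {0}ᶜ :=
    fun hr lam hl h0 => by
      rw [mem_singleton_iff] at h0
      rw [h0, mem_ofPred_eq, norm_zero] at hl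
      exact hr.not_ge hl.1
  have hsub' : ∀ {r R : ℝ}, 0 < r → {lam : ℂ | r < ‖lam‖ ∧ ‖lam‖ < R} ⊆ {0}ᶜ :=
    fun hr lam hl => hsub hr ⟨hl.1.le, hl.2.le⟩
  rcases le_total ‖lam‖ 1 with h1 | h1
  · exact (eq_zero_on_outer_iff hl h1 (hg.continuousOn.mono (hsub hl)) (hg.mono (hsub' hl))).1 h lam
      (by simp)
  · exact (eq_zero_on_outer_iff one_pos h1 (hg.continuousOn.mono (hsub one_pos))
      (hg.mono (hsub' one_pos))).2 h lam (by simp)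

/-- Reflection: `u` and `v` are holomorphic in the punctured disk, and conjugate to each other on
the unit circle. -/
theorem exists_reflection {u v : ℂ → ℂ} (huc : ContinuousOn u (closedBall 0 1 \ {0}))
    (hud : DifferentiableOn ℂ u (ball 0 1 \ {0})) (hvc : ContinuousOn v (closedBall 0 1 \ {0}))
    (hvd : DifferentiableOn ℂ v (ball 0 1 \ {0}))
    (huv : ∀ lam ∈ sphere (0 : ℂ) 1, v lam = (starRingEnd ℂ) (u lam)) :
    ∃ U : ℂ → ℂ, DifferentiableOn ℂ U {0}ᶜ ∧ ∀ lam ∈ closedBall (0 : ℂ) 1 \ {0}, U lam = u lam := by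
  have hcA : ∀ {s : ℝ}, 0 < s → {lam : ℂ | s ≤ ‖lam‖ ∧ ‖lam‖ ≤ 1} ⊆ closedBall 0 1 \ {0} :=
    fun hs lam hl => ⟨mem_closedBall_zero_iff.2 hl.2, fun h0 => by
      rw [mem_singleton_iff] at h0
      rw [h0, mem_ofPred_eq, norm_zero] at hl
      exact hs.not_ge hl.1⟩
  have hdA : ∀ {s : ℝ}, 0 < s → {lam : ℂ | s < ‖lam‖ ∧ ‖lam‖ < 1} ⊆ ball 0 1 \ {0} :=
    fun hs lam hl => ⟨mem_ball_zero_iff.2 hl.2, (hcA hs ⟨hl.1.le, hl.2.le⟩).2⟩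
  have hS : ∀ {s : ℝ}, 0 < s → s ≤ 1 → sphere (0 : ℂ) s ⊆ closedBall 0 1 \ {0} := fun hs hs1 =>
    (sphere_subset_annulus_left hs1).trans (hcA hs)
  set a : ℤ → ℂ := fun n => (2 * Real.pi : ℂ)⁻¹ * mode 1 (-n) u with ha
  have hmode : ∀ {w : ℂ → ℂ}, ContinuousOn w (closedBall 0 1 \ {0}) →
      DifferentiableOn ℂ w (ball 0 1 \ {0}) → ∀ s : ℝ, 0 < s → s ≤ 1 →
      ∃ C, 0 ≤ C ∧ ∀ n : ℤ, ‖mode 1 n w‖ ≤ C * s ^ n := fun hw hwd s hs hs1 => by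
    obtain ⟨C, hC0, hC⟩ := norm_mode_le hs (hw.mono (hS hs hs1))
    exact ⟨C, hC0, fun n => by
      rw [mode_annulus hs hs1 n (hw.mono (hcA hs)) (hwd.mono (hdA hs))]; exact hC n⟩
  have hbound : ∀ s : ℝ, 0 < s → s ≤ 1 → ∃ C, 0 ≤ C ∧ ∀ n : ℤ, ‖a n‖ ≤ C * s ^ n.natAbs := by
    intro s hs hs1
    obtain ⟨C, hC0, hC⟩ := hmode huc hud s hs hs1
    obtain ⟨C', hC'0, hC'⟩ := hmode hvc hvd s hs hs1
    have hpi : ‖(2 * Real.pi : ℂ)⁻¹‖ = (2 * Real.pi)⁻¹ := by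
      rw [norm_inv, norm_mul, Complex.norm_real, Complex.norm_ofNat, Real.norm_of_nonneg Real.pi_pos.le]
    refine ⟨(2 * Real.pi)⁻¹ * (C + C'), by positivity, fun n => ?_⟩
    rw [ha]
    simp only
    rw [norm_mul, hpi, mul_assoc]
    gcongr
    have hsn : 0 ≤ s ^ n.natAbs := by positivity
    rcases le_total n 0 with hn | hn
    · have e : ((n.natAbs : ℕ) : ℤ) = -n := by omega
      have := hC (-n)
      rw [← e, zpow_natCast] at this
      rw [← e]
      nlinarith
    · have e : ((n.natAbs : ℕ) : ℤ) = n := by omega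
      have h1 := mode_conj n u
      rw [← mode_congr zero_le_one huv] at h1
      have h2 := hC' n
      rw [h1, Complex.norm_conj] at h2
      conv_rhs at h2 => rw [← e, zpow_natCast]
      nlinarith
  have hsumm : ∀ ρ : ℝ, 0 ≤ ρ → ρ < 1 → Summable fun n : ℤ => ρ ^ n.natAbs := fun ρ h0 h1 => by
    have hg := summable_geometric_of_lt_one h0 h1
    refine Summable.of_nat_of_neg ?_ ?_
    · simpa using hg
    · simpa using hg
  set U : ℂ → ℂ := fun lam => ∑' n : ℤ, a n * lam ^ n with hU
  have hterm : ∀ R : ℝ, 1 < R → ∃ C, 0 ≤ C ∧ ∀ n : ℤ, ∀ lam : ℂ, R⁻¹ < ‖lam‖ → ‖lam‖ < R →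
      ‖a n * lam ^ n‖ ≤ C * (1 / 2) ^ n.natAbs := by
    intro R hR
    obtain ⟨C, hC0, hC⟩ := hbound (2 * R)⁻¹ (by positivity) (inv_le_one_of_one_le₀ (by linarith))
    refine ⟨C, hC0, fun n lam h1 h2 => ?_⟩
    have hl : 0 < ‖lam‖ := (inv_pos.2 (by linarith)).trans h1
    have h3 : ‖lam ^ n‖ ≤ R ^ n.natAbs := by
      rw [norm_zpow]
      rcases le_total 0 n with hn | hn
      · conv_lhs => rw [show n = (n.natAbs : ℤ) by omega, zpow_natCast]
        gcongr
      · conv_lhs => rw [show n = -(n.natAbs : ℤ) by omega, zpow_neg, zpow_natCast, ← inv_pow]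
        have : ‖lam‖⁻¹ ≤ R := inv_le_of_inv_le₀ (by linarith) h1.le
        gcongr
    calc ‖a n * lam ^ n‖ ≤ (C * (2 * R)⁻¹ ^ n.natAbs) * R ^ n.natAbs := by
          rw [norm_mul]; gcongr; exact hC n
      _ = C * (1 / 2) ^ n.natAbs := by
          rw [mul_assoc, ← mul_pow]; congr 2; field_simp
  have hUd : DifferentiableOn ℂ U {0}ᶜ := by
    intro lam hlam
    have hl : 0 < ‖lam‖ := norm_pos_iff.2 hlam
    set R := max 1 (max ‖lam‖ ‖lam‖⁻¹) + 1 with hR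
    have hR1 : 1 < R := by rw [hR]; linarith [le_max_left 1 (max ‖lam‖ ‖lam‖⁻¹)]
    have hR2 : ‖lam‖ < R := by
      rw [hR]; linarith [le_max_right 1 (max ‖lam‖ ‖lam‖⁻¹), le_max_left ‖lam‖ ‖lam‖⁻¹]
    have hR3 : R⁻¹ < ‖lam‖ := by
      rw [inv_lt_comm₀ (by linarith) hl, hR]
      linarith [le_max_right 1 (max ‖lam‖ ‖lam‖⁻¹), le_max_right ‖lam‖ ‖lam‖⁻¹]
    obtain ⟨C, hC0, hC⟩ := hterm R hR1
    have hopen : IsOpen {lam : ℂ | R⁻¹ < ‖lam‖ ∧ ‖lam‖ < R} :=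
      (isOpen_lt continuous_const continuous_norm).inter (isOpen_lt continuous_norm continuous_const)
    have := Complex.differentiableOn_tsum_of_summable_norm (F := fun (n : ℤ) lam => a n * lam ^ n)
      ((hsumm (1 / 2) (by norm_num) (by norm_num)).mul_left C)
      (fun n => (DifferentiableOn.zpow differentiableOn_id (Or.inl fun x hx => by
        have hx1 : R⁻¹ < ‖x‖ := hx.1
        have : 0 < R⁻¹ := inv_pos.2 (by linarith)
        exact norm_pos_iff.1 (this.trans hx1))).const_mul _) hopen
      fun n x hx => hC n x hx.1 hx.2
    exact (this.differentiableAt (hopen.mem_nhds ⟨hR3, hR2⟩)).differentiableWithinAt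
  have hU1 : ∀ lam ∈ sphere (0 : ℂ) 1, U lam = u lam := by
    intro lam hlam
    obtain ⟨t, rfl⟩ := exists_circleMap_eq one_pos hlam
    have huS := huc.mono (hS one_pos le_rfl)
    have hco : ∀ n, fourierCoeff (onAddCircle 1 u zero_le_one huS) n = a n := fun n => by
      rw [fourierCoeff_onAddCircle one_pos huS, Complex.ofReal_one, one_zpow, one_mul]
    have hsm : Summable (fourierCoeff (onAddCircle 1 u zero_le_one huS)) := by
      obtain ⟨C, hC0, hC⟩ := hbound (1 / 2) (by norm_num) (by norm_num)
      refine Summable.of_norm_bounded ((hsumm (1 / 2) (by norm_num) (by norm_num)).mul_left C)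
        fun n => by rw [hco]; exact hC n
    have h1 := has_pointwise_sum_fourier_series_of_summable hsm (t : Circ)
    rw [onAddCircle_coe] at h1
    rw [← h1.tsum_eq, hU]
    refine tsum_congr fun n => ?_
    rw [hco, fourier_two_pi_coe, smul_eq_mul]
  refine ⟨U, hUd, fun lam hlam => ?_⟩
  have hl : 0 < ‖lam‖ := norm_pos_iff.2 hlam.2
  have hl1 : ‖lam‖ ≤ 1 := mem_closedBall_zero_iff.1 hlam.1
  refine sub_eq_zero.1 ((eq_zero_on_outer_iff (g := fun lam => U lam - u lam) hl hl1 ?_ ?_).1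
    (fun lam hlam => sub_eq_zero.2 (hU1 lam hlam)) lam (by simp))
  · exact (hUd.continuousOn.mono fun x hx => (hcA hl hx).2).sub (huc.mono (hcA hl))
  · exact (hUd.mono fun x hx => (hdA hl hx).2).sub (hud.mono (hdA hl))

end DPW

end

noncomputable section

namespace DPW

open Set Metric MeasureTheory AddCircle

/-! ### The splitting of loops which are holomorphic in the punctured plane -/

lemma conj_apply_of_unitary {M : Mat2} (hM : M ∈ Matrix.unitaryGroup (Fin 2) ℂ) (hd : M.det = 1) :
    M 1 1 = (starRingEnd ℂ) (M 0 0) ∧ M 0 1 = (starRingEnd ℂ) (-M 1 0) := by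
  have h1 : star M = M⁻¹ := by
    have := Matrix.mem_unitaryGroup_iff'.1 hM
    exact (Matrix.inv_eq_left_inv this).symm
  rw [inv_eq_of_det_eq_one hd] at h1
  have h00 := congrFun (congrFun h1 0) 0
  have h01 := congrFun (congrFun h1 0) 1
  rw [Matrix.star_apply] at h00 h01
  simp only [Matrix.of_apply, Matrix.cons_val', Matrix.cons_val_zero, Matrix.cons_val_one] at h00 h01
  refine ⟨h00.symm, ?_⟩
  rw [map_neg]
  exact (neg_eq_iff_eq_neg.2 h01).symm

lemma exists_reflection_matrix {F : ℂ → Mat2}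
    (hc : ∀ i j, ContinuousOn (fun lam => F lam i j) (closedBall 0 1 \ {0}))
    (hd : ∀ i j, DifferentiableOn ℂ (fun lam => F lam i j) (ball 0 1 \ {0}))
    (hu : ∀ lam ∈ sphere (0 : ℂ) 1, F lam ∈ Matrix.unitaryGroup (Fin 2) ℂ)
    (hdet : ∀ lam ∈ sphere (0 : ℂ) 1, (F lam).det = 1) :
    ∃ G : ℂ → Mat2, (∀ i j, DifferentiableOn ℂ (fun lam => G lam i j) {0}ᶜ) ∧
      ∀ lam ∈ closedBall (0 : ℂ) 1 \ {0}, G lam = F lam := by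
  have h := fun lam hlam => conj_apply_of_unitary (hu lam hlam) (hdet lam hlam)
  obtain ⟨a, ha, hae⟩ := exists_reflection (hc 0 0) (hd 0 0) (hc 1 1) (hd 1 1) fun lam hl => (h lam hl).1
  obtain ⟨d, hd', hde⟩ := exists_reflection (hc 1 1) (hd 1 1) (hc 0 0) (hd 0 0) fun lam hl => by
    rw [(h lam hl).1, Complex.conj_conj]
  obtain ⟨b, hb, hbe⟩ := exists_reflection (hc 0 1) (hd 0 1) (v := fun lam => -F lam 1 0)
    (hc 1 0).neg (hd 1 0).neg fun lam hl => by rw [(h lam hl).2, Complex.conj_conj]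
  obtain ⟨c, hc', hce⟩ := exists_reflection (u := fun lam => -F lam 1 0) (hc 1 0).neg (hd 1 0).neg
    (hc 0 1) (hd 0 1) fun lam hl => (h lam hl).2
  refine ⟨fun lam => !![a lam, b lam; -c lam, d lam], fun i j => ?_, fun lam hl => ?_⟩
  · fin_cases i <;> fin_cases j
    · exact ha
    · exact hb
    · exact hc'.neg
    · exact hd'
  · ext i j
    fin_cases i <;> fin_cases j
    · exact hae lam hl
    · exact hbe lam hl
    · simpa using congrArg Neg.neg (hce lam hl)
    · exact hde lam hl

lemma closedAnnulus_subset {r : ℝ} (hr : 0 < r) : closedAnnulus r ⊆ {0}ᶜ := fun lam hl h0 => by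
  rw [mem_singleton_iff] at h0
  rw [h0, closedAnnulus, mem_ofPred_eq, norm_zero] at hl
  exact hr.not_ge hl.1

lemma isUnitaryLoop_of_differentiableOn {r : ℝ} (hr : 0 < r) {G : ℂ → Mat2}
    (hG : ∀ i j, DifferentiableOn ℂ (fun lam => G lam i j) {0}ᶜ)
    (hdet : ∀ lam ∈ sphere (0 : ℂ) 1, (G lam).det = 1) (ht : IsTwistedOn (sphere 0 1) G)
    (hu : ∀ lam ∈ sphere (0 : ℂ) 1, G lam ∈ Matrix.unitaryGroup (Fin 2) ℂ) :
    IsUnitaryLoop r G where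
  smooth i j := by
    rw [← contDiffOn_univ]
    exact (contDiffOn_real_of_differentiableOn isOpen_compl_singleton (hG i j)).comp
      (contDiff_circleMap_real r).contDiffOn fun t _ => circleMap_zero_ne_zero hr t
  continuousOn i j := (hG i j).continuousOn.mono (closedAnnulus_subset hr)
  holomorphic i j := (hG i j).mono fun lam hl => closedAnnulus_subset hr ⟨hl.1.le, hl.2.le⟩
  det_eq_one lam hl := by
    refine sub_eq_zero.1 (eq_zero_of_eq_zero_on_sphere (g := fun lam => (G lam).det - 1) ?_
      (fun lam hl => sub_eq_zero.2 (hdet lam hl)) (closedAnnulus_subset hr hl))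
    simp only [Matrix.det_fin_two]
    exact (((hG _ _).mul (hG _ _)).sub ((hG _ _).mul (hG _ _))).sub (differentiableOn_const _)
  twisted lam hl := by
    have hneg : MapsTo (fun lam : ℂ => -lam) {0}ᶜ {0}ᶜ := fun x hx => by simpa using hx
    ext i j
    refine sub_eq_zero.1 (eq_zero_of_eq_zero_on_sphere
      (g := fun lam => G (-lam) i j - (sigma3 * G lam * sigma3) i j) ?_
      (fun lam hl => sub_eq_zero.2 (by rw [ht lam hl])) (closedAnnulus_subset hr hl))
    refine ((hG i j).comp differentiable_neg.differentiableOn hneg).sub ?_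
    simp only [sigma3_conj_apply]
    fin_cases i <;> fin_cases j
    · exact hG 0 0
    · exact (hG 0 1).neg
    · exact (hG 1 0).neg
    · exact hG 1 1
  unitary := hu

theorem exists_iwasawa_of_contDiffOn {L : ℂ → ℂ → Mat2}
    (hL : ∀ i j, ContDiffOn ℂ ∞ (fun q : ℂ × ℂ => L q.1 q.2 i j) (univ ×ˢ {0}ᶜ))
    (hdet : ∀ z, ∀ lam ≠ 0, (L z lam).det = 1) (ht : ∀ z, IsTwistedOn {0}ᶜ (L z)) {r : ℝ}
    (hr : 0 < r) (hr1 : r < 1) :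
    ∃ F B : ℂ → ℂ → Mat2, (∀ z, IsUnitaryLoop r (F z)) ∧ (∀ s ∈ Icc r 1, JointlySmooth s univ F) ∧
      (∀ z, IsPosLoop r (B z)) ∧ (∀ z, IsNormalized (B z)) ∧
      (∀ z, ∀ lam ∈ closedBall (0 : ℂ) 1 \ {0}, L z lam = F z lam * B z lam) ∧
      ∀ z z', (∀ lam ∈ sphere (0 : ℂ) 1, star (L z' lam) * L z' lam = star (L z lam) * L z lam) →
        ∀ lam ∈ closedBall (0 : ℂ) 1, B z' lam = B z lam := by
  have hsub : ∀ {s : ℝ}, 0 < s → sphere (0 : ℂ) s ⊆ {0}ᶜ := fun hs lam h => by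
    rintro rfl; simp at h; exact hs.ne h
  have hLs : ∀ s : ℝ, 0 < s → JointlySmooth s univ L := fun s hs =>
    jointlySmooth_of_contDiffOn hs.le (hsub hs) hL
  have hl : ∀ z, IsLoop 1 (L z) := fun z =>
    ⟨fun i j => (hLs 1 one_pos).smooth_apply (mem_univ z) i j,
      fun lam h => hdet z lam (hsub one_pos h), (ht z).mono (hsub one_pos)⟩
  have hLz : ∀ z i j, DifferentiableOn ℂ (fun lam => L z lam i j) {0}ᶜ := fun z i j =>
    ((hL i j).comp (f := fun lam => (z, lam)) (contDiffOn_const.prodMk contDiffOn_id)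
      fun lam hlam => ⟨mem_univ _, hlam⟩).differentiableOn (by simp)
  obtain ⟨F, B, hFu, hFs, hBp, hBn, hsp, hBu⟩ := exists_iwasawa hl (hLs 1 one_pos)
  have hBi := fun z => (hBp z).inv zero_le_one
  have hBs : ∀ s : ℝ, 0 ≤ s → s ≤ 1 → JointlySmooth s univ B := fun s hs0 hs1 => by
    have h1 : JointlySmooth 1 univ B := by
      refine JointlySmooth.congr zero_le_one (((hFs.inv zero_le_one fun z _ lam h =>
        (hFu z).det_eq_one lam (closedAnnulus_one ▸ h))).mul (hLs 1 one_pos)) fun z _ lam h => ?_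
      rw [hsp z lam h, ← mul_assoc, inv_mul_of_det_eq_one ((hFu z).det_eq_one lam
        (closedAnnulus_one ▸ h)), one_mul]
    rcases hs1.lt_or_eq with h | rfl
    · intro i j
      rw [univ_prod_univ, contDiffOn_univ]
      have h2 := h1 i j
      rw [univ_prod_univ, contDiffOn_univ] at h2
      exact contDiff_of_boundary (g := fun z lam => B z lam i j) h2
        (fun z => (hBp z).continuousOn i j) (fun z => (hBp z).holomorphic i j) hs0 h
    · exact h1
  have hP : ∀ z, ∀ lam ∈ sphere (0 : ℂ) 1, L z lam * (B z lam)⁻¹ = F z lam := fun z lam h => by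
    rw [hsp z lam h, mul_assoc, mul_inv_of_det_eq_one ((hBp z).det_eq_one lam
      (sphere_subset_closedBall h)), mul_one]
  have hc : ∀ z i j, ContinuousOn (fun lam => (L z lam * (B z lam)⁻¹) i j) (closedBall 0 1 \ {0}) := by
    intro z i j
    simp only [mat2_mul_apply]
    have h1 := fun i j => (hLz z i j).continuousOn.mono (s := {0}ᶜ) (t := closedBall 0 1 \ {0})
      fun x hx => hx.2
    have h2 := fun i j => ((hBi z).continuousOn i j).mono
      (sdiff_subset : closedBall (0 : ℂ) 1 \ {0} ⊆ _)
    exact ((h1 _ _).mul (h2 _ _)).add ((h1 _ _).mul (h2 _ _))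
  have hd : ∀ z i j, DifferentiableOn ℂ (fun lam => (L z lam * (B z lam)⁻¹) i j) (ball 0 1 \ {0}) := by
    intro z i j
    simp only [mat2_mul_apply]
    have h1 := fun i j => (hLz z i j).mono (t := {0}ᶜ) (s := ball 0 1 \ {0}) fun x hx => hx.2
    have h2 := fun i j => ((hBi z).holomorphic i j).mono (sdiff_subset : ball (0 : ℂ) 1 \ {0} ⊆ _)
    exact ((h1 _ _).mul (h2 _ _)).add ((h1 _ _).mul (h2 _ _))
  choose G hGd hGe using fun z => exists_reflection_matrix (hc z) (hd z)
    (fun lam h => by rw [hP z lam h]; exact (hFu z).unitary lam h)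
    (fun lam h => by rw [hP z lam h]; exact (hFu z).det_eq_one lam (closedAnnulus_one ▸ h))
  have hG1 : ∀ z, ∀ lam ∈ sphere (0 : ℂ) 1, G z lam = F z lam := fun z lam h =>
    (hGe z lam ⟨sphere_subset_closedBall h, hsub one_pos h⟩).trans (hP z lam h)
  have hneg1 : ∀ lam ∈ sphere (0 : ℂ) 1, -lam ∈ sphere (0 : ℂ) 1 := fun lam h => by simpa using h
  refine ⟨G, B, fun z => ?_, fun s hs => ?_, fun z => ?_, hBn, fun z lam h => ?_, hBu⟩
  · refine isUnitaryLoop_of_differentiableOn hr (hGd z) (fun lam h => ?_) (fun lam h => ?_)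
      fun lam h => ?_
    · rw [hG1 z lam h]; exact (hFu z).det_eq_one lam (closedAnnulus_one ▸ h)
    · rw [hG1 z lam h, hG1 z (-lam) (hneg1 lam h)]
      exact (hFu z).twisted lam (closedAnnulus_one ▸ h)
    · rw [hG1 z lam h]; exact (hFu z).unitary lam h
  · have hs0 : 0 < s := hr.trans_le hs.1
    have hsB : sphere (0 : ℂ) s ⊆ closedBall 0 1 := fun lam h => by
      rw [mem_sphere_zero_iff_norm] at h
      simpa [h] using hs.2
    exact ((hLs s hs0).mul ((hBs s hs0.le hs.2).inv hs0.le fun z _ lam h =>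
      (hBp z).det_eq_one lam (hsB h))).congr hs0.le fun z _ lam h => hGe z lam ⟨hsB h, hsub hs0 h⟩
  · have hrb : closedBall (0 : ℂ) r ⊆ ball 0 1 := closedBall_subset_ball hr1
    exact isPosLoop_of_contDiffOn hr.le hrb
      (fun i j => ((hBp z).holomorphic i j).contDiffOn isOpen_ball)
      (fun lam h => (hBp z).det_eq_one lam (ball_subset_closedBall h))
      ((hBp z).twisted.mono (hrb.trans ball_subset_closedBall))
  · rw [hGe z lam h, mul_assoc, inv_mul_of_det_eq_one ((hBp z).det_eq_one lam h.1), mul_one]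

end DPW

end

noncomputable section

namespace DPW

open Set Metric MeasureTheory AddCircle

/-! ### Exponentials of off-diagonal matrices -/

/-- `C` is the entire function `cosh √x`, with first and second derivatives `C'` and `C''`. -/
structure IsCoshSqrt (C C' C'' : ℂ → ℂ) : Prop where
  contDiff : ContDiff ℂ ∞ C
  contDiff' : ContDiff ℂ ∞ C'
  deriv : ∀ x, HasDerivAt C (C' x) x
  deriv' : ∀ x, HasDerivAt C' (C'' x) x
  zero : C 0 = 1
  ode : ∀ x, 2 * C' x + 4 * (x * C'' x) = C x

theorem exists_coshSqrt : ∃ C C' C'' : ℂ → ℂ, IsCoshSqrt C C' C'' := by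
  obtain ⟨a, ha, ha0, hae⟩ := exists_entire_solution (α := 2) (β := 4) (by norm_num) (by norm_num) 1
    factBounded_zero
  refine ⟨ent a, ent (dcoef a), ent (dcoef (dcoef a)), ha.contDiff, ha.dcoef.contDiff, ha.hasDerivAt,
    ha.dcoef.hasDerivAt, by rw [ent_zero, ha0], fun x => ?_⟩
  have := hae x
  rw [ent_zero_fun, add_zero] at this
  exact_mod_cast this

section CoshSqrt

variable {C C' C'' : ℂ → ℂ}

lemma IsCoshSqrt.apply_sq (h : IsCoshSqrt C C' C'') (y : ℂ) : C (y ^ 2) = Complex.cosh y ∧ 2 * y * C' (y ^ 2) = Complex.sinh y := by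
  have hsq : ∀ y : ℂ, HasDerivAt (fun y : ℂ => y ^ 2) (2 * y) y := fun y => by
    simpa using hasDerivAt_pow 2 y
  have hC : ∀ y : ℂ, HasDerivAt (fun y => C (y ^ 2)) (C' (y ^ 2) * (2 * y)) y := fun y =>
    (h.deriv _).comp y (hsq y)
  have hC' : ∀ y : ℂ, HasDerivAt (fun y => 2 * y * C' (y ^ 2))
      (2 * C' (y ^ 2) + 2 * y * (C'' (y ^ 2) * (2 * y))) y := fun y => by
    have := ((hasDerivAt_id y).const_mul 2).mul ((h.deriv' (y ^ 2)).comp y (hsq y))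
    refine this.congr_deriv ?_
    simp
  have hg : ∀ y : ℂ, HasDerivAt (fun y => C (y ^ 2) * Complex.cosh y -
      2 * y * C' (y ^ 2) * Complex.sinh y) 0 y := fun y => by
    refine (((hC y).mul (Complex.hasDerivAt_cosh y)).sub
      ((hC' y).mul (Complex.hasDerivAt_sinh y))).congr_deriv ?_
    linear_combination (-Complex.sinh y) * h.ode (y ^ 2)
  have hh : ∀ y : ℂ, HasDerivAt (fun y => C (y ^ 2) * Complex.sinh y -
      2 * y * C' (y ^ 2) * Complex.cosh y) 0 y := fun y => by
    refine (((hC y).mul (Complex.hasDerivAt_sinh y)).sub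
      ((hC' y).mul (Complex.hasDerivAt_cosh y))).congr_deriv ?_
    linear_combination (-Complex.cosh y) * h.ode (y ^ 2)
  have eg := is_const_of_deriv_eq_zero (fun y => (hg y).differentiableAt) (fun y => (hg y).deriv) y 0
  have eh := is_const_of_deriv_eq_zero (fun y => (hh y).differentiableAt) (fun y => (hh y).deriv) y 0
  simp only [ne_eq, OfNat.ofNat_ne_zero, not_false_eq_true, zero_pow, h.zero, Complex.cosh_zero, mul_one,
    Complex.sinh_zero, mul_zero, sub_zero, zero_mul] at eg eh
  have hid := Complex.cosh_sq_sub_sinh_sq y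
  constructor
  · linear_combination Complex.cosh y * eg - Complex.sinh y * eh - C (y ^ 2) * hid
  · linear_combination Complex.sinh y * eg - Complex.cosh y * eh - 2 * y * C' (y ^ 2) * hid

lemma IsCoshSqrt.conj_apply (h : IsCoshSqrt C C' C'') (x : ℝ) : (starRingEnd ℂ) (C x) = C x ∧ (starRingEnd ℂ) (C' x) = C' x := by
  have key : ∀ y : ℂ, y ^ 2 = x → y ≠ 0 → (starRingEnd ℂ) y = y ∨ (starRingEnd ℂ) y = -y →
      (starRingEnd ℂ) (C x) = C x ∧ (starRingEnd ℂ) (C' x) = C' x := fun y hy hy0 hyc => by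
    obtain ⟨e1, e2⟩ := h.apply_sq y
    rw [hy] at e1 e2
    have e3 := congrArg (starRingEnd ℂ) e2
    rw [map_mul, map_mul, Complex.conj_ofNat, ← Complex.sinh_conj] at e3
    rcases hyc with hyc | hyc
    · refine ⟨by rw [e1, ← Complex.cosh_conj, hyc], ?_⟩
      rw [hyc, ← e2] at e3
      exact mul_left_cancel₀ (mul_ne_zero two_ne_zero hy0) e3
    · refine ⟨by rw [e1, ← Complex.cosh_conj, hyc, Complex.cosh_neg], ?_⟩
      rw [hyc, Complex.sinh_neg, ← e2] at e3
      refine mul_left_cancel₀ (mul_ne_zero two_ne_zero hy0) ?_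
      linear_combination -e3
  rcases lt_trichotomy x 0 with hx | rfl | hx
  · refine key (Complex.I * (√(-x) : ℝ)) ?_ ?_ (Or.inr ?_)
    · rw [mul_pow, Complex.I_sq, ← Complex.ofReal_pow, Real.sq_sqrt (by linarith)]
      push_cast; ring
    · exact mul_ne_zero Complex.I_ne_zero (by exact_mod_cast (Real.sqrt_pos.2 (by linarith)).ne')
    · rw [map_mul, Complex.conj_I, Complex.conj_ofReal]; ring
  · have := h.ode 0
    have e : C' 0 = 1 / 2 := by rw [h.zero] at this; linear_combination this / 2
    rw [Complex.ofReal_zero, h.zero, e, map_div₀, map_one, Complex.conj_ofNat]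
    exact ⟨rfl, rfl⟩
  · refine key (√x : ℝ) ?_ ?_ (Or.inl (Complex.conj_ofReal _))
    · rw [← Complex.ofReal_pow, Real.sq_sqrt hx.le]
    · exact_mod_cast (Real.sqrt_pos.2 hx).ne'

end CoshSqrt

end DPW

end

noncomputable section

namespace DPW

open Set Metric MeasureTheory AddCircle

/-- The exponential of `w [[0, p], [q, 0]]`. -/
def offExp (C C' : ℂ → ℂ) (w p q : ℂ) : Mat2 :=
  !![C (w ^ 2 * (p * q)), 2 * w * C' (w ^ 2 * (p * q)) * p;
    2 * w * C' (w ^ 2 * (p * q)) * q, C (w ^ 2 * (p * q))]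

section OffExp

variable {C C' C'' : ℂ → ℂ}

lemma IsCoshSqrt.hasDerivAt_offExp (h : IsCoshSqrt C C' C'') (p q w : ℂ) (i j : Fin 2) :
    HasDerivAt (fun w => offExp C C' w p q i j) ((offExp C C' w p q * !![0, p; q, 0]) i j) w := by
  have hx : HasDerivAt (fun w : ℂ => w ^ 2 * (p * q)) (2 * w * (p * q)) w := by
    simpa using (hasDerivAt_pow 2 w).mul_const (p * q)
  have hC : HasDerivAt (fun w : ℂ => C (w ^ 2 * (p * q)))
      (C' (w ^ 2 * (p * q)) * (2 * w * (p * q))) w := (h.deriv _).comp w hx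
  have hC' : ∀ k : ℂ, HasDerivAt (fun w : ℂ => 2 * w * C' (w ^ 2 * (p * q)) * k)
      (C (w ^ 2 * (p * q)) * k) w := fun k => by
    refine ((((hasDerivAt_id w).const_mul 2).mul ((h.deriv' _).comp w hx)).mul_const k).congr_deriv ?_
    simp only [id, Function.comp]
    linear_combination k * h.ode (w ^ 2 * (p * q))
  rw [mat2_mul_apply]
  fin_cases i <;> fin_cases j
  · exact hC.congr_deriv (by simp [offExp]; ring)
  · exact (hC' p).congr_deriv (by simp [offExp])
  · exact (hC' q).congr_deriv (by simp [offExp])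
  · exact hC.congr_deriv (by simp [offExp]; ring)

lemma IsCoshSqrt.offExp_zero (h : IsCoshSqrt C C' C'') (p q : ℂ) : offExp C C' 0 p q = 1 := by
  ext i j; fin_cases i <;> fin_cases j <;> simp [offExp, h.zero]

lemma IsCoshSqrt.det_offExp (h : IsCoshSqrt C C' C'') (w p q : ℂ) :
    (offExp C C' w p q).det = 1 := by
  have h1 : ∀ w, HasDerivAt (fun w => (offExp C C' w p q).det) 0 w := fun w =>
    hasDerivAt_det (A := fun _ => !![0, p; q, 0]) (h.hasDerivAt_offExp p q w)
      (by simp [Matrix.trace_fin_two])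
  have h2 := is_const_of_deriv_eq_zero (fun w => (h1 w).differentiableAt) (fun w => (h1 w).deriv) w 0
  rw [h2, h.offExp_zero, Matrix.det_one]

lemma IsCoshSqrt.offExp_add (h : IsCoshSqrt C C' C'') (w τ p q : ℂ) :
    offExp C C' (w + τ) p q = offExp C C' τ p q * offExp C C' w p q := by
  obtain ⟨y, hy⟩ := IsAlgClosed.exists_pow_nat_eq (p * q) (n := 2) (by norm_num)
  have hx : ∀ u : ℂ, u ^ 2 * (p * q) = (u * y) ^ 2 := fun u => by rw [← hy]; ring
  have e1 : ∀ u, C (u ^ 2 * (p * q)) = Complex.cosh (u * y) := fun u => by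
    rw [hx, (h.apply_sq _).1]
  have e2 : ∀ u, 2 * u * C' (u ^ 2 * (p * q)) * y = Complex.sinh (u * y) := fun u => by
    rw [← (h.apply_sq _).2, ← hx]; ring
  set S : ℂ → ℂ := fun u => 2 * u * C' (u ^ 2 * (p * q)) with hS
  have hadd : S (w + τ) = S τ * C (w ^ 2 * (p * q)) + C (τ ^ 2 * (p * q)) * S w := by
    by_cases hy0 : y = 0
    · have h0 : p * q = 0 := by rw [← hy, hy0]; norm_num
      have h3 : C' 0 = 1 / 2 := by
        have := h.ode 0
        rw [h.zero] at this; linear_combination this / 2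
      simp only [hS, h0, mul_zero, h3, h.zero]; ring
    · refine mul_right_cancel₀ hy0 ?_
      have := e2 (w + τ)
      rw [add_mul w τ y, Complex.sinh_add] at this
      rw [e1, e1]
      linear_combination this - Complex.cosh (w * y) * e2 τ - Complex.cosh (τ * y) * e2 w
  have hC : C ((w + τ) ^ 2 * (p * q)) =
      C (τ ^ 2 * (p * q)) * C (w ^ 2 * (p * q)) + S τ * S w * (p * q) := by
    rw [e1, e1, e1, add_mul, Complex.cosh_add, ← hy, ← e2 w, ← e2 τ]; ring
  ext i j
  rw [mat2_mul_apply]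
  fin_cases i <;> fin_cases j
  · change C _ = C _ * C _ + (S τ * p) * (S w * q)
    rw [hC]; ring
  · change S (w + τ) * p = C _ * (S w * p) + (S τ * p) * C _
    rw [hadd]; ring
  · change S (w + τ) * q = (S τ * q) * C _ + C _ * (S w * q)
    rw [hadd]; ring
  · change C _ = (S τ * q) * (S w * p) + C _ * C _
    rw [hC]; ring

lemma IsCoshSqrt.offExp_unitary (h : IsCoshSqrt C C' C'') (t : ℝ) {p q : ℂ}
    (hpq : q = (starRingEnd ℂ) p) :
    star (offExp C C' (Complex.I * t) p q) * offExp C C' (Complex.I * t) p q = 1 := by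
  have hx : (Complex.I * t) ^ 2 * (p * q) = ((-(t ^ 2 * Complex.normSq p) : ℝ) : ℂ) := by
    rw [hpq, Complex.mul_conj, mul_pow, Complex.I_sq]; push_cast; ring
  have hqp : (starRingEnd ℂ) q = p := by rw [hpq, Complex.conj_conj]
  have hd := h.det_offExp (Complex.I * t) p q
  obtain ⟨c1, c2⟩ := h.conj_apply (-(t ^ 2 * Complex.normSq p))
  rw [offExp, hx] at hd ⊢
  rw [Matrix.det_fin_two_of] at hd
  set α := C ((-(t ^ 2 * Complex.normSq p) : ℝ) : ℂ)
  set β := 2 * (Complex.I * t) * C' ((-(t ^ 2 * Complex.normSq p) : ℝ) : ℂ) with hβ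
  have c3 : (starRingEnd ℂ) β = -β := by
    rw [hβ, map_mul, map_mul, map_mul, c2, Complex.conj_I, Complex.conj_ofReal, Complex.conj_ofNat]
    ring
  ext i j
  rw [star_mul_apply]
  fin_cases i <;> fin_cases j
  · simp [c1, c3, hqp]; linear_combination hd
  · simp [c1, c3, hqp]; ring
  · simp [c1, c3, ← hpq]; ring
  · simp [c1, c3, ← hpq]; linear_combination hd

end OffExp

/-! ### Surfaces with trivial monodromy -/

lemma differentiableAt_angular {F : ℂ → Mat2} (hF : ∀ i j, ContDiff ℝ ∞ fun t : ℝ => F (circleMap 0 1 t) i j)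
    {lam₀ : ℂ} (hlam : lam₀ ∈ sphere (0 : ℂ) 1) (i j : Fin 2) :
    DifferentiableAt ℝ (fun t : ℝ => F (lam₀ * circleMap 0 1 t) i j) 0 := by
  obtain ⟨t₀, rfl⟩ := exists_circleMap_eq one_pos hlam
  have e : (fun t : ℝ => F (circleMap 0 1 t₀ * circleMap 0 1 t) i j) =
      fun t : ℝ => F (circleMap 0 1 (t₀ + t)) i j := by
    funext t
    congr 2
    simp only [circleMap, Complex.ofReal_one, one_mul, zero_add, ← Complex.exp_add]
    congr 1; push_cast; ring
  rw [e]
  exact (((hF i j).differentiable (by simp)).comp (differentiable_id.const_add t₀)) 0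

lemma symBobenko_eq_of_monodromy (ε H : ℝ) {F F' M : ℂ → Mat2} {lam₀ : ℂ}
    (hlam : lam₀ ∈ sphere (0 : ℂ) 1) (h : ∀ lam ∈ sphere (0 : ℂ) 1, F' lam = M lam * F lam)
    (hdet : (F lam₀).det = 1) (hM : M lam₀ = -1)
    (hM' : ∀ i j, HasDerivAt (fun t : ℝ => M (lam₀ * circleMap 0 1 t) i j) 0 0)
    (hF : ∀ i j, DifferentiableAt ℝ (fun t : ℝ => F (lam₀ * circleMap 0 1 t) i j) 0) :
    symBobenko ε H F' lam₀ = symBobenko ε H F lam₀ := by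
  have h0 : F' lam₀ = -F lam₀ := by rw [h lam₀ hlam, hM, neg_mul, one_mul]
  have hmem : ∀ t : ℝ, lam₀ * circleMap 0 1 t ∈ sphere (0 : ℂ) 1 := fun t => by
    rw [mem_sphere_zero_iff_norm] at hlam ⊢
    simp [hlam]
  have hl : lamDeriv F' lam₀ = -lamDeriv F lam₀ := by
    ext i j
    have e : (fun t : ℝ => F' (lam₀ * circleMap 0 1 t) i j) = fun t : ℝ =>
        M (lam₀ * circleMap 0 1 t) i 0 * F (lam₀ * circleMap 0 1 t) 0 j +
          M (lam₀ * circleMap 0 1 t) i 1 * F (lam₀ * circleMap 0 1 t) 1 j := by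
      funext t; rw [h _ (hmem t), mat2_mul_apply]
    have e1 : lam₀ * circleMap 0 1 0 = lam₀ := by simp [circleMap]
    have hd := ((hM' i 0).mul (hF 0 j).hasDerivAt).add ((hM' i 1).mul (hF 1 j).hasDerivAt)
    have hd' := hd.deriv
    simp only [e1, hM, zero_mul, zero_add] at hd'
    simp only [lamDeriv, Matrix.of_apply, Matrix.neg_apply, e]
    refine (congrArg _ hd').trans ?_
    fin_cases i <;> simp
  have hinv : (-F lam₀)⁻¹ = -(F lam₀)⁻¹ := by
    refine Matrix.inv_eq_right_inv ?_
    rw [neg_mul_neg, mul_inv_of_det_eq_one hdet]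
  rw [symBobenko, symBobenko, h0, hl, hinv]
  simp only [neg_mul, mul_neg, neg_neg]

end DPW

end

noncomputable section

namespace DPW

open Set Metric MeasureTheory AddCircle

/-! ### The potential of the Delaunay surfaces -/

lemma one_add_re_pos {r : ℝ} {κ lam : ℂ} (h : ‖κ‖ * r ^ 2 < 1) (hlam : ‖lam‖ ≤ r) :
    0 < (1 + κ * lam ^ 2).re := by
  have h1 : ‖κ * lam ^ 2‖ < 1 := by
    rw [norm_mul, norm_pow]
    refine lt_of_le_of_lt ?_ h
    gcongr
  have h2 := (abs_le.1 (Complex.abs_re_le_norm (κ * lam ^ 2))).1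
  rw [Complex.add_re, Complex.one_re]
  linarith

lemma one_add_exp_log_ne_zero {x y : ℂ} (hx : 0 < x.re) (hy : 0 < y.re) :
    1 + Complex.exp ((Complex.log x + Complex.log y) / 2) ≠ 0 := by
  intro h
  have hx' := abs_lt.1 (Complex.abs_arg_lt_pi_div_two_iff.2 (Or.inl hx))
  have hy' := abs_lt.1 (Complex.abs_arg_lt_pi_div_two_iff.2 (Or.inl hy))
  have e : ((Complex.log x + Complex.log y) / 2).im = (x.arg + y.arg) / 2 := by
    rw [show (2 : ℂ) = ((2 : ℝ) : ℂ) by norm_num, Complex.div_ofReal_im, Complex.add_im,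
      Complex.log_im, Complex.log_im]
  have h1 := congrArg Complex.re h
  rw [Complex.add_re, Complex.one_re, Complex.exp_re, e, Complex.zero_re] at h1
  have h2 : 0 < Real.cos ((x.arg + y.arg) / 2) :=
    Real.cos_pos_of_mem_Ioo ⟨by linarith [hx'.1, hy'.1], by linarith [hx'.2, hy'.2]⟩
  have h3 := mul_pos (Real.exp_pos ((Complex.log x + Complex.log y) / 2).re) h2
  linarith

lemma gaugeEquiv_delaunay {r : ℝ} (hr : 0 < r) {s t s' t' a : ℂ} (hs : s ≠ 0) (ht : t ≠ 0)
    (ha : a ^ 2 = s * t) (h1 : ‖t' / s‖ * r ^ 2 < 1) (h2 : ‖s' / t‖ * r ^ 2 < 1) :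
    GaugeEquiv r univ (fun _ lam => !![0, s * lam⁻¹ + t' * lam; s' * lam + t * lam⁻¹, 0])
      (fun _ lam => (a * lam⁻¹) • sigma1) := by
  have ha0 : a ≠ 0 := by rintro rfl; simp at ha; exact ha.elim hs ht
  set u : ℂ → ℂ := fun lam => 1 + t' / s * lam ^ 2 with hu
  set v : ℂ → ℂ := fun lam => 1 + s' / t * lam ^ 2 with hv
  set S : Set ℂ := {lam | 0 < (u lam).re ∧ 0 < (v lam).re} with hS
  have hrS : closedBall (0 : ℂ) r ⊆ S := fun lam hlam => by
    have hl : ‖lam‖ ≤ r := by simpa using hlam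
    exact ⟨one_add_re_pos h1 hl, one_add_re_pos h2 hl⟩
  have huc : ContDiffOn ℂ ∞ u S := (contDiff_const.add (contDiff_const.mul (contDiff_id.pow 2))).contDiffOn
  have hvc : ContDiffOn ℂ ∞ v S := (contDiff_const.add (contDiff_const.mul (contDiff_id.pow 2))).contDiffOn
  set l : ℂ → ℂ := fun lam => Complex.log (u lam) with hl
  set m : ℂ → ℂ := fun lam => Complex.log (v lam) with hm
  have hlc : ContDiffOn ℂ ∞ l S := fun lam hlam =>
    (Complex.contDiffAt_log (Or.inl hlam.1)).comp_contDiffWithinAt lam (huc lam hlam)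
  have hmc : ContDiffOn ℂ ∞ m S := fun lam hlam =>
    (Complex.contDiffAt_log (Or.inl hlam.2)).comp_contDiffWithinAt lam (hvc lam hlam)
  have hle : ∀ lam, l (-lam) = l lam := fun lam => by simp [hl, hu]
  have hme : ∀ lam, m (-lam) = m lam := fun lam => by simp [hm, hv]
  have hne : ∀ {x : ℂ}, 0 < x.re → x ≠ 0 := fun h h0 => by rw [h0] at h; simp at h
  have hul : ∀ lam ∈ S, Complex.exp (l lam) = u lam := fun lam h => Complex.exp_log (hne h.1)
  have hvm : ∀ lam ∈ S, Complex.exp (m lam) = v lam := fun lam h => Complex.exp_log (hne h.2)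
  set g : ℂ → ℂ := fun lam => Complex.exp ((l lam + m lam) / 2) with hg
  have hgc : ContDiffOn ℂ ∞ g S := ((hlc.add hmc).div_const 2).cexp
  have hg2 : ∀ lam ∈ S, g lam ^ 2 = u lam * v lam := fun lam h => by
    rw [← hul lam h, ← hvm lam h, hg, ← Complex.exp_nat_mul, ← Complex.exp_add]
    congr 1; push_cast; ring
  have hg1 : ∀ lam ∈ S, 1 + g lam ≠ 0 := fun lam h => one_add_exp_log_ne_zero h.1 h.2
  obtain ⟨d₀, hd₀⟩ := IsAlgClosed.exists_pow_nat_eq (s / a) (n := 2) (by norm_num)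
  have hd00 : d₀ ≠ 0 := by
    rintro rfl
    rw [zero_pow two_ne_zero] at hd₀
    exact div_ne_zero hs ha0 hd₀.symm
  set d : ℂ → ℂ := fun lam => d₀ * Complex.exp ((l lam - m lam) / 4) with hd
  have hd0 : ∀ lam, d lam ≠ 0 := fun lam => mul_ne_zero hd00 (Complex.exp_ne_zero _)
  have hdc : ContDiffOn ℂ ∞ d S := contDiffOn_const.mul ((hlc.sub hmc).div_const 4).cexp
  have hdd : ∀ lam, a * d lam ^ 2 = s * Complex.exp ((l lam - m lam) / 2) := fun lam => by
    rw [hd]; simp only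
    rw [mul_pow, hd₀, ← Complex.exp_nat_mul,
      show ((2 : ℕ) : ℂ) * ((l lam - m lam) / 4) = (l lam - m lam) / 2 by push_cast; ring]
    field_simp
  have hd1 : ∀ lam ∈ S, d lam ^ 2 * (a * g lam) = s * u lam := fun lam h => by
    have e : Complex.exp ((l lam - m lam) / 2) * g lam = u lam := by
      rw [← hul lam h, hg, ← Complex.exp_add]; congr 1; ring
    linear_combination g lam * hdd lam + s * e
  have hd2 : ∀ lam ∈ S, t * v lam * d lam ^ 2 = a * g lam := fun lam h => by
    have e : Complex.exp ((l lam - m lam) / 2) * v lam = g lam := by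
      rw [← hvm lam h, hg, ← Complex.exp_add]; congr 1; ring
    refine mul_left_cancel₀ ha0 ?_
    linear_combination t * v lam * hdd lam + s * t * e - g lam * ha
  refine GaugeEquiv.trans isOpen_univ (ξ' := fun _ lam => (a * g lam * lam⁻¹) • sigma1) ?_ ?_
  · refine gaugeEquiv_of_intertwining hr.le hrS (P := fun lam => !![d lam, 0; 0, (d lam)⁻¹])
      (fun i j => ?_) (fun lam _ => ?_) ?_ fun lam hlam => ?_
    · fin_cases i <;> fin_cases j
      · exact hdc
      · exact contDiffOn_const
      · exact contDiffOn_const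
      · exact hdc.inv fun lam _ => hd0 lam
    · rw [Matrix.det_fin_two_of]; simp [hd0 lam]
    · rw [isTwistedOn_iff]
      intro lam _
      simp [hd, hle, hme]
    · have hlam0 : lam ≠ 0 := by rintro rfl; simp at hlam; exact hr.ne hlam
      have hlS := hrS (sphere_subset_closedBall hlam)
      have e1 := hd1 lam hlS
      have e2 := hd2 lam hlS
      have e0 := hd0 lam
      have hp : s * lam⁻¹ + t' * lam = s * u lam * lam⁻¹ := by rw [hu]; field_simp
      have hq : s' * lam + t * lam⁻¹ = t * v lam * lam⁻¹ := by rw [hv]; field_simp; ring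
      ext i j
      rw [hp, hq, mat2_mul_apply, mat2_mul_apply]
      fin_cases i <;> fin_cases j <;> simp [sigma1] <;> field_simp
      · linear_combination e1
      · linear_combination -e2
  · set y : ℂ → ℂ := fun lam =>
      -(a * lam * (t' / s + s' / t + t' / s * (s' / t) * lam ^ 2)) / (1 + g lam) with hy
    refine gaugeEquiv_rescale hr a hrS (y := y) ?_ (fun lam _ => ?_) fun lam hlam => ?_
    · refine ContDiffOn.div ?_ (contDiffOn_const.add hgc) hg1
      exact ((contDiffOn_const.mul contDiffOn_id).mul
        (contDiffOn_const.add (contDiffOn_const.mul (contDiffOn_id.pow 2)))).neg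
    · simp only [hy, hg, hle, hme, neg_sq]; ring
    · have hS' := hrS (sphere_subset_closedBall hlam)
      have e1 := hg2 lam hS'
      have e2 := hg1 lam hS'
      simp only [hu, hv] at e1
      simp only [hy]
      rw [mul_div_assoc', ← sub_eq_zero, ← mul_left_inj' e2, zero_mul, sub_mul, add_mul, div_mul_cancel₀ _ e2]
      linear_combination a * e1

/-! ### Surfaces over the punctured plane -/

lemma IsClosedDPWSurface.isConformalCMC {r ε H : ℝ} (hr : r ∈ Ioc (0 : ℝ) 1) (hε : ε = 1 ∨ ε = -1)
    (hH : H ≠ 0) {c lam₀ : ℂ} (hc : c ≠ 0) {k : ℤ} (hlam : lam₀ ∈ sphere (0 : ℂ) 1) {f : ℂ → E3}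
    (h : IsClosedDPWSurface r ε H lam₀ (xi c k) {0}ᶜ f) : IsConformalCMC H {0}ᶜ f := by
  have key : ∀ z ∈ ({0}ᶜ : Set ℂ), ContDiffAt ℝ ∞ f z ∧ IsCMCAt H f z := by
    intro z₀ hz₀
    have hz₀ : z₀ ≠ 0 := hz₀
    set V : Set ℂ := {z | z / z₀ ∈ Complex.slitPlane} with hV
    have hVo : IsOpen V := Complex.isOpen_slitPlane.preimage (continuous_id.div_const z₀)
    have hzV : z₀ ∈ V := by simp [hV, hz₀]
    have hV0 : ∀ z ∈ V, z ≠ 0 := fun z hz h0 => by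
      have : z / z₀ ∈ Complex.slitPlane := hz
      rw [h0, zero_div] at this; simp at this
    set l : ℂ → ℂ := fun z => Complex.log z₀ + Complex.log (z / z₀) with hl
    have hexp : ∀ z ∈ V, Complex.exp (l z) = z := fun z hz => by
      rw [hl, Complex.exp_add, Complex.exp_log hz₀, Complex.exp_log (div_ne_zero (hV0 z hz) hz₀),
        mul_div_cancel₀ _ hz₀]
    have hld : ∀ z ∈ V, HasDerivAt l z⁻¹ z := fun z hz => by
      have h1 := (Complex.hasDerivAt_log (z := z / z₀) hz).comp z ((hasDerivAt_id z).div_const z₀)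
      refine (h1.const_add (Complex.log z₀)).congr_deriv ?_
      have := hV0 z hz
      field_simp
    obtain ⟨L, F, B, hd, hs⟩ := IsDPWSurface.pullback h hVo (φ := l)
      (fun z hz => (hld z hz).differentiableAt.differentiableWithinAt)
      (fun z hz => by simp [hexp z hz, hV0 z hz])
    have hd' : IsDPWData r (offDiag (fun _ => 1) fun z => c * z ^ k) V L F B :=
      hd.congr fun z hz lam _ => by
        rw [pullback, pullback, (hld z hz).deriv, Complex.deriv_exp, hexp z hz, smul_smul,
          inv_mul_cancel₀ (hV0 z hz), one_smul]
        rfl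
    have hf : ∀ z ∈ V, f z = toR3 (symBobenko ε H (F z) lam₀) := fun z hz => by
      rw [← hs z hz]
      simp only [Function.comp, hexp z hz]
    have hev : f =ᶠ[nhds z₀] fun z => toR3 (symBobenko ε H (F z) lam₀) := by
      filter_upwards [hVo.mem_nhds hzV] with z hz using hf z hz
    have h11 : (1 : ℝ) ∈ Icc r 1 := ⟨hr.2, le_rfl⟩
    have hcd := contDiffOn_symBobenko hVo (hd'.smooth_F 1 h11)
      (fun z hz lam hl => hd'.det_F hr.1 h11 hz hl) hlam ε H
    refine ⟨(hcd.contDiffAt (hVo.mem_nhds hzV)).congr_of_eventuallyEq hev, ?_⟩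
    refine (hd'.isCMCAt hr hVo (differentiableOn_const _) ?_ hzV hlam hε hH (fun _ => one_ne_zero)
      fun _ => mul_ne_zero hc (zpow_ne_zero _ hz₀)).congr hev
    exact ((differentiableOn_id.zpow (Or.inl hV0))).const_mul c
  exact isConformalCMC_of_isCMCAt hH isOpen_compl_singleton
    (fun z hz => (key z hz).1.contDiffWithinAt) fun z hz => (key z hz).2

lemma isClosedDPWSurface_of_periodic {r ε H : ℝ} {lam₀ : ℂ} {ξ : Potential} {g : ℂ → E3}
    (hg : Function.Periodic g (2 * Real.pi * Complex.I))
    (h : IsDPWSurface r ε H lam₀ (pullback Complex.exp ξ) univ g) :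
    IsClosedDPWSurface r ε H lam₀ ξ {0}ᶜ (g ∘ Complex.log) := by
  refine IsDPWSurface.mono (IsDPWSurface.congr h (fun _ _ _ _ => rfl) fun w _ => ?_) (subset_univ _)
  obtain ⟨n, hn⟩ := Complex.exp_eq_exp_iff_exists_int.1 (Complex.exp_log (Complex.exp_ne_zero w))
  simp only [Function.comp, hn]
  exact hg.int_mul n w

end DPW

end

noncomputable section

namespace DPW

open Set Metric MeasureTheory AddCircle

/-! ### Delaunay surfaces -/

lemma exists_delaunay_radius (k₁ k₂ k₃ : ℝ) (h₁ : 0 ≤ k₁) (h₂ : 0 ≤ k₂) (h₃ : 0 < k₃) :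
    ∃ r : ℝ, 0 < r ∧ r < 1 ∧ k₁ * r ^ 2 < 1 ∧ k₂ * r ^ 2 < 1 ∧ r ^ 2 < k₃ := by
  set K := 1 + k₁ + k₂ + k₃⁻¹ with hK
  have h4 : 0 < k₃⁻¹ := inv_pos.2 h₃
  have hK1 : 1 < K := by linarith
  have hr0 : 0 < K⁻¹ := inv_pos.2 (by linarith)
  have hr1 : K⁻¹ < 1 := inv_lt_one_of_one_lt₀ hK1
  have hr2 : K⁻¹ ^ 2 < K⁻¹ := by nlinarith
  have key : ∀ k, 0 ≤ k → k ≤ K → k * K⁻¹ ^ 2 < 1 := fun k hk0 hk => by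
    have : K * K⁻¹ = 1 := mul_inv_cancel₀ (by linarith)
    nlinarith
  refine ⟨K⁻¹, hr0, hr1, key k₁ h₁ (by linarith), key k₂ h₂ (by linarith), ?_⟩
  have := key k₃⁻¹ h4.le (by linarith)
  rwa [inv_mul_lt_iff₀ h₃, mul_one] at this

section Frame

variable {C C' C'' : ℂ → ℂ}

lemma IsCoshSqrt.contDiffOn_offExp (h : IsCoshSqrt C C' C'') {p q : ℂ → ℂ} {S : Set ℂ}
    (hp : ContDiffOn ℂ ∞ p S) (hq : ContDiffOn ℂ ∞ q S) (i j : Fin 2) :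
    ContDiffOn ℂ ∞ (fun z : ℂ × ℂ => offExp C C' z.1 (p z.2) (q z.2) i j) (univ ×ˢ S) := by
  have hp' : ContDiffOn ℂ ∞ (fun z : ℂ × ℂ => p z.2) (univ ×ˢ S) :=
    hp.comp contDiffOn_snd fun z hz => hz.2
  have hq' : ContDiffOn ℂ ∞ (fun z : ℂ × ℂ => q z.2) (univ ×ˢ S) :=
    hq.comp contDiffOn_snd fun z hz => hz.2
  have hx : ContDiffOn ℂ ∞ (fun z : ℂ × ℂ => z.1 ^ 2 * (p z.2 * q z.2)) (univ ×ˢ S) :=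
    (contDiffOn_fst.pow 2).mul (hp'.mul hq')
  have hC := h.contDiff.comp_contDiffOn hx
  have hC' : ContDiffOn ℂ ∞ (fun z : ℂ × ℂ => 2 * z.1 * C' (z.1 ^ 2 * (p z.2 * q z.2))) (univ ×ˢ S) :=
    (contDiffOn_const.mul contDiffOn_fst).mul (h.contDiff'.comp_contDiffOn hx)
  fin_cases i <;> fin_cases j
  · exact hC
  · exact hC'.mul hp'
  · exact hC'.mul hq'
  · exact hC

lemma offExp_neg (C C' : ℂ → ℂ) (w p q : ℂ) :
    offExp C C' w (-p) (-q) = sigma3 * offExp C C' w p q * sigma3 := by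
  rw [sigma3_conj_apply]
  simp [offExp]

lemma IsCoshSqrt.offExp_eq_neg_one (h : IsCoshSqrt C C' C'') {p q : ℂ} (hpq : p * q = 1 / 4) :
    offExp C C' (2 * Real.pi * Complex.I) p q = -1 ∧
      C' ((2 * Real.pi * Complex.I) ^ 2 * (p * q)) = 0 := by
  have e : (2 * Real.pi * Complex.I) ^ 2 * (p * q) = (Real.pi * Complex.I) ^ 2 := by
    rw [hpq]; ring
  obtain ⟨e1, e2⟩ := h.apply_sq (Real.pi * Complex.I)
  rw [← e] at e1 e2
  rw [Complex.cosh_mul_I, Complex.cos_pi] at e1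
  rw [Complex.sinh_mul_I, Complex.sin_pi, zero_mul] at e2
  have hpi : (Real.pi : ℂ) ≠ 0 := by exact_mod_cast Real.pi_ne_zero
  have e3 : C' ((2 * Real.pi * Complex.I) ^ 2 * (p * q)) = 0 :=
    (mul_eq_zero.1 e2).resolve_left (mul_ne_zero two_ne_zero (mul_ne_zero hpi Complex.I_ne_zero))
  refine ⟨?_, e3⟩
  rw [offExp, e1, e3]
  ext i j; fin_cases i <;> fin_cases j <;> simp

/-- At a critical point of `p q`, the monodromy has vanishing derivative. -/
lemma IsCoshSqrt.hasDerivAt_monodromy (h : IsCoshSqrt C C' C'') {P Q : ℝ → ℂ} {P' Q' τ : ℂ} {t : ℝ}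
    (hP : HasDerivAt P P' t) (hQ : HasDerivAt Q Q' t) (hcrit : P' * Q t + P t * Q' = 0)
    (h0 : C' (τ ^ 2 * (P t * Q t)) = 0) (i j : Fin 2) :
    HasDerivAt (fun u => offExp C C' τ (P u) (Q u) i j) 0 t := by
  have hx : HasDerivAt (fun u => τ ^ 2 * (P u * Q u)) 0 t :=
    ((hP.mul hQ).const_mul (τ ^ 2)).congr_deriv (by rw [hcrit, mul_zero])
  have hC : HasDerivAt (fun u => C (τ ^ 2 * (P u * Q u))) 0 t :=
    ((h.deriv _).comp t hx).congr_deriv (mul_zero _)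
  have hC' : ∀ {K : ℝ → ℂ} {K' : ℂ}, HasDerivAt K K' t →
      HasDerivAt (fun u => 2 * τ * C' (τ ^ 2 * (P u * Q u)) * K u) 0 t := fun {K K'} hK => by
    have h1 : HasDerivAt (fun u => C' (τ ^ 2 * (P u * Q u))) 0 t :=
      ((h.deriv' _).comp t hx).congr_deriv (mul_zero _)
    exact ((h1.const_mul (2 * τ)).mul hK).congr_deriv (by rw [h0]; ring)
  fin_cases i <;> fin_cases j
  · exact hC
  · exact hC' hP
  · exact hC' hQ
  · exact hC

end Frame

theorem exists_delaunay {ε H : ℝ} (hε : ε = 1 ∨ ε = -1) (hH : H ≠ 0) {c : ℂ} (hc : c ≠ 0) :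
    ∃ r ∈ Ioc (0 : ℝ) 1, ∃ lam₀ ∈ sphere (0 : ℂ) 1, ∃ f : ℂ → E3,
      IsConformalCMC H {0}ᶜ f ∧ IsClosedDPWSurface r ε H lam₀ (xi c (-2)) {0}ᶜ f := by
  obtain ⟨C, C', C'', hC⟩ := exists_coshSqrt
  have hn : 0 < ‖c‖ := norm_pos_iff.2 hc
  obtain ⟨s, hs0, hs⟩ : ∃ s : ℝ, 0 < s ∧ s * s = s / 2 + ‖c‖ := by
    have h1 : 0 ≤ 1 / 4 + 4 * ‖c‖ := by positivity
    refine ⟨(1 / 2 + √(1 / 4 + 4 * ‖c‖)) / 2, by positivity, ?_⟩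
    linear_combination (1 / 4) * Real.mul_self_sqrt h1
  have hsC : (s : ℂ) ≠ 0 := by exact_mod_cast hs0.ne'
  have hnC : (‖c‖ : ℂ) ≠ 0 := by exact_mod_cast hn.ne'
  set t : ℂ := c / s with ht
  have ht0 : t ≠ 0 := div_ne_zero hc hsC
  have hst : (s : ℂ) * t = c := mul_div_cancel₀ _ hsC
  have htc : (starRingEnd ℂ) t = (starRingEnd ℂ) c / s := by rw [ht, map_div₀, Complex.conj_ofReal]
  obtain ⟨lam₀, hlam₀⟩ := IsAlgClosed.exists_pow_nat_eq (-c / ‖c‖) (n := 2) (by norm_num)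
  have hlam : lam₀ ∈ sphere (0 : ℂ) 1 := by
    rw [mem_sphere_zero_iff_norm]
    have h1 := congrArg norm hlam₀
    rw [norm_pow, norm_div, norm_neg, Complex.norm_real, norm_norm, div_self hn.ne'] at h1
    exact (pow_eq_one_iff_of_nonneg (norm_nonneg _) two_ne_zero).1 h1
  have hlam0 : lam₀ ≠ 0 := by rintro rfl; simp at hlam
  obtain ⟨a, ha⟩ := IsAlgClosed.exists_pow_nat_eq c (n := 2) (by norm_num)
  obtain ⟨r, hr0, hr1, hk1, hk2, hk3⟩ := exists_delaunay_radius ‖(starRingEnd ℂ) t / s‖ ‖(s : ℂ) / t‖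
    (4 * ‖c‖) (norm_nonneg _) (norm_nonneg _) (by positivity)
  have hr : r ∈ Ioc (0 : ℝ) 1 := ⟨hr0, hr1.le⟩
  set p : ℂ → ℂ := fun lam => s * lam⁻¹ + (starRingEnd ℂ) t * lam with hp
  set q : ℂ → ℂ := fun lam => s * lam + t * lam⁻¹ with hq
  set L : ℂ → ℂ → Mat2 := fun w lam => offExp C C' w (p lam) (q lam) with hL
  have hpc : ContDiffOn ℂ ∞ p {0}ᶜ :=
    (contDiffOn_const.mul (contDiffOn_id.inv fun x hx => hx)).add (contDiffOn_const.mul contDiffOn_id)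
  have hqc : ContDiffOn ℂ ∞ q {0}ᶜ :=
    (contDiffOn_const.mul contDiffOn_id).add (contDiffOn_const.mul (contDiffOn_id.inv fun x hx => hx))
  have hpn : ∀ lam, p (-lam) = -p lam := fun lam => by simp only [hp, inv_neg]; ring
  have hqn : ∀ lam, q (-lam) = -q lam := fun lam => by simp only [hq, inv_neg]; ring
  have hpq : ∀ lam ∈ sphere (0 : ℂ) 1, q lam = (starRingEnd ℂ) (p lam) := fun lam h => by
    have e := inv_eq_conj_of_norm_one h
    simp only [hp, hq, map_add, map_mul, map_inv₀, Complex.conj_conj, Complex.conj_ofReal, ← e, inv_inv]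
  have hLt : ∀ w, IsTwistedOn {0}ᶜ (L w) := fun w lam _ => by
    simp only [hL, hpn, hqn, offExp_neg]
  have hLc := hC.contDiffOn_offExp hpc hqc
  have hdet : ∀ w lam, (L w lam).det = 1 := fun w lam => hC.det_offExp _ _ _
  obtain ⟨F, B, hFu, hFs, hBp, hBn, hsp, hBu⟩ :=
    exists_iwasawa_of_contDiffOn hLc (fun w lam _ => hdet w lam) hLt hr0 hr1
  have hsub : ∀ {s : ℝ}, 0 < s → s ≤ 1 → sphere (0 : ℂ) s ⊆ closedBall 0 1 \ {0} := fun hs hs1 lam h => by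
    rw [mem_sphere_zero_iff_norm] at h
    refine ⟨by simpa [h] using hs1, fun h0 => ?_⟩
    rw [mem_singleton_iff.1 h0, norm_zero] at h
    exact hs.ne h
  have hLs : JointlySmooth r univ L :=
    jointlySmooth_of_contDiffOn hr0.le (fun lam h => (hsub hr0 hr1.le h).2) hLc
  have hdata : IsDPWData r (fun _ lam => !![0, p lam; q lam, 0]) univ L F B :=
    ⟨fun w _ => ⟨fun i j => hLs.smooth_apply (mem_univ w) i j, fun lam _ => hdet w lam,
        (hLt w).mono fun lam h => (hsub hr0 hr1.le h).2⟩,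
      fun w _ lam _ i j => hC.hasDerivAt_offExp _ _ w i j, hLs, fun w _ => hFu w, hFs,
      fun w _ => hBp w, fun w _ => hBn w, fun w _ lam h => hsp w lam (hsub hr0 hr1.le h)⟩
  set τ : ℂ := 2 * Real.pi * Complex.I with hτ
  have hτ' : τ = Complex.I * ((2 * Real.pi : ℝ) : ℂ) := by rw [hτ]; push_cast; ring
  have hmon : ∀ w, ∀ lam ∈ sphere (0 : ℂ) 1, F (w + τ) lam = L τ lam * F w lam := by
    intro w lam hl
    have hB : B (w + τ) lam = B w lam := by
      refine hBu w (w + τ) (fun lam hl => ?_) lam (sphere_subset_closedBall hl)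
      simp only [hL]
      rw [hC.offExp_add, star_mul, mul_assoc, ← mul_assoc (star (offExp C C' τ _ _)), hτ',
        hC.offExp_unitary _ (hpq lam hl), one_mul]
    have hl' := hsub one_pos le_rfl hl
    have hBd : (B w lam).det = 1 := by
      have h1 := congrArg Matrix.det (hsp w lam hl')
      rw [hdet, Matrix.det_mul, (hFu w).det_eq_one lam, one_mul] at h1
      · exact h1.symm
      · have := mem_sphere_zero_iff_norm.1 hl
        exact ⟨by rw [this]; exact hr1.le, by rw [this]; exact (one_le_inv₀ hr0).2 hr1.le⟩
    have h1 : F (w + τ) lam * B w lam = L τ lam * F w lam * B w lam := by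
      rw [mul_assoc, ← hsp w lam hl', ← hB, ← hsp (w + τ) lam hl']
      exact hC.offExp_add _ _ _ _
    calc F (w + τ) lam = F (w + τ) lam * B w lam * (B w lam)⁻¹ := by
          rw [mul_assoc, mul_inv_of_det_eq_one hBd, mul_one]
      _ = _ := by rw [h1, mul_assoc, mul_inv_of_det_eq_one hBd, mul_one]
  have hp0 : p lam₀ = lam₀⁻¹ * (1 / 2) := by
    have e : (starRingEnd ℂ) t * lam₀ ^ 2 = -(‖c‖ / s) := by
      rw [hlam₀, htc]
      have := Complex.mul_conj c
      rw [Complex.normSq_eq_norm_sq] at this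
      push_cast at this
      field_simp
      linear_combination -this
    have e2 : (s : ℂ) - ‖c‖ / s = 1 / 2 := by
      have : (s : ℂ) * s = s / 2 + ‖c‖ := by exact_mod_cast hs
      field_simp
      linear_combination 2 * this
    have : p lam₀ = lam₀⁻¹ * (s + (starRingEnd ℂ) t * lam₀ ^ 2) := by
      simp only [hp]; field_simp
    rw [this, e, ← e2]; ring
  have hq0 : q lam₀ = lam₀ * (1 / 2) := by
    have e := inv_eq_conj_of_norm_one hlam
    rw [hpq lam₀ hlam, hp0, map_mul, map_inv₀, ← e, inv_inv, map_div₀, map_one, Complex.conj_ofNat]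
  have hpq0 : p lam₀ * q lam₀ = 1 / 4 := by rw [hp0, hq0]; field_simp; norm_num
  obtain ⟨hM1, hM2⟩ := hC.offExp_eq_neg_one hpq0
  have hM' : ∀ i j, HasDerivAt (fun u : ℝ => L τ (lam₀ * circleMap 0 1 u) i j) 0 0 := by
    have hlu : HasDerivAt (fun u : ℝ => lam₀ * circleMap 0 1 u) (lam₀ * Complex.I) 0 := by
      have := (hasDerivAt_circleMap 0 1 0).const_mul lam₀
      simpa [circleMap] using this
    have e0 : lam₀ * circleMap 0 1 0 = lam₀ := by simp [circleMap]
    have hi : HasDerivAt (fun u : ℝ => (lam₀ * circleMap 0 1 u)⁻¹)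
        (-(lam₀ * Complex.I) / lam₀ ^ 2) 0 := by
      have := hlu.inv (by rw [e0]; exact hlam0)
      rwa [e0] at this
    have hP := (hi.const_mul (s : ℂ)).add (hlu.const_mul ((starRingEnd ℂ) t))
    have hQ := (hlu.const_mul (s : ℂ)).add (hi.const_mul t)
    refine hC.hasDerivAt_monodromy (P := fun u => p (lam₀ * circleMap 0 1 u))
      (Q := fun u => q (lam₀ * circleMap 0 1 u)) hP hQ ?_ ?_
    · rw [e0]
      have h1 : (s : ℂ) * lam₀⁻¹ + (starRingEnd ℂ) t * lam₀ = lam₀⁻¹ * (1 / 2) := hp0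
      have h2 : (s : ℂ) * lam₀ + t * lam₀⁻¹ = lam₀ * (1 / 2) := hq0
      rw [hp0, hq0]
      field_simp at h1 h2 ⊢
      linear_combination Complex.I / 2 * (lam₀ ^ 2 * h1 - h2)
    · rw [e0]; exact hM2
  set g : ℂ → E3 := fun w => toR3 (symBobenko ε H (F w) lam₀) with hg
  have hper : Function.Periodic g τ := fun w => by
    simp only [hg]
    congr 1
    refine symBobenko_eq_of_monodromy ε H hlam (hmon w) ?_ hM1 hM'
      (differentiableAt_angular (fun i j => (hFs 1 ⟨hr1.le, le_rfl⟩).smooth_apply (mem_univ w) i j) hlam)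
    exact hdata.det_F hr0 ⟨hr1.le, le_rfl⟩ (mem_univ w) hlam
  have hS1 : IsDPWSurface r ε H lam₀ (fun _ lam => !![0, p lam; q lam, 0]) univ g :=
    ⟨L, F, B, hdata, fun _ _ => rfl⟩
  have hG1 : GaugeEquiv r univ (fun _ lam => !![0, p lam; q lam, 0])
      (pullback Complex.exp (cylinderPotential a)) :=
    (gaugeEquiv_delaunay hr0 hsC ht0 (by rw [ha, hst]) hk1 hk2).congr (fun _ _ _ _ => rfl)
      fun w _ lam _ => pullback_exp_cylinderPotential a w lam
  have hG2 := (gaugeEquiv_xi_neg_two hr0 hc ha hk3).symm hr0.le isOpen_univ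
  have hS2 := GaugeEquiv.isDPWSurface hr0 isOpen_univ (hG1.trans isOpen_univ hG2) hS1
  have hS3 := isClosedDPWSurface_of_periodic hper hS2
  exact ⟨r, hr, lam₀, hlam, _, hS3.isConformalCMC hr hε hH hc hlam, hS3⟩

end DPW

end

noncomputable section

namespace DPW

open Set Metric MeasureTheory AddCircle

/-! ### A fundamental solution with a logarithm -/

/-- The potential for `k = -1` in the coordinate `w = log z`. -/
def logPotential (c : ℂ) (w lam : ℂ) : Mat2 := lam⁻¹ • !![0, Complex.exp w; c, 0]

/-- Coefficients of the solutions regular and logarithmic at the singular point. -/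
structure IsLogSystem (J0 J1 J2 k1 k2 : ℂ → ℂ) (k1' : ℂ → ℂ) : Prop where
  contDiff : ContDiff ℂ ∞ J0 ∧ ContDiff ℂ ∞ J1 ∧ ContDiff ℂ ∞ k1 ∧ ContDiff ℂ ∞ k2
  deriv_J0 : ∀ x, HasDerivAt J0 (J1 x) x
  deriv_J1 : ∀ x, HasDerivAt J1 (J2 x) x
  deriv_k1 : ∀ x, HasDerivAt k1 (k1' x) x
  deriv_k2 : ∀ x, HasDerivAt k2 (k1 x - J1 x) x
  J0_eq : ∀ x, J1 x + x * J2 x = J0 x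
  k2_eq : ∀ x, k2 x = J0 x + x * k1' x
  J0_zero : J0 0 = 1

lemma exists_logSystem : ∃ J0 J1 J2 k1 k2 k1' : ℂ → ℂ, IsLogSystem J0 J1 J2 k1 k2 k1' := by
  obtain ⟨a, ha, ha0, hae⟩ := exists_entire_solution (α := 1) (β := 1) le_rfl le_rfl 1 factBounded_zero
  have hb : FactBounded fun n => -2 * dcoef a n := by
    obtain ⟨C, hC⟩ := ha.dcoef
    refine ⟨2 * C, fun n => ?_⟩
    rw [norm_mul, norm_neg, Complex.norm_ofNat, mul_div_assoc]
    gcongr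
    exact hC n
  obtain ⟨k, hk, -, hke⟩ := exists_entire_solution (α := 1) (β := 1) le_rfl le_rfl 0 hb
  have hbe : ∀ x, ent (fun n => -2 * dcoef a n) x = -2 * ent (dcoef a) x := fun x => by
    rw [ent, ent, ← tsum_mul_left]
    exact tsum_congr fun n => by ring
  simp only [Complex.ofReal_one, one_mul, ent_zero_fun, add_zero, hbe] at hae hke
  refine ⟨ent a, ent (dcoef a), ent (dcoef (dcoef a)), ent k,
    fun x => ent a x + x * ent (dcoef k) x, ent (dcoef k),
    ⟨ha.contDiff, ha.dcoef.contDiff, hk.contDiff, ha.contDiff.add (contDiff_id.mul hk.dcoef.contDiff)⟩,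
    ha.hasDerivAt, ha.dcoef.hasDerivAt, hk.hasDerivAt, fun x => ?_, hae, fun _ => rfl, ?_⟩
  · refine ((ha.hasDerivAt x).add ((hasDerivAt_id x).mul (hk.dcoef.hasDerivAt x))).congr_deriv ?_
    simp only [id]
    linear_combination hke x
  · rw [ent_zero, ha0]

section

variable {J0 J1 J2 k1 k2 k1' : ℂ → ℂ}

/-- The solution of `dL = L ξ` with the logarithm `w`. -/
def logFrame (J0 J1 k1 k2 : ℂ → ℂ) (c w lam : ℂ) : Mat2 :=
  !![J0 (c * lam⁻¹ ^ 2 * Complex.exp w),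
      lam⁻¹ * Complex.exp w * J1 (c * lam⁻¹ ^ 2 * Complex.exp w);
    lam⁻¹ * c * (w * J0 (c * lam⁻¹ ^ 2 * Complex.exp w) + k1 (c * lam⁻¹ ^ 2 * Complex.exp w)),
      w * (c * lam⁻¹ ^ 2 * Complex.exp w) * J1 (c * lam⁻¹ ^ 2 * Complex.exp w) +
        k2 (c * lam⁻¹ ^ 2 * Complex.exp w)]

lemma IsLogSystem.det_logFrame (h : IsLogSystem J0 J1 J2 k1 k2 k1') (c w lam : ℂ) :
    (logFrame J0 J1 k1 k2 c w lam).det = 1 := by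
  have hW : ∀ x, HasDerivAt (fun x => J0 x * k2 x - x * J1 x * k1 x) 0 x := fun x => by
    refine (((h.deriv_J0 x).mul (h.deriv_k2 x)).sub
      (((hasDerivAt_id x).mul (h.deriv_J1 x)).mul (h.deriv_k1 x))).congr_deriv ?_
    simp only [id, Pi.mul_apply]
    linear_combination J1 x * h.k2_eq x - k1 x * h.J0_eq x
  have hc := fun x => is_const_of_deriv_eq_zero (fun x => (hW x).differentiableAt)
    (fun x => (hW x).deriv) x 0
  simp only [h.k2_eq 0, h.J0_zero, zero_mul, add_zero, mul_one, sub_zero] at hc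
  rw [logFrame, Matrix.det_fin_two_of]
  linear_combination hc (c * lam⁻¹ ^ 2 * Complex.exp w)

lemma IsLogSystem.hasDerivAt_logFrame (h : IsLogSystem J0 J1 J2 k1 k2 k1') (c w lam : ℂ)
    (i j : Fin 2) : HasDerivAt (fun w => logFrame J0 J1 k1 k2 c w lam i j)
      ((logFrame J0 J1 k1 k2 c w lam * logPotential c w lam) i j) w := by
  set x : ℂ := c * lam⁻¹ ^ 2 * Complex.exp w with hx
  have hx' : x = c * (lam ^ 2)⁻¹ * Complex.exp w := by rw [hx, inv_pow]
  have hxd : HasDerivAt (fun w => c * lam⁻¹ ^ 2 * Complex.exp w) x w :=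
    (Complex.hasDerivAt_exp w).const_mul _
  have d0 := (h.deriv_J0 x).comp w hxd
  have d1 := (h.deriv_J1 x).comp w hxd
  have dk := (h.deriv_k1 x).comp w hxd
  have dl := (h.deriv_k2 x).comp w hxd
  rw [mat2_mul_apply]
  fin_cases i <;> fin_cases j
  · refine d0.congr_deriv ?_
    simp [logFrame, logPotential, ← hx']
    rw [hx]; ring
  · refine (((Complex.hasDerivAt_exp w).const_mul lam⁻¹).mul d1).congr_deriv ?_
    simp [logFrame, logPotential, ← hx']
    linear_combination lam⁻¹ * Complex.exp w * h.J0_eq x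
  · refine ((((hasDerivAt_id w).mul d0).add dk).const_mul (lam⁻¹ * c)).congr_deriv ?_
    simp [logFrame, logPotential, ← hx']
    linear_combination (-(lam⁻¹ * c)) * h.k2_eq x
  · refine ((((hasDerivAt_id w).mul hxd).mul d1).add dl).congr_deriv ?_
    simp [logFrame, logPotential, ← hx']
    linear_combination (x * w) * h.J0_eq x + (w * J0 x + k1 x) * hx

lemma logFrame_add (J0 J1 k1 k2 : ℂ → ℂ) (c w lam : ℂ) {τ : ℂ} (hτ : Complex.exp τ = 1) :
    logFrame J0 J1 k1 k2 c (w + τ) lam = !![1, 0; c * lam⁻¹ * τ, 1] * logFrame J0 J1 k1 k2 c w lam := by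
  ext i j
  rw [mat2_mul_apply]
  fin_cases i <;> fin_cases j <;> simp [logFrame, Complex.exp_add, hτ] <;> ring

lemma IsLogSystem.contDiffOn_logFrame (h : IsLogSystem J0 J1 J2 k1 k2 k1') (c : ℂ) (i j : Fin 2) :
    ContDiffOn ℂ ∞ (fun q : ℂ × ℂ => logFrame J0 J1 k1 k2 c q.1 q.2 i j) (univ ×ˢ {0}ᶜ) := by
  obtain ⟨h0, h1, h2, h3⟩ := h.contDiff
  have hi : ContDiffOn ℂ ∞ (fun q : ℂ × ℂ => q.2⁻¹) (univ ×ˢ {0}ᶜ) :=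
    contDiffOn_snd.inv fun q hq => hq.2
  have he : ContDiffOn ℂ ∞ (fun q : ℂ × ℂ => Complex.exp q.1) (univ ×ˢ {0}ᶜ) := contDiffOn_fst.cexp
  have hx : ContDiffOn ℂ ∞ (fun q : ℂ × ℂ => c * q.2⁻¹ ^ 2 * Complex.exp q.1) (univ ×ˢ {0}ᶜ) :=
    (contDiffOn_const.mul (hi.pow 2)).mul he
  have e0 := h0.comp_contDiffOn hx
  have e1 := h1.comp_contDiffOn hx
  have e2 := h2.comp_contDiffOn hx
  have e3 := h3.comp_contDiffOn hx
  fin_cases i <;> fin_cases j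
  · exact e0
  · exact (hi.mul he).mul e1
  · exact (hi.mul contDiffOn_const).mul ((contDiffOn_fst.mul e0).add e2)
  · exact ((contDiffOn_fst.mul hx).mul e1).add e3

lemma norm_le_of_continuous {f : ℂ → ℂ} (hf : Continuous f) (R : ℝ) :
    ∃ C, 0 ≤ C ∧ ∀ x, ‖x‖ ≤ R → ‖f x‖ ≤ C := by
  obtain ⟨M, hM⟩ := (isCompact_closedBall (0 : ℂ) R).exists_bound_of_continuousOn hf.continuousOn
  exact ⟨max M 0, le_max_right _ _, fun x hx => (hM x (by simpa using hx)).trans (le_max_left _ _)⟩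

lemma IsLogSystem.norm_logFrame_le (h : IsLogSystem J0 J1 J2 k1 k2 k1') (c : ℂ) {r : ℝ} (hr : 0 < r) :
    ∃ C, 0 ≤ C ∧ ∀ y : ℝ, 0 ≤ y → ∀ lam ∈ sphere (0 : ℂ) r, ∀ i j,
      ‖logFrame J0 J1 k1 k2 c (-y : ℝ) lam i j‖ ≤ C * (1 + y) := by
  obtain ⟨h0, h1, h2, h3⟩ := h.contDiff
  set R : ℝ := ‖c‖ * r⁻¹ ^ 2 with hR
  have hR0 : 0 ≤ R := by positivity
  obtain ⟨C0, hC0, b0⟩ := norm_le_of_continuous h0.continuous R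
  obtain ⟨C1, hC1, b1⟩ := norm_le_of_continuous h1.continuous R
  obtain ⟨C2, hC2, b2⟩ := norm_le_of_continuous h2.continuous R
  obtain ⟨C3, hC3, b3⟩ := norm_le_of_continuous h3.continuous R
  set D := C0 + r⁻¹ * C1 + r⁻¹ * ‖c‖ * (C0 + C2) + (R * C1 + C3) with hD
  have hri : 0 < r⁻¹ := inv_pos.2 hr
  have p1 : 0 ≤ r⁻¹ * C1 := by positivity
  have p2 : 0 ≤ r⁻¹ * ‖c‖ * (C0 + C2) := by positivity
  have p3 : 0 ≤ R * C1 + C3 := by positivity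
  have hD0 : 0 ≤ D := by positivity
  refine ⟨D, hD0, fun y hy lam hlam i j => ?_⟩
  have hl : ‖lam⁻¹‖ = r⁻¹ := by rw [norm_inv, mem_sphere_zero_iff_norm.1 hlam]
  have hE : ‖Complex.exp ((-y : ℝ) : ℂ)‖ ≤ 1 := by
    rw [Complex.norm_exp_ofReal]; exact Real.exp_le_one_iff.2 (by linarith)
  set x := c * lam⁻¹ ^ 2 * Complex.exp ((-y : ℝ) : ℂ) with hx
  have hxR : ‖x‖ ≤ R := by
    rw [hx, norm_mul, norm_mul, norm_pow, hl]
    exact mul_le_of_le_one_right hR0 hE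
  have hyn : ‖((-y : ℝ) : ℂ)‖ = y := by
    rw [Complex.norm_real, norm_neg, Real.norm_of_nonneg hy]
  have g1 : D ≤ D * (1 + y) := by nlinarith
  fin_cases i <;> fin_cases j
  · exact (b0 x hxR).trans (le_trans (by linarith) g1)
  · refine le_trans (?_ : _ ≤ r⁻¹ * C1) (le_trans (by linarith) g1)
    change ‖lam⁻¹ * _ * J1 x‖ ≤ _
    rw [norm_mul, norm_mul, hl]
    exact mul_le_mul (mul_le_of_le_one_right hri.le hE) (b1 x hxR) (norm_nonneg _) hri.le
  · change ‖lam⁻¹ * c * (_ * J0 x + k1 x)‖ ≤ _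
    rw [norm_mul, norm_mul, hl]
    have e : ‖((-y : ℝ) : ℂ) * J0 x + k1 x‖ ≤ (C0 + C2) * (1 + y) := by
      refine (norm_add_le _ _).trans ?_
      rw [norm_mul, hyn]
      have := mul_le_mul_of_nonneg_left (b0 x hxR) hy
      nlinarith [b2 x hxR]
    calc r⁻¹ * ‖c‖ * ‖((-y : ℝ) : ℂ) * J0 x + k1 x‖ ≤ r⁻¹ * ‖c‖ * ((C0 + C2) * (1 + y)) := by gcongr
      _ = r⁻¹ * ‖c‖ * (C0 + C2) * (1 + y) := by ring
      _ ≤ D * (1 + y) := by gcongr; linarith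
  · change ‖_ * x * J1 x + k2 x‖ ≤ _
    have e : ‖((-y : ℝ) : ℂ) * x * J1 x + k2 x‖ ≤ (R * C1 + C3) * (1 + y) := by
      refine (norm_add_le _ _).trans ?_
      rw [norm_mul, norm_mul, hyn]
      have : y * ‖x‖ * ‖J1 x‖ ≤ y * R * C1 := by gcongr; exact b1 x hxR
      nlinarith [b3 x hxR, mul_nonneg hR0 hC1]
    exact e.trans (by gcongr; linarith)

end

end DPW

end

noncomputable section

namespace DPW

open Set Metric MeasureTheory AddCircle

/-! ### Commuting with the logarithmic potential -/

lemma eq_zero_of_exp_growth {κ C : ℝ} (hκ : 0 ≤ κ)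
    (h : ∀ y : ℝ, 0 ≤ y → κ * Real.exp (y / 2) ≤ C * (1 + y) ^ 2) : κ = 0 := by
  by_contra hne
  have hκ' : 0 < κ := lt_of_le_of_ne hκ (Ne.symm hne)
  have key : ∀ y : ℝ, 0 ≤ y → κ * (1 + y / 6) ≤ 36 * C := fun y hy => by
    have h1 : (1 + y / 6) ^ 3 ≤ Real.exp (y / 2) := by
      have e : Real.exp (y / 2) = Real.exp (y / 6) ^ 3 := by
        rw [← Real.exp_nat_mul]; congr 1; push_cast; ring
      rw [e]
      have := Real.add_one_le_exp (y / 6)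
      gcongr
      linarith
    have h2 : (0 : ℝ) < (1 + y / 6) ^ 2 := by positivity
    have hC : 0 ≤ C := by
      have := h 0 le_rfl
      simp at this; linarith
    have h3 : C * (1 + y) ^ 2 ≤ C * (36 * (1 + y / 6) ^ 2) := by gcongr; nlinarith
    have h4 := (mul_le_mul_of_nonneg_left h1 hκ).trans ((h y hy).trans h3)
    refine le_of_mul_le_mul_right ?_ h2
    linarith
  have hC : 0 < 36 * C := lt_of_lt_of_le (by positivity) (key 0 le_rfl)
  have := key (36 * C / κ * 6) (by positivity)
  have e : κ * (1 + 36 * C / κ * 6 / 6) = κ + 36 * C := by field_simp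
  linarith

/-- The coefficients of a solution of `S' = [S, ξ]` without poles in `lam`, of moderate growth. -/
theorem scalar_of_commutator {c : ℂ} (hc : c ≠ 0) {a b g d : ℤ → ℂ → ℂ}
    (ha : ∀ n w, HasDerivAt (a n) (c * b (n - 1) w - Complex.exp w * g (n - 1) w) w)
    (hb : ∀ n w, HasDerivAt (b n) (Complex.exp w * (a (n - 1) w - d (n - 1) w)) w)
    (hg : ∀ n w, HasDerivAt (g n) (c * (d (n - 1) w - a (n - 1) w)) w)
    (hd : ∀ n w, HasDerivAt (d n) (Complex.exp w * g (n - 1) w - c * b (n - 1) w) w)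
    (h0 : ∀ n, 0 < n → ∀ w, a n w = 0 ∧ b n w = 0 ∧ g n w = 0 ∧ d n w = 0)
    (hgrow : ∀ n, ∃ C, ∀ y : ℝ, 0 ≤ y → ‖g n (-y : ℝ)‖ ≤ C * (1 + y) ^ 2) :
    ∀ n w, b n w = 0 ∧ g n w = 0 ∧ a n w = d n w := by
  have hE : ∀ w, Complex.exp w ≠ 0 := Complex.exp_ne_zero
  have hvanish : ∀ n, (∀ w, c * b n w = Complex.exp w * g n w) → ∀ w, g n w = 0 := by
    intro n hn
    have hrel : ∀ w, c * (d (n - 1) w - a (n - 1) w) = -(g n w / 2) := fun w => by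
      have e1 := (hb n w).const_mul c
      have e2 := (Complex.hasDerivAt_exp w).mul (hg n w)
      have e3 := (e1.congr_of_eventuallyEq (f₁ := fun w => Complex.exp w * g n w)
        (Filter.Eventually.of_forall fun w => (hn w).symm)).unique e2
      refine mul_left_cancel₀ (hE w) ?_
      linear_combination (-1 / 2 : ℂ) * e3
    have hconst : ∀ w, HasDerivAt (fun w => g n w * Complex.exp (w / 2)) 0 w := fun w => by
      have := (hg n w).mul (((hasDerivAt_id w).div_const 2).cexp)
      refine this.congr_deriv ?_
      rw [hrel]
      simp only [id]; ring
    have hk := fun w => is_const_of_deriv_eq_zero (fun w => (hconst w).differentiableAt)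
      (fun w => (hconst w).deriv) w 0
    simp only [zero_div, Complex.exp_zero, mul_one] at hk
    obtain ⟨C, hC⟩ := hgrow n
    have hz : ‖g n 0‖ = 0 := by
      refine eq_zero_of_exp_growth (C := C) (norm_nonneg _) fun y hy => ?_
      refine le_trans (le_of_eq ?_) (hC y hy)
      have h1 := congrArg norm (hk ((-y : ℝ) : ℂ))
      have h2 : ‖Complex.exp (((-y : ℝ) : ℂ) / 2)‖ = Real.exp (-(y / 2)) := by
        rw [← Complex.ofReal_ofNat, ← Complex.ofReal_div, Complex.norm_exp_ofReal]
        congr 1; ring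
      rw [norm_mul, h2] at h1
      rw [← h1, mul_assoc, ← Real.exp_add, neg_add_cancel, Real.exp_zero, mul_one]
    intro w
    have := hk w
    rw [norm_eq_zero.1 hz] at this
    exact (mul_eq_zero.1 this).resolve_right (hE _)
  have main : ∀ k : ℕ, ∀ w, a (1 - k) w = d (1 - k) w ∧
      c * b (1 - k) w = Complex.exp w * g (1 - k) w := by
    intro k
    induction k with
    | zero =>
      intro w
      obtain ⟨h1, h2, h3, h4⟩ := h0 1 one_pos w
      simp [h1, h2, h3, h4]
    | succ k ih =>
      have e : ((1 : ℤ) - ((k + 1 : ℕ) : ℤ)) = 1 - k - 1 := by push_cast; ring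
      rw [e]
      have hg0 := hvanish _ fun w => (ih w).2
      intro w
      constructor
      · have h1 := (hg (1 - k) w).congr_of_eventuallyEq (f₁ := fun _ => 0)
          (Filter.Eventually.of_forall fun w => (hg0 w).symm)
        have h2 := h1.unique (hasDerivAt_const w 0)
        exact (sub_eq_zero.1 ((mul_eq_zero.1 h2).resolve_left hc)).symm
      · have h1 := (ha (1 - k) w).congr_of_eventuallyEq (f₁ := d (1 - k))
          (Filter.Eventually.of_forall fun w => (ih w).1.symm)
        have h2 := h1.unique (hd (1 - k) w)
        linear_combination h2 / 2
  intro n w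
  rcases lt_or_ge 0 n with hn | hn
  · obtain ⟨h1, h2, h3, h4⟩ := h0 n hn w
    exact ⟨h2, h3, h1.trans h4.symm⟩
  · obtain ⟨k, hk⟩ : ∃ k : ℕ, n = 1 - k := ⟨(1 - n).toNat, by omega⟩
    rw [hk]
    have hm := main k
    have hg0 := hvanish _ fun w => (hm w).2
    refine ⟨?_, hg0 w, (hm w).1⟩
    have := (hm w).2
    rw [hg0 w, mul_zero] at this
    exact (mul_eq_zero.1 this).resolve_left hc

end DPW

end

noncomputable section

namespace DPW

open Set Metric MeasureTheory AddCircle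

/-! ### Annular domains with nontrivial winding -/

lemma isConnected_roundAnnulus : IsConnected {z : ℂ | 1 < ‖z‖ ∧ ‖z‖ < 2} := by
  have e : {z : ℂ | 1 < ‖z‖ ∧ ‖z‖ < 2} = Complex.exp '' (Complex.re ⁻¹' Ioo 0 (Real.log 2)) := by
    ext z
    constructor
    · rintro ⟨h1, h2⟩
      have hz : z ≠ 0 := by rintro rfl; simp at h1; linarith
      refine ⟨Complex.log z, ⟨?_, ?_⟩, Complex.exp_log hz⟩
      · rw [Complex.log_re]; exact Real.log_pos h1
      · rw [Complex.log_re]; exact Real.log_lt_log (by linarith) h2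
    · rintro ⟨w, ⟨h1, h2⟩, rfl⟩
      refine ⟨?_, ?_⟩
      · rw [Complex.norm_exp]; exact Real.one_lt_exp_iff.2 h1
      · rw [Complex.norm_exp]
        exact (Real.lt_log_iff_exp_lt two_pos).1 h2
  rw [e]
  refine IsConnected.image ⟨⟨((Real.log 2 / 2 : ℝ) : ℂ), ?_⟩, ?_⟩ _
    Complex.continuous_exp.continuousOn
  · have := Real.log_pos one_lt_two
    exact ⟨by simp only [Complex.ofReal_re]; linarith, by simp only [Complex.ofReal_re]; linarith⟩
  · exact ((convex_Ioo (0 : ℝ) (Real.log 2)).linear_preimage Complex.reLm).isPreconnected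

lemma IsWindingAnnulus.isConnected {Ω : Set ℂ} (h : IsWindingAnnulus Ω) : IsConnected Ω := by
  obtain ⟨e⟩ := h.annular
  have h1 : ConnectedSpace {z : ℂ | 1 < ‖z‖ ∧ ‖z‖ < 2} :=
    isConnected_iff_connectedSpace.1 isConnected_roundAnnulus
  exact isConnected_iff_connectedSpace.2 (e.symm.surjective.connectedSpace e.symm.continuous)

lemma exists_log_branch_ball {z : ℂ} (hz : z ≠ 0) : ∃ l : ℂ → ℂ, ContinuousOn l (ball z ‖z‖) ∧
    ∀ y ∈ ball z ‖z‖, Complex.exp (l y) = y := by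
  have hmem : ∀ y ∈ ball z ‖z‖, y / z ∈ Complex.slitPlane := fun y hy => by
    refine Complex.mem_slitPlane_of_norm_lt_one (z := y / z - 1) ?_ |> fun h => by simpa using h
    rw [show y / z - 1 = (y - z) / z by field_simp, norm_div, div_lt_one (norm_pos_iff.2 hz)]
    exact mem_ball_iff_norm.1 hy
  refine ⟨fun y => Complex.log z + Complex.log (y / z), ?_, fun y hy => ?_⟩
  · exact continuousOn_const.add (ContinuousOn.clog (continuousOn_id.div_const z) hmem)
  · have h0 : y / z ≠ 0 := Complex.slitPlane_ne_zero (hmem y hy)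
    rw [Complex.exp_add, Complex.exp_log hz, Complex.exp_log h0, mul_div_cancel₀ _ hz]

theorem IsWindingAnnulus.exists_period {Ω : Set ℂ} (h : IsWindingAnnulus Ω) :
    ∃ V ⊆ Complex.exp ⁻¹' Ω, IsOpen V ∧ IsPreconnected V ∧ V.Nonempty ∧
      ∃ m : ℤ, m ≠ 0 ∧ ∀ w ∈ V, w + m * (2 * Real.pi * Complex.I) ∈ V := by
  have hne : ∀ z ∈ Ω, z ≠ 0 := fun z hz => h.subset hz
  set U := Complex.exp ⁻¹' Ω with hU
  have hUo : IsOpen U := h.isOpen.preimage Complex.continuous_exp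
  obtain ⟨z₀, hz₀⟩ := h.isConnected.nonempty
  set w₀ := Complex.log z₀ with hw₀
  have hw₀U : w₀ ∈ U := by
    change Complex.exp w₀ ∈ Ω
    rwa [hw₀, Complex.exp_log (hne z₀ hz₀)]
  set V := connectedComponentIn U w₀ with hV
  have hVU : V ⊆ U := connectedComponentIn_subset U w₀
  have hVo : IsOpen V := hUo.connectedComponentIn
  have hVc : IsPreconnected V := isPreconnected_connectedComponentIn
  have hVn : w₀ ∈ V := mem_connectedComponentIn hw₀U
  have hmax : ∀ W : Set ℂ, IsPreconnected W → W ⊆ U → ∀ v ∈ V, v ∈ W → W ⊆ V := by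
    intro W hW hWU v hv hvW
    rw [hV, connectedComponentIn_eq hv]
    exact hW.subset_connectedComponentIn hvW hWU
  have himg : Ω ⊆ Complex.exp '' V := by
    refine h.isConnected.isPreconnected.subset_of_closure_inter_subset
      (Complex.isOpenMap_exp V hVo) ⟨z₀, hz₀, w₀, hVn, Complex.exp_log (hne z₀ hz₀)⟩ ?_
    rintro z ⟨hz, hzΩ⟩
    have hz0 := hne z hzΩ
    obtain ⟨δ, hδ, hδΩ⟩ := Metric.isOpen_iff.1 h.isOpen z hzΩ
    obtain ⟨l, hl, hle⟩ := exists_log_branch_ball hz0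
    set ρ := min δ ‖z‖ with hρ
    have hρ0 : 0 < ρ := lt_min hδ (norm_pos_iff.2 hz0)
    have hsub : ball z ρ ⊆ ball z ‖z‖ := ball_subset_ball (min_le_right _ _)
    obtain ⟨y, hyu, hyz⟩ := Metric.mem_closure_iff.1 hz ρ hρ0
    obtain ⟨v, hv, rfl⟩ := hyu
    have hvb : Complex.exp v ∈ ball z ρ := by rw [mem_ball, dist_comm]; exact hyz
    obtain ⟨n, hn⟩ := Complex.exp_eq_exp_iff_exists_int.1 (hle _ (hsub hvb)).symm
    set W : Set ℂ := (fun x => l x + n * (2 * Real.pi * Complex.I)) '' ball z ρ with hW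
    have hexpW : ∀ x ∈ ball z ρ, Complex.exp (l x + n * (2 * Real.pi * Complex.I)) = x := fun x hx => by
      rw [Complex.exp_add, hle x (hsub hx), Complex.exp_int_mul_two_pi_mul_I, mul_one]
    have hWV : W ⊆ V := by
      refine hmax W ?_ ?_ v hv ⟨Complex.exp v, hvb, hn.symm⟩
      · exact (convex_ball z ρ).isPreconnected.image _ ((hl.mono hsub).add continuousOn_const)
      · rintro _ ⟨x, hx, rfl⟩
        change Complex.exp _ ∈ Ω
        rw [hexpW x hx]
        exact hδΩ (ball_subset_ball (min_le_left _ _) hx)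
    have hzb : z ∈ ball z ρ := mem_ball_self hρ0
    exact ⟨_, hWV ⟨z, hzb, rfl⟩, hexpW z hzb⟩
  have hninj : ¬ InjOn Complex.exp V := fun hinj => by
    have hex : ∀ z ∈ Ω, ∃ w, w ∈ V ∧ Complex.exp w = z := fun z hz => himg hz
    choose! l hlV hle using hex
    refine h.winding ⟨l, fun z hz => ContinuousAt.continuousWithinAt ?_, hle⟩
    rw [ContinuousAt, Filter.tendsto_def]
    intro N hN
    obtain ⟨N', hN'N, hN'o, hlN⟩ := _root_.mem_nhds_iff.1 hN
    have hopen := Complex.isOpenMap_exp (N' ∩ V) (hN'o.inter hVo)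
    refine Filter.mem_of_superset (hopen.mem_nhds ⟨l z, ⟨hlN, hlV z hz⟩, hle z hz⟩) ?_
    rintro _ ⟨v, ⟨hvN, hvV⟩, rfl⟩
    have hvΩ : Complex.exp v ∈ Ω := hVU hvV
    have : l (Complex.exp v) = v := hinj (hlV _ hvΩ) hvV (hle _ hvΩ)
    rw [mem_preimage, this]
    exact hN'N hvN
  simp only [InjOn, not_forall] at hninj
  obtain ⟨w₁, hw₁, w₂, hw₂, heq, hne12⟩ := hninj
  obtain ⟨m, hm⟩ := Complex.exp_eq_exp_iff_exists_int.1 heq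
  refine ⟨V, hVU, hVo, hVc, ⟨w₀, hVn⟩, m, ?_, ?_⟩
  · rintro rfl
    exact hne12 (by simpa using hm)
  · intro w hw
    refine hmax ((fun x => x + m * (2 * Real.pi * Complex.I)) '' V)
      (hVc.image _ (continuous_add_const _).continuousOn) ?_ w₁ hw₁ ⟨w₂, hw₂, hm.symm⟩ ⟨w, hw, rfl⟩
    rintro _ ⟨x, hx, rfl⟩
    change Complex.exp _ ∈ Ω
    rw [Complex.exp_add, Complex.exp_int_mul_two_pi_mul_I, mul_one]
    exact hVU hx

end DPW

end

noncomputable section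
namespace DPW
open Set Metric MeasureTheory AddCircle

/-! ### Nonexistence of closed surfaces for the exponent `-1` -/

lemma mul_inv_eq_of_mfd_eq {V : Set ℂ} (hV : IsOpen V) (hVc : IsPreconnected V) {g h : ℂ → Mat2}
    {φ : ℂ → ℂ → Mat2} (hg : ∀ z ∈ V, MDiff g z) (hh : ∀ z ∈ V, MDiff h z)
    (hdet : ∀ z ∈ V, (h z).det = 1) (hg' : ∀ z ∈ V, ∀ v, mfd g z v = g z * φ z v)
    (hh' : ∀ z ∈ V, ∀ v, mfd h z v = h z * φ z v) {z w : ℂ} (hz : z ∈ V) (hw : w ∈ V) :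
    g z * (h z)⁻¹ = g w * (h w)⁻¹ := by
  have hev : ∀ z ∈ V, ∀ᶠ w in nhds z, (h w).det = 1 := fun z hz => by
    filter_upwards [hV.mem_nhds hz] with w hw using hdet w hw
  have hzero : ∀ z ∈ V, ∀ v, mfd (fun w => g w * (h w)⁻¹) z v = 0 := fun z hz v => by
    rw [mfd_mul (hg z hz) ((hh z hz).inv (hev z hz)), mfd_inv (hh z hz) (hev z hz), hg' z hz,
      hh' z hz, ← mul_assoc (h z)⁻¹, inv_mul_of_det_eq_one (hdet z hz), one_mul, mul_neg, mul_assoc,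
      add_neg_cancel]
  ext i j
  refine hV.is_const_of_fderiv_eq_zero (𝕜 := ℝ) (f := fun w => (g w * (h w)⁻¹) i j) hVc
    (fun z hz => (((hg z hz).mul ((hh z hz).inv (hev z hz))) i j).differentiableWithinAt)
    (fun z hz => ?_) hz hw
  ext v
  exact congr_entry (hzero z hz v) i j

lemma surfDensity_injective {ε : ℝ} {b b' : ℝ} (hb : 0 < b) (hb' : 0 < b') {p q : ℂ}
    (hp : p ≠ 0) (hq : q ≠ 0)
    (h : surfDensity ε (fun _ => b) (fun _ => p) (fun _ => q) 0 =
      surfDensity ε (fun _ => b') (fun _ => p) (fun _ => q) 0) : b = b' := by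
  have hp' := Complex.normSq_pos.2 hp
  have hq' := Complex.normSq_pos.2 hq
  have key : (b ^ 2) ^ 2 = (b' ^ 2) ^ 2 := by
    unfold surfDensity at h
    split_ifs at h
    · simp only [map_mul, map_pow, Complex.normSq_ofReal] at h
      have := mul_right_cancel₀ hp'.ne' h
      linarith [this]
    · simp only [map_mul, map_pow, map_inv₀, Complex.normSq_ofReal] at h
      have := inv_injective (mul_right_cancel₀ hq'.ne' h)
      linarith [this]
  have h1 : b ^ 2 = b' ^ 2 := (pow_left_inj₀ (by positivity) (by positivity) two_ne_zero).1 key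
  exact (pow_left_inj₀ hb.le hb'.le two_ne_zero).1 h1

/-- The monodromy of the frame of a surface with a period. -/
theorem IsDPWData.monodromy_eq {r : ℝ} {p q : ℂ → ℂ} {V : Set ℂ} {L F B : ℂ → ℂ → Mat2}
    (h : IsDPWData r (offDiag p q) V L F B) (hr : r ∈ Ioc (0 : ℝ) 1) (hV : IsOpen V)
    (hVc : IsPreconnected V) {τ : ℂ} (hτ : ∀ w ∈ V, w + τ ∈ V) (hp : ∀ w, p (w + τ) = p w)
    (hq : ∀ w, q (w + τ) = q w) (hp0 : ∀ w, p w ≠ 0) (hq0 : ∀ w, q w ≠ 0) {lam₀ : ℂ}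
    (hlam₀ : lam₀ ∈ sphere (0 : ℂ) 1) {ε H : ℝ} (hε : ε = 1 ∨ ε = -1) (hH : H ≠ 0)
    (hf : ∀ w ∈ V, toR3 (symBobenko ε H (F (w + τ)) lam₀) = toR3 (symBobenko ε H (F w) lam₀))
    {lam : ℂ} (hlam : lam ∈ sphere (0 : ℂ) r) {w w' : ℂ} (hw : w ∈ V) (hw' : w' ∈ V) :
    F (w + τ) lam * (F w lam)⁻¹ = F (w' + τ) lam * (F w' lam)⁻¹ := by
  set b := metricFn B with hb
  have hper : ∀ z ∈ V, b (z + τ) = b z := fun z hz => by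
    have e : fderiv ℝ (fun w => toR3 (symBobenko ε H (F w) lam₀)) (z + τ) =
        fderiv ℝ (fun w => toR3 (symBobenko ε H (F w) lam₀)) z := by
      rw [← fderiv_comp_add_right (f := fun w => toR3 (symBobenko ε H (F w) lam₀))]
      refine Filter.EventuallyEq.fderiv_eq ?_
      filter_upwards [hV.mem_nhds hz] with w hw using hf w hw
    have e1 := h.inner_fderiv_surface hr hV (hτ z hz) hlam₀ hε H 1 1
    rw [e, h.inner_fderiv_surface hr hV hz hlam₀ hε H 1 1] at e1
    have hH2 : (H ^ 2)⁻¹ ≠ 0 := inv_ne_zero (pow_ne_zero 2 hH)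
    have e2 : surfDensity ε b p q z = surfDensity ε b p q (z + τ) := by
      simp only [inner_self_eq_norm_sq_to_K, norm_one] at e1
      have := mul_right_cancel₀ hH2 (by simpa using e1 :
        4 * surfDensity ε b p q z * (H ^ 2)⁻¹ = 4 * surfDensity ε b p q (z + τ) * (H ^ 2)⁻¹)
      linarith
    refine (surfDensity_injective (ε := ε) (h.metricFn_pos hz).1 (h.metricFn_pos (hτ z hz)).1 (hp0 z)
      (hq0 z) ?_).symm
    simpa [surfDensity, hp, hq] using e2
  have hform : ∀ z ∈ V, ∀ v, frameForm b p q (z + τ) lam v = frameForm b p q z lam v :=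
    fun z hz v => by
      have e : fderiv ℝ b (z + τ) = fderiv ℝ b z := by
        rw [← fderiv_comp_add_right (f := b)]
        refine Filter.EventuallyEq.fderiv_eq ?_
        filter_upwards [hV.mem_nhds hz] with w hw using hper w hw
      simp only [frameForm, e, hper z hz, hp, hq]
  have hr1 : r ∈ Icc r 1 := ⟨le_rfl, hr.2⟩
  have hmd : ∀ z ∈ V, MDiff (fun w => F w lam) z := fun z hz =>
    (h.smooth_F r hr1).mdiff hr.1 hV hz hlam
  refine mul_inv_eq_of_mfd_eq hV hVc (g := fun w => F (w + τ) lam) (h := fun w => F w lam)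
    (φ := fun z v => frameForm b p q z lam v) (fun z hz i j => ?_) hmd
    (fun z hz => h.det_F hr.1 hr1 hz hlam) (fun z hz v => ?_)
    (fun z hz v => h.frame_eq hr hV hz v (Or.inl rfl) hlam) hw hw'
  · exact (hmd (z + τ) (hτ z hz) i j).comp z (differentiableAt_id.add_const τ)
  · rw [← hform z hz, ← h.frame_eq hr hV (hτ z hz) v (Or.inl rfl) hlam]
    ext i j
    simp only [mfd_apply]
    rw [fderiv_comp_add_right (f := fun w => F w lam i j)]

lemma mode_commutator_entry {r : ℝ} (hr : 0 < r) (n : ℤ) {x y : ℂ → ℂ}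
    (hx : ContinuousOn x (sphere 0 r)) (hy : ContinuousOn y (sphere 0 r)) (v α β : ℂ) :
    mode r n (fun lam => v * (lam⁻¹ * (α * x lam - β * y lam))) =
      v * (α * mode r (n - 1) x - β * mode r (n - 1) y) := by
  rw [mode_const_mul]
  have e : (fun lam : ℂ => lam⁻¹ * (α * x lam - β * y lam)) =
      fun lam => lam ^ (-1 : ℤ) * (α * x lam - β * y lam) := by simp
  rw [e, mode_zpow_mul hr, mode_sub hr (g := fun lam => α * x lam) (h := fun lam => β * y lam)
    (continuousOn_const.mul hx) (continuousOn_const.mul hy),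
    mode_const_mul, mode_const_mul, ← sub_eq_add_neg]

section Conj
variable {J0 J1 J2 k1 k2 k1' : ℂ → ℂ}

/-- The conjugate of a loop by the inverse of the explicit solution. -/
def logConj (J0 J1 k1 k2 : ℂ → ℂ) (c : ℂ) (K : ℂ → Mat2) (w lam : ℂ) : Mat2 :=
  (logFrame J0 J1 k1 k2 c w lam)⁻¹ * K lam * logFrame J0 J1 k1 k2 c w lam

lemma IsLogSystem.jointlySmooth_logFrame (h : IsLogSystem J0 J1 J2 k1 k2 k1') (c : ℂ) {r : ℝ}
    (hr : 0 < r) : JointlySmooth r univ (logFrame J0 J1 k1 k2 c) := by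
  refine jointlySmooth_of_contDiffOn hr.le (S := {0}ᶜ) (fun lam hlam h0 => ?_)
    (h.contDiffOn_logFrame c)
  rw [mem_singleton_iff.1 h0] at hlam
  simp at hlam
  exact hr.ne hlam

lemma IsLogSystem.jointlySmooth_logConj (h : IsLogSystem J0 J1 J2 k1 k2 k1') (c : ℂ) {r : ℝ}
    (hr : 0 < r) {K : ℂ → Mat2} (hK : ∀ i j, ContDiff ℝ ∞ fun t : ℝ => K (circleMap 0 r t) i j) :
    JointlySmooth r univ (logConj J0 J1 k1 k2 c K) := by
  have h1 := h.jointlySmooth_logFrame c hr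
  have h2 : JointlySmooth r univ fun _ lam => K lam := fun i j =>
    (hK i j).comp_contDiffOn contDiffOn_snd
  exact ((h1.inv hr.le fun z _ lam _ => h.det_logFrame c z lam).mul h2).mul h1

lemma IsLogSystem.mfd_logFrame (h : IsLogSystem J0 J1 J2 k1 k2 k1') (c z v lam : ℂ) :
    mfd (fun w => logFrame J0 J1 k1 k2 c w lam) z v =
      v • (logFrame J0 J1 k1 k2 c z lam * logPotential c z lam) := by
  ext i j
  have := (h.hasDerivAt_logFrame c z lam i j).hasFDerivAt.restrictScalars ℝ
  rw [mfd_apply, this.fderiv]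
  simp

lemma IsLogSystem.mdiff_logFrame (h : IsLogSystem J0 J1 J2 k1 k2 k1') (c z lam : ℂ) :
    MDiff (fun w => logFrame J0 J1 k1 k2 c w lam) z := fun i j =>
  ((h.hasDerivAt_logFrame c z lam i j).differentiableAt.restrictScalars ℝ)

lemma IsLogSystem.mfd_logConj (h : IsLogSystem J0 J1 J2 k1 k2 k1') (c : ℂ) (K : ℂ → Mat2)
    (z v lam : ℂ) : mfd (fun w => logConj J0 J1 k1 k2 c K w lam) z v =
      v • (logConj J0 J1 k1 k2 c K z lam * logPotential c z lam -
        logPotential c z lam * logConj J0 J1 k1 k2 c K z lam) := by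
  have hd : ∀ᶠ w in nhds z, (logFrame J0 J1 k1 k2 c w lam).det = 1 :=
    Filter.Eventually.of_forall fun w => h.det_logFrame c w lam
  have hm := h.mdiff_logFrame c z lam
  have hi := inv_mul_of_det_eq_one (h.det_logFrame c z lam)
  unfold logConj
  rw [mfd_mul ((hm.inv hd).mul (MDiff.const _ _)) hm, mfd_mul (hm.inv hd) (MDiff.const _ _),
    mfd_inv hm hd, mfd_const, h.mfd_logFrame, mul_zero, add_zero]
  set G := logFrame J0 J1 k1 k2 c z lam
  have e : G⁻¹ * (v • (G * logPotential c z lam)) = v • logPotential c z lam := by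
    rw [mul_smul_comm, ← mul_assoc, hi, one_mul]
  rw [e]
  simp only [mul_smul_comm, smul_mul_assoc, smul_sub, neg_mul, mul_assoc]
  abel

lemma IsLogSystem.hasDerivAt_mode_logConj (h : IsLogSystem J0 J1 J2 k1 k2 k1') (c : ℂ) {r : ℝ}
    (hr : 0 < r) {K : ℂ → Mat2} (hK : ∀ i j, ContDiff ℝ ∞ fun t : ℝ => K (circleMap 0 r t) i j)
    (n : ℤ) (z : ℂ) (i j : Fin 2) {α β : ℂ} {i₁ j₁ i₂ j₂ : Fin 2}
    (he : ∀ lam, (logConj J0 J1 k1 k2 c K z lam * logPotential c z lam -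
        logPotential c z lam * logConj J0 J1 k1 k2 c K z lam) i j =
      lam⁻¹ * (α * logConj J0 J1 k1 k2 c K z lam i₁ j₁ - β * logConj J0 J1 k1 k2 c K z lam i₂ j₂)) :
    HasDerivAt (fun w => mode r n fun lam => logConj J0 J1 k1 k2 c K w lam i j)
      (α * mode r (n - 1) (fun lam => logConj J0 J1 k1 k2 c K z lam i₁ j₁) -
        β * mode r (n - 1) fun lam => logConj J0 J1 k1 k2 c K z lam i₂ j₂) z := by
  have hS := h.jointlySmooth_logConj c hr hK
  have hcont := fun i j => hS.continuousOn_sphere hr (mem_univ z) i j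
  obtain ⟨D, hD, hDv⟩ := mode_mfd hr n isOpen_univ hS (mem_univ z) i j
  rw [hasDerivAt_iff_hasFDerivAt]
  refine hasFDerivAt_of_restrictScalars ℝ hD ?_
  ext v
  rw [hDv]
  simp only [h.mfd_logConj, Matrix.smul_apply, he, smul_eq_mul]
  rw [mode_commutator_entry hr n (hcont _ _) (hcont _ _)]
  simp

lemma IsLogSystem.norm_logConj_le (h : IsLogSystem J0 J1 J2 k1 k2 k1') (c : ℂ) {r : ℝ}
    (hr : 0 < r) {K : ℂ → Mat2} (hK : ∀ i j, ContDiff ℝ ∞ fun t : ℝ => K (circleMap 0 r t) i j)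
    (i j : Fin 2) : ∃ C, ∀ y : ℝ, 0 ≤ y → ∀ lam ∈ sphere (0 : ℂ) r,
      ‖logConj J0 J1 k1 k2 c K (-y : ℝ) lam i j‖ ≤ C * (1 + y) ^ 2 := by
  obtain ⟨C, hC, hCb⟩ := h.norm_logFrame_le c hr
  have hKc : ∀ i j, ContinuousOn (fun lam => K lam i j) (sphere 0 r) := fun i j =>
    continuousOn_sphere_of_comp hr (hK i j).continuous
  choose M hM using fun i j => (isCompact_sphere (0 : ℂ) r).exists_bound_of_continuousOn (hKc i j)
  set N := |M 0 0| + |M 0 1| + |M 1 0| + |M 1 1| with hN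
  have hNb : ∀ i j, ∀ lam ∈ sphere (0 : ℂ) r, ‖K lam i j‖ ≤ N := fun i j lam hl => by
    refine (hM i j lam hl).trans ((le_abs_self _).trans ?_)
    have := abs_nonneg (M 0 0)
    have := abs_nonneg (M 0 1)
    have := abs_nonneg (M 1 0)
    have := abs_nonneg (M 1 1)
    fin_cases i <;> fin_cases j <;> simp only [hN, Fin.zero_eta, Fin.mk_one] <;> linarith
  have hN0 : 0 ≤ N := by positivity
  refine ⟨4 * (C * N * C), fun y hy lam hl => ?_⟩
  have hG := hCb y hy lam hl
  have hGi : ∀ i j, ‖(logFrame J0 J1 k1 k2 c (-y : ℝ) lam)⁻¹ i j‖ ≤ C * (1 + y) := fun i j => by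
    rw [inv_eq_of_det_eq_one (h.det_logFrame c _ lam)]
    fin_cases i <;> fin_cases j
    · exact hG 1 1
    · exact (norm_neg _).trans_le (hG 0 1)
    · exact (norm_neg _).trans_le (hG 1 0)
    · exact hG 0 0
  have hterm : ∀ k l, ‖(logFrame J0 J1 k1 k2 c (-y : ℝ) lam)⁻¹ i k * K lam k l *
      logFrame J0 J1 k1 k2 c (-y : ℝ) lam l j‖ ≤ C * N * C * (1 + y) ^ 2 := fun k l => by
    rw [norm_mul, norm_mul]
    calc _ ≤ C * (1 + y) * N * (C * (1 + y)) := by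
          gcongr
          · exact hGi i k
          · exact hNb k l lam hl
          · exact hG l j
      _ = _ := by ring
  rw [logConj, mat2_mul_apply, mat2_mul_apply, mat2_mul_apply, add_mul, add_mul]
  refine (norm_add_le _ _).trans ?_
  have e1 := (norm_add_le _ _).trans (add_le_add (hterm 0 0) (hterm 1 0))
  have e2 := (norm_add_le _ _).trans (add_le_add (hterm 0 1) (hterm 1 1))
  linarith

/-- A loop whose conjugates by the inverse of the explicit solution are positive for the points of
an open set is scalar. -/
theorem IsLogSystem.scalar_of_logConj_positive (h : IsLogSystem J0 J1 J2 k1 k2 k1') {c : ℂ}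
    (hc : c ≠ 0) {r : ℝ} (hr : 0 < r) {K : ℂ → Mat2}
    (hK : ∀ i j, ContDiff ℝ ∞ fun t : ℝ => K (circleMap 0 r t) i j) {V : Set ℂ} (hV : IsOpen V)
    (hVn : V.Nonempty)
    (hpos : ∀ w ∈ V, ∃ P, IsPosLoop r P ∧
      ∀ lam ∈ sphere (0 : ℂ) r, logConj J0 J1 k1 k2 c K w lam = P lam)
    {lam : ℂ} (hlam : lam ∈ sphere (0 : ℂ) r) : ∃ κ : ℂ, K lam = κ • (1 : Mat2) := by
  set S := logConj J0 J1 k1 k2 c K with hSdef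
  have hS : JointlySmooth r univ S := h.jointlySmooth_logConj c hr hK
  have ha : ∀ n w, HasDerivAt (fun w => mode r n fun lam => S w lam 0 0)
      (c * mode r (n - 1) (fun lam => S w lam 0 1) -
        Complex.exp w * mode r (n - 1) fun lam => S w lam 1 0) w := fun n w =>
    h.hasDerivAt_mode_logConj c hr hK n w 0 0 fun lam => by
      rw [Matrix.sub_apply, mat2_mul_apply, mat2_mul_apply]; simp [logPotential]; ring
  have hb : ∀ n w, HasDerivAt (fun w => mode r n fun lam => S w lam 0 1)
      (Complex.exp w * mode r (n - 1) (fun lam => S w lam 0 0) -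
        Complex.exp w * mode r (n - 1) fun lam => S w lam 1 1) w := fun n w =>
    h.hasDerivAt_mode_logConj c hr hK n w 0 1 fun lam => by
      rw [Matrix.sub_apply, mat2_mul_apply, mat2_mul_apply]; simp [logPotential]; ring
  have hg : ∀ n w, HasDerivAt (fun w => mode r n fun lam => S w lam 1 0)
      (c * mode r (n - 1) (fun lam => S w lam 1 1) -
        c * mode r (n - 1) fun lam => S w lam 0 0) w := fun n w =>
    h.hasDerivAt_mode_logConj c hr hK n w 1 0 fun lam => by
      rw [Matrix.sub_apply, mat2_mul_apply, mat2_mul_apply]; simp [logPotential]; ring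
  have hd : ∀ n w, HasDerivAt (fun w => mode r n fun lam => S w lam 1 1)
      (Complex.exp w * mode r (n - 1) (fun lam => S w lam 1 0) -
        c * mode r (n - 1) fun lam => S w lam 0 1) w := fun n w =>
    h.hasDerivAt_mode_logConj c hr hK n w 1 1 fun lam => by
      rw [Matrix.sub_apply, mat2_mul_apply, mat2_mul_apply]; simp [logPotential]; ring
  have hdiff : ∀ n i j, Differentiable ℂ fun w => mode r n fun lam => S w lam i j := by
    intro n i j
    fin_cases i <;> fin_cases j
    · exact fun w => (ha n w).differentiableAt
    · exact fun w => (hb n w).differentiableAt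
    · exact fun w => (hg n w).differentiableAt
    · exact fun w => (hd n w).differentiableAt
  obtain ⟨w₀, hw₀⟩ := hVn
  have hzero : ∀ n, 0 < n → ∀ i j w, (mode r n fun lam => S w lam i j) = 0 := by
    intro n hn i j w
    have e := AnalyticOnNhd.eqOn_of_preconnected_of_eventuallyEq (U := univ)
      (f := fun w => mode r n fun lam => S w lam i j) (g := fun _ => (0 : ℂ)) (z₀ := w₀)
      (fun z _ => (hdiff n i j).analyticAt z) (fun z _ => analyticAt_const) isPreconnected_univ
      (mem_univ _) ?_
    · exact e (mem_univ w)
    · filter_upwards [hV.mem_nhds hw₀] with w hw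
      obtain ⟨P, hP, hPe⟩ := hpos w hw
      rw [mode_congr hr.le (h := fun lam => P lam i j) fun lam hl => congr_entry (hPe lam hl) i j]
      exact mode_disc_pos hr hn (hP.continuousOn i j) (hP.holomorphic i j)
  have hgrow : ∀ n : ℤ, ∃ C, ∀ y : ℝ, 0 ≤ y →
      ‖mode r n fun lam => S (-y : ℝ) lam 1 0‖ ≤ C * (1 + y) ^ 2 := fun n => by
    obtain ⟨C, hC⟩ := h.norm_logConj_le c hr hK 1 0
    refine ⟨r ^ n * C * (2 * Real.pi), fun y hy => ?_⟩
    exact (norm_mode_le_of_le hr (hC y hy) n).trans_eq (by ring)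
  have key := scalar_of_commutator hc ha (fun n w => (hb n w).congr_deriv (by ring))
    (fun n w => (hg n w).congr_deriv (by ring)) hd
    (fun n hn w => ⟨hzero n hn _ _ w, hzero n hn _ _ w, hzero n hn _ _ w, hzero n hn _ _ w⟩) hgrow
  have hcont := fun i j => hS.continuousOn_sphere hr (mem_univ w₀) i j
  have h01 : S w₀ lam 0 1 = 0 := eq_zero_of_mode_eq_zero hr (hcont 0 1) (fun n => (key n w₀).1) _ hlam
  have h10 : S w₀ lam 1 0 = 0 := eq_zero_of_mode_eq_zero hr (hcont 1 0) (fun n => (key n w₀).2.1) _ hlam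
  have h00 : S w₀ lam 0 0 = S w₀ lam 1 1 :=
    eq_of_mode_eq hr (hcont 0 0) (hcont 1 1) (fun n => (key n w₀).2.2) _ hlam
  refine ⟨S w₀ lam 0 0, ?_⟩
  have hscal : S w₀ lam = S w₀ lam 0 0 • (1 : Mat2) := by
    ext i j
    fin_cases i <;> fin_cases j <;> simp [h01, h10, h00]
  set G := logFrame J0 J1 k1 k2 c w₀ lam with hGdef
  have hG := mul_inv_of_det_eq_one (h.det_logFrame c w₀ lam)
  have e : K lam = G * S w₀ lam * G⁻¹ := by
    rw [hSdef, logConj, ← hGdef]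
    simp only [mul_assoc]
    rw [hG, mul_one, ← mul_assoc, hG, one_mul]
  rw [e, hscal, mul_smul_comm, mul_one, smul_mul_assoc, hG]
  simp

end Conj

lemma scalar_of_unitary_of_trace_sq {M : Mat2} (hM : M ∈ Matrix.unitaryGroup (Fin 2) ℂ)
    (hd : M.det = 1) (ht : (M 0 0 + M 1 1) ^ 2 - 4 = 0) :
    M 0 1 = 0 ∧ M 1 0 = 0 ∧ M 0 0 - M 1 1 = 0 := by
  obtain ⟨h11, h01⟩ := conj_apply_of_unitary hM hd
  rw [Matrix.det_fin_two, h01, h11] at hd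
  rw [h11] at ht
  have e1 : Complex.normSq (M 0 0) + Complex.normSq (M 1 0) = 1 := by
    have : (Complex.normSq (M 0 0) : ℂ) + Complex.normSq (M 1 0) = 1 := by
      rw [Complex.normSq_eq_conj_mul_self, Complex.normSq_eq_conj_mul_self, map_neg] at *
      linear_combination hd
    exact_mod_cast this
  have e2 : (M 0 0).re ^ 2 = 1 := by
    rw [Complex.add_conj] at ht
    have : (2 * (M 0 0).re) ^ 2 - 4 = (0 : ℝ) := by exact_mod_cast ht
    linarith
  have e3 : Complex.normSq (M 0 0) = (M 0 0).re ^ 2 + (M 0 0).im ^ 2 := by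
    rw [Complex.normSq_apply]; ring
  have e4 : Complex.normSq (M 1 0) = 0 := by
    have := Complex.normSq_nonneg (M 1 0)
    nlinarith [sq_nonneg (M 0 0).im]
  have e5 : (M 0 0).im = 0 := by
    have : (M 0 0).im ^ 2 = 0 := by linarith
    exact pow_eq_zero_iff two_ne_zero |>.1 this
  have h10 := Complex.normSq_eq_zero.1 e4
  refine ⟨by rw [h01, h10]; simp, h10, ?_⟩
  rw [h11]
  apply Complex.ext <;> simp [e5]

/-- An `SU(2)`-loop, on the annulus between the circle of radius `r` and the unit circle, with
trace `±2` on the inner circle is scalar there. -/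
lemma scalar_of_trace_sq {r : ℝ} (hr : r ∈ Ioc (0 : ℝ) 1) {N : ℂ → Mat2}
    (hc : ∀ i j, ContinuousOn (fun lam => N lam i j) {lam | r ≤ ‖lam‖ ∧ ‖lam‖ ≤ 1})
    (hd : ∀ i j, DifferentiableOn ℂ (fun lam => N lam i j) {lam | r < ‖lam‖ ∧ ‖lam‖ < 1})
    (hdet : ∀ lam ∈ sphere (0 : ℂ) 1, (N lam).det = 1)
    (hu : ∀ lam ∈ sphere (0 : ℂ) 1, N lam ∈ Matrix.unitaryGroup (Fin 2) ℂ)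
    (ht : ∀ lam ∈ sphere (0 : ℂ) r, (N lam 0 0 + N lam 1 1) ^ 2 - 4 = 0) {lam : ℂ}
    (hlam : lam ∈ sphere (0 : ℂ) r) : N lam 0 1 = 0 ∧ N lam 1 0 = 0 ∧ N lam 0 0 - N lam 1 1 = 0 := by
  have h1 := (eq_zero_on_outer_iff (g := fun lam => (N lam 0 0 + N lam 1 1) ^ 2 - 4) hr.1 hr.2
    ((((hc 0 0).add (hc 1 1)).pow 2).sub continuousOn_const)
    ((((hd 0 0).add (hd 1 1)).pow 2).sub (differentiableOn_const _))).2 ht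
  have h2 := fun lam hl => scalar_of_unitary_of_trace_sq (hu lam hl) (hdet lam hl) (h1 lam hl)
  exact ⟨(eq_zero_on_outer_iff hr.1 hr.2 (hc 0 1) (hd 0 1)).1 (fun lam hl => (h2 lam hl).1) lam hlam,
    (eq_zero_on_outer_iff hr.1 hr.2 (hc 1 0) (hd 1 0)).1 (fun lam hl => (h2 lam hl).2.1) lam hlam,
    (eq_zero_on_outer_iff hr.1 hr.2 ((hc 0 0).sub (hc 1 1)) ((hd 0 0).sub (hd 1 1))).1
      (fun lam hl => (h2 lam hl).2.2) lam hlam⟩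

end DPW

end

noncomputable section
namespace DPW
open Set Metric MeasureTheory AddCircle

/-- The relative loop of two `SU(2)`-loops, written with the adjugate. -/
lemma IsUnitaryLoop.scalar_mul_inv {r : ℝ} (hr : r ∈ Ioc (0 : ℝ) 1) {F G : ℂ → Mat2}
    (hF : IsUnitaryLoop r F) (hG : IsUnitaryLoop r G)
    (ht : ∀ lam ∈ sphere (0 : ℂ) r, (F lam * (G lam)⁻¹).trace ^ 2 - 4 = 0) {lam : ℂ}
    (hlam : lam ∈ sphere (0 : ℂ) r) : ∃ ν : ℂ, F lam * (G lam)⁻¹ = ν • (1 : Mat2) := by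
  have hr1 : 1 ≤ r⁻¹ := (one_le_inv₀ hr.1).2 hr.2
  have hsub : {lam : ℂ | r ≤ ‖lam‖ ∧ ‖lam‖ ≤ 1} ⊆ closedAnnulus r := fun l hl =>
    ⟨hl.1, hl.2.trans hr1⟩
  have hsub' : {lam : ℂ | r < ‖lam‖ ∧ ‖lam‖ < 1} ⊆ {lam | r < ‖lam‖ ∧ ‖lam‖ < r⁻¹} := fun l hl =>
    ⟨hl.1, hl.2.trans_le hr1⟩
  set N : ℂ → Mat2 := fun lam => F lam * !![G lam 1 1, -G lam 0 1; -G lam 1 0, G lam 0 0] with hN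
  have hNe : ∀ lam ∈ closedAnnulus r, N lam = F lam * (G lam)⁻¹ := fun lam hl => by
    rw [hN, inv_eq_of_det_eq_one (hG.det_eq_one lam hl)]
  have hr' : ∀ lam ∈ sphere (0 : ℂ) r, lam ∈ closedAnnulus r := fun lam hl =>
    mem_closedAnnulus_of_sphere hr.1 ⟨le_rfl, hr.2⟩ hl
  have h1' : ∀ lam ∈ sphere (0 : ℂ) 1, lam ∈ closedAnnulus r := fun lam hl =>
    mem_closedAnnulus_of_sphere hr.1 ⟨hr.2, le_rfl⟩ hl
  have hadjc : ∀ i j, ContinuousOn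
      (fun lam => (!![G lam 1 1, -G lam 0 1; -G lam 1 0, G lam 0 0] : Mat2) i j)
      (closedAnnulus r) := by
    intro i j
    fin_cases i <;> fin_cases j
    · exact hG.continuousOn 1 1
    · exact (hG.continuousOn 0 1).neg
    · exact (hG.continuousOn 1 0).neg
    · exact hG.continuousOn 0 0
  have hadjd : ∀ i j, DifferentiableOn ℂ
      (fun lam => (!![G lam 1 1, -G lam 0 1; -G lam 1 0, G lam 0 0] : Mat2) i j)
      {lam | r < ‖lam‖ ∧ ‖lam‖ < r⁻¹} := by
    intro i j
    fin_cases i <;> fin_cases j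
    · exact hG.holomorphic 1 1
    · exact (hG.holomorphic 0 1).neg
    · exact (hG.holomorphic 1 0).neg
    · exact hG.holomorphic 0 0
  have key := scalar_of_trace_sq hr (N := N) (fun i j => ?_) (fun i j => ?_) (fun lam hl => ?_)
    (fun lam hl => ?_) (fun lam hl => ?_) hlam
  · refine ⟨N lam 0 0, ?_⟩
    rw [← hNe lam (hr' lam hlam)]
    ext i j
    fin_cases i <;> fin_cases j <;> simp [key.1, key.2.1]
    exact (sub_eq_zero.1 key.2.2).symm
  · simp only [hN, mat2_mul_apply]
    exact ((((hF.continuousOn i 0).mul (hadjc 0 j))).add ((hF.continuousOn i 1).mul (hadjc 1 j))).mono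
      hsub
  · simp only [hN, mat2_mul_apply]
    exact ((((hF.holomorphic i 0).mul (hadjd 0 j))).add ((hF.holomorphic i 1).mul (hadjd 1 j))).mono
      hsub'
  · rw [hNe lam (h1' lam hl), Matrix.det_mul, hF.det_eq_one lam (h1' lam hl),
      det_inv_of_det_eq_one (hG.det_eq_one lam (h1' lam hl)), one_mul]
  · rw [hNe lam (h1' lam hl), inv_eq_star_of_mem_unitary (hG.unitary lam hl)]
    exact mul_mem (hF.unitary lam hl) (Unitary.star_mem (hG.unitary lam hl))
  · have := ht lam hl
    rwa [← hNe lam (hr' lam hl), Matrix.trace_fin_two] at this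

/-- DPW data for the exponent `-1` have no periodic surface. -/
theorem IsDPWData.not_periodic {r : ℝ} {c : ℂ} (hc : c ≠ 0) {V : Set ℂ} {L F B : ℂ → ℂ → Mat2}
    (h : IsDPWData r (offDiag Complex.exp fun _ => c) V L F B) (hr : r ∈ Ioc (0 : ℝ) 1)
    (hV : IsOpen V) (hVc : IsPreconnected V) (hVn : V.Nonempty) {τ : ℂ} (hτ0 : τ ≠ 0)
    (hτe : Complex.exp τ = 1) (hτ : ∀ w ∈ V, w + τ ∈ V) {lam₀ : ℂ}
    (hlam₀ : lam₀ ∈ sphere (0 : ℂ) 1) {ε H : ℝ} (hε : ε = 1 ∨ ε = -1) (hH : H ≠ 0) :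
    ¬ ∀ w ∈ V, toR3 (symBobenko ε H (F (w + τ)) lam₀) = toR3 (symBobenko ε H (F w) lam₀) := by
  intro hf
  obtain ⟨J0, J1, J2, k1, k2, k1', hJ⟩ := exists_logSystem
  set L₀ := logFrame J0 J1 k1 k2 c with hL₀
  have hr1 : r ∈ Icc r 1 := ⟨le_rfl, hr.2⟩
  have hd₀ := fun w lam => hJ.det_logFrame c w lam
  have hmono : ∀ lam ∈ sphere (0 : ℂ) r, ∀ w ∈ V, ∀ w' ∈ V,
      F (w + τ) lam * (F w lam)⁻¹ = F (w' + τ) lam * (F w' lam)⁻¹ := fun lam hl w hw w' hw' =>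
    h.monodromy_eq hr hV hVc hτ (fun w => by rw [Complex.exp_add, hτe, mul_one]) (fun _ => rfl)
      Complex.exp_ne_zero (fun _ => hc) hlam₀ hε hH hf hl hw hw'
  have hconst : ∀ lam ∈ sphere (0 : ℂ) r, ∀ w ∈ V, ∀ w' ∈ V,
      L w lam * (L₀ w lam)⁻¹ = L w' lam * (L₀ w' lam)⁻¹ := fun lam hl w hw w' hw' =>
    mul_inv_eq_of_mfd_eq hV hVc (g := fun w => L w lam) (h := fun w => L₀ w lam)
      (φ := fun z v => v • logPotential c z lam) (fun z hz => h.smooth_L.mdiff hr.1 hV hz hl)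
      (fun z _ => hJ.mdiff_logFrame c z lam) (fun z _ => hd₀ z lam)
      (fun z hz v => by rw [h.mfd_L hz v hl, mul_smul_comm]; rfl)
      (fun z _ v => by rw [hJ.mfd_logFrame, mul_smul_comm]) hw hw'
  obtain ⟨w₀, hw₀⟩ := hVn
  set Z : ℂ → Mat2 := fun lam => !![1, 0; c * lam⁻¹ * τ, 1] with hZ
  have hshift : ∀ w lam, L₀ (w + τ) lam = Z lam * L₀ w lam := fun w lam =>
    logFrame_add J0 J1 k1 k2 c w lam hτe
  set A : ℂ → Mat2 := fun lam => L w₀ lam * (L₀ w₀ lam)⁻¹ with hA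
  have hAdet : ∀ lam ∈ sphere (0 : ℂ) r, (A lam).det = 1 := fun lam hl => by
    rw [hA, Matrix.det_mul, h.det_L hw₀ hl, det_inv_of_det_eq_one (hd₀ w₀ lam), one_mul]
  have hLA : ∀ lam ∈ sphere (0 : ℂ) r, ∀ w ∈ V, L w lam = A lam * L₀ w lam := fun lam hl w hw => by
    have e : A lam = L w lam * (L₀ w lam)⁻¹ := hconst lam hl w₀ hw₀ w hw
    rw [e, mul_assoc, inv_mul_of_det_eq_one (hd₀ w lam), mul_one]
  set M : ℂ → Mat2 := fun lam => F (w₀ + τ) lam * (F w₀ lam)⁻¹ with hM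
  have hFM : ∀ lam ∈ sphere (0 : ℂ) r, ∀ w ∈ V, F (w + τ) lam = M lam * F w lam :=
    fun lam hl w hw => by
      have e : M lam = F (w + τ) lam * (F w lam)⁻¹ := hmono lam hl w₀ hw₀ w hw
      rw [e, mul_assoc, inv_mul_of_det_eq_one (h.det_F hr.1 hr1 hw hl), mul_one]
  set K : ℂ → Mat2 := fun lam => L₀ w₀ lam * ((B w₀ lam)⁻¹ * B (w₀ + τ) lam) * (L₀ w₀ lam)⁻¹ with hK
  -- The monodromy relation `M A (L₀ (B⁻¹ B(· + τ)) L₀⁻¹) = A Z`.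
  have hrel : ∀ lam ∈ sphere (0 : ℂ) r, ∀ w ∈ V,
      M lam * A lam * (L₀ w lam * ((B w lam)⁻¹ * B (w + τ) lam) * (L₀ w lam)⁻¹) = A lam * Z lam := by
    intro lam hl w hw
    have hAL : A lam * L₀ w lam * (B w lam)⁻¹ = F w lam := by
      rw [← hLA lam hl w hw, h.splitting w hw lam hl, mul_assoc,
        mul_inv_of_det_eq_one (h.det_B hw hl), mul_one]
    calc _ = M lam * (A lam * L₀ w lam * (B w lam)⁻¹) * B (w + τ) lam * (L₀ w lam)⁻¹ := by
          simp only [mul_assoc]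
      _ = L (w + τ) lam * (L₀ w lam)⁻¹ := by
          rw [hAL, ← hFM lam hl w hw, ← h.splitting (w + τ) (hτ w hw) lam hl]
      _ = A lam * Z lam := by
          rw [hLA lam hl (w + τ) (hτ w hw), hshift, mul_assoc (A lam), mul_assoc (Z lam),
            mul_inv_of_det_eq_one (hd₀ w lam), mul_one]
  have hMdet : ∀ lam ∈ sphere (0 : ℂ) r, (M lam).det = 1 := fun lam hl => by
    rw [hM, Matrix.det_mul, h.det_F hr.1 hr1 (hτ w₀ hw₀) hl,
      det_inv_of_det_eq_one (h.det_F hr.1 hr1 hw₀ hl), one_mul]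
  have hKw : ∀ lam ∈ sphere (0 : ℂ) r, ∀ w ∈ V,
      K lam = L₀ w lam * ((B w lam)⁻¹ * B (w + τ) lam) * (L₀ w lam)⁻¹ := fun lam hl w hw => by
    have hMA : (M lam * A lam).det = 1 := by rw [Matrix.det_mul, hMdet lam hl, hAdet lam hl, one_mul]
    have e := (hrel lam hl w₀ hw₀).trans (hrel lam hl w hw).symm
    have e' := congrArg ((M lam * A lam)⁻¹ * ·) e
    beta_reduce at e'
    rwa [← mul_assoc (M lam * A lam)⁻¹ (M lam * A lam), ← mul_assoc (M lam * A lam)⁻¹ (M lam * A lam),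
      inv_mul_of_det_eq_one hMA, one_mul, one_mul] at e'
  have hKsm : ∀ i j, ContDiff ℝ ∞ fun t : ℝ => K (circleMap 0 r t) i j := by
    have hB := h.smooth_B hr
    have hBi := hB.inv hr.1.le fun w hw lam hlam => h.det_B hw hlam
    have hBτ : JointlySmooth r V fun w => B (w + τ) :=
      hB.comp (contDiffOn_id.add contDiffOn_const) hτ
    have hLs := (hJ.jointlySmooth_logFrame c hr.1).mono (subset_univ V)
    have hLi := hLs.inv hr.1.le fun w _ lam _ => hd₀ w lam
    have hall := (hLs.mul (hBi.mul hBτ)).mul hLi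
    intro i j
    rw [← contDiffOn_univ]
    exact (hall i j).comp (f := fun t : ℝ => (w₀, t)) (contDiffOn_const.prodMk contDiffOn_id)
      fun t _ => ⟨hw₀, mem_univ _⟩
  have hscal : ∀ lam ∈ sphere (0 : ℂ) r, ∃ κ : ℂ, K lam = κ • (1 : Mat2) := fun lam hl => by
    refine hJ.scalar_of_logConj_positive hc hr.1 hKsm hV ⟨w₀, hw₀⟩ (fun w hw => ?_) hl
    refine ⟨_, ((h.positive w hw).inv hr.1.le).mul (h.positive (w + τ) (hτ w hw)),
      fun lam hl => ?_⟩
    rw [logConj, hKw lam hl w hw, ← hL₀]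
    simp only [mul_assoc]
    rw [inv_mul_of_det_eq_one (hd₀ w lam), mul_one, ← mul_assoc (L₀ w lam)⁻¹,
      inv_mul_of_det_eq_one (hd₀ w lam), one_mul]
  have hconj : ∀ lam ∈ sphere (0 : ℂ) r, ∃ κ : ℂ, κ ^ 2 = 1 ∧ κ • (M lam * A lam) = A lam * Z lam := by
    intro lam hl
    obtain ⟨κ, hκ⟩ := hscal lam hl
    have e : κ • (M lam * A lam) = A lam * Z lam := by
      rw [← hrel lam hl w₀ hw₀]
      change _ = M lam * A lam * K lam
      rw [hκ, mul_smul_comm, mul_one]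
    refine ⟨κ, ?_, e⟩
    have := congrArg Matrix.det e
    rw [Matrix.det_smul, Matrix.det_mul (M lam), Matrix.det_mul (A lam), hMdet lam hl, hAdet lam hl] at this
    simpa [hZ] using this
  have htr : ∀ lam ∈ sphere (0 : ℂ) r, (M lam).trace ^ 2 - 4 = 0 := fun lam hl => by
    obtain ⟨κ, hκ, e⟩ := hconj lam hl
    have hAi := mul_inv_of_det_eq_one (hAdet lam hl)
    have e1 : κ • M lam = A lam * Z lam * (A lam)⁻¹ := by
      rw [← e, smul_mul_assoc, mul_assoc, hAi, mul_one]
    have e2 := congrArg Matrix.trace e1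
    rw [trace_conj (hAdet lam hl), Matrix.trace_smul, smul_eq_mul] at e2
    have e3 : (Z lam).trace = 2 := by
      rw [hZ, Matrix.trace_fin_two]; norm_num
    rw [e3] at e2
    linear_combination (κ * (M lam).trace + 2) * e2 - (M lam).trace ^ 2 * hκ
  have hl : (r : ℂ) ∈ sphere (0 : ℂ) r := by simp [abs_of_pos hr.1]
  obtain ⟨ν, hν⟩ := (h.unitary _ (hτ w₀ hw₀)).scalar_mul_inv hr (h.unitary w₀ hw₀) htr hl
  obtain ⟨κ, -, e⟩ := hconj r hl
  have hν' : M r = ν • (1 : Mat2) := hν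
  have hAi := inv_mul_of_det_eq_one (hAdet r hl)
  have e1 : Z r = (κ * ν) • (1 : Mat2) := by
    have := congrArg ((A r)⁻¹ * ·) e
    simp only [hν', smul_mul_assoc, one_mul, mul_smul_comm, ← mul_assoc, hAi] at this
    rw [← this, smul_smul]
  have e2 := congr_entry e1 1 0
  simp [hZ] at e2
  rcases e2 with (hc0 | hr0) | hτz
  · exact hc hc0
  · exact hr.1.ne' hr0
  · exact hτ0 hτz

/-- The exponent `-1` produces no closed surfaces. -/
theorem not_exists_isClosedDPWSurface_neg_one {r ε H : ℝ} {c lam₀ : ℂ} {Ω : Set ℂ}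
    (hr : r ∈ Ioc (0 : ℝ) 1) (hlam₀ : lam₀ ∈ sphere (0 : ℂ) 1) (hε : ε = 1 ∨ ε = -1) (hH : H ≠ 0)
    (hc : c ≠ 0) (hΩ : IsWindingAnnulus Ω) :
    ¬ ∃ f : ℂ → E3, IsClosedDPWSurface r ε H lam₀ (xi c (-1)) Ω f := by
  rintro ⟨f, L, F, B, h, hf⟩
  obtain ⟨V, hVΩ, hVo, hVc, hVn, m, hm, hτ⟩ := hΩ.exists_period
  have h' : IsDPWData r (offDiag Complex.exp fun _ => c) V L F B := by
    refine (h.mono hVΩ).congr fun z _ lam _ => ?_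
    rw [pullback_exp_xi]
    simp [offDiag]
  have hτe : Complex.exp (m * (2 * Real.pi * Complex.I)) = 1 := Complex.exp_int_mul_two_pi_mul_I m
  refine h'.not_periodic hc hr hVo hVc hVn ?_ hτe hτ hlam₀ hε hH fun w hw => ?_
  · simp [hm, Real.pi_ne_zero]
  · rw [← hf _ (hVΩ (hτ w hw)), ← hf w (hVΩ hw)]
    simp only [Function.comp_apply, Complex.exp_add, hτe, mul_one]

end DPW

end

open DPW in
theorem theorem5p1 (ε H : ℝ) (hε : ε = 1 ∨ ε = -1) (hH : H ≠ 0) (c : ℂ) (hc : c ≠ 0) :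
    -- Inversion of the coordinate and a gauge take the potential for `k` to that for `-k-4`, ...
    (∀ r ∈ Set.Ioc (0 : ℝ) 1, ∀ k : ℤ,
      GaugeEquiv r {0}ᶜ (pullback (fun z => z⁻¹) (xi c k)) (xi c (-k - 4))) ∧
    (∀ r ∈ Set.Ioc (0 : ℝ) 1, ∀ k : ℤ, ∀ lam₀ ∈ Metric.sphere (0 : ℂ) 1,
      ∀ U : Set ℂ, IsOpen U → ∀ f : ℂ → E3,
        IsDPWSurface r ε H lam₀ (pullback Complex.exp (xi c k)) U f ↔
          IsDPWSurface r ε H lam₀ (pullback Complex.exp (xi c (-k - 4)))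
            ((fun w => -w) ⁻¹' U) (fun w => f (-w))) ∧
    -- ... and every `k` reduces to some `k' ≥ -2`.
    (∀ k : ℤ, ∃ k' : ℤ, -2 ≤ k' ∧ (k' = k ∨ k' = -k - 4) ∧
      ∀ r ∈ Set.Ioc (0 : ℝ) 1, CoordGaugeEquiv r (xi c k) (xi c k')) ∧
    -- Each `k ≥ -2` other than `-1` makes CMC surfaces that close on annular domains.
    (∀ k : ℤ, -2 ≤ k → k ≠ -1 →
      ∃ r ∈ Set.Ioc (0 : ℝ) 1, ∃ lam₀ ∈ Metric.sphere (0 : ℂ) 1, ∃ f : ℂ → E3,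
        IsConformalCMC H {0}ᶜ f ∧ IsClosedDPWSurface r ε H lam₀ (xi c k) {0}ᶜ f ∧
        ∀ Ω : Set ℂ, IsWindingAnnulus Ω →
          IsConformalCMC H Ω f ∧ IsClosedDPWSurface r ε H lam₀ (xi c k) Ω f) ∧
    -- The case `k = -1` makes none.
    (∀ r ∈ Set.Ioc (0 : ℝ) 1, ∀ lam₀ ∈ Metric.sphere (0 : ℂ) 1,
      ∀ Ω : Set ℂ, IsWindingAnnulus Ω →
        ¬ ∃ f : ℂ → E3, IsClosedDPWSurface r ε H lam₀ (xi c (-1)) Ω f) ∧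
    -- For `k ≥ 0` the Smyth surfaces exist and close, with loops on the unit circle and at every
    -- spectral parameter.
    (∀ k : ℕ, ∀ lam₀ ∈ Metric.sphere (0 : ℂ) 1,
      (∃ f : ℂ → E3, IsSmythSurface ε H lam₀ c k f) ∧
      ∀ f : ℂ → E3, IsSmythSurface ε H lam₀ c k f →
        IsConformalCMC H {0}ᶜ f ∧ (ε = 1 → IsConformalCMC H Set.univ f) ∧
        IsClosedDPWSurface 1 ε H lam₀ (xi c k) {0}ᶜ f ∧
        ∀ Ω : Set ℂ, IsWindingAnnulus Ω → IsClosedDPWSurface 1 ε H lam₀ (xi c k) Ω f) ∧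
    -- For `k = -2` the potential gauges, on the universal cover of `ℂ \ {0}`, to that of a round
    -- cylinder.
    (∀ r ∈ Set.Ioc (0 : ℝ) 1, r ^ 2 < 4 * ‖c‖ → ∀ a : ℂ, a ^ 2 = c →
      GaugeEquiv r Set.univ (pullback Complex.exp (xi c (-2)))
        (pullback Complex.exp (cylinderPotential a)) ∧
      ∀ lam₀ ∈ Metric.sphere (0 : ℂ) 1, ∃ f : ℂ → E3,
        IsDPWSurface r ε H lam₀ (pullback Complex.exp (cylinderPotential a)) Set.univ f ∧
        IsDPWSurface r ε H lam₀ (pullback Complex.exp (xi c (-2))) Set.univ f ∧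
        IsConformalCMC H Set.univ f ∧ IsRoundCylinder (1 / (2 * |H|)) (Set.range f)) := by
  have hcompl : IsOpen ({0}ᶜ : Set ℂ) := isOpen_compl_singleton
  refine ⟨fun r hr k => gaugeEquiv_inversion hr c k,
    fun r hr k lam₀ _ U hU f => isDPWSurface_inversion_iff hr hU,
    exists_coordGaugeEquiv c, fun k hk hk1 => ?_, fun r hr lam₀ hlam Ω hΩ => ?_,
    fun k lam₀ hlam => ⟨exists_isSmythSurface ε H lam₀ c k, fun f hf =>
      ⟨hf.isConformalCMC_compl hlam hε hH hc, fun h1 => hf.isConformalCMC_univ hlam h1 hH hc,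
        hf.isClosedDPWSurface hcompl, fun Ω hΩ => hf.isClosedDPWSurface hΩ.isOpen⟩⟩,
    fun r hr hrc a ha => ⟨gaugeEquiv_xi_neg_two hr.1 hc ha hrc, fun lam₀ hlam =>
      exists_cylinder_surface hr hε hH hc ha hrc hlam⟩⟩
  · suffices h : ∃ r ∈ Set.Ioc (0 : ℝ) 1, ∃ lam₀ ∈ Metric.sphere (0 : ℂ) 1, ∃ f : ℂ → E3,
        IsConformalCMC H {0}ᶜ f ∧ IsClosedDPWSurface r ε H lam₀ (xi c k) {0}ᶜ f by
      obtain ⟨r, hr, lam₀, hlam, f, hf, hd⟩ := h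
      exact ⟨r, hr, lam₀, hlam, f, hf, hd, fun Ω hΩ => ⟨hf.mono hΩ.subset,
        hd.mono (Set.preimage_mono hΩ.subset)⟩⟩
    rcases lt_or_ge k 0 with h0 | h0
    · obtain rfl : k = -2 := by omega
      exact exists_delaunay hε hH hc
    · obtain ⟨n, rfl⟩ := Int.eq_ofNat_of_zero_le h0
      obtain ⟨f, hf⟩ := exists_isSmythSurface ε H 1 c n
      have h1 : (1 : ℂ) ∈ Metric.sphere (0 : ℂ) 1 := by simp
      exact ⟨1, ⟨one_pos, le_rfl⟩, 1, h1, f, hf.isConformalCMC_compl h1 hε hH hc,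
        hf.isClosedDPWSurface hcompl⟩
  · exact not_exists_isClosedDPWSurface_neg_one hr hlam hε hH hc hΩ
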